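/- Let $R\subset\mathbb{C}$ be a subring that is finitely generated as a $\mathbb{Z}$-algebra, $S$ a smooth $R$-scheme, $f:\overline X\to S$ a smooth proper morphism (for example, a smooth projective one), and $D=\sum_i D_i\subset\overline X$ a simple normal crossings divisor relative to $S$ with finitely many components. Let $s\in S(R)$, and let $(\mathscr E,\nabla)$ be a flat vector bundle on $\overline X_s/R$ with regular singularities along $D_s$ (an integrable connection relative to $R$ with logarithmic poles along $D_s$). Suppose that for all but finitely many primes $p$ the reduction of $(\mathscr E,\nabla)$ modulo $p$ (a logarithmic flat bundle on $\overline X_s\otimes R/p$ relative to $R/p$) has vanishing $p$-curvature. Then $(\mathscr E,\nabla)$ admits an $\omega(p)$-integral isomonodromic deformation over the completion $\widehat S$ of $S$ at $s$. Explicitly: there is a nonzero $a\in R$ such that, with $R'=R[1/a]$, the completion of $S_{R'}$ at $s$ is isomorphic over $R'$ to $\operatorname{Spf}R'[[x_1,\dots,x_d]]$ for some $d$, with the ideal of $s$ given by $(x_1,\dots,x_d)$. Moreover, for every nonzero $a\in R$ and every such isomorphism, the following hold. For $g:\mathrm{Primes}\to\mathbb{Z}_{\ge 0}$ let $A_g\subset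 R'_{\mathbb Q}[[x_1,\dots,x_d]]$ be the subring generated by $R'[[x_1,\dots,x_d]]$ and by the sets $(x_1,\dots,x_d)^{g(p)+1}R'[1/p][[x_1,\dots,x_d]]$ for all primes $p$; let $J_g\subset A_g$ be the ideal of elements without constant term, and let $\widehat S^g$ be the formal spectrum of the $J_g$-adic completion of $A_g$, i.e. $\operatorname{colim}_n\operatorname{Spec}A_g/J_g^{n+1}$. Let $\widehat S_{\mathbb Q}=\operatorname{Spf}R'_{\mathbb Q}[[x_1,\dots,x_d]]$. An isomonodromic deformation of $(\mathscr E,\nabla)$ over $\widehat S_{\mathbb Q}$ is a logarithmic flat bundle on $(\overline X,D)\times_S\widehat S_{\mathbb Q}$ relative to $\widehat S_{\mathbb Q}$, with an isomorphism of its restriction to $s$ with $(\mathscr E,\nabla)_{\mathbb Q}$, whose connection extends to an absolute (that is, relative to $R'_{\mathbb Q}$) flat logarithmic connection. 1. There is a function $g$ with $\lim_{p\to\infty}g(p)/p=\infty$ such that an isomonodromic deformation of $(\mathscr E,\nabla)$ over $\widehat S_{\mathbb Q}$ descends to a logarithmic flat bundle on $(\overline X,D)\times_S\widehat S^g$ relative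 to $\widehat S^g$. 2. There is a function $g$ with $g(p)=p^2-1$ for all but finitely many primes $p$ such that an isomonodromic deformation of $(\mathscr E,\nabla)$ over $\widehat S_{\mathbb Q}$ descends to a logarithmic flat bundle on $(\overline X,D)\times_S\operatorname{colim}_n\operatorname{Spec}\bigl(A_g/(A_g\cap(x_1,\dots,x_d)^{n+1}R'_{\mathbb Q}[[x_1,\dots,x_d]])\bigr)$; that is, it is defined with coefficients that are $p$-integral up to total degree $p^2-1$, for almost all $p$. -/

import Mathlib

open CategoryTheory CategoryTheory.Limits AlgebraicGeometry TopologicalSpace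

noncomputable section

namespace Isomonodromy

/-! ### Sections, frames, relative normal crossings divisors -/

/-- Restriction of functions. -/
def resO {Y : Scheme.{0}} {U V : Y.Opens} (h : V ≤ U) : Γ(Y, U) →+* Γ(Y, V) :=
  (Y.presheaf.map (homOfLE h).op).hom

/-- Restriction of sections of a sheaf of modules. -/
def resM {Y : Scheme.{0}} (M : Y.Modules) {U V : Y.Opens} (h : V ≤ U) : Γ(M, U) →+ Γ(M, V) :=
  (M.presheaf.map (homOfLE h).op).hom

/-- `e₁, …, eₙ` is a frame of `M` over `U`: it induces an isomorphism `𝒪ⁿ ≅ M` over `U`. -/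
def IsFrame {Y : Scheme.{0}} (M : Y.Modules) (U : Y.Opens) {n : ℕ} (e : Fin n → Γ(M, U)) : Prop :=
  ∀ (V : Y.Opens) (h : V ≤ U), Function.Bijective
    (fun a : Fin n → Γ(Y, V) => ∑ i, a i • (resM M h (e i) : Γ(M, V)))

/-- The function `a` on the open set `U` is a section of the ideal sheaf `I`. -/
def MemIdeal {Y : Scheme.{0}} (I : Y.IdealSheafData) {U : Y.Opens} (a : Γ(Y, U)) : Prop :=
  ∀ (V : Y.affineOpens) (h : V.1 ≤ U), resO h a ∈ I.ideal V

/-- `D = ∑ Dᵢ` is a simple normal crossings divisor on `Y` relative to `T` with components `Dᵢ`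
(given by their ideal sheaves): near every point `y` of `Y` there are étale coordinates
`c₁, …, cₙ` of `Y` over `T` (functions whose differentials form a basis of the relative
differentials; `Y` is smooth over `T` in all uses) such that the components through `y`
are cut out by pairwise distinct coordinates. -/
def IsRelSNC {Y T : Scheme.{0}} (f : Y ⟶ T) {ι : Type} (D : ι → Y.IdealSheafData) : Prop :=
  ∀ y : Y, ∃ (W : T.affineOpens) (V : Y.affineOpens) (_ : y ∈ V.1) (hV : V.1 ≤ f ⁻¹ᵁ W.1)
    (n : ℕ) (c : Fin n → Γ(Y, V.1)) (k : {i : ι // y ∈ (D i).support} → Fin n),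
    letI := (f.appLE W.1 V.1 hV).hom.toAlgebra
    (∃ b : Module.Basis (Fin n) Γ(Y, V.1) (Ω[Γ(Y, V.1)⁄Γ(T, W.1)]),
      ∀ j, b j = KaehlerDifferential.D Γ(T, W.1) Γ(Y, V.1) (c j)) ∧
    Function.Injective k ∧
    (∀ i, (D i.1).ideal V = Ideal.span {c (k i)}) ∧
    ∀ i, y ∉ (D i).support → (D i).ideal V = ⊤

/-! ### Logarithmic vector fields and logarithmic flat bundles -/

/-- A section over `U` of `T_{Y/T}(-log D)`: a derivation of the structure sheaf of `U` over `T`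
that preserves the ideals of the components of `D`. -/
structure LogField {Y T : Scheme.{0}} (f : Y ⟶ T) {ι : Type} (D : ι → Y.IdealSheafData)
    (U : Y.Opens) where
  app : ∀ V : Y.Opens, V ≤ U → (Γ(Y, V) →+ Γ(Y, V))
  res_app : ∀ (V W : Y.Opens) (hV : V ≤ U) (hW : W ≤ V) (a : Γ(Y, V)),
    resO hW (app V hV a) = app W (hW.trans hV) (resO hW a)
  leibniz : ∀ (V : Y.Opens) (hV : V ≤ U) (a b : Γ(Y, V)),
    app V hV (a * b) = a * app V hV b + b * app V hV a
  const : ∀ (V : Y.Opens) (hV : V ≤ U) (W : T.Opens) (hW : V ≤ f ⁻¹ᵁ W) (a : Γ(T, W)),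
    app V hV ((f.appLE W V hW).hom a) = 0
  log : ∀ (i : ι) (V : Y.Opens) (hV : V ≤ U) (a : Γ(Y, V)),
    MemIdeal (D i) a → MemIdeal (D i) (app V hV a)

/-- Restriction of a vector field to a smaller open set. -/
def LogField.restrict {Y T : Scheme.{0}} {f : Y ⟶ T} {ι : Type} {D : ι → Y.IdealSheafData}
    {U : Y.Opens} (θ : LogField f D U) {U' : Y.Opens} (h : U' ≤ U) : LogField f D U' where
  app V hV := θ.app V (hV.trans h)
  res_app V W hV hW a := θ.res_app V W (hV.trans h) hW a
  leibniz V hV a b := θ.leibniz V (hV.trans h) a b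
  const V hV W hW a := θ.const V (hV.trans h) W hW a
  log i V hV a := θ.log i V (hV.trans h) a

/-- A flat bundle on `(Y, D)/T` with regular singularities along `D`: a vector bundle of finite
rank with an integrable connection relative to `T` and with logarithmic poles along `D`. The
connection is given by the operators `∇_θ`, for `θ` a local section of `T_{Y/T}(-log D)`. -/
structure LogFlatBundle {Y T : Scheme.{0}} (f : Y ⟶ T) {ι : Type} (D : ι → Y.IdealSheafData) where
  M : Y.Modules
  locallyFree : ∀ y : Y, ∃ (U : Y.Opens) (_ : y ∈ U) (n : ℕ) (e : Fin n → Γ(M, U)), IsFrame M U e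
  nabla : ∀ U : Y.Opens, LogField f D U → (Γ(M, U) →+ Γ(M, U))
  res_nabla : ∀ (U V : Y.Opens) (h : V ≤ U) (θ : LogField f D U) (e : Γ(M, U)),
    resM M h (nabla U θ e) = nabla V (θ.restrict h) (resM M h e)
  /-- `∇_θ` is `𝒪`-linear in `θ`. -/
  linear : ∀ (U : Y.Opens) (r : Γ(Y, U)) (θ θ₁ θ₂ : LogField f D U),
    (∀ (V : Y.Opens) (hV : V ≤ U) (a : Γ(Y, V)),
      θ.app V hV a = resO hV r * θ₁.app V hV a + θ₂.app V hV a) →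
    ∀ e : Γ(M, U), nabla U θ e = (r • (nabla U θ₁ e : Γ(M, U)) : Γ(M, U)) + nabla U θ₂ e
  leibniz : ∀ (U : Y.Opens) (θ : LogField f D U) (a : Γ(Y, U)) (e : Γ(M, U)),
    nabla U θ (a • e) = a • (nabla U θ e : Γ(M, U)) + θ.app U le_rfl a • e
  /-- If `θ = [θ₁, θ₂]` then `∇_θ = [∇_{θ₁}, ∇_{θ₂}]`. -/
  flat : ∀ (U : Y.Opens) (θ θ₁ θ₂ : LogField f D U),
    (∀ (V : Y.Opens) (hV : V ≤ U) (a : Γ(Y, V)),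
      θ.app V hV a = θ₁.app V hV (θ₂.app V hV a) - θ₂.app V hV (θ₁.app V hV a)) →
    ∀ e : Γ(M, U), nabla U θ e = nabla U θ₁ (nabla U θ₂ e) - nabla U θ₂ (nabla U θ₁ e)

/-- The `p`-curvature `θ ↦ (∇_θ)^p - ∇_{θ^p}` of a flat bundle on a scheme in characteristic `p`
vanishes. -/
def LogFlatBundle.PCurvatureVanishes {Y T : Scheme.{0}} {f : Y ⟶ T} {ι : Type}
    {D : ι → Y.IdealSheafData} (E : LogFlatBundle f D) (p : ℕ) : Prop :=
  ∀ (U : Y.Opens) (θ η : LogField f D U),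
    (∀ (V : Y.Opens) (hV : V ≤ U) (a : Γ(Y, V)), η.app V hV a = (θ.app V hV)^[p] a) →
    ∀ e : Γ(E.M, U), (E.nabla U θ)^[p] e = E.nabla U η e

/-- An identification of the flat bundle `E'` on `(Y', D')/T'` with the pullback of the flat bundle
`E` on `(Y, D)/T` along the projection `h : Y' = Y ×_T T' ⟶ Y` of a base change: a semilinear map
of sheaves `E ⟶ E'` over `h` that takes frames to frames (that is, the map `h^* E ⟶ E'` is an
isomorphism of vector bundles) and commutes with the connections along any vector field `θ'`
induced by a vector field `θ`. For `h` the identity these are the isomorphisms `E ≅ E'`. -/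
structure PullbackMap {Y T Y' T' : Scheme.{0}} {f : Y ⟶ T} {f' : Y' ⟶ T'} {ι : Type}
    {D : ι → Y.IdealSheafData} {D' : ι → Y'.IdealSheafData} (h : Y' ⟶ Y)
    (E : LogFlatBundle f D) (E' : LogFlatBundle f' D') where
  app : ∀ (U : Y.Opens) (U' : Y'.Opens), U' ≤ h ⁻¹ᵁ U → (Γ(E.M, U) →+ Γ(E'.M, U'))
  app_res : ∀ (U V : Y.Opens) (U' V' : Y'.Opens) (hU : U' ≤ h ⁻¹ᵁ U) (hV : V' ≤ h ⁻¹ᵁ V)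
    (i : V ≤ U) (i' : V' ≤ U') (e : Γ(E.M, U)),
    resM E'.M i' (app U U' hU e) = app V V' hV (resM E.M i e)
  semilinear : ∀ (U : Y.Opens) (U' : Y'.Opens) (hU : U' ≤ h ⁻¹ᵁ U) (a : Γ(Y, U)) (e : Γ(E.M, U)),
    app U U' hU (a • e) = (h.appLE U U' hU).hom a • (app U U' hU e : Γ(E'.M, U'))
  frame : ∀ (U : Y.Opens) (U' : Y'.Opens) (hU : U' ≤ h ⁻¹ᵁ U) (n : ℕ) (e : Fin n → Γ(E.M, U)),
    IsFrame E.M U e → IsFrame E'.M U' (fun i => app U U' hU (e i))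
  horizontal : ∀ (U : Y.Opens) (U' : Y'.Opens) (hU : U' ≤ h ⁻¹ᵁ U)
    (θ : LogField f D U) (θ' : LogField f' D' U'),
    (∀ (V : Y.Opens) (V' : Y'.Opens) (i : V ≤ U) (i' : V' ≤ U') (hV : V' ≤ h ⁻¹ᵁ V) (a : Γ(Y, V)),
      θ'.app V' i' ((h.appLE V V' hV).hom a) = (h.appLE V V' hV).hom (θ.app V i a)) →
    ∀ e : Γ(E.M, U), app U U' hU (E.nabla U θ e) = E'.nabla U' θ' (app U U' hU e)

/-! ### Families over a base `S` and their base changes -/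

section family

variable {X S : Scheme.{0}} (f : X ⟶ S) {ι : Type} (D : ι → X.IdealSheafData)

/-- Flat bundles on `(X_T, D_T)/T` with regular singularities along `D_T`, for `t : T ⟶ S`. -/
abbrev FlatBundleOver {T : Scheme.{0}} (t : T ⟶ S) : Type 1 :=
  LogFlatBundle (pullback.snd f t) (fun i => (D i).comap (pullback.fst f t))

/-- The map `X_{T'} ⟶ X_T` induced by a morphism `u : T' ⟶ T` over `S`. -/
def bcMap {T T' : Scheme.{0}} {t : T ⟶ S} {t' : T' ⟶ S} (u : T' ⟶ T) (w : u ≫ t = t') :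
    pullback f t' ⟶ pullback f t :=
  pullback.lift (pullback.fst f t') (pullback.snd f t' ≫ u)
    (by rw [Category.assoc, w, pullback.condition])

/-- A sequence `T₀ ⟶ T₁ ⟶ T₂ ⟶ ⋯` of schemes over `S`, in the uses below successive nilpotent
thickenings; it stands for the formal `S`-scheme `colim Tₙ`. -/
structure Tower (S : Scheme.{0}) where
  T : ℕ → Scheme.{0}
  t : ∀ n, T n ⟶ S
  i : ∀ n, T n ⟶ T (n + 1)
  w : ∀ n, i n ≫ t (n + 1) = t n

/-- A morphism of formal `S`-schemes given by towers. -/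
structure TowerMap {S : Scheme.{0}} (𝒬 𝒮 : Tower S) where
  j : ∀ n, 𝒬.T n ⟶ 𝒮.T n
  w : ∀ n, j n ≫ 𝒮.t n = 𝒬.t n
  comm : ∀ n, j n ≫ 𝒮.i n = 𝒬.i n ≫ j (n + 1)

/-- The base change of `X` to the `n`-th step of a tower. -/
abbrev Tower.fam {S : Scheme.{0}} (𝒯 : Tower S) {X : Scheme.{0}} (f : X ⟶ S) (n : ℕ) : Scheme.{0} :=
  pullback f (𝒯.t n)

/-- The inclusion of the `n`-th step into the next one. -/
abbrev Tower.incl {S : Scheme.{0}} (𝒯 : Tower S) {X : Scheme.{0}} (f : X ⟶ S) (n : ℕ) :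
    𝒯.fam f n ⟶ 𝒯.fam f (n + 1) :=
  bcMap f (𝒯.i n) (𝒯.w n)

/-- A flat bundle with regular singularities on the formal scheme `(X, D) ×_S colim Tₙ`, relative
to `colim Tₙ`: a compatible system of flat bundles on the `(X, D) ×_S Tₙ`, relative to `Tₙ`. -/
structure FormalFlatBundle (𝒯 : Tower S) where
  E : ∀ n, FlatBundleOver f D (𝒯.t n)
  β : ∀ n, PullbackMap (𝒯.incl f n) (E (n + 1)) (E n)

/-- An identification of `E'` with the pullback of the formal flat bundle `E`: a compatible system
of identifications at all finite levels. -/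
structure FormalPullbackMap {𝒬 𝒮 : Tower S} (j : TowerMap 𝒬 𝒮) (E : FormalFlatBundle f D 𝒮)
    (E' : FormalFlatBundle f D 𝒬) where
  γ : ∀ n, PullbackMap (bcMap f (j.j n) (j.w n)) (E.E n) (E'.E n)
  comm : ∀ (n : ℕ) (U : (𝒮.fam f (n + 1)).Opens) (V : (𝒬.fam f (n + 1)).Opens)
    (U' : (𝒮.fam f n).Opens) (V' : (𝒬.fam f n).Opens)
    (h₁ : V ≤ bcMap f (j.j (n + 1)) (j.w (n + 1)) ⁻¹ᵁ U) (h₂ : V' ≤ 𝒬.incl f n ⁻¹ᵁ V)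
    (h₃ : U' ≤ 𝒮.incl f n ⁻¹ᵁ U) (h₄ : V' ≤ bcMap f (j.j n) (j.w n) ⁻¹ᵁ U')
    (e : Γ((E.E (n + 1)).M, U)),
    (E'.β n).app V V' h₂ ((γ (n + 1)).app U V h₁ e) = (γ n).app U' V' h₄ ((E.β n).app U U' h₃ e)

/-! ### Absolute connections on formal flat bundles

Below the map `colim Tₙ ⟶ S` is the formal completion of `S` at a point, up to localization; so
every open set of the formal scheme `X ×_S colim Tₙ` is the preimage of an open set of `X`, and we
index open sets of the formal scheme by open sets of `X`. -/

/-- The open subset of `X ×_S Tₙ` given by an open subset of `X`. -/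
abbrev Tower.opens (𝒯 : Tower S) (n : ℕ) (W : X.Opens) : (𝒯.fam f n).Opens :=
  pullback.fst f (𝒯.t n) ⁻¹ᵁ W

lemma Tower.opens_mono (𝒯 : Tower S) (n : ℕ) {V W : X.Opens} (h : V ≤ W) :
    𝒯.opens f n V ≤ 𝒯.opens f n W :=
  fun _ hx => h hx

lemma Tower.opens_le (𝒯 : Tower S) (n : ℕ) (W : X.Opens) :
    𝒯.opens f n W ≤ 𝒯.incl f n ⁻¹ᵁ 𝒯.opens f (n + 1) W := by
  rw [Tower.opens, Tower.opens, ← Scheme.Hom.comp_preimage, Tower.incl, bcMap, pullback.lift_fst]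

/-- Reduction of functions from `X ×_S Tₙ₊₁` to `X ×_S Tₙ`. -/
def Tower.red (𝒯 : Tower S) (n : ℕ) (W : X.Opens) :
    Γ(𝒯.fam f (n + 1), 𝒯.opens f (n + 1) W) →+* Γ(𝒯.fam f n, 𝒯.opens f n W) :=
  ((𝒯.incl f n).appLE _ _ (𝒯.opens_le f n W)).hom

variable {B : Scheme.{0}} (q : S ⟶ B)

/-- A vector field over `W` on the formal scheme `X ×_S colim Tₙ` that is absolute, that is, linear
over `B` only, and tangent to `D`. As a derivation lowers the adic order by at most one, it is a
compatible system of derivations from the functions on `X ×_S Tₙ₊₁` to those on `X ×_S Tₙ`. -/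
structure AbsField (𝒯 : Tower S) (W : X.Opens) where
  app : ∀ (n : ℕ) (V : X.Opens), V ≤ W →
    (Γ(𝒯.fam f (n + 1), 𝒯.opens f (n + 1) V) →+ Γ(𝒯.fam f n, 𝒯.opens f n V))
  res_app : ∀ (n : ℕ) (V V' : X.Opens) (hV : V ≤ W) (h : V' ≤ V)
    (a : Γ(𝒯.fam f (n + 1), 𝒯.opens f (n + 1) V)),
    resO (𝒯.opens_mono f n h) (app n V hV a) =
      app n V' (h.trans hV) (resO (𝒯.opens_mono f (n + 1) h) a)
  red_app : ∀ (n : ℕ) (V : X.Opens) (hV : V ≤ W)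
    (a : Γ(𝒯.fam f (n + 2), 𝒯.opens f (n + 2) V)),
    𝒯.red f n V (app (n + 1) V hV a) = app n V hV (𝒯.red f (n + 1) V a)
  leibniz : ∀ (n : ℕ) (V : X.Opens) (hV : V ≤ W)
    (a b : Γ(𝒯.fam f (n + 1), 𝒯.opens f (n + 1) V)),
    app n V hV (a * b) = 𝒯.red f n V a * app n V hV b + 𝒯.red f n V b * app n V hV a
  const : ∀ (n : ℕ) (V : X.Opens) (hV : V ≤ W) (O : B.Opens)
    (hO : 𝒯.opens f (n + 1) V ≤ (pullback.fst f (𝒯.t (n + 1)) ≫ f ≫ q) ⁻¹ᵁ O) (a : Γ(B, O)),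
    app n V hV (((pullback.fst f (𝒯.t (n + 1)) ≫ f ≫ q).appLE O _ hO).hom a) = 0
  log : ∀ (n : ℕ) (i : ι) (V : X.Opens) (hV : V ≤ W)
    (a : Γ(𝒯.fam f (n + 1), 𝒯.opens f (n + 1) V)),
    MemIdeal ((D i).comap (pullback.fst f (𝒯.t (n + 1)))) a →
      MemIdeal ((D i).comap (pullback.fst f (𝒯.t n))) (app n V hV a)

/-- Restriction of an absolute vector field to a smaller open set. -/
def AbsField.restrict {f : X ⟶ S} {D : ι → X.IdealSheafData} {q : S ⟶ B} {𝒯 : Tower S}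
    {W : X.Opens} (δ : AbsField f D q 𝒯 W) {W' : X.Opens} (h : W' ≤ W) :
    AbsField f D q 𝒯 W' where
  app n V hV := δ.app n V (hV.trans h)
  res_app n V V' hV i a := δ.res_app n V V' (hV.trans h) i a
  red_app n V hV a := δ.red_app n V (hV.trans h) a
  leibniz n V hV a b := δ.leibniz n V (hV.trans h) a b
  const n V hV O hO a := δ.const n V (hV.trans h) O hO a
  log n i V hV a := δ.log n i V (hV.trans h) a

/-- Sections over `W` of the `n`-th level of a formal flat bundle. -/
abbrev FormalFlatBundle.sec {f : X ⟶ S} {D : ι → X.IdealSheafData} {𝒯 : Tower S}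
    (E : FormalFlatBundle f D 𝒯) (n : ℕ) (W : X.Opens) : Type :=
  Γ((E.E n).M, 𝒯.opens f n W)

/-- Reduction of sections from level `n + 1` to level `n`. -/
def FormalFlatBundle.red {f : X ⟶ S} {D : ι → X.IdealSheafData} {𝒯 : Tower S}
    (E : FormalFlatBundle f D 𝒯) (n : ℕ) (W : X.Opens) : E.sec (n + 1) W →+ E.sec n W :=
  (E.β n).app _ _ (𝒯.opens_le f n W)

/-- An absolute flat logarithmic connection on a formal flat bundle which extends the given
relative connection. -/
structure AbsConnection {f : X ⟶ S} {D : ι → X.IdealSheafData} (q : S ⟶ B) {𝒯 : Tower S}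
    (E : FormalFlatBundle f D 𝒯) where
  nabla : ∀ (W : X.Opens), AbsField f D q 𝒯 W → ∀ n, E.sec (n + 1) W →+ E.sec n W
  res_nabla : ∀ (W W' : X.Opens) (h : W' ≤ W) (δ : AbsField f D q 𝒯 W) (n : ℕ)
    (e : E.sec (n + 1) W),
    resM (E.E n).M (𝒯.opens_mono f n h) (nabla W δ n e) =
      nabla W' (δ.restrict h) n (resM (E.E (n + 1)).M (𝒯.opens_mono f (n + 1) h) e)
  red_nabla : ∀ (W : X.Opens) (δ : AbsField f D q 𝒯 W) (n : ℕ) (e : E.sec (n + 2) W),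
    E.red n W (nabla W δ (n + 1) e) = nabla W δ n (E.red (n + 1) W e)
  linear : ∀ (W : X.Opens) (r : ∀ n, Γ(𝒯.fam f n, 𝒯.opens f n W)) (δ δ₁ δ₂ : AbsField f D q 𝒯 W),
    (∀ n, 𝒯.red f n W (r (n + 1)) = r n) →
    (∀ (n : ℕ) (V : X.Opens) (hV : V ≤ W) (a : Γ(𝒯.fam f (n + 1), 𝒯.opens f (n + 1) V)),
      δ.app n V hV a =
        resO (𝒯.opens_mono f n hV) (r n) * δ₁.app n V hV a + δ₂.app n V hV a) →
    ∀ (n : ℕ) (e : E.sec (n + 1) W),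
      nabla W δ n e = (r n • (nabla W δ₁ n e : E.sec n W) : E.sec n W) + nabla W δ₂ n e
  leibniz : ∀ (W : X.Opens) (δ : AbsField f D q 𝒯 W) (n : ℕ)
    (a : Γ(𝒯.fam f (n + 1), 𝒯.opens f (n + 1) W)) (e : E.sec (n + 1) W),
    nabla W δ n (a • e) =
      𝒯.red f n W a • (nabla W δ n e : E.sec n W) + δ.app n W le_rfl a • (E.red n W e : E.sec n W)
  flat : ∀ (W : X.Opens) (δ δ₁ δ₂ : AbsField f D q 𝒯 W),
    (∀ (n : ℕ) (V : X.Opens) (hV : V ≤ W) (a : Γ(𝒯.fam f (n + 2), 𝒯.opens f (n + 2) V)),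
      δ.app n V hV (𝒯.red f (n + 1) V a) =
        δ₁.app n V hV (δ₂.app (n + 1) V hV a) - δ₂.app n V hV (δ₁.app (n + 1) V hV a)) →
    ∀ (n : ℕ) (e : E.sec (n + 2) W),
      nabla W δ n (E.red (n + 1) W e) =
        nabla W δ₁ n (nabla W δ₂ (n + 1) e) - nabla W δ₂ n (nabla W δ₁ (n + 1) e)
  /-- Along relative vector fields (those inducing relative vector fields `θₙ` on all levels) the
  absolute connection is the given one. -/
  extend : ∀ (W : X.Opens) (δ : AbsField f D q 𝒯 W)
    (θ : ∀ n, LogField (pullback.snd f (𝒯.t n)) (fun i => (D i).comap (pullback.fst f (𝒯.t n)))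
      (𝒯.opens f n W)),
    (∀ (n : ℕ) (V : X.Opens) (hV : V ≤ W) (a : Γ(𝒯.fam f (n + 1), 𝒯.opens f (n + 1) V)),
      δ.app n V hV a = (θ n).app _ (𝒯.opens_mono f n hV) (𝒯.red f n V a)) →
    ∀ (n : ℕ) (e : E.sec (n + 1) W),
      nabla W δ n e = (E.E n).nabla _ (θ n) (E.red n W e)

end family

/-! ### Rings of power series -/

/-- The subring `R[[x₁, …, x_d]]` of `ℂ[[x₁, …, x_d]]`. -/
def coeffsIn (d : ℕ) (R : Subring ℂ) : Subring (MvPowerSeries (Fin d) ℂ) :=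
  (MvPowerSeries.map (σ := Fin d) R.subtype).range

/-- `f ∈ (x₁, …, x_d)^m`, for a power series `f`. -/
def OrderGE {d : ℕ} (m : ℕ) (f : MvPowerSeries (Fin d) ℂ) : Prop :=
  ∀ I : Fin d →₀ ℕ, I.degree < m → MvPowerSeries.coeff I f = 0

/-- `R[1/f]`, for nonzero `f`. -/
def invert (R : Subring ℂ) (f : ℂ) : Subring ℂ := R ⊔ Subring.closure {f⁻¹}

/-- `R_ℚ = R ⊗ ℚ`. -/
def rat (R : Subring ℂ) : Subring ℂ := R ⊔ (algebraMap ℚ ℂ).range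

lemma coeffsIn_mono {d : ℕ} {R R' : Subring ℂ} (h : R ≤ R') : coeffsIn d R ≤ coeffsIn d R' := by
  rintro _ ⟨f, rfl⟩
  refine ⟨MvPowerSeries.map (Subring.inclusion h) f, ?_⟩
  ext I
  simp

/-- The subring generated by `R[[x]]` and all `(x)^{g(p) + 1} R[1/p][[x]]`, for primes `p`. -/
def gSubring (d : ℕ) (R : Subring ℂ) (g : Nat.Primes → ℕ) : Subring (MvPowerSeries (Fin d) ℂ) :=
  Subring.closure (coeffsIn d R ∪
    {f | ∃ p : Nat.Primes, f ∈ coeffsIn d (invert R ((p : ℕ) : ℂ)) ∧ OrderGE (g p + 1) f})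

/-- A subring of `ℂ[[x₁, …, x_d]]` with a decreasing sequence of ideals defining a linear
topology; it stands for the formal scheme `Spf` of its completion, that is, for
`colim Spec (A / Iₙ)`. -/
structure AdicRing (d : ℕ) where
  A : Subring (MvPowerSeries (Fin d) ℂ)
  I : ℕ → Ideal A
  anti : ∀ n, I (n + 1) ≤ I n

/-- The ideal of a subring of the ring of power series formed by its elements without constant
term. -/
def augIdeal {d : ℕ} (A : Subring (MvPowerSeries (Fin d) ℂ)) : Ideal A :=
  RingHom.ker ((MvPowerSeries.constantCoeff (σ := Fin d) (R := ℂ)).comp A.subtype)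

/-- The ideal of the elements of order at least `m`. -/
def orderIdeal {d : ℕ} (A : Subring (MvPowerSeries (Fin d) ℂ)) (m : ℕ) : Ideal A where
  carrier := {f | OrderGE m f.1}
  zero_mem' := fun I _ => by simp
  add_mem' := fun {a b} ha hb I hI => by simp [ha I hI, hb I hI]
  smul_mem' := fun c f hf I hI => by
    rw [smul_eq_mul, Subring.coe_mul, MvPowerSeries.coeff_mul]
    refine Finset.sum_eq_zero fun x hx => ?_
    rw [hf x.2 (lt_of_le_of_lt ?_ hI), mul_zero]
    rw [← Finset.HasAntidiagonal.mem_antidiagonal.mp hx, map_add]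
    exact Nat.le_add_left _ _

lemma orderIdeal_mul {d : ℕ} (A : Subring (MvPowerSeries (Fin d) ℂ)) (m k : ℕ) :
    orderIdeal A m * orderIdeal A k ≤ orderIdeal A (m + k) := by
  rw [Ideal.mul_le]
  intro a ha b hb I hI
  rw [Subring.coe_mul, MvPowerSeries.coeff_mul]
  refine Finset.sum_eq_zero fun x hx => ?_
  rw [← Finset.HasAntidiagonal.mem_antidiagonal.mp hx, map_add] at hI
  by_cases h : x.1.degree < m
  · rw [ha _ h, zero_mul]
  · rw [hb _ (by omega), mul_zero]

lemma augIdeal_pow_le {d : ℕ} (A : Subring (MvPowerSeries (Fin d) ℂ)) (n : ℕ) :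
    augIdeal A ^ n ≤ orderIdeal A n := by
  induction n with
  | zero => intro f _ I hI; exact absurd hI (Nat.not_lt_zero _)
  | succ n ih =>
    rw [pow_succ]
    refine (Ideal.mul_mono ih ?_).trans (orderIdeal_mul A n 1)
    intro f hf I hI
    have : I = 0 := by
      rwa [Nat.lt_one_iff, Finsupp.degree_eq_zero_iff] at hI
    subst this
    exact hf

/-- `A` with the adic topology of its ideal of elements without constant term. For
`A = R[[x₁, …, x_d]]` this is the ideal `(x₁, …, x_d)`; for `gSubring d R g` it is the ideal
generated by the elements of `R[[x]]` without constant term and by all `(x)^{g(p) + 1} R[1/p][[x]]`,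
so that `adic (gSubring d R g)` stands for the formal spectrum of the ring of `g`-integral
elements. -/
def adic {d : ℕ} (A : Subring (MvPowerSeries (Fin d) ℂ)) : AdicRing d where
  A := A
  I n := augIdeal A ^ (n + 1)
  anti _ := Ideal.pow_le_pow_right (Nat.le_succ _)

/-- `A` with the topology induced by the `(x₁, …, x_d)`-adic topology of the ring of power series.
On `R[[x₁, …, x_d]]` this is the adic topology of the ideal `(x₁, …, x_d)`. -/
def trunc {d : ℕ} (A : Subring (MvPowerSeries (Fin d) ℂ)) : AdicRing d where
  A := A
  I n := orderIdeal A (n + 1)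
  anti _ _ hf I hI := hf I (hI.trans (Nat.lt_succ_self _))

/-- `P` is contained in `Q`, with continuous inclusion. -/
def AdicRing.Le {d : ℕ} (P Q : AdicRing d) : Prop :=
  ∃ h : P.A ≤ Q.A, ∀ n, P.I n ≤ (Q.I n).comap (Subring.inclusion h)

lemma AdicRing.Le.refl {d : ℕ} (P : AdicRing d) : P.Le P := ⟨le_rfl, fun _ _ h => h⟩

lemma AdicRing.Le.trans {d : ℕ} {P Q O : AdicRing d} (h : P.Le Q) (h' : Q.Le O) : P.Le O :=
  ⟨h.1.trans h'.1, fun n _ ha => h'.2 n (h.2 n ha)⟩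

lemma augIdeal_le_comap {d : ℕ} {A A' : Subring (MvPowerSeries (Fin d) ℂ)} (h : A ≤ A') :
    augIdeal A ≤ (augIdeal A').comap (Subring.inclusion h) := fun _ ha => ha

lemma adic_le_adic {d : ℕ} {A A' : Subring (MvPowerSeries (Fin d) ℂ)} (h : A ≤ A') :
    (adic A).Le (adic A') :=
  ⟨h, fun n => (Ideal.pow_right_mono (augIdeal_le_comap h) (n + 1)).trans
    (Ideal.le_comap_pow _ _)⟩

lemma trunc_le_trunc {d : ℕ} {A A' : Subring (MvPowerSeries (Fin d) ℂ)} (h : A ≤ A') :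
    (trunc A).Le (trunc A') := ⟨h, fun _ _ ha => ha⟩

lemma adic_le_trunc {d : ℕ} (A : Subring (MvPowerSeries (Fin d) ℂ)) : (adic A).Le (trunc A) :=
  ⟨le_rfl, fun n _ ha => augIdeal_pow_le A (n + 1) ha⟩

lemma coeffsIn_le_gSubring {d : ℕ} (R : Subring ℂ) (g : Nat.Primes → ℕ) :
    coeffsIn d R ≤ gSubring d R g :=
  fun _ hf => Subring.subset_closure (Or.inl hf)

lemma gSubring_le {d : ℕ} (R : Subring ℂ) (g : Nat.Primes → ℕ) :
    gSubring d R g ≤ coeffsIn d (rat R) := by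
  rw [gSubring, Subring.closure_le]
  rintro f (hf | ⟨p, hf, -⟩)
  · exact coeffsIn_mono le_sup_left hf
  · refine coeffsIn_mono (sup_le le_sup_left ?_) hf
    rw [Subring.closure_le, Set.singleton_subset_iff]
    exact (le_sup_right : _ ≤ rat R) ⟨((p : ℕ) : ℚ)⁻¹, by simp⟩

/-- The ring `A / Iₙ`. -/
abbrev AdicRing.Level {d : ℕ} (P : AdicRing d) (n : ℕ) : Type := P.A ⧸ P.I n

/-- The map on levels induced by an inclusion. -/
def AdicRing.Le.level {d : ℕ} {P Q : AdicRing d} (h : P.Le Q) (n : ℕ) : P.Level n →+* Q.Level n :=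
  Ideal.quotientMap (Q.I n) (Subring.inclusion h.1) (h.2 n)

/-- The projection from a level to the previous one. -/
def AdicRing.proj {d : ℕ} (P : AdicRing d) (n : ℕ) : P.Level (n + 1) →+* P.Level n :=
  Ideal.Quotient.factor (P.anti n)

/-- `Spec (A / Iₙ)`. -/
abbrev AdicRing.spec {d : ℕ} (P : AdicRing d) (n : ℕ) : Scheme.{0} :=
  Spec (CommRingCat.of (P.Level n))

/-- The inclusion `Spec (A / Iₙ) ⟶ Spec (A / Iₙ₊₁)`. -/
abbrev AdicRing.specIncl {d : ℕ} (P : AdicRing d) (n : ℕ) : P.spec n ⟶ P.spec (n + 1) :=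
  Spec.map (CommRingCat.ofHom (P.proj n))

/-- The map `Spec (B / Jₙ) ⟶ Spec (A / Iₙ)` induced by an inclusion `A ≤ B`. -/
abbrev AdicRing.Le.spec {d : ℕ} {P Q : AdicRing d} (h : P.Le Q) (n : ℕ) : Q.spec n ⟶ P.spec n :=
  Spec.map (CommRingCat.ofHom (h.level n))

lemma AdicRing.Le.level_proj {d : ℕ} {P Q : AdicRing d} (h : P.Le Q) (n : ℕ) :
    (Q.proj n).comp (h.level (n + 1)) = (h.level n).comp (P.proj n) := by
  ext x; rfl

lemma AdicRing.Le.spec_incl {d : ℕ} {P Q : AdicRing d} (h : P.Le Q) (n : ℕ) :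
    h.spec n ≫ P.specIncl n = Q.specIncl n ≫ h.spec (n + 1) := by
  rw [← Spec.map_comp, ← Spec.map_comp, ← CommRingCat.ofHom_comp, ← CommRingCat.ofHom_comp,
    h.level_proj]

lemma AdicRing.Le.spec_comp {d : ℕ} {P Q O : AdicRing d} (h : P.Le Q) (h' : Q.Le O) (n : ℕ) :
    h'.spec n ≫ h.spec n = (h.trans h').spec n := by
  rw [← Spec.map_comp, ← CommRingCat.ofHom_comp]
  congr 2
  ext x; rfl

/-- The inclusion of constants `R → R'[[x]] / (x)^{n+1}`, where `R ≤ R'`. -/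
def constHom (d : ℕ) {R R' : Subring ℂ} (h : R ≤ R') (n : ℕ) :
    R →+* (adic (coeffsIn d R')).Level n :=
  (Ideal.Quotient.mk _).comp
    ((MvPowerSeries.map (σ := Fin d) R'.subtype).rangeRestrict.comp
      (MvPowerSeries.C.comp (Subring.inclusion h)))

/-- The morphism `Spec R'[[x]] / (x)^{n+1} ⟶ Spec R`. -/
abbrev constSpec (d : ℕ) {R R' : Subring ℂ} (h : R ≤ R') (n : ℕ) :
    (adic (coeffsIn d R')).spec n ⟶ Spec (CommRingCat.of R) :=
  Spec.map (CommRingCat.ofHom (constHom d h n))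

/-! ### Formal coordinates -/

/-- The closed immersion of the zeroth step of an adic ring into the `n`-th one. -/
def AdicRing.specZero {d : ℕ} (P : AdicRing d) : ∀ n, P.spec 0 ⟶ P.spec n
  | 0 => 𝟙 _
  | n + 1 => P.specZero n ≫ P.specIncl n

/-- An isomorphism over `R` of the formal completion of `S ×_R R'` at the `R'`-point given by
`s ∈ S(R)` with `Spf R'[[x₁, …, x_d]]`, where `R'` is a localization of `R`; the ideal of the point
corresponds to `(x₁, …, x_d)`. It is given by compatible maps `Spec R'[[x]] / (x)^{n+1} ⟶ S`
that identify the source with the `n`-th infinitesimal neighbourhood of the point: the map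
on local rings is surjective, and its kernel is the `(n+1)`-st power of the ideal of the point. -/
structure FormalCoordinates {S : Scheme.{0}} {R R' : Subring ℂ} (h : R ≤ R')
    (q : S ⟶ Spec (CommRingCat.of R)) (s : Spec (CommRingCat.of R) ⟶ S) (d : ℕ) where
  σ : ∀ n, (adic (coeffsIn d R')).spec n ⟶ S
  comp_q : ∀ n, σ n ≫ q = constSpec d h n
  trans : ∀ n, (adic (coeffsIn d R')).specIncl n ≫ σ (n + 1) = σ n
  zero : constSpec d h 0 ≫ s = σ 0
  surj : ∀ (n : ℕ) (z : (adic (coeffsIn d R')).spec 0),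
    Function.Surjective ((σ n).stalkMap ((adic (coeffsIn d R')).specZero n z)).hom
  ker : ∀ (n : ℕ) (z : (adic (coeffsIn d R')).spec 0),
    RingHom.ker ((σ n).stalkMap ((adic (coeffsIn d R')).specZero n z)).hom =
      RingHom.ker ((σ n).stalkMap ((adic (coeffsIn d R')).specZero n z) ≫
        ((adic (coeffsIn d R')).specZero n).stalkMap z).hom ^ (n + 1)

section deformation

variable {S : Scheme.{0}} {R R' : Subring ℂ} {h : R ≤ R'}
  {q : S ⟶ Spec (CommRingCat.of R)} {s : Spec (CommRingCat.of R) ⟶ S} {d : ℕ}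

/-- The formal `S`-scheme defined by an adic ring that contains `R'[[x]]`. -/
def FormalCoordinates.tower (c : FormalCoordinates h q s d) (P : AdicRing d)
    (hP : (adic (coeffsIn d R')).Le P) : Tower S where
  T := P.spec
  t n := hP.spec n ≫ c.σ n
  i := P.specIncl
  w n := by rw [← Category.assoc, ← hP.spec_incl, Category.assoc, c.trans]

/-- The morphism of formal `S`-schemes defined by an inclusion of adic rings. -/
def FormalCoordinates.towerMap (c : FormalCoordinates h q s d) {P Q : AdicRing d}
    (hP : (adic (coeffsIn d R')).Le P) (hQ : P.Le Q) :
    TowerMap (c.tower Q (hP.trans hQ)) (c.tower P hP) where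
  j n := hQ.spec n
  w n := by
    change hQ.spec n ≫ hP.spec n ≫ c.σ n = (hP.trans hQ).spec n ≫ c.σ n
    rw [← Category.assoc, hP.spec_comp hQ]
  comm n := hQ.spec_incl n

/-- The morphism over `S` from the zeroth step of a formal scheme to the point `s`. -/
lemma FormalCoordinates.tower_zero (c : FormalCoordinates h q s d) (P : AdicRing d)
    (hP : (adic (coeffsIn d R')).Le P) :
    (hP.spec 0 ≫ constSpec d h 0) ≫ s = (c.tower P hP).t 0 := by
  change _ = hP.spec 0 ≫ c.σ 0
  rw [Category.assoc, c.zero]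

variable {X : Scheme.{0}} {f : X ⟶ S} {ι : Type} {D : ι → X.IdealSheafData}

/-- The formal flat bundle `E'` over the formal scheme of `Q` is an isomonodromic deformation of
(the base change of) the flat bundle `E` on the fiber at `s`: the relative connection extends
to an absolute one, and the restriction to the special fiber is identified with `E`. -/
def IsIsomonodromicDeformation (c : FormalCoordinates h q s d) (Q : AdicRing d)
    (hQ : (adic (coeffsIn d R')).Le Q) (E : FlatBundleOver f D s)
    (E' : FormalFlatBundle f D (c.tower Q hQ)) : Prop :=
  Nonempty (AbsConnection q E') ∧
  Nonempty (PullbackMap (bcMap f (hQ.spec 0 ≫ constSpec d h 0) (c.tower_zero Q hQ)) E (E'.E 0))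

/-- The flat bundle `E` on the fiber at `s` has an isomonodromic deformation over the formal scheme
of `R'_ℚ[[x]]` which descends to a flat bundle over the formal scheme of `P`. -/
def HasModel (c : FormalCoordinates h q s d) (P : AdicRing d)
    (hP : (adic (coeffsIn d R')).Le P) (hQ : P.Le (trunc (coeffsIn d (rat R'))))
    (E : FlatBundleOver f D s) : Prop :=
  ∃ E' : FormalFlatBundle f D (c.tower _ (hP.trans hQ)),
    IsIsomonodromicDeformation c _ (hP.trans hQ) E E' ∧
    ∃ E'' : FormalFlatBundle f D (c.tower P hP),
      Nonempty (FormalPullbackMap f D (c.towerMap hP hQ) E'' E')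

/-- `E` has a `g`-integral isomonodromic deformation: the isomonodromic deformation descends to
the formal spectrum of the ring of `g`-integral elements. -/
def IsGIntegral (c : FormalCoordinates h q s d) (g : Nat.Primes → ℕ)
    (E : FlatBundleOver f D s) : Prop :=
  HasModel c (adic (gSubring d R' g)) (adic_le_adic (coeffsIn_le_gSubring R' g))
    ((adic_le_trunc _).trans (trunc_le_trunc (gSubring_le R' g))) E

/-- The variant of `g`-integrality for the topology that the ring of `g`-integral elements inherits
from the ring of power series: modulo terms of degree greater than `n`, the coefficients of degree
`m ≤ n` are in `R'[1/p : g(p) < m]`. -/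
def IsGIntegralDegreewise (c : FormalCoordinates h q s d) (g : Nat.Primes → ℕ)
    (E : FlatBundleOver f D s) : Prop :=
  HasModel c (trunc (gSubring d R' g))
    ((adic_le_trunc _).trans (trunc_le_trunc (coeffsIn_le_gSubring R' g)))
    (trunc_le_trunc (gSubring_le R' g)) E

/-- `E` has an `ω(p)`-integral isomonodromic deformation: it has a `g`-integral one for some `g`
with `g(p)/p → ∞`. -/
def IsOmegaIntegral (c : FormalCoordinates h q s d) (E : FlatBundleOver f D s) : Prop :=
  ∃ g : Nat.Primes → ℕ,
    Filter.Tendsto (fun p : Nat.Primes => (g p : ℝ) / (p : ℕ)) Filter.cofinite Filter.atTop ∧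
    IsGIntegral c g E

end deformation

/-! ### Reduction modulo `p` -/

/-- The morphism `Spec R/p ⟶ Spec R`. -/
abbrev modP (R : Subring ℂ) (p : ℕ) :
    Spec (CommRingCat.of (R ⧸ Ideal.span {(p : R)})) ⟶ Spec (CommRingCat.of R) :=
  Spec.map (CommRingCat.ofHom (Ideal.Quotient.mk (Ideal.span {(p : R)})))

/-- The reduction modulo `p` of a flat bundle on the fiber at `s` has vanishing `p`-curvature. -/
def PCurvatureVanishesModP {X S : Scheme.{0}} {f : X ⟶ S} {ι : Type} {D : ι → X.IdealSheafData}
    {R : Subring ℂ} {s : Spec (CommRingCat.of R) ⟶ S} (E : FlatBundleOver f D s) (p : ℕ) : Prop :=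
  ∃ Ep : FlatBundleOver f D (modP R p ≫ s),
    Nonempty (PullbackMap (bcMap f (modP R p) rfl) E Ep) ∧ Ep.PCurvatureVanishes p

end Isomonodromy

end

open CategoryTheory CategoryTheory.Limits AlgebraicGeometry TopologicalSpace

noncomputable section

namespace Isomonodromy

section

/-! ### Étale coordinates -/

section EtaleCoordinates

variable {Λ A : Type} [CommRing Λ] [CommRing A] {n : ℕ}

/-- `c₁, …, cₙ` are étale coordinates of the `Λ`-algebra `A`. -/
def EtaleCoords (f : Λ →+* A) (c : Fin n → A) : Prop :=
  (MvPolynomial.eval₂Hom f c).Etale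

lemma EtaleCoords.derivation_ext {f : Λ →+* A} {c : Fin n → A} (h : EtaleCoords f c)
    {B : Type} [CommRing B] (r : A →+* B) (d₁ d₂ : A →+ B)
    (h₁ : ∀ a b, d₁ (a * b) = r a * d₁ b + r b * d₁ a)
    (h₂ : ∀ a b, d₂ (a * b) = r a * d₂ b + r b * d₂ a)
    (hf : ∀ x, d₁ (f x) = d₂ (f x)) (hc : ∀ k, d₁ (c k) = d₂ (c k)) : d₁ = d₂ := by
  let P := MvPolynomial (Fin n) Λ
  let _ : Algebra P A := (MvPolynomial.eval₂Hom f c).toAlgebra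
  let _ : Module A B := Module.compHom B r
  let _ : Module P B := Module.compHom B (r.comp (algebraMap P A))
  have : IsScalarTower P A B := ⟨fun x y z => by
    change r (x • y) * z = r (algebraMap P A x) * (r y * z)
    rw [Algebra.smul_def, map_mul, mul_assoc]⟩
  have hE : Algebra.Etale P A := h
  let d : A →+ B := d₁ - d₂
  have hd : ∀ a b, d (a * b) = r a * d b + r b * d a := fun a b => by
    simp only [d, AddMonoidHom.sub_apply, h₁, h₂]; ring
  have hP : ∀ x : P, d (algebraMap P A x) = 0 := by
    intro x
    induction x using MvPolynomial.induction_on with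
    | C a =>
      change d (MvPolynomial.eval₂Hom f c (MvPolynomial.C a)) = 0
      simp [d, hf]
    | add p q hp hq => rw [map_add, map_add, hp, hq, add_zero]
    | mul_X p k hp =>
      rw [map_mul, hd, hp]
      change r _ * d (MvPolynomial.eval₂Hom f c (MvPolynomial.X k)) + _ = 0
      simp [d, hc]
  let δ : Derivation P A B :=
    { toFun := d
      map_add' := d.map_add
      map_smul' := fun x a => by
        change d (x • a) = r (algebraMap P A x) * d a
        rw [Algebra.smul_def, hd, hP, mul_zero, add_zero]
      map_one_eq_zero' := by
        change d 1 = 0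
        simpa using hP 1
      leibniz' := fun a b => hd a b }
  have h0 : δ.liftKaehlerDifferential = 0 := by
    refine LinearMap.ext fun x => ?_
    rw [Subsingleton.elim x 0, map_zero, map_zero]
  ext a
  have : δ a = 0 := by rw [← Derivation.liftKaehlerDifferential_comp_D, h0, LinearMap.zero_apply]
  exact sub_eq_zero.mp this

lemma EtaleCoords.exists_derivation {f : Λ →+* A} {c : Fin n → A} (h : EtaleCoords f c)
    (k : Fin n) : ∃ d : A →+ A, (∀ a b, d (a * b) = a * d b + b * d a) ∧ (∀ x, d (f x) = 0) ∧
      ∀ l, d (c l) = if l = k then 1 else 0 := by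
  let P := MvPolynomial (Fin n) Λ
  let _ : Algebra P A := (MvPolynomial.eval₂Hom f c).toAlgebra
  let _ : Algebra Λ A := f.toAlgebra
  have : IsScalarTower Λ P A := .of_algebraMap_eq fun x => by
    change f x = MvPolynomial.eval₂Hom f c (MvPolynomial.C x); simp
  have hE : Algebra.Etale P A := h
  let δ₀ : Derivation Λ P A := MvPolynomial.mkDerivation Λ (fun l => if l = k then (1 : A) else 0)
  let L : TensorProduct P A (Ω[P⁄Λ]) →ₗ[A] A := δ₀.liftKaehlerDifferential.liftBaseChange A
  let δ : Derivation Λ A A := (L.comp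
    (KaehlerDifferential.tensorKaehlerEquivOfFormallyEtale Λ P A).symm.toLinearMap).compDer
      (KaehlerDifferential.D Λ A)
  have hδ : ∀ x : P, δ (algebraMap P A x) = δ₀ x := fun x => by
    change L ((KaehlerDifferential.tensorKaehlerEquivOfFormallyEtale Λ P A).symm
      (KaehlerDifferential.D Λ A (algebraMap P A x))) = _
    rw [KaehlerDifferential.tensorKaehlerEquivOfFormallyEtale_symm_D_algebraMap]
    simp [L]
  refine ⟨δ.toLinearMap.toAddMonoidHom, fun a b => δ.leibniz a b, fun x => δ.map_algebraMap x,
    fun l => ?_⟩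
  have : c l = algebraMap P A (MvPolynomial.X l) := by
    change _ = MvPolynomial.eval₂Hom f c (MvPolynomial.X l); simp
  change δ (c l) = _
  rw [this, hδ]
  exact MvPolynomial.mkDerivation_X Λ _ l

lemma EtaleCoords.mem_nonZeroDivisors {f : Λ →+* A} {c : Fin n → A} (h : EtaleCoords f c)
    (k : Fin n) : c k ∈ nonZeroDivisors A := by
  have hflat : (MvPolynomial.eval₂Hom f c).Flat := (RingHom.Etale.iff_flat_and_formallyUnramified.mp h).1
  algebraize [MvPolynomial.eval₂Hom f c]
  have hX : IsSMulRegular (MvPolynomial (Fin n) Λ) (MvPolynomial.X k : MvPolynomial (Fin n) Λ) := by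
    exact MvPolynomial.isRegular_X.left
  have hA : IsSMulRegular A (MvPolynomial.X k : MvPolynomial (Fin n) Λ) :=
    hX.of_flat
  rw [mem_nonZeroDivisors_iff]
  have key : ∀ x, c k * x = 0 → x = 0 := by
    intro x hx
    apply hA
    simp only [smul_zero]
    rw [Algebra.smul_def]
    change MvPolynomial.eval₂Hom f c (MvPolynomial.X k) * x = 0
    simpa using hx
  exact ⟨key, fun x hx => key x (by rwa [mul_comm])⟩

lemma EtaleCoords.flat {f : Λ →+* A} {c : Fin n → A} (h : EtaleCoords f c) : f.Flat := by
  have hflat : (MvPolynomial.eval₂Hom f c).Flat := (RingHom.Etale.iff_flat_and_formallyUnramified.mp h).1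
  have h1 : (MvPolynomial.C : Λ →+* MvPolynomial (Fin n) Λ).Flat := by
    rw [← MvPolynomial.algebraMap_eq, RingHom.flat_algebraMap_iff]
    infer_instance
  have : f = (MvPolynomial.eval₂Hom f c).comp MvPolynomial.C := by ext; simp
  rw [this]
  exact RingHom.Flat.comp h1 hflat

lemma EtaleCoords.hom_ext {f : Λ →+* A} {c : Fin n → A} (h : EtaleCoords f c)
    {C C₀ : Type} [CommRing C] [CommRing C₀] (π : C →+* C₀) (hπ : IsNilpotent (RingHom.ker π))
    (φ ψ : A →+* C) (hf : ∀ x, φ (f x) = ψ (f x)) (hc : ∀ k, φ (c k) = ψ (c k))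
    (h0 : ∀ a, π (φ a) = π (ψ a)) : φ = ψ := by
  let P := MvPolynomial (Fin n) Λ
  let _ : Algebra P A := (MvPolynomial.eval₂Hom f c).toAlgebra
  let _ : Algebra P C := (φ.comp (MvPolynomial.eval₂Hom f c)).toAlgebra
  have hE : Algebra.Etale P A := h
  let φ' : A →ₐ[P] C := ⟨φ, fun x => rfl⟩
  let ψ' : A →ₐ[P] C := ⟨ψ, fun x => by
    change (ψ.comp (MvPolynomial.eval₂Hom f c)) x = (φ.comp (MvPolynomial.eval₂Hom f c)) x
    congr 1
    apply MvPolynomial.ringHom_ext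
    · intro r; simp [hf]
    · intro k; simp [hc]⟩
  have := Algebra.FormallyUnramified.ext' π hπ φ' ψ' h0
  ext a
  exact congr($this a)

lemma EtaleCoords.exists_lift {f : Λ →+* A} {c : Fin n → A} (h : EtaleCoords f c)
    {C C₀ : Type} [CommRing C] [CommRing C₀] (π : C →+* C₀) (hs : Function.Surjective π)
    (hπ : IsNilpotent (RingHom.ker π)) (φ₀ : A →+* C₀) (β : Λ →+* C) (b : Fin n → C)
    (hβ : ∀ x, π (β x) = φ₀ (f x)) (hb : ∀ k, π (b k) = φ₀ (c k)) :
    ∃ φ : A →+* C, (∀ x, φ (f x) = β x) ∧ (∀ k, φ (c k) = b k) ∧ ∀ a, π (φ a) = φ₀ a := by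
  let P := MvPolynomial (Fin n) Λ
  let _ : Algebra P A := (MvPolynomial.eval₂Hom f c).toAlgebra
  let _ : Algebra P C := (MvPolynomial.eval₂Hom β b).toAlgebra
  let _ : Algebra P C₀ := (φ₀.comp (MvPolynomial.eval₂Hom f c)).toAlgebra
  have hE : Algebra.Etale P A := h
  let φ₀' : A →ₐ[P] C₀ := ⟨φ₀, fun x => rfl⟩
  let π' : C →ₐ[P] C₀ := ⟨π, fun x => by
    change (π.comp (MvPolynomial.eval₂Hom β b)) x = (φ₀.comp (MvPolynomial.eval₂Hom f c)) x
    congr 1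
    apply MvPolynomial.ringHom_ext
    · intro r; simp [hβ]
    · intro k; simp [hb]⟩
  let φ := Algebra.FormallySmooth.liftOfSurjective φ₀' π' hs hπ
  refine ⟨φ.toRingHom, fun x => ?_, fun k => ?_, fun a =>
    Algebra.FormallySmooth.liftOfSurjective_apply φ₀' π' hs hπ a⟩
  · have := φ.commutes (MvPolynomial.C x)
    change φ (MvPolynomial.eval₂Hom f c (MvPolynomial.C x)) =
      MvPolynomial.eval₂Hom β b (MvPolynomial.C x) at this
    simpa using this
  · have := φ.commutes (MvPolynomial.X k)
    change φ (MvPolynomial.eval₂Hom f c (MvPolynomial.X k)) =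
      MvPolynomial.eval₂Hom β b (MvPolynomial.X k) at this
    simpa using this

lemma EtaleCoords.comp {f : Λ →+* A} {c : Fin n → A} (h : EtaleCoords f c)
    {B : Type} [CommRing B] (r : A →+* B) (hr : r.Etale) :
    EtaleCoords (r.comp f) (fun k => r (c k)) := by
  have : MvPolynomial.eval₂Hom (r.comp f) (fun k => r (c k)) =
      r.comp (MvPolynomial.eval₂Hom f c) := by
    apply MvPolynomial.ringHom_ext <;> simp
  rw [EtaleCoords, this]
  exact RingHom.Etale.stableUnderComposition _ _ h hr

lemma etale_of_isPushout {Λ A Λ' A' : CommRingCat.{0}} {f : Λ ⟶ A} {g : Λ ⟶ Λ'}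
    {g' : A ⟶ A'} {f' : Λ' ⟶ A'} (hp : IsPushout f g g' f') (h : f.hom.Etale) :
    f'.hom.Etale := by
  algebraize [f.hom, g.hom, g'.hom, f'.hom, g'.hom.comp f.hom]
  have : IsScalarTower Λ Λ' A' := .of_algebraMap_eq fun x => congr($(hp.w) x)
  have : Algebra.IsPushout Λ A Λ' A' := CommRingCat.isPushout_iff_isPushout.mp hp
  exact RingHom.Etale.isStableUnderBaseChange Λ A Λ' A' h

lemma isPushout_mvPolynomial_map {Λ Λ' : Type} [CommRing Λ] [CommRing Λ'] (g : Λ →+* Λ') :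
    IsPushout (CommRingCat.ofHom (MvPolynomial.C (R := Λ) (σ := Fin n))) (CommRingCat.ofHom g)
      (CommRingCat.ofHom (MvPolynomial.map g))
      (CommRingCat.ofHom (MvPolynomial.C (R := Λ') (σ := Fin n))) := by
  algebraize [g]
  let _ : Algebra (MvPolynomial (Fin n) Λ) (MvPolynomial (Fin n) Λ') :=
    MvPolynomial.algebraMvPolynomial
  exact CommRingCat.isPushout_of_isPushout Λ (MvPolynomial (Fin n) Λ) Λ' (MvPolynomial (Fin n) Λ')

lemma EtaleCoords.of_isPushout {Λ A Λ' A' : CommRingCat.{0}} {f : Λ ⟶ A} {g : Λ ⟶ Λ'}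
    {g' : A ⟶ A'} {f' : Λ' ⟶ A'} (hp : IsPushout f g g' f') {c : Fin n → A}
    (h : EtaleCoords f.hom c) : EtaleCoords f'.hom (fun k => g'.hom (c k)) := by
  have sq := isPushout_mvPolynomial_map g.hom (n := n)
  have hr : IsPushout (CommRingCat.ofHom (MvPolynomial.eval₂Hom f.hom c))
      (CommRingCat.ofHom (MvPolynomial.map g.hom)) g'
      (CommRingCat.ofHom (MvPolynomial.eval₂Hom f'.hom (fun k => g'.hom (c k)))) := by
    have e₁ : CommRingCat.ofHom (MvPolynomial.C (R := Λ) (σ := Fin n)) ≫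
        CommRingCat.ofHom (MvPolynomial.eval₂Hom f.hom c) = f := by ext; simp
    have e₂ : CommRingCat.ofHom (MvPolynomial.C (R := Λ') (σ := Fin n)) ≫
        CommRingCat.ofHom (MvPolynomial.eval₂Hom f'.hom (fun k => g'.hom (c k))) = f' := by
      ext; simp
    refine IsPushout.of_left (h₁₁ := CommRingCat.ofHom (MvPolynomial.C (R := Λ) (σ := Fin n)))
      (h₂₁ := CommRingCat.ofHom (MvPolynomial.C (R := Λ') (σ := Fin n))) (v₁₁ := g) ?_ ?_ sq
    · rw [e₁, e₂]; exact hp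
    · refine CommRingCat.hom_ext (MvPolynomial.ringHom_ext (fun a => ?_) fun k => ?_)
      · simpa using congr($(hp.w) a)
      · simp
  exact etale_of_isPushout hr h

lemma EtaleCoords.of_base {f : Λ →+* A} {c : Fin n → A} (h : EtaleCoords f c)
    {Λ₀ : Type} [CommRing Λ₀] (r : Λ₀ →+* Λ) (hr : r.Etale) : EtaleCoords (f.comp r) c := by
  have : MvPolynomial.eval₂Hom (f.comp r) c =
      (MvPolynomial.eval₂Hom f c).comp (MvPolynomial.map r) := by
    apply MvPolynomial.ringHom_ext <;> simp
  rw [EtaleCoords, this]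
  exact RingHom.Etale.stableUnderComposition _ _
    (etale_of_isPushout (isPushout_mvPolynomial_map r (n := n)).flip hr) h

/-- The Jacobian criterion. -/
lemma EtaleCoords.of_basis [Algebra Λ A] [Algebra.Smooth Λ A] (c : Fin n → A)
    (b : Module.Basis (Fin n) A (Ω[A⁄Λ])) (hb : ∀ j, b j = KaehlerDifferential.D Λ A (c j)) :
    EtaleCoords (algebraMap Λ A) c := by
  let P := MvPolynomial (Fin n) Λ
  let _ : Algebra P A := (MvPolynomial.eval₂Hom (algebraMap Λ A) c).toAlgebra
  have : IsScalarTower Λ P A := .of_algebraMap_eq fun x => by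
    change _ = MvPolynomial.eval₂Hom (algebraMap Λ A) c (MvPolynomial.C x); simp
  have hX : ∀ k, algebraMap P A (MvPolynomial.X k) = c k := fun k => by
    change MvPolynomial.eval₂Hom (algebraMap Λ A) c (MvPolynomial.X k) = _; simp
  let bP : Module.Basis (Fin n) A (TensorProduct P A (Ω[P⁄Λ])) :=
    (KaehlerDifferential.mvPolynomialBasis Λ (Fin n)).baseChange A
  have hm : ⇑(KaehlerDifferential.mapBaseChange Λ P A) = bP.equiv b (Equiv.refl _) := by
    have : KaehlerDifferential.mapBaseChange Λ P A = (bP.equiv b (Equiv.refl _)).toLinearMap := by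
      refine bP.ext fun k => ?_
      rw [LinearEquiv.coe_coe, Module.Basis.equiv_apply, Equiv.refl_apply, hb, ← hX]
      simp only [bP, Module.Basis.baseChange_apply, KaehlerDifferential.mvPolynomialBasis_apply]
      exact (KaehlerDifferential.mapBaseChange_tmul ..).trans (by
        rw [one_smul, KaehlerDifferential.map_D])
    rw [this]; rfl
  have h1 : Subsingleton (Algebra.H1Cotangent P A) := by
    refine ⟨fun x y => ?_⟩
    have key : ∀ x : Algebra.H1Cotangent P A, x = 0 := by
      intro x
      have hx : Algebra.H1Cotangent.δ Λ P A x = 0 := by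
        have := (Algebra.H1Cotangent.exact_δ_mapBaseChange Λ P A).apply_apply_eq_zero x
        rw [hm] at this
        exact (bP.equiv b (Equiv.refl _)).map_eq_zero_iff.mp this
      obtain ⟨y, rfl⟩ := (Algebra.H1Cotangent.exact_map_δ Λ P A x).mp hx
      rw [Subsingleton.elim y 0, map_zero]
    rw [key x, key y]
  have h2 : Subsingleton (Ω[A⁄P]) := by
    refine ⟨fun x y => ?_⟩
    have key : ∀ x : Ω[A⁄P], x = 0 := by
      intro x
      obtain ⟨y, rfl⟩ := KaehlerDifferential.map_surjective Λ P A x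
      refine (KaehlerDifferential.exact_mapBaseChange_map Λ P A y).mpr ?_
      rw [hm]
      exact (bP.equiv b (Equiv.refl _)).surjective y
    rw [key x, key y]
  have : Algebra.FormallyEtale P A := ⟨h2, h1⟩
  have : Algebra.FinitePresentation P A :=
    Algebra.FinitePresentation.of_restrict_scalars_finitePresentation Λ P A
  change Algebra.Etale P A
  exact ⟨inferInstance, inferInstance⟩

lemma EtaleCoords.of_etale {f : Λ →+* A} (hf : f.Etale) : EtaleCoords f (Fin.elim0 : Fin 0 → A) := by
  have : MvPolynomial.eval₂Hom f (Fin.elim0 : Fin 0 → A) =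
      f.comp (MvPolynomial.isEmptyRingEquiv Λ (Fin 0)).toRingHom := by
    refine MvPolynomial.ringHom_ext (fun a => ?_) fun k => k.elim0
    have : (MvPolynomial.C a : MvPolynomial (Fin 0) Λ) =
        (MvPolynomial.isEmptyRingEquiv Λ (Fin 0)).symm a :=
      congr($(MvPolynomial.isEmptyRingEquiv_symm_toRingHom Λ) a).symm
    have h2 : MvPolynomial.eval₂Hom f (Fin.elim0 : Fin 0 → A) (MvPolynomial.C a) = f a := by simp
    have h3 : MvPolynomial.isEmptyRingEquiv Λ (Fin 0) (MvPolynomial.C a) = a := by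
      rw [this, RingEquiv.apply_symm_apply]
    exact h2.trans (congrArg f h3.symm)
  rw [EtaleCoords, this]
  exact RingHom.Etale.stableUnderComposition _ _
    (RingHom.Etale.of_bijective (MvPolynomial.isEmptyRingEquiv Λ (Fin 0)).bijective) hf

/-- A derivation is determined by its values on étale coordinates. -/
lemma EtaleCoords.derivation_eq_sum {f : Λ →+* A} {c : Fin n → A} (h : EtaleCoords f c)
    {B : Type} [CommRing B] (r : A →+* B) (d : A →+ B)
    (hd : ∀ a b, d (a * b) = r a * d b + r b * d a) (hf : ∀ x, d (f x) = 0)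
    (w : Fin n → ℕ) (D : Fin n → A →+ A)
    (hD : ∀ k a b, D k (a * b) = a * D k b + b * D k a) (hDf : ∀ k x, D k (f x) = 0)
    (hDc : ∀ k l, D k (c l) = if l = k then c l ^ w l else 0)
    (lam : Fin n → B) (hlam : ∀ k, d (c k) = r (c k) ^ w k * lam k) (a : A) :
    d a = ∑ k, lam k * r (D k a) := by
  let d' : A →+ B := ∑ k, (AddMonoidHom.mulLeft (lam k)).comp (r.toAddMonoidHom.comp (D k))
  have hd' : ∀ a, d' a = ∑ k, lam k * r (D k a) := fun a => by
    simp [d', AddMonoidHom.finsetSum_apply]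
  rw [← hd']
  refine DFunLike.congr_fun (h.derivation_ext r d d' hd (fun a b => ?_) (fun x => ?_)
    fun l => ?_) a
  · simp only [hd', hD, Finset.mul_sum, map_add, map_mul, ← Finset.sum_add_distrib]
    exact Finset.sum_congr rfl fun k _ => by ring
  · simp [hd', hDf, hf]
  · simp only [hd', hDc, hlam]
    rw [Finset.sum_eq_single l]
    · simp [mul_comm]
    · intro k _ hk; simp [hk.symm]
    · simp

end EtaleCoordinates

end

section

/-! ### Gluing functions -/

section Gluing

variable {Y : Scheme.{0}}

@[simp] lemma resO_resO {U V W : Y.Opens} (h : V ≤ U) (h' : W ≤ V) (a : Γ(Y, U)) :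
    resO h' (resO h a) = resO (h'.trans h) a := by
  simp only [resO, ← CommRingCat.comp_apply, ← Functor.map_comp]
  rfl

@[simp] lemma resO_self {U : Y.Opens} (h : U ≤ U) (a : Γ(Y, U)) : resO h a = a := by
  have : homOfLE h = 𝟙 U := rfl
  rw [resO, this]
  simp

lemma resO_ext {U : Y.Opens} {a b : Γ(Y, U)}
    (h : ∀ x ∈ U, ∃ (V : Y.Opens) (hV : V ≤ U), x ∈ V ∧ resO hV a = resO hV b) : a = b := by
  refine Y.IsSheaf.section_ext fun x hx => ?_
  obtain ⟨V, hV, hxV, e⟩ := h x hx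
  exact ⟨V, hV, hxV, e⟩

lemma exists_affine_mem {U : Y.Opens} {x : Y} (hx : x ∈ U) :
    ∃ V : Y.Opens, IsAffineOpen V ∧ V ≤ U ∧ x ∈ V := by
  obtain ⟨_, ⟨V, hV, rfl⟩, hxV, hVU⟩ :=
    Y.isBasis_affineOpens.exists_subset_of_mem_open hx U.isOpen
  exact ⟨V, hV, hVU, hxV⟩

lemma resO_ext_affine {U : Y.Opens} {a b : Γ(Y, U)}
    (h : ∀ (V : Y.Opens) (hV : V ≤ U), IsAffineOpen V → resO hV a = resO hV b) : a = b := by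
  refine resO_ext fun x hx => ?_
  obtain ⟨V, hV, hVU, hxV⟩ := exists_affine_mem hx
  exact ⟨V, hVU, hxV, h V hVU hV⟩

/-- A local property of functions that determines the function. -/
lemma exists_of_locally {U : Y.Opens} (P : ∀ V : Y.Opens, V ≤ U → Γ(Y, V) → Prop)
    (hres : ∀ (V W : Y.Opens) (hV : V ≤ U) (hW : W ≤ V) (a : Γ(Y, V)), P V hV a →
      P W (hW.trans hV) (resO hW a))
    (huniq : ∀ (V : Y.Opens) (hV : V ≤ U) (a b : Γ(Y, V)), P V hV a → P V hV b → a = b)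
    (hloc : ∀ x ∈ U, ∃ (V : Y.Opens) (hV : V ≤ U), x ∈ V ∧ ∃ a, P V hV a)
    (hglue : ∀ a : Γ(Y, U), (∀ x ∈ U, ∃ (V : Y.Opens) (hV : V ≤ U), x ∈ V ∧ P V hV (resO hV a)) →
      P U le_rfl a) : ∃ a, P U le_rfl a := by
  choose V hV hxV s hs using hloc
  obtain ⟨a, ha, -⟩ := Y.sheaf.existsUnique_gluing' (fun x : U => V x.1 x.2) U
    (fun x => homOfLE (hV x.1 x.2)) (fun x hx => Opens.mem_iSup.mpr ⟨⟨x, hx⟩, hxV x hx⟩)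
    (fun x => s x.1 x.2) (fun x y => huniq _ (inf_le_left.trans (hV x.1 x.2)) _ _
      (hres _ _ (hV x.1 x.2) inf_le_left _ (hs x.1 x.2))
      (hres _ _ (hV y.1 y.2) inf_le_right _ (hs y.1 y.2)))
  refine ⟨a, hglue a fun x hx => ⟨V x hx, hV x hx, hxV x hx, ?_⟩⟩
  have : resO (hV x hx) a = s x hx := ha ⟨x, hx⟩
  rw [this]
  exact hs x hx

lemma etale_resO {U V : Y.Opens} (h : V ≤ U) (hU : IsAffineOpen U) (hV : IsAffineOpen V) :
    (resO h).Etale := by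
  have := Scheme.Hom.etale_appLE (𝟙 Y) hU hV h
  have e : (𝟙 Y : Y ⟶ Y).appLE U V h = Y.presheaf.map (homOfLE h).op := by
    simp only [Scheme.Hom.appLE]
    exact Category.id_comp _
  rwa [e] at this

lemma appLE_resO {Y' : Scheme.{0}} (h : Y' ⟶ Y) {U V : Y.Opens} {U' V' : Y'.Opens}
    (hU : U' ≤ h ⁻¹ᵁ U) (hV : V' ≤ h ⁻¹ᵁ V) (i : V ≤ U) (i' : V' ≤ U') (a : Γ(Y, U)) :
    (h.appLE V V' hV).hom (resO i a) = resO i' ((h.appLE U U' hU).hom a) := by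
  simp only [resO, ← CommRingCat.comp_apply, Scheme.Hom.appLE_map, Scheme.Hom.map_appLE]

lemma resO_appLE {Y' : Scheme.{0}} (h : Y' ⟶ Y) {U : Y.Opens} {U' V' : Y'.Opens}
    (hU : U' ≤ h ⁻¹ᵁ U) (i' : V' ≤ U') (a : Γ(Y, U)) :
    resO i' ((h.appLE U U' hU).hom a) = (h.appLE U V' (i'.trans hU)).hom a := by
  simp only [resO, ← CommRingCat.comp_apply, Scheme.Hom.appLE_map]

lemma le_preimage_top {T : Scheme.{0}} (g : Y ⟶ T) (U : Y.Opens) : U ≤ g ⁻¹ᵁ ⊤ := fun _ _ => trivial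

/-- The functions on `T` as functions on an open subset of `Y`. -/
def constMap {T : Scheme.{0}} (g : Y ⟶ T) (U : Y.Opens) : Γ(T, ⊤) →+* Γ(Y, U) :=
  (g.appLE ⊤ U (le_preimage_top g U)).hom

@[simp] lemma resO_constMap {T : Scheme.{0}} (g : Y ⟶ T) {U V : Y.Opens} (h : V ≤ U)
    (a : Γ(T, ⊤)) : resO h (constMap g U a) = constMap g V a := resO_appLE g _ h a

lemma MemIdeal.res {I : Y.IdealSheafData} {U V : Y.Opens} (h : V ≤ U) {a : Γ(Y, U)}
    (ha : MemIdeal I a) : MemIdeal I (resO h a) := fun W hW => by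
  rw [resO_resO]; exact ha W _

lemma memIdeal_of_affine {I : Y.IdealSheafData} {V : Y.affineOpens} {a : Γ(Y, V.1)}
    (ha : a ∈ I.ideal V) : MemIdeal I a := fun W hW => I.ideal_le_comap_ideal hW ha

end Gluing

/-! ### Logarithmic étale charts -/

/-- An affine open subset `V` of `Y` with étale coordinates over `T` such that each of the `D i` is
either empty on `V` or cut out by one of the coordinates. The coordinates of weight one are
those that cut out some `D i`. -/
structure LogChart {Y T : Scheme.{0}} (g : Y ⟶ T) {ι : Type} (D : ι → Y.IdealSheafData)
    (n : ℕ) where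
  V : Y.Opens
  affine : IsAffineOpen V
  c : Fin n → Γ(Y, V)
  w : Fin n → ℕ
  w_eq : ∀ k, w k = 0 ∨ w k = 1
  etale : EtaleCoords (constMap g V) c
  log : ∀ k, w k = 1 → ∃ i, (D i).ideal ⟨V, affine⟩ = Ideal.span {c k}
  ideal : ∀ i, (D i).ideal ⟨V, affine⟩ = ⊤ ∨
    ∃ k, w k = 1 ∧ (D i).ideal ⟨V, affine⟩ = Ideal.span {c k}

namespace LogChart

variable {Y T : Scheme.{0}} {g : Y ⟶ T} {ι : Type} {D : ι → Y.IdealSheafData} {n : ℕ}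
  (ch : LogChart g D n)

/-- The coordinates on a smaller open set. -/
def coord {U : Y.Opens} (h : U ≤ ch.V) (k : Fin n) : Γ(Y, U) := resO h (ch.c k)

@[simp] lemma resO_coord {U V : Y.Opens} (h : U ≤ ch.V) (h' : V ≤ U) (k : Fin n) :
    resO h' (ch.coord h k) = ch.coord (h'.trans h) k := resO_resO _ _ _

lemma etaleCoords {U : Y.Opens} (h : U ≤ ch.V) (hU : IsAffineOpen U) :
    EtaleCoords (constMap g U) (ch.coord h) := by
  have := ch.etale.comp (resO h) (etale_resO h ch.affine hU)
  have e : (resO h).comp (constMap g ch.V) = constMap g U := by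
    ext a
    exact resO_appLE g _ h a
  rwa [e] at this

lemma ideal_eq {U : Y.Opens} (h : U ≤ ch.V) (hU : IsAffineOpen U) {i : ι} {k : Fin n}
    (hk : (D i).ideal ⟨ch.V, ch.affine⟩ = Ideal.span {ch.c k}) :
    (D i).ideal ⟨U, hU⟩ = Ideal.span {ch.coord h k} := by
  rw [← (D i).map_ideal (U := ⟨U, hU⟩) (V := ⟨ch.V, ch.affine⟩) h, hk, Ideal.map_span,
    Set.image_singleton]
  rfl

lemma ideal_eq_top {U : Y.Opens} (h : U ≤ ch.V) (hU : IsAffineOpen U) {i : ι}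
    (hk : (D i).ideal ⟨ch.V, ch.affine⟩ = ⊤) : (D i).ideal ⟨U, hU⟩ = ⊤ := by
  rw [← (D i).map_ideal (U := ⟨U, hU⟩) (V := ⟨ch.V, ch.affine⟩) h, hk, Ideal.map_top]

lemma coord_pow_cancel {U : Y.Opens} (h : U ≤ ch.V) (k : Fin n) (m : ℕ) {a b : Γ(Y, U)}
    (e : ch.coord h k ^ m * a = ch.coord h k ^ m * b) : a = b := by
  refine resO_ext_affine fun V hV hVa => ?_
  have h1 := pow_mem ((ch.etaleCoords (hV.trans h) hVa).mem_nonZeroDivisors k) m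
  apply (mul_cancel_left_mem_nonZeroDivisors h1).mp
  have := congr(resO hV $e)
  simpa using this

/-- A function that is divisible by the coordinate `c k` if that is a logarithmic one. -/
def Divisible {U : Y.Opens} (h : U ≤ ch.V) (k : Fin n) (y : Γ(Y, U)) : Prop :=
  ∃ a, ch.coord h k ^ ch.w k * a = y

lemma divisible_of_exists {U : Y.Opens} (h : U ≤ ch.V) (k : Fin n) (y : Γ(Y, U))
    (hy : ch.w k = 1 → ∃ i, (D i).ideal ⟨ch.V, ch.affine⟩ = Ideal.span {ch.c k} ∧
      MemIdeal (D i) y) :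
    ch.Divisible h k y := by
  rcases ch.w_eq k with hk | hk
  · exact ⟨y, by simp [hk]⟩
  obtain ⟨i, hi, hy'⟩ := hy hk
  refine exists_of_locally
    (fun V hV a => ch.coord (hV.trans h) k ^ ch.w k * a = resO hV y) ?_ ?_ ?_ ?_ |>.imp
    fun a ha => by simpa using ha
  · intro V W hV hW a ha
    simpa using congr(resO hW $ha)
  · intro V hV a b ha hb
    exact ch.coord_pow_cancel _ _ _ (ha.trans hb.symm)
  · intro x hx
    obtain ⟨V, hVa, hVU, hxV⟩ := exists_affine_mem hx
    refine ⟨V, hVU, hxV, ?_⟩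
    have := hy' ⟨V, hVa⟩ hVU
    rw [ch.ideal_eq (hVU.trans h) hVa hi, Ideal.mem_span_singleton] at this
    obtain ⟨a, ha⟩ := this
    exact ⟨a, by rw [hk, pow_one]; exact ha.symm⟩
  · intro a ha
    refine resO_ext fun x hx => ?_
    obtain ⟨V, hV, hxV, e⟩ := ha x hx
    exact ⟨V, hV, hxV, by simpa using e⟩

lemma divisible_of_memIdeal {U : Y.Opens} (h : U ≤ ch.V) (k : Fin n) (y : Γ(Y, U))
    (hy : ∀ i, (D i).ideal ⟨ch.V, ch.affine⟩ = Ideal.span {ch.c k} → MemIdeal (D i) y) :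
    ch.Divisible h k y :=
  ch.divisible_of_exists h k y fun hk =>
    let ⟨i, hi⟩ := ch.log k hk
    ⟨i, hi, hy i hi⟩

open Classical in
/-- The quotient of a function by the coordinate `c k` if that is a logarithmic one. -/
def div {U : Y.Opens} (h : U ≤ ch.V) (k : Fin n) (y : Γ(Y, U)) : Γ(Y, U) :=
  if hy : ch.Divisible h k y then hy.choose else 0

lemma div_spec {U : Y.Opens} (h : U ≤ ch.V) (k : Fin n) {y : Γ(Y, U)}
    (hy : ch.Divisible h k y) : ch.coord h k ^ ch.w k * ch.div h k y = y := by
  rw [div, dif_pos hy]; exact hy.choose_spec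

lemma div_eq {U : Y.Opens} (h : U ≤ ch.V) (k : Fin n) {y a : Γ(Y, U)}
    (hy : ch.coord h k ^ ch.w k * a = y) : ch.div h k y = a :=
  ch.coord_pow_cancel h k (ch.w k) ((ch.div_spec h k ⟨a, hy⟩).trans hy.symm)

lemma res_div {U V : Y.Opens} (h : U ≤ ch.V) (hV : V ≤ U) (k : Fin n) {y : Γ(Y, U)}
    (hy : ch.Divisible h k y) : resO hV (ch.div h k y) = ch.div (hV.trans h) k (resO hV y) := by
  symm
  apply ch.div_eq
  simpa using congr(resO hV $(ch.div_spec h k hy))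

/-! ### The logarithmic vector fields dual to the coordinates -/

lemma exists_derAffine (k : Fin n) {U : Y.Opens} (h : U ≤ ch.V) (hU : IsAffineOpen U) :
    ∃ d : Γ(Y, U) →+ Γ(Y, U), (∀ a b, d (a * b) = a * d b + b * d a) ∧
      (∀ x, d (constMap g U x) = 0) ∧
      ∀ l, d (ch.coord h l) = if l = k then ch.coord h l ^ ch.w l else 0 := by
  obtain ⟨d, h1, h2, h3⟩ := (ch.etaleCoords h hU).exists_derivation k
  refine ⟨(AddMonoidHom.mulLeft (ch.coord h k ^ ch.w k)).comp d, fun a b => ?_, fun x => ?_,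
    fun l => ?_⟩
  · simp only [AddMonoidHom.comp_apply, AddMonoidHom.mulLeft, AddMonoidHom.coe_mk,
      ZeroHom.coe_mk, h1]
    ring
  · simp [h2]
  · simp only [AddMonoidHom.comp_apply, h3]
    split_ifs with hl
    · subst hl; simp
    · simp

def derAffine (k : Fin n) {U : Y.Opens} (h : U ≤ ch.V) (hU : IsAffineOpen U) :
    Γ(Y, U) →+ Γ(Y, U) := (ch.exists_derAffine k h hU).choose

lemma derAffine_res (k : Fin n) {U V : Y.Opens} (h : U ≤ ch.V) (hU : IsAffineOpen U)
    (hV : V ≤ U) (hVa : IsAffineOpen V) (a : Γ(Y, U)) :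
    resO hV (ch.derAffine k h hU a) = ch.derAffine k (hV.trans h) hVa (resO hV a) := by
  obtain ⟨h1, h2, h3⟩ := (ch.exists_derAffine k h hU).choose_spec
  obtain ⟨h1', h2', h3'⟩ := (ch.exists_derAffine k (hV.trans h) hVa).choose_spec
  refine DFunLike.congr_fun ((ch.etaleCoords h hU).derivation_ext (resO hV)
    ((resO hV).toAddMonoidHom.comp (ch.derAffine k h hU))
    ((ch.derAffine k (hV.trans h) hVa).comp (resO hV).toAddMonoidHom) (fun a b => ?_)
    (fun a b => ?_) (fun x => ?_) fun l => ?_) a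
  · simp [derAffine, h1]
  · simp [derAffine, h1']
  · change resO hV (ch.derAffine k h hU _) = ch.derAffine k (hV.trans h) hVa (resO hV _)
    rw [resO_constMap, derAffine, h2, derAffine, h2', map_zero]
  · change resO hV (ch.derAffine k h hU _) = ch.derAffine k (hV.trans h) hVa (resO hV _)
    rw [resO_coord, derAffine, h3, derAffine, h3']
    split_ifs <;> simp

lemma exists_derFun (k : Fin n) {U : Y.Opens} (h : U ≤ ch.V) (a : Γ(Y, U)) :
    ∃ b : Γ(Y, U), ∀ (V : Y.Opens) (hV : V ≤ U) (hVa : IsAffineOpen V),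
      resO hV b = ch.derAffine k (hV.trans h) hVa (resO hV a) := by
  refine (exists_of_locally (fun W hW b => ∀ (V : Y.Opens) (hV : V ≤ W) (hVa : IsAffineOpen V),
    resO hV b = ch.derAffine k (hV.trans (hW.trans h)) hVa (resO (hV.trans hW) a)) ?_ ?_ ?_ ?_)
  · intro V W hV hW b hb V' hV' hVa
    simpa using hb V' (hV'.trans hW) hVa
  · intro V hV b b' hb hb'
    exact resO_ext_affine fun W hW hWa => (hb W hW hWa).trans (hb' W hW hWa).symm
  · intro x hx
    obtain ⟨V, hVa, hVU, hxV⟩ := exists_affine_mem hx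
    refine ⟨V, hVU, hxV, ch.derAffine k (hVU.trans h) hVa (resO hVU a), fun W hW hWa => ?_⟩
    rw [ch.derAffine_res, resO_resO]
  · intro b hb V hV hVa
    refine resO_ext fun x hx => ?_
    obtain ⟨W, hW, hxW, e⟩ := hb x (hV hx)
    obtain ⟨W', hWa', hWW', hxW'⟩ := exists_affine_mem (U := W ⊓ V) ⟨hxW, hx⟩
    have hW'V := hWW'.trans inf_le_right
    refine ⟨W', hW'V, hxW', ?_⟩
    have := e W' (hWW'.trans inf_le_left) hWa'
    rw [ch.derAffine_res _ _ _ hW'V hWa', resO_resO]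
    simpa using this

def derFun (k : Fin n) {U : Y.Opens} (h : U ≤ ch.V) (a : Γ(Y, U)) : Γ(Y, U) :=
  (ch.exists_derFun k h a).choose

lemma derFun_res_affine (k : Fin n) {U : Y.Opens} (h : U ≤ ch.V) (a : Γ(Y, U))
    {V : Y.Opens} (hV : V ≤ U) (hVa : IsAffineOpen V) :
      resO hV (ch.derFun k h a) = ch.derAffine k (hV.trans h) hVa (resO hV a) :=
  (ch.exists_derFun k h a).choose_spec V hV hVa

lemma derFun_res (k : Fin n) {U V : Y.Opens} (h : U ≤ ch.V) (hV : V ≤ U) (a : Γ(Y, U)) :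
    resO hV (ch.derFun k h a) = ch.derFun k (hV.trans h) (resO hV a) := by
  refine resO_ext_affine fun W hW hWa => ?_
  rw [resO_resO, derFun_res_affine _ _ _ _ _ hWa, derFun_res_affine _ _ _ _ hW hWa, resO_resO]

lemma derFun_mul (k : Fin n) {U : Y.Opens} (h : U ≤ ch.V) (a b : Γ(Y, U)) :
    ch.derFun k h (a * b) = a * ch.derFun k h b + b * ch.derFun k h a := by
  refine resO_ext_affine fun W hW hWa => ?_
  simp only [map_mul, map_add, derFun_res_affine _ _ _ _ hW hWa]
  exact (ch.exists_derAffine k (hW.trans h) hWa).choose_spec.1 _ _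

lemma derFun_add (k : Fin n) {U : Y.Opens} (h : U ≤ ch.V) (a b : Γ(Y, U)) :
    ch.derFun k h (a + b) = ch.derFun k h a + ch.derFun k h b := by
  refine resO_ext_affine fun W hW hWa => ?_
  simp only [map_add, derFun_res_affine _ _ _ _ hW hWa]

lemma derFun_coord (k : Fin n) {U : Y.Opens} (h : U ≤ ch.V) (l : Fin n) :
    ch.derFun k h (ch.coord h l) = if l = k then ch.coord h l ^ ch.w l else 0 := by
  refine resO_ext_affine fun W hW hWa => ?_
  rw [derFun_res_affine _ _ _ _ hW hWa, resO_coord]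
  refine ((ch.exists_derAffine k (hW.trans h) hWa).choose_spec.2.2 l).trans ?_
  split_ifs <;> simp

lemma _root_.Isomonodromy.LogField.constMap {U V : Y.Opens} (θ : LogField g D U) (h : V ≤ U)
    (x : Γ(T, ⊤)) : θ.app V h (Isomonodromy.constMap g V x) = 0 :=
  θ.const V h ⊤ (le_preimage_top g V) x

lemma divisible_logField {U V : Y.Opens} (θ : LogField g D U) (h : V ≤ U) (h' : V ≤ ch.V)
    (k : Fin n) : ch.Divisible h' k (θ.app V h (ch.coord h' k)) := by
  refine ch.divisible_of_memIdeal h' k _ fun i hi => θ.log i V h _ ?_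
  refine MemIdeal.res h' (memIdeal_of_affine (V := ⟨ch.V, ch.affine⟩) ?_)
  rw [hi]
  exact Ideal.mem_span_singleton_self _

lemma _root_.Isomonodromy.LogField.app_one {U V : Y.Opens} (θ : LogField g D U) (h : V ≤ U) :
    θ.app V h 1 = 0 := by
  have := θ.leibniz V h 1 1
  simpa using this

variable [IsAffine T]

/-- A derivation that kills the functions on `T` kills the functions on its open subsets. -/
lemma eq_zero_of_const {U : Y.Opens} (d : ∀ V : Y.Opens, V ≤ U → (Γ(Y, V) →+ Γ(Y, V)))
    (hres : ∀ (V W : Y.Opens) (hV : V ≤ U) (hW : W ≤ V) (a : Γ(Y, V)),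
      resO hW (d V hV a) = d W (hW.trans hV) (resO hW a))
    (hmul : ∀ (V : Y.Opens) (hV : V ≤ U) (a b : Γ(Y, V)),
      d V hV (a * b) = a * d V hV b + b * d V hV a)
    (hc : ∀ (V : Y.Opens) (hV : V ≤ U) (a : Γ(T, ⊤)), d V hV (constMap g V a) = 0)
    (V : Y.Opens) (hV : V ≤ U) (W : T.Opens) (hW : V ≤ g ⁻¹ᵁ W) (a : Γ(T, W)) :
    d V hV ((g.appLE W V hW).hom a) = 0 := by
  refine resO_ext fun x hx => ?_
  obtain ⟨W', hWa', hWW', hxW'⟩ := exists_affine_mem (Y := T) (U := W) (x := g x) (hW hx)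
  have hV' : V ⊓ g ⁻¹ᵁ W' ≤ V := inf_le_left
  refine ⟨V ⊓ g ⁻¹ᵁ W', hV', ⟨hx, hxW'⟩, ?_⟩
  have hW₁ : V ⊓ g ⁻¹ᵁ W' ≤ g ⁻¹ᵁ W' := inf_le_right
  rw [map_zero, hres _ _ _ hV', ← appLE_resO g hW hW₁ hWW' hV']
  have hE : (resO (Y := T) (le_top : W' ≤ ⊤)).Etale :=
    etale_resO _ (isAffineOpen_top T) hWa'
  let r := (g.appLE W' (V ⊓ g ⁻¹ᵁ W') hW₁).hom
  refine DFunLike.congr_fun ((EtaleCoords.of_etale hE).derivation_ext r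
    ((d _ (hV'.trans hV)).comp r.toAddMonoidHom) 0 (fun a b => ?_) (fun a b => ?_) (fun x => ?_)
    fun l => l.elim0) (resO hWW' a)
  · simp [hmul]
  · simp
  · change d _ _ ((g.appLE W' (V ⊓ g ⁻¹ᵁ W') hW₁).hom (resO le_top x)) = 0
    rw [appLE_resO g (le_preimage_top g _) hW₁ le_top le_rfl, resO_self]
    exact hc _ _ _

/-- The logarithmic vector field `c ^ w ∂/∂c` for the coordinate `c = c k` of weight `w`. -/
def der (k : Fin n) : LogField g D ch.V where
  app V hV := ⟨⟨ch.derFun k hV, by simpa using ch.derFun_add k hV 0 0⟩, ch.derFun_add k hV⟩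
  res_app V W hV hW a := ch.derFun_res k hV hW a
  leibniz V hV a b := ch.derFun_mul k hV a b
  const := by
    refine eq_zero_of_const _ (fun V W hV hW a => ch.derFun_res k hV hW a)
      (fun V hV a b => ch.derFun_mul k hV a b) fun V hV a => ?_
    refine resO_ext_affine fun W hW hWa => ?_
    refine (ch.derFun_res_affine k hV _ hW hWa).trans ?_
    rw [resO_constMap, map_zero]
    exact (ch.exists_derAffine k (hW.trans hV) hWa).choose_spec.2.1 a
  log i V hV a ha := fun W hW => by
    have ha' := ha W hW
    change resO hW (ch.derFun k hV a) ∈ _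
    rw [derFun_res]
    rcases ch.ideal i with hi | ⟨l, hl, hi⟩
    · rw [ch.ideal_eq_top (hW.trans hV) W.2 hi]; trivial
    · rw [ch.ideal_eq (hW.trans hV) W.2 hi, Ideal.mem_span_singleton] at ha' ⊢
      obtain ⟨b, hb⟩ := ha'
      rw [hb, derFun_mul, derFun_coord]
      refine dvd_add (dvd_mul_right _ _) (dvd_mul_of_dvd_right ?_ _)
      split_ifs
      · rw [hl, pow_one]
      · exact dvd_zero _

@[simp] lemma der_coord (k : Fin n) {U : Y.Opens} (h : U ≤ ch.V) (l : Fin n) :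
    (ch.der k).app U h (ch.coord h l) = if l = k then ch.coord h l ^ ch.w l else 0 :=
  ch.derFun_coord k h l

/-- The coefficients of a vector field with respect to the fields `der k`. -/
def lam {U V : Y.Opens} (θ : LogField g D U) (h : V ≤ U) (h' : V ≤ ch.V) (k : Fin n) :
    Γ(Y, V) := ch.div h' k (θ.app V h (ch.coord h' k))

lemma lam_spec {U V : Y.Opens} (θ : LogField g D U) (h : V ≤ U) (h' : V ≤ ch.V) (k : Fin n) :
    ch.coord h' k ^ ch.w k * ch.lam θ h h' k = θ.app V h (ch.coord h' k) :=
  ch.div_spec _ _ (ch.divisible_logField θ h h' k)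

lemma lam_eq {U V : Y.Opens} (θ : LogField g D U) (h : V ≤ U) (h' : V ≤ ch.V) (k : Fin n)
    {a : Γ(Y, V)} (ha : ch.coord h' k ^ ch.w k * a = θ.app V h (ch.coord h' k)) :
    ch.lam θ h h' k = a := ch.div_eq _ _ ha

lemma res_lam {U V W : Y.Opens} (θ : LogField g D U) (h : V ≤ U) (h' : V ≤ ch.V) (i : W ≤ V)
    (k : Fin n) : resO i (ch.lam θ h h' k) = ch.lam θ (i.trans h) (i.trans h') k := by
  rw [lam, ch.res_div _ _ _ (ch.divisible_logField θ h h' k), θ.res_app, resO_coord]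
  rfl

lemma app_eq_sum {U V : Y.Opens} (θ : LogField g D U) (h : V ≤ U) (h' : V ≤ ch.V) (a : Γ(Y, V)) :
    θ.app V h a = ∑ k, ch.lam θ h h' k * (ch.der k).app V h' a := by
  refine resO_ext_affine fun W hW hWa => ?_
  rw [θ.res_app, map_sum]
  simp only [map_mul, res_lam, LogField.res_app]
  exact (ch.etaleCoords (hW.trans h') hWa).derivation_eq_sum (RingHom.id _)
    (θ.app W (hW.trans h)) (θ.leibniz W _) (fun x => θ.constMap _ x) ch.w
    (fun k => (ch.der k).app W (hW.trans h')) (fun k => (ch.der k).leibniz W _)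
    (fun k x => (ch.der k).constMap _ x) (fun k l => ch.der_coord k _ l) _
    (fun k => (ch.lam_spec θ _ _ k).symm) _

lemma lam_der {V : Y.Opens} (h' : V ≤ ch.V) (k l : Fin n) :
    ch.lam (ch.der k) h' h' l = if l = k then 1 else 0 := by
  apply ch.lam_eq
  rw [der_coord]
  split_ifs <;> simp

/-- The vector fields `der k` commute. -/
lemma der_comm {V : Y.Opens} (h : V ≤ ch.V) (k l : Fin n) (a : Γ(Y, V)) :
    (ch.der k).app V h ((ch.der l).app V h a) = (ch.der l).app V h ((ch.der k).app V h a) := by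
  refine resO_ext_affine fun W hW hWa => ?_
  simp only [LogField.res_app]
  have hWV := hW.trans h
  let dk := (ch.der k).app W hWV
  let dl := (ch.der l).app W hWV
  have key : dk.comp dl - dl.comp dk = 0 := by
    refine (ch.etaleCoords hWV hWa).derivation_ext (RingHom.id _) _ _ (fun a b => ?_)
      (fun a b => by simp) (fun x => ?_) fun m => ?_
    · simp only [dk, dl, AddMonoidHom.sub_apply, AddMonoidHom.comp_apply, LogField.leibniz, map_add,
        RingHom.id_apply]
      ring
    · simp [dk, dl, LogField.constMap]
    · simp only [dk, dl, AddMonoidHom.sub_apply, AddMonoidHom.comp_apply, der_coord,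
        AddMonoidHom.zero_apply]
      rcases ch.w_eq m with hm | hm
      · simp only [hm, pow_zero]
        split_ifs <;> simp [LogField.app_one]
      · simp only [hm, pow_one]
        by_cases h1 : m = l <;> by_cases h2 : m = k <;> simp [h1, h2]
        all_goals simp_all
  exact sub_eq_zero.mp congr($key (resO hW a))

end LogChart

end

section

/-! ### Bundles given by cocycles -/

/-- Restriction of vectors of functions. -/
def resV {Y : Scheme.{0}} {U V : Y.Opens} (h : V ≤ U) {r : ℕ} : (Fin r → Γ(Y, U)) →+ (Fin r → Γ(Y, V)) :=
  (resO h).toAddMonoidHom.compLeft (Fin r)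

@[simp] lemma resV_apply {Y : Scheme.{0}} {U V : Y.Opens} (h : V ≤ U) {r : ℕ}
    (v : Fin r → Γ(Y, U)) (x : Fin r) : resV h v x = resO h (v x) := rfl

lemma resV_mulVec {Y : Scheme.{0}} {U V : Y.Opens} (h : V ≤ U) {r s : ℕ}
    (M : Matrix (Fin r) (Fin s) Γ(Y, U)) (v : Fin s → Γ(Y, U)) :
    resV h (M.mulVec v) = (M.map (resO h)).mulVec (resV h v) := by
  ext x
  exact RingHom.map_mulVec (resO h) M v x

@[simp] lemma map_resO_resO {Y : Scheme.{0}} {U V W : Y.Opens} (h : V ≤ U) (h' : W ≤ V) {r s : ℕ}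
    (M : Matrix (Fin r) (Fin s) Γ(Y, U)) :
    (M.map (resO h)).map (resO h') = M.map (resO (h'.trans h)) := by
  ext; simp

/-- A cocycle with values in the general linear groups. -/
structure VectorCocycle (Y : Scheme.{0}) {I : Type} (r : I → ℕ) where
  V : I → Y.Opens
  cover : ∀ y : Y, ∃ i, y ∈ V i
  G : ∀ i j, Matrix (Fin (r i)) (Fin (r j)) Γ(Y, V i ⊓ V j)
  G_self : ∀ i, G i i = 1
  G_mul : ∀ i j k (U : Y.Opens) (hi : U ≤ V i) (hj : U ≤ V j) (hk : U ≤ V k),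
    (G i j).map (resO (le_inf hi hj)) * (G j k).map (resO (le_inf hj hk)) =
      (G i k).map (resO (le_inf hi hk))

namespace VectorCocycle

variable {Y : Scheme.{0}} {I : Type} {r : I → ℕ} (Z : VectorCocycle Y r)

/-- The transition matrices on a smaller open set. -/
def on (i j : I) {U : Y.Opens} (hi : U ≤ Z.V i) (hj : U ≤ Z.V j) :
    Matrix (Fin (r i)) (Fin (r j)) Γ(Y, U) :=
  (Z.G i j).map (resO (le_inf hi hj))

@[simp] lemma on_map (i j : I) {U V : Y.Opens} (hi : U ≤ Z.V i) (hj : U ≤ Z.V j) (h : V ≤ U) :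
    (Z.on i j hi hj).map (resO h) = Z.on i j (h.trans hi) (h.trans hj) := map_resO_resO _ _ _

lemma on_self (i : I) {U : Y.Opens} (hi hi' : U ≤ Z.V i) : Z.on i i hi hi' = 1 := by
  rw [on, G_self]; exact Matrix.map_one _ (map_zero _) (map_one _)

lemma on_mul (i j k : I) {U : Y.Opens} (hi : U ≤ Z.V i) (hj : U ≤ Z.V j) (hk : U ≤ Z.V k) :
    Z.on i j hi hj * Z.on j k hj hk = Z.on i k hi hk := Z.G_mul i j k U hi hj hk

/-- Sections: families of vectors that transform according to the cocycle. -/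
def sections (U : Y.Opens) : AddSubgroup (∀ i : I, Fin (r i) → Γ(Y, U ⊓ Z.V i)) where
  carrier := {b | ∀ i j O (hU : O ≤ U) (hi : O ≤ Z.V i) (hj : O ≤ Z.V j),
      resV (le_inf hU hi) (b i) = (Z.on i j hi hj).mulVec (resV (le_inf hU hj) (b j))}
  zero_mem' := fun i j O hU hi hj => by
    simp only [Pi.zero_apply, map_zero, Matrix.mulVec_zero]
  add_mem' := fun ha hb i j O hU hi hj => by
    simp only [Pi.add_apply, map_add, Matrix.mulVec_add, ha i j O hU hi hj, hb i j O hU hi hj]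
  neg_mem' := fun ha i j O hU hi hj => by
    simp only [Pi.neg_apply, map_neg, Matrix.mulVec_neg, ha i j O hU hi hj]

instance (U : Y.Opens) : Module Γ(Y, U) (Z.sections U) where
  smul f b := ⟨fun i => resO inf_le_left f • b.1 i, fun i j O hU hi hj => by
    have h (i : I) (hi : O ≤ Z.V i) : resV (le_inf hU hi) (resO (inf_le_left (b := Z.V i)) f • b.1 i) =
        resO hU f • resV (le_inf hU hi) (b.1 i) := by ext x; simp
    rw [h i hi, h j hj, Matrix.mulVec_smul, b.2 i j O hU hi hj]⟩
  one_smul b := Subtype.ext <| funext fun i => by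
    change resO _ 1 • b.1 i = b.1 i
    rw [map_one, one_smul]
  mul_smul f f' b := Subtype.ext <| funext fun i => by
    change resO _ (f * f') • b.1 i = resO _ f • resO _ f' • b.1 i
    rw [map_mul, mul_smul]
  smul_zero f := Subtype.ext <| funext fun i => smul_zero _
  smul_add f b b' := Subtype.ext <| funext fun i => smul_add _ _ _
  add_smul f f' b := Subtype.ext <| funext fun i => by
    exact (congrArg (· • b.1 i) (map_add (resO inf_le_left) f f')).trans (add_smul _ _ _)
  zero_smul b := Subtype.ext <| funext fun i => by
    change resO _ 0 • b.1 i = 0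
    rw [map_zero, zero_smul]

/-- Restriction of sections. -/
def sectionsRes {U V : Y.Opens} (h : V ≤ U) : Z.sections U →+ Z.sections V where
  toFun b := ⟨fun i => resV (inf_le_inf_right _ h) (b.1 i), fun i j O hU hi hj => by
    have e (i : I) (hi : O ≤ Z.V i) : resV (le_inf hU hi) (resV (inf_le_inf_right _ h) (b.1 i)) =
      resV (le_inf (hU.trans h) hi) (b.1 i) := by ext; simp
    rw [e i hi, e j hj]
    exact b.2 i j O (hU.trans h) hi hj⟩
  map_zero' := Subtype.ext <| funext fun i => map_zero _
  map_add' _ _ := Subtype.ext <| funext fun i => map_add _ _ _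

def presheafAb : TopCat.Presheaf Ab Y where
  obj U := AddCommGrpCat.of (Z.sections U.unop)
  map h := AddCommGrpCat.ofHom (Z.sectionsRes h.unop.le)
  map_id U := by
    ext b i x
    exact resO_self _ _
  map_comp g h := by
    ext b i x
    exact (resO_resO _ _ _).symm

lemma presheafAb_isSheaf : Z.presheafAb.IsSheaf := by
  rw [TopCat.Presheaf.isSheaf_iff_isSheafUniqueGluing]
  intro κ U s hs
  have hs' : ∀ (k k' : κ) (i : I) (O : Y.Opens) (h : O ≤ U k) (h' : O ≤ U k') (hi : O ≤ Z.V i),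
      resV (le_inf h hi) ((s k : Z.sections (U k)).1 i) =
        resV (le_inf h' hi) ((s k' : Z.sections (U k')).1 i) := by
    intro k k' i O h h' hi
    have := congrArg (fun (b : Z.sections (U k ⊓ U k')) => resV (le_inf (le_inf h h') hi) (b.1 i))
      (hs k k')
    refine Eq.trans ?_ (this.trans ?_)
    · exact funext fun x => (resO_resO _ _ _).symm
    · exact funext fun x => resO_resO _ _ _
  have cov : ∀ {O : Y.Opens} {x : Y}, O ≤ iSup U → x ∈ O → ∃ k, x ∈ U k := fun {O x} hO hx =>
    Opens.mem_iSup.mp (hO hx)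
  have ext0 : ∀ {O : Y.Opens} (hU : O ≤ iSup U) {a a' : Γ(Y, O)}, (∀ (k : κ) (W : Y.Opens)
      (hW : W ≤ O) (_ : W ≤ U k), resO hW a = resO hW a') → a = a' := by
    intro O hU a a' h
    refine resO_ext fun y hy => ?_
    obtain ⟨k, hk⟩ := cov hU hy
    exact ⟨O ⊓ U k, inf_le_left, ⟨hy, hk⟩, h k _ inf_le_left inf_le_right⟩
  have key : ∀ (i : I) (x : Fin (r i)),
      ∃ a : Γ(Y, iSup U ⊓ Z.V i), ∀ (k : κ) (W : Y.Opens) (hW : W ≤ iSup U ⊓ Z.V i) (hk : W ≤ U k),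
        resO hW a = resO (le_inf hk (hW.trans inf_le_right)) ((s k : Z.sections (U k)).1 i x) := by
    intro i x
    refine exists_of_locally (fun O hO a => ∀ (k : κ) (W : Y.Opens) (hW : W ≤ O) (hk : W ≤ U k),
        resO hW a = resO (le_inf hk (hW.trans (hO.trans inf_le_right)))
          ((s k : Z.sections (U k)).1 i x)) ?_ ?_ ?_ ?_
    · intro V W hV hW a ha k W' hW' hk
      rw [resO_resO]; exact ha k W' _ hk
    · intro V hV a b ha hb
      refine ext0 (hV.trans inf_le_left) fun k W hW hk => ?_
      rw [ha k _ hW hk, hb k _ hW hk]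
    · intro y hy
      obtain ⟨k, hk⟩ := cov inf_le_left hy
      refine ⟨U k ⊓ Z.V i, le_inf (inf_le_left.trans (le_iSup U k)) inf_le_right, ⟨hk, hy.2⟩,
        (s k : Z.sections (U k)).1 i x, ?_⟩
      intro k' W hW hk'
      exact congr($(hs' k k' i W (hW.trans inf_le_left) hk' (hW.trans inf_le_right)) x)
    · intro a ha k W hW hk
      refine resO_ext fun y hy => ?_
      obtain ⟨O', hO', hyO', e⟩ := ha y (hW hy)
      refine ⟨W ⊓ O', inf_le_left, ⟨hy, hyO'⟩, ?_⟩
      have := e k (W ⊓ O') inf_le_right (inf_le_left.trans hk)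
      rw [resO_resO] at this ⊢
      rw [this, resO_resO]
  choose b hb using key
  refine ⟨(⟨fun i x => b i x, ?_⟩ : Z.sections (iSup U)), ?_, ?_⟩
  · intro i j O hU hi hj
    refine funext fun x => ext0 hU fun k W hW hk => ?_
    have h1 := congr($(resV_mulVec hW (Z.on i j hi hj) (resV (le_inf hU hj) (fun x => b j x))) x)
    rw [resV_apply] at h1
    rw [h1, on_map, resV_apply, resO_resO, hb i x k W _ hk]
    have h2 := congr($((s k : Z.sections (U k)).2 i j W hk (hW.trans hi) (hW.trans hj)) x)
    rw [resV_apply] at h2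
    rw [h2]
    refine congrArg (fun v => (Z.on i j (hW.trans hi) (hW.trans hj)).mulVec v x) (funext fun y => ?_)
    simp only [resV_apply, resO_resO]
    exact (hb j y k W _ hk).symm
  · intro k
    refine Subtype.ext (funext fun i => funext fun x => ?_)
    have := hb i x k (U k ⊓ Z.V i) (inf_le_inf_right _ (le_iSup U k)) inf_le_left
    rw [resO_self] at this
    exact this
  · intro t ht
    refine Subtype.ext (funext fun i => funext fun x => ?_)
    refine ext0 inf_le_left fun k W hW hk => ?_
    rw [hb i x k W hW hk, ← ht k]
    exact (resO_resO _ _ _).symm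

instance (U : Y.Opensᵒᵖ) : Module (Y.ringCatSheaf.obj.obj U) (Z.presheafAb.obj U) :=
  inferInstanceAs (Module Γ(Y, U.unop) (Z.sections U.unop))

/-- The vector bundle defined by a cocycle. -/
def bundle : Y.Modules where
  val := PresheafOfModules.ofPresheaf (R := Y.ringCatSheaf.obj) Z.presheafAb (by
      intro U V f r m
      refine Subtype.ext (funext fun i => funext fun x => ?_)
      have key (r : Γ(Y, U.unop)) (m : Γ(Y, U.unop ⊓ Z.V i)) :
          resO (inf_le_inf_right (Z.V i) f.unop.le) (resO inf_le_left r * m) =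
            resO inf_le_left (resO f.unop.le r) * resO (inf_le_inf_right (Z.V i) f.unop.le) m := by
        rw [map_mul, resO_resO, resO_resO]
      exact key r _)
  isSheaf := Z.presheafAb_isSheaf

/-- The sections of the bundle. -/
def toSections {U : Y.Opens} : Γ(Z.bundle, U) ≃+ Z.sections U where
  toFun b := b
  invFun b := b
  left_inv _ := rfl
  right_inv _ := rfl
  map_add' _ _ := rfl

end VectorCocycle

end

section

/-! ### Derivations along ring homomorphisms and matrices -/

section Derivations

variable {A B C : Type} [CommRing A] [CommRing B] [CommRing C]

lemma map_mulVec_of_leibniz (π : A →+* B) (δ : A →+ B)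
    (hδ : ∀ a b, δ (a * b) = π a * δ b + π b * δ a) {r s : ℕ}
    (M : Matrix (Fin r) (Fin s) A) (v : Fin s → A) :
    δ ∘ (M.mulVec v) = (M.map δ).mulVec (π ∘ v) + (M.map π).mulVec (δ ∘ v) := by
  ext x
  simp only [Function.comp_apply, Matrix.mulVec, dotProduct, map_sum, hδ, Matrix.map_apply,
    Pi.add_apply, ← Finset.sum_add_distrib]
  exact Finset.sum_congr rfl fun y _ => by ring

lemma map_sum_smul_of_leibniz (π : A →+* B) (δ : A →+ B)
    (hδ : ∀ a b, δ (a * b) = π a * δ b + π b * δ a) {n r s : ℕ} (l : Fin n → A)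
    (M : Fin n → Matrix (Fin r) (Fin s) A) :
    (∑ k, l k • M k).map δ = ∑ k, (δ (l k) • (M k).map π + π (l k) • (M k).map δ) := by
  ext x y
  simp only [Matrix.map_apply, Matrix.sum_apply, Matrix.smul_apply, smul_eq_mul, map_sum, hδ,
    Matrix.add_apply]
  exact Finset.sum_congr rfl fun y _ => by ring

lemma map_sum_smul (π : A →+* B) {n r s : ℕ} (l : Fin n → A)
    (M : Fin n → Matrix (Fin r) (Fin s) A) :
    (∑ k, l k • M k).map π = ∑ k, π (l k) • (M k).map π := by
  ext x y
  simp [Matrix.sum_apply]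

/-- The curvature of the connection with matrices `a k` in the direction of derivations
`δ₁`, `δ₂` with coefficients `l₁`, `l₂`. -/
lemma nabla_comm {r n : ℕ} (π' : A →+* B) (π : B →+* C) (d₁ d₂ : A →+ B) (δ₁ δ₂ : B →+ C)
    (δ : B →+ C) (hδ₁ : ∀ a b, δ₁ (a * b) = π a * δ₁ b + π b * δ₁ a)
    (hδ₂ : ∀ a b, δ₂ (a * b) = π a * δ₂ b + π b * δ₂ a)
    (hd₁ : ∀ a, π (d₁ a) = δ₁ (π' a)) (hd₂ : ∀ a, π (d₂ a) = δ₂ (π' a))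
    (hδ : ∀ a, δ (π' a) = δ₁ (d₂ a) - δ₂ (d₁ a)) (a : Fin n → Matrix (Fin r) (Fin r) B)
    (l₁ l₂ : Fin n → B) (da : Fin n → Fin n → Matrix (Fin r) (Fin r) C)
    (h₁ : ∀ k, (a k).map δ₁ = ∑ m, π (l₁ m) • da m k)
    (h₂ : ∀ k, (a k).map δ₂ = ∑ m, π (l₂ m) • da m k)
    (hflat : ∀ k m, da k m - da m k + (a k).map π * (a m).map π - (a m).map π * (a k).map π = 0)
    (v : Fin r → A) :
    δ ∘ (π' ∘ v) + (∑ k, (δ₁ (l₂ k) - δ₂ (l₁ k)) • (a k).map π).mulVec (π ∘ π' ∘ v) =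
      (δ₁ ∘ (d₂ ∘ v + (∑ k, l₂ k • a k).mulVec (π' ∘ v)) +
        (∑ k, π (l₁ k) • (a k).map π).mulVec (π ∘ (d₂ ∘ v + (∑ k, l₂ k • a k).mulVec (π' ∘ v)))) -
      (δ₂ ∘ (d₁ ∘ v + (∑ k, l₁ k • a k).mulVec (π' ∘ v)) +
        (∑ k, π (l₂ k) • (a k).map π).mulVec
          (π ∘ (d₁ ∘ v + (∑ k, l₁ k • a k).mulVec (π' ∘ v)))) := by
  have add (f : B →+ C) (u u' : Fin r → B) : f ∘ (u + u') = f ∘ u + f ∘ u' := by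
    ext; simp
  have addπ (u u' : Fin r → B) : π ∘ (u + u') = π ∘ u + π ∘ u' := by
    ext; simp
  have mulπ (M : Matrix (Fin r) (Fin r) B) (u : Fin r → B) :
      π ∘ (M.mulVec u) = (M.map π).mulVec (π ∘ u) := by
    ext; exact RingHom.map_mulVec π _ _ _
  have e₁ : π ∘ d₁ ∘ v = δ₁ ∘ π' ∘ v := by ext; simp [hd₁]
  have e₂ : π ∘ d₂ ∘ v = δ₂ ∘ π' ∘ v := by ext; simp [hd₂]
  have e : δ ∘ π' ∘ v = δ₁ ∘ d₂ ∘ v - δ₂ ∘ d₁ ∘ v := by ext; simp [hδ]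
  rw [add, add, addπ, addπ, mulπ, mulπ, map_mulVec_of_leibniz π δ₁ hδ₁,
    map_mulVec_of_leibniz π δ₂ hδ₂, map_sum_smul_of_leibniz π δ₁ hδ₁,
    map_sum_smul_of_leibniz π δ₂ hδ₂, map_sum_smul, map_sum_smul, e, e₁, e₂]
  simp only [h₁, h₂, Matrix.mulVec_add, Matrix.mulVec_mulVec]
  have key : ∑ k, (δ₁ (l₂ k) - δ₂ (l₁ k)) • (a k).map π =
      (∑ k, (δ₁ (l₂ k) • (a k).map π + π (l₂ k) • ∑ m, π (l₁ m) • da m k)) -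
      (∑ k, (δ₂ (l₁ k) • (a k).map π + π (l₁ k) • ∑ m, π (l₂ m) • da m k)) +
      ((∑ k, π (l₁ k) • (a k).map π) * (∑ k, π (l₂ k) • (a k).map π) -
      (∑ k, π (l₂ k) • (a k).map π) * (∑ k, π (l₁ k) • (a k).map π)) := by
    have h3 : ∑ k, ∑ m, (π (l₁ k) * π (l₂ m)) •
      (da k m - da m k + (a k).map π * (a m).map π - (a m).map π * (a k).map π) = 0 := by
      simp [hflat]
    simp only [smul_sub, smul_add, Finset.sum_sub_distrib, Finset.sum_add_distrib] at h3
    simp only [Finset.sum_mul_sum, Finset.sum_add_distrib, Finset.smul_sum, smul_smul,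
      Matrix.smul_mul, Matrix.mul_smul, sub_smul, Finset.sum_sub_distrib]
    have c1 : ∑ x, ∑ x_1, (π (l₂ x) * π (l₁ x_1)) • da x_1 x =
      ∑ k, ∑ m, (π (l₁ k) * π (l₂ m)) • da k m := by
      rw [Finset.sum_comm]; simp only [mul_comm]
    have c2 : ∑ x, ∑ x_1, (π (l₁ x_1) * π (l₂ x)) • ((a x).map π * (a x_1).map π) =
      ∑ k, ∑ m, (π (l₁ k) * π (l₂ m)) • ((a m).map π * (a k).map π) := Finset.sum_comm
    have c3 : ∑ x, ∑ x_1, (π (l₂ x_1) * π (l₁ x)) • ((a x).map π * (a x_1).map π) =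
      ∑ k, ∑ m, (π (l₁ k) * π (l₂ m)) • ((a k).map π * (a m).map π) := by
      simp only [mul_comm]
    rw [c1, c2, c3]
    rw [← sub_eq_zero, ← neg_eq_zero, ← h3]
    abel
  rw [key]
  simp only [Matrix.add_mulVec, Matrix.sub_mulVec]
  abel

end Derivations

/-! ### Flat bundles given by cocycles and connection matrices -/

namespace VectorCocycle

variable {Y : Scheme.{0}} {I : Type} {r : I → ℕ} (Z : VectorCocycle Y r)

/-- The coordinates of sections of a bundle with respect to the frame over `V i`. -/
def vec (i : I) {U O : Y.Opens} (b : Γ(Z.bundle, U)) (h : O ≤ U) (h' : O ≤ Z.V i) :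
    Fin (r i) → Γ(Y, O) := resV (le_inf h h') ((Z.toSections b).1 i)

lemma vec_res (i : I) {U V O : Y.Opens} (b : Γ(Z.bundle, U)) (hV : V ≤ U) (h : O ≤ V)
    (h' : O ≤ Z.V i) : Z.vec i (resM Z.bundle hV b) h h' = Z.vec i b (h.trans hV) h' :=
  funext fun _ => resO_resO _ _ _

lemma resV_vec (i : I) {U O O' : Y.Opens} (b : Γ(Z.bundle, U)) (h : O ≤ U)
    (h' : O ≤ Z.V i) (h'' : O' ≤ O) :
    resV h'' (Z.vec i b h h') = Z.vec i b (h''.trans h) (h''.trans h') :=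
  funext fun _ => resO_resO _ _ _

lemma vec_smul (i : I) {U O : Y.Opens} (f : Γ(Y, U)) (b : Γ(Z.bundle, U)) (h : O ≤ U)
    (h' : O ≤ Z.V i) : Z.vec i (f • b : Γ(Z.bundle, U)) h h' = resO h f • Z.vec i b h h' := by
  ext x
  refine (map_mul (resO (le_inf h h')) (resO inf_le_left f) _).trans ?_
  rw [resO_resO]
  rfl

lemma vec_add (i : I) {U O : Y.Opens} (b b' : Γ(Z.bundle, U)) (h : O ≤ U)
    (h' : O ≤ Z.V i) : Z.vec i (b + b') h h' = Z.vec i b h h' + Z.vec i b' h h' :=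
  map_add (resV (le_inf h h')) _ _

lemma vec_sub (i : I) {U O : Y.Opens} (b b' : Γ(Z.bundle, U)) (h : O ≤ U)
    (h' : O ≤ Z.V i) : Z.vec i (b - b') h h' = Z.vec i b h h' - Z.vec i b' h h' :=
  map_sub (resV (le_inf h h')) _ _

lemma vec_sum (i : I) {U O : Y.Opens} {n : ℕ} (b : Fin n → Γ(Z.bundle, U)) (h : O ≤ U)
    (h' : O ≤ Z.V i) : Z.vec i (∑ l, b l) h h' = ∑ l, Z.vec i (b l) h h' :=
  map_sum (AddMonoidHom.mk' (fun b : Γ(Z.bundle, U) => Z.vec i b h h')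
    fun b b' => Z.vec_add i b b' h h') _ _

lemma on_mulVec_vec (i j : I) {U O : Y.Opens} (b : Γ(Z.bundle, U)) (h : O ≤ U)
    (hi : O ≤ Z.V i) (hj : O ≤ Z.V j) :
    (Z.on i j hi hj).mulVec (Z.vec j b h hj) = Z.vec i b h hi :=
  ((Z.toSections b).2 i j O h hi hj).symm

lemma vec_ext {U : Y.Opens} {b b' : Γ(Z.bundle, U)}
    (h : ∀ i (O : Y.Opens) (h : O ≤ U) (h' : O ≤ Z.V i), Z.vec i b h h' = Z.vec i b' h h') :
    b = b' := by
  apply Z.toSections.injective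
  refine Subtype.ext (funext fun i => funext fun x => ?_)
  have := congr($(h i (U ⊓ Z.V i) inf_le_left inf_le_right) x)
  simpa [vec] using this

/-- Sections given by their coordinates. -/
def mkSection {U : Y.Opens} (v : ∀ i, Fin (r i) → Γ(Y, U ⊓ Z.V i))
    (hv : ∀ i j O (hU : O ≤ U) (hi : O ≤ Z.V i) (hj : O ≤ Z.V j),
      resV (le_inf hU hi) (v i) = (Z.on i j hi hj).mulVec (resV (le_inf hU hj) (v j))) :
    Γ(Z.bundle, U) := Z.toSections.symm ⟨v, hv⟩

lemma vec_mkSection {U : Y.Opens} (v : ∀ i, Fin (r i) → Γ(Y, U ⊓ Z.V i)) (hv) (i : I) {O : Y.Opens}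
    (h : O ≤ U) (h' : O ≤ Z.V i) : Z.vec i (Z.mkSection v hv) h h' = resV (le_inf h h') (v i) := rfl

/-- The section over an open subset of `V i` with given coordinates in the frame over `V i`. -/
lemma exists_vec_eq (i : I) {U : Y.Opens} (hU : U ≤ Z.V i) (v : Fin (r i) → Γ(Y, U)) :
    ∃ b : Γ(Z.bundle, U), Z.vec i b le_rfl hU = v := by
  have e (j : I) (O : Y.Opens) (h : O ≤ U) (hj : O ≤ Z.V j) : resV (le_inf h hj)
      ((Z.on j i inf_le_right (inf_le_left.trans hU)).mulVec
        (resV (inf_le_left : U ⊓ Z.V j ≤ U) v)) =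
      (Z.on j i hj (h.trans hU)).mulVec (resV h v) := by
    rw [resV_mulVec, on_map]
    congr 1
    ext x; simp
  refine ⟨Z.mkSection (fun j => (Z.on j i inf_le_right (inf_le_left.trans hU)).mulVec
    (resV inf_le_left v)) fun j k O h hj hk => ?_, ?_⟩
  · rw [e j O h hj, e k O h hk, Matrix.mulVec_mulVec, on_mul]
  · rw [vec_mkSection, e i U le_rfl hU, on_self, Matrix.one_mulVec]
    ext x; simp

/-- The matrix of sections. -/
def mat (i : I) {U O : Y.Opens} {n : ℕ} (e : Fin n → Γ(Z.bundle, U)) (h : O ≤ U) (h' : O ≤ Z.V i) :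
    Matrix (Fin (r i)) (Fin n) Γ(Y, O) := Matrix.of fun x l => Z.vec i (e l) h h' x

lemma vec_sum_smul (i : I) {U V O : Y.Opens} {n : ℕ} (e : Fin n → Γ(Z.bundle, U)) (hV : V ≤ U)
    (a : Fin n → Γ(Y, V)) (h : O ≤ V) (h' : O ≤ Z.V i) :
    Z.vec i (∑ l, a l • (resM Z.bundle hV (e l) : Γ(Z.bundle, V))) h h' =
      (Z.mat i e (h.trans hV) h').mulVec (resV h a) := by
  rw [vec_sum]
  ext x
  simp only [vec_smul, vec_res, Finset.sum_apply, Pi.smul_apply, smul_eq_mul, Matrix.mulVec,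
    dotProduct, mat, Matrix.of_apply, resV_apply]
  exact Finset.sum_congr rfl fun l _ => mul_comm _ _

lemma mat_map (i : I) {U O O' : Y.Opens} {n : ℕ} (e : Fin n → Γ(Z.bundle, U)) (h : O ≤ U)
    (h' : O ≤ Z.V i) (h'' : O' ≤ O) :
    (Z.mat i e h h').map (resO h'') = Z.mat i e (h''.trans h) (h''.trans h') := by
  ext x l
  exact congr($(Z.resV_vec i (e l) h h' h'') x)

lemma exists_inverse_of_isFrame {U : Y.Opens} {n : ℕ} {e : Fin n → Γ(Z.bundle, U)}
    (he : IsFrame Z.bundle U e) (i : I) :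
    ∃ Q : Matrix (Fin n) (Fin (r i)) Γ(Y, U ⊓ Z.V i),
      Z.mat i e inf_le_left inf_le_right * Q = 1 ∧ Q * Z.mat i e inf_le_left inf_le_right = 1 := by
  set P := Z.mat i e (inf_le_left : U ⊓ Z.V i ≤ U) inf_le_right
  have hb : Function.Bijective P.mulVecLin := by
    have h1 := he (U ⊓ Z.V i) inf_le_left
    have key (a) : P.mulVecLin a = Z.vec i (∑ l, a l • (resM Z.bundle inf_le_left (e l) :
        Γ(Z.bundle, U ⊓ Z.V i))) le_rfl inf_le_right := by
      rw [vec_sum_smul, Matrix.mulVecLin_apply]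
      congr 1
      ext; simp
    constructor
    · intro a a' haa
      rw [key, key] at haa
      refine h1.1 (Z.vec_ext fun j O h h' => ?_)
      rw [← Z.on_mulVec_vec j i _ h h' (h.trans inf_le_right), ← Z.resV_vec i _ le_rfl inf_le_right h,
        haa, Z.resV_vec, Z.on_mulVec_vec]
    · intro v
      obtain ⟨b, hb⟩ := Z.exists_vec_eq i inf_le_right v
      obtain ⟨a, ha⟩ := h1.2 b
      exact ⟨a, by rw [key, ← hb]; exact congrArg (fun b => Z.vec i b _ _) ha⟩
  let L := LinearEquiv.ofBijective P.mulVecLin hb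
  have hL : LinearMap.toMatrix' L.toLinearMap = P := by
    ext x l
    rw [LinearMap.toMatrix'_apply]
    simp [L]
  refine ⟨LinearMap.toMatrix' L.symm.toLinearMap, ?_, ?_⟩
  · rw [← hL, ← LinearMap.toMatrix'_comp]; simp
  · rw [← hL, ← LinearMap.toMatrix'_comp]; simp

lemma isFrame_of_inverse {U : Y.Opens} {n : ℕ} {e : Fin n → Γ(Z.bundle, U)}
    (Q : ∀ i, Matrix (Fin n) (Fin (r i)) Γ(Y, U ⊓ Z.V i))
    (h1 : ∀ i, Z.mat i e inf_le_left inf_le_right * Q i = 1)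
    (h2 : ∀ i, Q i * Z.mat i e inf_le_left inf_le_right = 1) : IsFrame Z.bundle U e := by
  have hP (i : I) (O : Y.Opens) (h : O ≤ U) (h' : O ≤ Z.V i) :
      Z.mat i e h h' * (Q i).map (resO (le_inf h h')) = 1 ∧
      (Q i).map (resO (le_inf h h')) * Z.mat i e h h' = 1 := by
    have a1 := congrArg (fun M => M.map (resO (le_inf h h'))) (h1 i)
    have a2 := congrArg (fun M => M.map (resO (le_inf h h'))) (h2 i)
    simp only [Matrix.map_mul, mat_map, Matrix.map_one _ (map_zero (resO _)) (map_one (resO _))]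
      at a1 a2
    exact ⟨a1, a2⟩
  have inj (O : Y.Opens) (h : O ≤ U) (a a' : Fin n → Γ(Y, O)) (haa : ∀ i (W : Y.Opens) (hW : W ≤ O)
      (hi : W ≤ Z.V i), (Z.mat i e (hW.trans h) hi).mulVec (resV hW a) =
        (Z.mat i e (hW.trans h) hi).mulVec (resV hW a')) : a = a' := by
    funext l
    refine resO_ext fun y hy => ?_
    obtain ⟨i, hi⟩ := Z.cover y
    refine ⟨O ⊓ Z.V i, inf_le_left, ⟨hy, hi⟩, ?_⟩
    have := congrArg (fun v => ((Q i).map (resO (le_inf (inf_le_left.trans h)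
      inf_le_right))).mulVec v) (haa i (O ⊓ Z.V i) inf_le_left inf_le_right)
    simp only [Matrix.mulVec_mulVec] at this
    rw [(hP i (O ⊓ Z.V i) (inf_le_left.trans h) inf_le_right).2, Matrix.one_mulVec,
      Matrix.one_mulVec] at this
    exact congr($this l)
  intro V hV
  constructor
  · intro a a' haa
    refine inj V hV a a' fun i W hW hi => ?_
    rw [← Z.vec_sum_smul i e hV a hW, ← Z.vec_sum_smul i e hV a' hW]
    exact congrArg (fun b => Z.vec i b hW hi) haa
  · intro b
    have hQ (i j : I) (W : Y.Opens) (hW : W ≤ V) (hi : W ≤ Z.V i) (hj : W ≤ Z.V j) :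
        ((Q i).map (resO (le_inf (hW.trans hV) hi))).mulVec (Z.vec i b hW hi) =
        ((Q j).map (resO (le_inf (hW.trans hV) hj))).mulVec (Z.vec j b hW hj) := by
      refine inj W (hW.trans hV) _ _ fun k W' hW' hk => ?_
      have e1 (i : I) (hi : W ≤ Z.V i) : (Z.mat k e (hW'.trans (hW.trans hV)) hk).mulVec (resV hW'
          (((Q i).map (resO (le_inf (hW.trans hV) hi))).mulVec (Z.vec i b hW hi))) =
          Z.vec k b (hW'.trans hW) hk := by
        have e2 : Z.mat k e (hW'.trans (hW.trans hV)) hk = Z.on k i hk (hW'.trans hi) *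
            Z.mat i e (hW'.trans (hW.trans hV)) (hW'.trans hi) := by
          ext x l
          exact congr($(Z.on_mulVec_vec k i (e l) (hW'.trans (hW.trans hV)) hk (hW'.trans hi)) x).symm
        rw [e2, resV_mulVec, Matrix.mulVec_mulVec, map_resO_resO, Matrix.mul_assoc,
          (hP i W' _ _).1, Matrix.mul_one, resV_vec, on_mulVec_vec]
      rw [e1, e1]
    have key (l : Fin n) : ∃ a : Γ(Y, V), ∀ i (W : Y.Opens) (hW : W ≤ V) (hi : W ≤ Z.V i),
        resO hW a = ((Q i).map (resO (le_inf (hW.trans hV) hi))).mulVec (Z.vec i b hW hi) l := by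
      refine exists_of_locally (fun O hO a => ∀ i (W : Y.Opens) (hW : W ≤ O) (hi : W ≤ Z.V i),
        resO hW a = ((Q i).map (resO (le_inf ((hW.trans hO).trans hV) hi))).mulVec
          (Z.vec i b (hW.trans hO) hi) l) ?_ ?_ ?_ ?_
      · intro V W hV hW a ha i W' hW' hi
        rw [resO_resO]; exact ha i W' _ hi
      · intro O hO a a' ha ha'
        refine resO_ext fun y hy => ?_
        obtain ⟨i, hi⟩ := Z.cover y
        exact ⟨O ⊓ Z.V i, inf_le_left, ⟨hy, hi⟩,
          (ha i _ inf_le_left inf_le_right).trans (ha' i _ inf_le_left inf_le_right).symm⟩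
      · intro y hy
        obtain ⟨i, hi⟩ := Z.cover y
        refine ⟨V ⊓ Z.V i, inf_le_left, ⟨hy, hi⟩, ((Q i).map (resO (le_inf (inf_le_left.trans hV)
          inf_le_right))).mulVec (Z.vec i b inf_le_left inf_le_right) l, fun j W hW hj => ?_⟩
        have := congr($(resV_mulVec hW ((Q i).map (resO (le_inf (inf_le_left.trans hV)
          inf_le_right))) (Z.vec i b inf_le_left inf_le_right)) l)
        rw [resV_apply, resV_vec, map_resO_resO] at this
        rw [this, hQ i j W (hW.trans inf_le_left) (hW.trans inf_le_right) hj]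
      · intro a ha i W hW hi
        refine resO_ext fun y hy => ?_
        obtain ⟨O, hO, hyO, e'⟩ := ha y (hW hy)
        refine ⟨W ⊓ O, inf_le_left, ⟨hy, hyO⟩, ?_⟩
        have := e' i (W ⊓ O) inf_le_right (inf_le_left.trans hi)
        rw [resO_resO] at this
        have h3 := congr($(resV_mulVec (inf_le_left : W ⊓ O ≤ W) ((Q i).map (resO (le_inf
          (hW.trans hV) hi))) (Z.vec i b hW hi)) l)
        rw [resV_apply, resV_vec, map_resO_resO] at h3
        rw [resO_resO, this, h3]
    choose a ha using key
    refine ⟨a, Z.vec_ext fun i O h h' => ?_⟩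
    rw [vec_sum_smul]
    have : resV h a = ((Q i).map (resO (le_inf (h.trans hV) h'))).mulVec (Z.vec i b h h') :=
      funext fun l => ha l i O h h'
    rw [this, Matrix.mulVec_mulVec, (hP i O _ _).1, Matrix.one_mulVec]

lemma exists_isFrame (y : Y) : ∃ (U : Y.Opens) (_ : y ∈ U) (n : ℕ) (e : Fin n → Γ(Z.bundle, U)),
    IsFrame Z.bundle U e := by
  obtain ⟨i, hi⟩ := Z.cover y
  choose e he using fun l => Z.exists_vec_eq i le_rfl (Pi.single l (1 : Γ(Y, Z.V i)))
  have hm (j : I) : Z.mat j e inf_le_left inf_le_right =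
      Z.on j i (inf_le_right : Z.V i ⊓ Z.V j ≤ _) inf_le_left := by
    ext x l
    have h1 := Z.on_mulVec_vec j i (e l) (inf_le_left : Z.V i ⊓ Z.V j ≤ _) inf_le_right inf_le_left
    rw [← Z.resV_vec i (e l) le_rfl le_rfl inf_le_left, he] at h1
    have h2 : resV (inf_le_left : Z.V i ⊓ Z.V j ≤ _) (Pi.single l (1 : Γ(Y, Z.V i))) =
        Pi.single l 1 := by
      ext x
      rw [resV_apply]
      by_cases hx : x = l
      · subst hx; simp
      · simp [hx]
    rw [h2, Matrix.mulVec_single_one] at h1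
    exact congr($h1 x).symm
  refine ⟨Z.V i, hi, r i, e, Z.isFrame_of_inverse
    (fun j => Z.on i j inf_le_left inf_le_right) (fun j => ?_) fun j => ?_⟩
  · rw [hm, on_mul, on_self]
  · rw [hm, on_mul, on_self]

end VectorCocycle

end

section

/-- A flat bundle on `Y / T` in terms of frames over the open sets of a covering by charts: the
transition matrices `Z` and the connection matrices `A` in the direction of the vector fields
dual to the coordinates. -/
structure BundleDatum {Y T : Scheme.{0}} [IsAffine T] (g : Y ⟶ T) {ι : Type}
    (D : ι → Y.IdealSheafData) {I : Type} (n r : I → ℕ) where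
  Z : VectorCocycle Y r
  ch : ∀ i, LogChart g D (n i)
  V_le : ∀ i, Z.V i ≤ (ch i).V
  A : ∀ i, Fin (n i) → Matrix (Fin (r i)) (Fin (r i)) Γ(Y, Z.V i)
  flat : ∀ i k l, (A i l).map (((ch i).der k).app _ (V_le i)) -
    (A i k).map (((ch i).der l).app _ (V_le i)) + A i k * A i l - A i l * A i k = 0
  gauge : ∀ i j k, (Z.G i j).map (((ch i).der k).app _ (inf_le_left.trans (V_le i))) =
    Z.G i j * (∑ m, (ch j).lam ((ch i).der k) (inf_le_left.trans (V_le i))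
      (inf_le_right.trans (V_le j)) m • (A j m).map (resO inf_le_right) :
        Matrix (Fin (r j)) (Fin (r j)) Γ(Y, Z.V i ⊓ Z.V j)) -
    ((A i k).map (resO inf_le_left) : Matrix (Fin (r i)) (Fin (r i)) Γ(Y, Z.V i ⊓ Z.V j)) * Z.G i j

namespace BundleDatum

variable {Y T : Scheme.{0}} [IsAffine T] {g : Y ⟶ T} {ι : Type} {D : ι → Y.IdealSheafData}
  {I : Type} {n r : I → ℕ} (N : BundleDatum g D n r)

/-- The connection matrix in the direction of a vector field. -/
def conn (i : I) {U V : Y.Opens} (θ : LogField g D U) (h : V ≤ U) (h' : V ≤ N.Z.V i) :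
    Matrix (Fin (r i)) (Fin (r i)) Γ(Y, V) :=
  ∑ k, (N.ch i).lam θ h (h'.trans (N.V_le i)) k • (N.A i k).map (resO h')

lemma conn_map (i : I) {U V W : Y.Opens} (θ : LogField g D U) (h : V ≤ U) (h' : V ≤ N.Z.V i)
    (h'' : W ≤ V) : (N.conn i θ h h').map (resO h'') = N.conn i θ (h''.trans h) (h''.trans h') := by
  rw [conn, map_sum_smul]
  simp only [LogChart.res_lam, map_resO_resO]
  rfl

lemma map_app_res {U V W : Y.Opens} (θ : LogField g D U) (h : V ≤ U) (h' : W ≤ V) {s t : ℕ}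
    (M : Matrix (Fin s) (Fin t) Γ(Y, V)) :
    (M.map (θ.app V h)).map (resO h') = (M.map (resO h')).map (θ.app W (h'.trans h)) := by
  ext; simp [LogField.res_app]

lemma map_app_eq_sum (i : I) {U V : Y.Opens} (θ : LogField g D U) (h : V ≤ U) (h' : V ≤ N.Z.V i)
    {s t : ℕ} (M : Matrix (Fin s) (Fin t) Γ(Y, V)) : M.map (θ.app V h) =
      ∑ k, (N.ch i).lam θ h (h'.trans (N.V_le i)) k •
        M.map (((N.ch i).der k).app V (h'.trans (N.V_le i))) := by
  ext x y
  simp only [Matrix.map_apply, Matrix.sum_apply, Matrix.smul_apply, smul_eq_mul]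
  exact (N.ch i).app_eq_sum θ h _ _

lemma map_on (i j : I) {U V : Y.Opens} (θ : LogField g D U) (h : V ≤ U) (hi : V ≤ N.Z.V i)
    (hj : V ≤ N.Z.V j) : (N.Z.on i j hi hj).map (θ.app V h) =
      N.Z.on i j hi hj * N.conn j θ h hj - N.conn i θ h hi * N.Z.on i j hi hj := by
  have key (k : Fin (n i)) :
      (N.Z.on i j hi hj).map (((N.ch i).der k).app V (hi.trans (N.V_le i))) =
      N.Z.on i j hi hj * (∑ m, (N.ch j).lam ((N.ch i).der k) (hi.trans (N.V_le i))
        (hj.trans (N.V_le j)) m • (N.A j m).map (resO hj) :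
        Matrix (Fin (r j)) (Fin (r j)) Γ(Y, V)) -
      (N.A i k).map (resO hi) * N.Z.on i j hi hj := by
    have := congrArg (fun M => M.map (resO (le_inf hi hj))) (N.gauge i j k)
    rw [map_app_res, Matrix.map_sub _ (map_sub _), Matrix.map_mul, Matrix.map_mul,
      map_sum_smul, map_resO_resO] at this
    simp only [LogChart.res_lam, map_resO_resO] at this
    exact this
  rw [N.map_app_eq_sum i θ h hi]
  simp only [key, smul_sub, Finset.sum_sub_distrib, conn, Matrix.sum_mul, Matrix.smul_mul]
  congr 1
  simp only [← Matrix.mul_smul, Finset.smul_sum, smul_smul]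
  rw [← Matrix.mul_sum, Finset.sum_comm]
  simp only [← Finset.sum_smul]
  refine congrArg _ (Finset.sum_congr rfl fun m _ => congrArg (· • _) ?_)
  symm
  apply LogChart.lam_eq
  rw [Finset.mul_sum, (N.ch i).app_eq_sum θ h (hi.trans (N.V_le i))]
  refine Finset.sum_congr rfl fun k _ => ?_
  rw [← (N.ch j).lam_spec ((N.ch i).der k) (hi.trans (N.V_le i)) (hj.trans (N.V_le j)) m]
  ring

/-- The covariant derivative in coordinates. -/
def cov (i : I) {U O : Y.Opens} (θ : LogField g D U) (h : O ≤ U) (h' : O ≤ N.Z.V i)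
    (v : Fin (r i) → Γ(Y, O)) : Fin (r i) → Γ(Y, O) :=
  θ.app O h ∘ v + (N.conn i θ h h').mulVec v

lemma resV_cov (i : I) {U O O' : Y.Opens} (θ : LogField g D U) (h : O ≤ U) (h' : O ≤ N.Z.V i)
    (h'' : O' ≤ O) (v : Fin (r i) → Γ(Y, O)) : resV h'' (N.cov i θ h h' v) =
      N.cov i θ (h''.trans h) (h''.trans h') (resV h'' v) := by
  rw [cov, map_add, resV_mulVec, conn_map, cov]
  congr 1
  ext x; simp [LogField.res_app]

lemma on_mulVec_cov (i j : I) {U O : Y.Opens} (θ : LogField g D U) (h : O ≤ U) (hi : O ≤ N.Z.V i)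
    (hj : O ≤ N.Z.V j) (v : Fin (r j) → Γ(Y, O)) :
    (N.Z.on i j hi hj).mulVec (N.cov j θ h hj v) =
      N.cov i θ h hi ((N.Z.on i j hi hj).mulVec v) := by
  rw [cov, cov, map_mulVec_of_leibniz (RingHom.id _) _ (θ.leibniz O h), N.map_on i j θ h hi hj]
  have e : (N.Z.on i j hi hj).map (RingHom.id Γ(Y, O)) = N.Z.on i j hi hj := by ext; simp
  have e' : RingHom.id Γ(Y, O) ∘ v = v := by ext; simp
  rw [e, e', Matrix.sub_mulVec, Matrix.mulVec_add, Matrix.mulVec_mulVec, Matrix.mulVec_mulVec]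
  abel

/-- The connection on the bundle given by a datum. -/
def nabla (U : Y.Opens) (θ : LogField g D U) : Γ(N.Z.bundle, U) →+ Γ(N.Z.bundle, U) :=
  AddMonoidHom.mk' (fun b => N.Z.mkSection
    (fun i => N.cov i θ inf_le_left inf_le_right (N.Z.vec i b inf_le_left inf_le_right))
    fun i j O hU hi hj => by
      simp only [resV_cov, VectorCocycle.resV_vec, on_mulVec_cov, VectorCocycle.on_mulVec_vec])
    fun b b' => N.Z.vec_ext fun i O h h' => by
      simp only [VectorCocycle.vec_add, VectorCocycle.vec_mkSection, ← map_add]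
      congr 1
      simp only [cov, Matrix.mulVec_add]
      have : ∀ v v' : Fin (r i) → Γ(Y, U ⊓ N.Z.V i), ((θ.app _ inf_le_left) ∘ (v + v')) =
        (θ.app _ inf_le_left) ∘ v + (θ.app _ inf_le_left) ∘ v' := fun v v' => by ext; simp
      rw [this]
      abel

lemma vec_nabla (i : I) {U O : Y.Opens} (θ : LogField g D U) (b : Γ(N.Z.bundle, U)) (h : O ≤ U)
    (h' : O ≤ N.Z.V i) : N.Z.vec i (N.nabla U θ b) h h' = N.cov i θ h h' (N.Z.vec i b h h') := by
  change resV (le_inf h h') (N.cov i θ inf_le_left inf_le_right _) = _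
  rw [resV_cov, VectorCocycle.resV_vec]

/-- The flat bundle given by a datum. -/
def bundle : LogFlatBundle g D where
  M := N.Z.bundle
  locallyFree := N.Z.exists_isFrame
  nabla := N.nabla
  res_nabla U V h θ e := N.Z.vec_ext fun i O hO hi => by
    rw [VectorCocycle.vec_res, vec_nabla, vec_nabla, VectorCocycle.vec_res]
    rfl
  linear U f θ θ₁ θ₂ hθ e := N.Z.vec_ext fun i O hO hi => by
    have hl (k : Fin (n i)) : (N.ch i).lam θ hO (hi.trans (N.V_le i)) k =
        resO hO f * (N.ch i).lam θ₁ hO (hi.trans (N.V_le i)) k +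
          (N.ch i).lam θ₂ hO (hi.trans (N.V_le i)) k := by
      apply LogChart.lam_eq
      rw [hθ, mul_add, LogChart.lam_spec, ← (N.ch i).lam_spec θ₁ hO (hi.trans (N.V_le i))]
      ring
    rw [VectorCocycle.vec_add, VectorCocycle.vec_smul, vec_nabla, vec_nabla, vec_nabla]
    simp only [cov, conn, hl, add_smul, Finset.sum_add_distrib, Matrix.add_mulVec, mul_smul,
      ← Finset.smul_sum, Matrix.smul_mulVec, smul_add]
    have : θ.app O hO ∘ N.Z.vec i e hO hi = resO hO f • θ₁.app O hO ∘ N.Z.vec i e hO hi +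
        θ₂.app O hO ∘ N.Z.vec i e hO hi := by
      ext x; simp [hθ]
    rw [this]
    abel
  leibniz U θ a e := N.Z.vec_ext fun i O hO hi => by
    rw [VectorCocycle.vec_add, VectorCocycle.vec_smul, VectorCocycle.vec_smul, vec_nabla, vec_nabla,
      VectorCocycle.vec_smul, cov, cov, smul_add, Matrix.mulVec_smul, add_right_comm]
    congr 1
    ext x
    simp only [Function.comp_apply, Pi.smul_apply, smul_eq_mul, θ.leibniz, Pi.add_apply,
      θ.res_app]
    ring
  flat U θ θ₁ θ₂ hθ e := N.Z.vec_ext fun i O hO hi => by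
    have hi' := hi.trans (N.V_le i)
    have hl (k : Fin (n i)) : (N.ch i).lam θ hO hi' k =
        θ₁.app O hO ((N.ch i).lam θ₂ hO hi' k) - θ₂.app O hO ((N.ch i).lam θ₁ hO hi' k) := by
      apply LogChart.lam_eq
      rw [hθ, ← (N.ch i).lam_spec θ₁ hO hi' k, ← (N.ch i).lam_spec θ₂ hO hi' k]
      rw [θ₁.leibniz, θ₂.leibniz]
      rcases (N.ch i).w_eq k with hw | hw
      · simp only [hw, pow_zero, LogField.app_one]; ring
      · have h1 := (N.ch i).lam_spec θ₁ hO hi' k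
        have h2 := (N.ch i).lam_spec θ₂ hO hi' k
        rw [hw] at h1 h2
        simp only [hw, pow_one] at h1 h2 ⊢
        rw [← h1, ← h2]
        ring
    have hd (θ : LogField g D U) (k : Fin (n i)) : ((N.A i k).map (resO hi)).map (θ.app O hO) =
        ∑ m, (N.ch i).lam θ hO hi' m •
          ((N.A i k).map (resO hi)).map (((N.ch i).der m).app O hi') :=
      N.map_app_eq_sum i θ hO hi _
    have hf (k m : Fin (n i)) : ((N.A i m).map (resO hi)).map (((N.ch i).der k).app O hi') -
        ((N.A i k).map (resO hi)).map (((N.ch i).der m).app O hi') +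
        (N.A i k).map (resO hi) * (N.A i m).map (resO hi) -
        (N.A i m).map (resO hi) * (N.A i k).map (resO hi) = 0 := by
      have := congrArg (fun M => M.map (resO hi)) (N.flat i k m)
      simp only [Matrix.map_sub _ (map_sub (resO hi)), Matrix.map_add _ (map_add (resO hi)),
        Matrix.map_mul, map_app_res, Matrix.map_zero _ (map_zero (resO hi))] at this
      exact this
    have key := nabla_comm (RingHom.id Γ(Y, O)) (RingHom.id Γ(Y, O)) (θ₁.app O hO) (θ₂.app O hO)
      (θ₁.app O hO) (θ₂.app O hO) (θ.app O hO) (θ₁.leibniz O hO) (θ₂.leibniz O hO)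
      (fun _ => rfl) (fun _ => rfl) (fun a => hθ O hO a) (fun k => (N.A i k).map (resO hi))
      ((N.ch i).lam θ₁ hO hi') ((N.ch i).lam θ₂ hO hi')
      (fun m k => ((N.A i k).map (resO hi)).map (((N.ch i).der m).app O hi'))
      (hd θ₁) (hd θ₂) hf (N.Z.vec i e hO hi)
    rw [VectorCocycle.vec_sub]
    simp only [vec_nabla]
    simp only [cov, conn, hl]
    exact key

/-! ### Pullback -/

variable {Y' T' : Scheme.{0}} [IsAffine T'] {g' : Y' ⟶ T'} {D' : ι → Y'.IdealSheafData}

/-- The chart `ch'` is the pullback of the chart `ch` along `h`. -/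
structure _root_.Isomonodromy.LogChart.IsPullback {m : ℕ} (h : Y' ⟶ Y) (ch : LogChart g D m)
    (ch' : LogChart g' D' m) : Prop where
  le : ch'.V ≤ h ⁻¹ᵁ ch.V
  w : ch'.w = ch.w
  c : ∀ k, ch'.c k = (h.appLE _ _ le).hom (ch.c k)

lemma _root_.Isomonodromy.LogChart.IsPullback.lam {m : ℕ} {h : Y' ⟶ Y} {ch : LogChart g D m}
    {ch' : LogChart g' D' m} (p : ch.IsPullback h ch') {U : Y.Opens} {U' : Y'.Opens}
    {O : Y.Opens} {O' : Y'.Opens} (hO : O ≤ U) (hV : O ≤ ch.V) (hO' : O' ≤ U') (hV' : O' ≤ ch'.V)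
    (hOO' : O' ≤ h ⁻¹ᵁ O) (θ : LogField g D U) (θ' : LogField g' D' U')
    (hθ : ∀ a : Γ(Y, O), θ'.app O' hO' ((h.appLE O O' hOO').hom a) =
      (h.appLE O O' hOO').hom (θ.app O hO a)) (k : Fin m) :
    ch'.lam θ' hO' hV' k = (h.appLE O O' hOO').hom (ch.lam θ hO hV k) := by
  have hc : ch'.coord hV' k = (h.appLE O O' hOO').hom (ch.coord hV k) := by
    rw [LogChart.coord, LogChart.coord, p.c, appLE_resO h p.le hOO' hV hV']
  apply LogChart.lam_eq
  rw [hc, hθ, ← ch.lam_spec θ hO hV k, p.w, map_mul, map_pow]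

/-- The datum `N'` is the pullback of the datum `N` along `h`. -/
structure IsPullback (h : Y' ⟶ Y) (N : BundleDatum g D n r) (N' : BundleDatum g' D' n r) :
    Prop where
  chart : ∀ i, (N.ch i).IsPullback h (N'.ch i)
  le : ∀ i, N'.Z.V i ≤ h ⁻¹ᵁ N.Z.V i
  G : ∀ i j, N'.Z.G i j = (N.Z.G i j).map (h.appLE (N.Z.V i ⊓ N.Z.V j) (N'.Z.V i ⊓ N'.Z.V j)
    (inf_le_inf (le i) (le j))).hom
  A : ∀ i k, N'.A i k = (N.A i k).map (h.appLE (N.Z.V i) (N'.Z.V i) (le i)).hom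

namespace IsPullback

variable {h : Y' ⟶ Y} {N} {N' : BundleDatum g' D' n r}

lemma on (p : N.IsPullback h N') (i j : I) {O : Y.Opens} {O' : Y'.Opens} (hO : O' ≤ h ⁻¹ᵁ O)
    (hi : O ≤ N.Z.V i) (hj : O ≤ N.Z.V j) (hi' : O' ≤ N'.Z.V i) (hj' : O' ≤ N'.Z.V j) :
    N'.Z.on i j hi' hj' = (N.Z.on i j hi hj).map (h.appLE O O' hO).hom := by
  rw [VectorCocycle.on, p.G, VectorCocycle.on]
  ext x y
  simp only [Matrix.map_apply]
  exact (appLE_resO h _ hO (le_inf hi hj) (le_inf hi' hj') _).symm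

lemma conn (p : N.IsPullback h N') (i : I) {U O : Y.Opens} {U' O' : Y'.Opens} (hO : O ≤ U)
    (hi : O ≤ N.Z.V i) (hO' : O' ≤ U') (hi' : O' ≤ N'.Z.V i) (hOO' : O' ≤ h ⁻¹ᵁ O)
    (θ : LogField g D U) (θ' : LogField g' D' U')
    (hθ : ∀ a : Γ(Y, O), θ'.app O' hO' ((h.appLE O O' hOO').hom a) =
      (h.appLE O O' hOO').hom (θ.app O hO a)) :
    N'.conn i θ' hO' hi' = (N.conn i θ hO hi).map (h.appLE O O' hOO').hom := by
  rw [BundleDatum.conn, BundleDatum.conn, map_sum_smul]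
  refine Finset.sum_congr rfl fun k _ => ?_
  rw [(p.chart i).lam hO (hi.trans (N.V_le i)) hO' (hi'.trans (N'.V_le i)) hOO' θ θ' hθ, p.A]
  congr 1
  ext x y
  simp only [Matrix.map_apply]
  exact (appLE_resO h (p.le i) hOO' hi hi' _).symm

/-- Pullback of sections. -/
def app (p : N.IsPullback h N') (U : Y.Opens) (U' : Y'.Opens) (hU : U' ≤ h ⁻¹ᵁ U) :
    Γ(N.Z.bundle, U) →+ Γ(N'.Z.bundle, U') :=
  AddMonoidHom.mk' (fun b => N'.Z.mkSection
    (fun i => (h.appLE (U ⊓ N.Z.V i) (U' ⊓ N'.Z.V i) (inf_le_inf hU (p.le i))).hom ∘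
      N.Z.vec i b inf_le_left inf_le_right) fun i j O hO hi hj => by
      have hO₀ : O ≤ h ⁻¹ᵁ (U ⊓ (N.Z.V i ⊓ N.Z.V j)) :=
        le_inf (hO.trans hU) (le_inf (hi.trans (p.le i)) (hj.trans (p.le j)))
      have e (k : I) (hk : O ≤ N'.Z.V k) (hk' : U ⊓ (N.Z.V i ⊓ N.Z.V j) ≤ N.Z.V k) :
          resV (le_inf hO hk) ((h.appLE (U ⊓ N.Z.V k) (U' ⊓ N'.Z.V k)
            (inf_le_inf hU (p.le k))).hom ∘ N.Z.vec k b inf_le_left inf_le_right) =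
          (h.appLE _ O hO₀).hom ∘ N.Z.vec k b inf_le_left hk' := by
        rw [← N.Z.resV_vec k b inf_le_left inf_le_right (le_inf inf_le_left hk')]
        ext x
        exact (appLE_resO h _ hO₀ _ _ _).symm
      rw [e i hi (inf_le_right.trans inf_le_left), e j hj (inf_le_right.trans inf_le_right),
        p.on i j hO₀ (inf_le_right.trans inf_le_left) (inf_le_right.trans inf_le_right)]
      ext x
      rw [← RingHom.map_mulVec, Function.comp_apply, VectorCocycle.on_mulVec_vec])
    fun b b' => N'.Z.vec_ext fun i O hO hi => by
      simp only [VectorCocycle.vec_add, VectorCocycle.vec_mkSection, ← map_add]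
      congr 1
      ext x
      simp

lemma vec_app (p : N.IsPullback h N') (i : I) {U O : Y.Opens} {U' O' : Y'.Opens}
    (hU : U' ≤ h ⁻¹ᵁ U) (hO : O ≤ U) (hi : O ≤ N.Z.V i) (hO' : O' ≤ U') (hi' : O' ≤ N'.Z.V i)
    (hOO' : O' ≤ h ⁻¹ᵁ O) (b : Γ(N.Z.bundle, U)) :
    N'.Z.vec i (p.app U U' hU b) hO' hi' =
      (h.appLE O O' hOO').hom ∘ N.Z.vec i b hO hi := by
  rw [← N.Z.resV_vec i b inf_le_left inf_le_right (le_inf hO hi)]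
  ext x
  exact (appLE_resO h _ hOO' _ _ _).symm

lemma app_res (p : N.IsPullback h N') (U V : Y.Opens) (U' V' : Y'.Opens) (hU : U' ≤ h ⁻¹ᵁ U)
    (hV : V' ≤ h ⁻¹ᵁ V) (i : V ≤ U) (i' : V' ≤ U') (e : Γ(N.Z.bundle, U)) :
    resM N'.Z.bundle i' (p.app U U' hU e) = p.app V V' hV (resM N.Z.bundle i e) :=
  N'.Z.vec_ext fun k O hO hk => by
    have hO₀ : O ≤ h ⁻¹ᵁ (V ⊓ N.Z.V k) := le_inf (hO.trans hV) (hk.trans (p.le k))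
    rw [VectorCocycle.vec_res, p.vec_app k hU (inf_le_left.trans i) inf_le_right _ hk hO₀,
      p.vec_app k hV inf_le_left inf_le_right hO hk hO₀, VectorCocycle.vec_res]

lemma app_smul (p : N.IsPullback h N') (U : Y.Opens) (U' : Y'.Opens) (hU : U' ≤ h ⁻¹ᵁ U)
    (a : Γ(Y, U)) (e : Γ(N.Z.bundle, U)) : p.app U U' hU (a • e : Γ(N.Z.bundle, U)) =
      ((h.appLE U U' hU).hom a • p.app U U' hU e : Γ(N'.Z.bundle, U')) :=
  N'.Z.vec_ext fun k O hO hk => by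
    have hO₀ : O ≤ h ⁻¹ᵁ (U ⊓ N.Z.V k) := le_inf (hO.trans hU) (hk.trans (p.le k))
    rw [VectorCocycle.vec_smul, p.vec_app k hU inf_le_left inf_le_right _ hk hO₀,
      p.vec_app k hU inf_le_left inf_le_right hO hk hO₀, VectorCocycle.vec_smul]
    ext x
    simp only [Function.comp_apply, Pi.smul_apply, smul_eq_mul, map_mul]
    rw [appLE_resO h hU hO₀ inf_le_left hO]

lemma isFrame_app (p : N.IsPullback h N') (U : Y.Opens) (U' : Y'.Opens) (hU : U' ≤ h ⁻¹ᵁ U)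
    (m : ℕ) (e : Fin m → Γ(N.Z.bundle, U)) (he : IsFrame N.Z.bundle U e) :
    IsFrame N'.Z.bundle U' fun l => p.app U U' hU (e l) := by
  choose Q hQ using N.Z.exists_inverse_of_isFrame he
  have hm (i : I) : N'.Z.mat i (fun l => p.app U U' hU (e l)) inf_le_left inf_le_right =
      (N.Z.mat i e inf_le_left inf_le_right).map
        (h.appLE (U ⊓ N.Z.V i) (U' ⊓ N'.Z.V i) (inf_le_inf hU (p.le i))).hom := by
    ext x l
    exact congr($(p.vec_app i hU inf_le_left inf_le_right inf_le_left inf_le_right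
      (inf_le_inf hU (p.le i)) (e l)) x)
  refine N'.Z.isFrame_of_inverse (fun i => (Q i).map
    (h.appLE (U ⊓ N.Z.V i) (U' ⊓ N'.Z.V i) (inf_le_inf hU (p.le i))).hom)
    (fun i => ?_) fun i => ?_
  · rw [hm, ← Matrix.map_mul, (hQ i).1]; exact Matrix.map_one _ (map_zero _) (map_one _)
  · rw [hm, ← Matrix.map_mul, (hQ i).2]; exact Matrix.map_one _ (map_zero _) (map_one _)

lemma app_nabla (p : N.IsPullback h N') (U : Y.Opens) (U' : Y'.Opens) (hU : U' ≤ h ⁻¹ᵁ U)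
    (θ : LogField g D U) (θ' : LogField g' D' U')
    (hθ : ∀ (V : Y.Opens) (V' : Y'.Opens) (i : V ≤ U) (i' : V' ≤ U') (hV : V' ≤ h ⁻¹ᵁ V)
      (a : Γ(Y, V)),
      θ'.app V' i' ((h.appLE V V' hV).hom a) = (h.appLE V V' hV).hom (θ.app V i a))
    (e : Γ(N.Z.bundle, U)) :
    p.app U U' hU (N.nabla U θ e) = N'.nabla U' θ' (p.app U U' hU e) :=
  N'.Z.vec_ext fun k O hO hk => by
    have hO₀ : O ≤ h ⁻¹ᵁ (U ⊓ N.Z.V k) := le_inf (hO.trans hU) (hk.trans (p.le k))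
    rw [p.vec_app k hU inf_le_left inf_le_right hO hk hO₀, vec_nabla, vec_nabla,
      p.vec_app k hU inf_le_left inf_le_right _ hk hO₀, cov,
      cov, p.conn k inf_le_left inf_le_right hO hk hO₀ θ θ' (hθ _ _ _ _ _)]
    ext x
    have := RingHom.map_mulVec (h.appLE _ _ hO₀).hom
      (N.conn k θ (inf_le_left : U ⊓ N.Z.V k ≤ U) inf_le_right)
      (N.Z.vec k e inf_le_left inf_le_right) x
    simp only [Function.comp_apply, Pi.add_apply, map_add, this]
    rw [hθ _ _ inf_le_left hO hO₀]

/-- The pullback map between the bundles. -/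
def pullbackMap (p : N.IsPullback h N') : PullbackMap h N.bundle N'.bundle where
  app := p.app
  app_res := p.app_res
  semilinear := p.app_smul
  frame := p.isFrame_app
  horizontal := p.app_nabla

end IsPullback

lemma _root_.Isomonodromy.appLE_constMap {h : Y' ⟶ Y} {u : T' ⟶ T} (w : h ≫ g = g' ≫ u)
    {O : Y.Opens} {O' : Y'.Opens} (hO : O' ≤ h ⁻¹ᵁ O) (x : Γ(T, ⊤)) :
    (h.appLE O O' hO).hom (Isomonodromy.constMap g O x) =
      Isomonodromy.constMap g' O' ((u.appLE ⊤ ⊤ le_top).hom x) := by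
  have e1 := Scheme.Hom.appLE_comp_appLE h g ⊤ O O' (le_preimage_top g O) hO
  have e2 := Scheme.Hom.appLE_comp_appLE g' u ⊤ ⊤ O' le_top (le_preimage_top g' O')
  have e3 : g.appLE ⊤ O (le_preimage_top g O) ≫ h.appLE O O' hO =
      u.appLE ⊤ ⊤ le_top ≫ g'.appLE ⊤ O' (le_preimage_top g' O') := by
    rw [e1, e2]
    simp only [w]
  exact congr($(congrArg CommRingCat.Hom.hom e3) x)

lemma _root_.Isomonodromy.LogChart.IsPullback.der {h : Y' ⟶ Y} {u : T' ⟶ T} (w : h ≫ g = g' ≫ u)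
    {m : ℕ} {ch : LogChart g D m} {ch' : LogChart g' D' m} (p : ch.IsPullback h ch')
    {O : Y.Opens} {O' : Y'.Opens} (hV : O ≤ ch.V) (hV' : O' ≤ ch'.V) (hO : O' ≤ h ⁻¹ᵁ O)
    (k : Fin m) (a : Γ(Y, O)) : (ch'.der k).app O' hV' ((h.appLE O O' hO).hom a) =
      (h.appLE O O' hO).hom ((ch.der k).app O hV a) := by
  refine resO_ext fun y hy => ?_
  obtain ⟨W, hWa, hWO, hyW⟩ := exists_affine_mem (show h y ∈ O from hO hy)
  obtain ⟨W', hWa', hWO', hyW'⟩ := exists_affine_mem (U := O' ⊓ h ⁻¹ᵁ W) ⟨hy, hyW⟩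
  have hW'O := hWO'.trans inf_le_left
  have hW'W := hWO'.trans inf_le_right
  refine ⟨W', hW'O, hyW', ?_⟩
  rw [LogField.res_app, ← appLE_resO h hO hW'W hWO hW'O, ← appLE_resO h hO hW'W hWO hW'O,
    LogField.res_app]
  let π := (h.appLE W W' hW'W).hom
  refine DFunLike.congr_fun ((ch.etaleCoords (hWO.trans hV) hWa).derivation_ext π
    (((ch'.der k).app W' (hW'O.trans hV')).comp π.toAddMonoidHom)
    (π.toAddMonoidHom.comp ((ch.der k).app W (hWO.trans hV))) (fun a b => ?_)
    (fun a b => ?_) (fun x => ?_) fun l => ?_) (resO hWO a)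
  · simp [LogField.leibniz]
  · simp [LogField.leibniz]
  · change (ch'.der k).app W' (hW'O.trans hV') (π _) = π ((ch.der k).app W _ _)
    rw [LogField.constMap, map_zero, appLE_constMap w, LogField.constMap _ (hW'O.trans hV')]
  · have hc (l : Fin m) : π (ch.coord (hWO.trans hV) l) = ch'.coord (hW'O.trans hV') l := by
      rw [LogChart.coord, LogChart.coord, p.c, appLE_resO h p.le hW'W _ (hW'O.trans hV')]
    change (ch'.der k).app W' (hW'O.trans hV') (π _) = π ((ch.der k).app W _ _)
    rw [hc, LogChart.der_coord, LogChart.der_coord]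
    split_ifs
    · rw [map_pow, hc, p.w]
    · rw [map_zero]

end BundleDatum

end

section

/-! ### Taylor series -/

section Taylor

open Finset

variable {A : Type} [CommRing A] [Algebra ℚ A]

/-- `x ^ m / m!`. -/
def divPow (m : ℕ) (x : A) : A := algebraMap ℚ A (m.factorial : ℚ)⁻¹ * x ^ m

/-- The derivative `x ^ (m - 1) / (m - 1)!` of `x ^ m / m!`. -/
def divPowPred : ℕ → A → A
  | 0, _ => 0
  | m + 1, x => divPow m x

lemma divPow_zero (x : A) : divPow 0 x = 1 := by simp [divPow]

lemma divPow_eq_zero {x : A} {N : ℕ} (h : x ^ N = 0) {m : ℕ} (hm : N ≤ m) : divPow m x = 0 := by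
  rw [divPow, pow_eq_zero_of_le hm h, mul_zero]

lemma smul_divPow (m : ℕ) (x : A) : (m : A) * divPow m x = x * divPowPred m x := by
  cases m with
  | zero => simp [divPowPred]
  | succ m =>
    have h : ((m + 1 : ℕ) : A) * algebraMap ℚ A ((m + 1).factorial : ℚ)⁻¹ =
        algebraMap ℚ A (m.factorial : ℚ)⁻¹ := by
      rw [← map_natCast (algebraMap ℚ A), ← map_mul]
      congr 1
      rw [Nat.factorial_succ]
      have := Nat.factorial_ne_zero m
      push_cast
      field_simp
    rw [divPowPred, divPow, divPow, ← mul_assoc, h, pow_succ]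
    ring

variable {A' : Type} [CommRing A'] [Algebra ℚ A']

lemma map_divPow (π : A →+* A') (m : ℕ) (x : A) : π (divPow m x) = divPow m (π x) := by
  have h (c : ℚ) : π (algebraMap ℚ A c) = algebraMap ℚ A' c := by
    rw [← RingHom.comp_apply]; congr 1; exact Subsingleton.elim _ _
  rw [divPow, divPow, map_mul, h, map_pow]

lemma leibniz_algebraMap_rat (π : A →+* A') (δ : A →+ A')
    (hδ : ∀ a b, δ (a * b) = π a * δ b + π b * δ a) (c : ℚ) (a : A) :
    δ (algebraMap ℚ A c * a) = algebraMap ℚ A' c * δ a := by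
  rw [← Algebra.smul_def, ← Algebra.smul_def]
  exact map_rat_smul δ c a

lemma leibniz_pow (π : A →+* A') (δ : A →+ A')
    (hδ : ∀ a b, δ (a * b) = π a * δ b + π b * δ a) (x : A) (m : ℕ) :
    δ (x ^ (m + 1)) = ((m + 1 : ℕ) : A') * π x ^ m * δ x := by
  induction m with
  | zero => simp
  | succ m ih =>
    rw [pow_succ, hδ, ih, map_pow]
    push_cast
    ring

lemma leibniz_divPow (π : A →+* A') (δ : A →+ A')
    (hδ : ∀ a b, δ (a * b) = π a * δ b + π b * δ a) (m : ℕ) (x : A) :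
    δ (divPow m x) = divPowPred m (π x) * δ x := by
  cases m with
  | zero =>
    have h1 : δ 1 = 0 := by simpa using hδ 1 1
    simp [divPow_zero, divPowPred, h1]
  | succ m =>
    have h : algebraMap ℚ A' ((m + 1).factorial : ℚ)⁻¹ * ((m + 1 : ℕ) : A') =
        algebraMap ℚ A' (m.factorial : ℚ)⁻¹ := by
      rw [← map_natCast (algebraMap ℚ A'), ← map_mul]
      congr 1
      rw [Nat.factorial_succ]
      have := Nat.factorial_ne_zero m
      push_cast
      field_simp
    rw [divPow, leibniz_algebraMap_rat π δ hδ, leibniz_pow π δ hδ, divPowPred, divPow, ← h]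
    ring

lemma leibniz_prod (π : A →+* A') (δ : A →+ A')
    (hδ : ∀ a b, δ (a * b) = π a * δ b + π b * δ a) {κ : Type} [DecidableEq κ] (s : Finset κ)
    (f : κ → A) : δ (∏ k ∈ s, f k) = ∑ k ∈ s, (∏ j ∈ s.erase k, π (f j)) * δ (f k) := by
  induction s using Finset.induction_on with
  | empty => simpa using hδ 1 1
  | insert a s ha ih =>
    rw [prod_insert ha, hδ, ih, sum_insert ha, erase_insert ha, map_prod, mul_sum, add_comm]
    congr 1
    refine sum_congr rfl fun k hk => ?_
    have hka : a ≠ k := fun h => ha (h ▸ hk)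
    rw [erase_insert_of_ne hka, prod_insert (by simp [ha]), mul_assoc]

variable {n r : ℕ}

/-- `ξ ^ K / K!`. -/
def multiPow (ξ : Fin n → A) (K : Fin n → ℕ) : A := ∏ k, divPow (K k) (ξ k)

/-- The derivative of `ξ ^ K / K!` by `ξ k`. -/
def multiPowPred (ξ : Fin n → A) (k : Fin n) (K : Fin n → ℕ) : A :=
  (∏ j ∈ univ.erase k, divPow (K j) (ξ j)) * divPowPred (K k) (ξ k)

lemma multiPow_zero (ξ : Fin n → A) : multiPow ξ 0 = 1 := by simp [multiPow, divPow_zero]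

lemma multiPowPred_add_single (ξ : Fin n → A) (k : Fin n) (K : Fin n → ℕ) :
    multiPowPred ξ k (K + Pi.single k 1) = multiPow ξ K := by
  rw [multiPowPred, multiPow, ← prod_erase_mul univ _ (mem_univ k)]
  congr 1
  · refine prod_congr rfl fun j hj => ?_
    simp [(ne_of_mem_erase hj)]
  · simp [divPowPred]

lemma multiPowPred_eq_zero (ξ : Fin n → A) (k : Fin n) (K : Fin n → ℕ) (h : K k = 0) :
    multiPowPred ξ k K = 0 := by
  rw [multiPowPred, h, divPowPred, mul_zero]

lemma smul_multiPow (ξ : Fin n → A) (k : Fin n) (K : Fin n → ℕ) :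
    (K k : A) * multiPow ξ K = ξ k * multiPowPred ξ k K := by
  rw [multiPowPred, multiPow, ← prod_erase_mul univ _ (mem_univ k), mul_left_comm, smul_divPow]
  ring

lemma leibniz_multiPow (π : A →+* A') (δ : A →+ A')
    (hδ : ∀ a b, δ (a * b) = π a * δ b + π b * δ a) (ξ : Fin n → A) (K : Fin n → ℕ) :
    δ (multiPow ξ K) = ∑ k, δ (ξ k) * multiPowPred (π ∘ ξ) k K := by
  rw [multiPow, leibniz_prod π δ hδ]
  refine sum_congr rfl fun k _ => ?_
  rw [leibniz_divPow π δ hδ, multiPowPred]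
  simp only [map_divPow, Function.comp_apply]
  ring

lemma map_multiPow (π : A →+* A') (ξ : Fin n → A) (K : Fin n → ℕ) :
    π (multiPow ξ K) = multiPow (π ∘ ξ) K := by
  simp [multiPow, map_prod, map_divPow]

/-- The multi-indices with entries at most `N`. -/
def box (n N : ℕ) : Finset (Fin n → ℕ) := Fintype.piFinset fun _ => range (N + 1)

lemma mem_box {N : ℕ} {K : Fin n → ℕ} : K ∈ box n N ↔ ∀ k, K k ≤ N := by
  simp [box]

lemma multiPow_eq_zero {ξ : Fin n → A} {N : ℕ} (h : ∀ k, ξ k ^ N = 0) {K : Fin n → ℕ} {k : Fin n}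
    (hk : N ≤ K k) : multiPow ξ K = 0 :=
  prod_eq_zero (mem_univ k) (divPow_eq_zero (h k) hk)

/-- Shifting a sum over multi-indices. -/
lemma sum_multiPowPred {ξ : Fin n → A} {N : ℕ} (h : ∀ k, ξ k ^ N = 0) (k : Fin n)
    (u : (Fin n → ℕ) → (Fin r → A)) : ∑ K ∈ box n N, multiPowPred ξ k K • u K =
      ∑ K ∈ box n N, multiPow ξ K • u (K + Pi.single k 1) := by
  symm
  refine sum_bij_ne_zero (fun K _ _ => K + Pi.single k 1) ?_ ?_ ?_ ?_
  · intro K hK hne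
    rw [mem_box] at hK ⊢
    intro j
    by_cases hj : j = k
    · subst hj
      by_contra! hc
      apply hne
      rw [multiPow_eq_zero h (k := j) (by simp at hc; omega), zero_smul]
    · simpa [hj] using hK j
  · intro K _ _ L _ _ e
    exact add_right_cancel e
  · intro K hK hne
    have hk : K k ≠ 0 := fun h0 => hne (by rw [multiPowPred_eq_zero ξ k K h0, zero_smul])
    have e : K - Pi.single k 1 + Pi.single k 1 = K := by
      ext j
      by_cases hj : j = k
      · subst hj; simp; omega
      · simp [hj]
    refine ⟨K - Pi.single k 1, ?_, ?_, e⟩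
    · rw [mem_box] at hK ⊢
      exact fun j => (Nat.sub_le _ _).trans (hK j)
    · rwa [← multiPowPred_add_single ξ k, e]
  · intro K _ _
    rw [multiPowPred_add_single]

/-- The Taylor series with coefficients `u`. -/
def taylor (N : ℕ) (ξ : Fin n → A) (u : (Fin n → ℕ) → (Fin r → A)) : Fin r → A :=
  ∑ K ∈ box n N, multiPow ξ K • u K

lemma taylor_eq_of_le {ξ : Fin n → A} {N N' : ℕ} (h : ∀ k, ξ k ^ N = 0) (hN : N ≤ N')
    (u : (Fin n → ℕ) → (Fin r → A)) : taylor N' ξ u = taylor N ξ u := by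
  symm
  refine sum_subset (fun K hK => ?_) fun K _ hK => ?_
  · rw [mem_box] at hK ⊢
    exact fun k => (hK k).trans hN
  · rw [mem_box] at hK
    push Not at hK
    obtain ⟨k, hk⟩ := hK
    rw [multiPow_eq_zero h hk.le, zero_smul]

lemma map_taylor (π : A →+* A') (N : ℕ) (ξ : Fin n → A) (u : (Fin n → ℕ) → (Fin r → A)) :
    π ∘ taylor N ξ u = taylor N (π ∘ ξ) fun K => π ∘ u K := by
  ext x
  simp [taylor, map_sum, map_multiPow]

variable {E : Type} [AddCommGroup E]

/-- Iterated covariant derivatives in the directions of `n` commuting vector fields; for a vector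
field with weight `w = 1` these are the falling factorials. -/
structure IterDer (nabla : Fin n → E →+ E) (w : Fin n → ℕ) where
  N : (Fin n → ℕ) → E →+ E
  N_zero : ∀ e, N 0 e = e
  comm : ∀ k K e, N K (nabla k e) = nabla k (N K e)
  succ : ∀ k K e, nabla k (N K e) = N (K + Pi.single k 1) e + (w k * K k) • N K e

variable {nabla : Fin n → E →+ E} {w : Fin n → ℕ} (P : IterDer nabla w)

lemma IterDer.taylor_nabla {ξ : Fin n → A} {N : ℕ} (h : ∀ k, ξ k ^ N = 0)
    (κ : E →+ (Fin r → A)) (k : Fin n) (e : E) :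
    taylor N ξ (fun K => κ (P.N K (nabla k e))) =
      (1 + w k * ξ k) • taylor N ξ fun K => κ (P.N (K + Pi.single k 1) e) := by
  have h1 : ∀ K, multiPow ξ K • κ (P.N K (nabla k e)) =
      multiPow ξ K • κ (P.N (K + Pi.single k 1) e) +
        (w k * ξ k : A) • multiPowPred ξ k K • κ (P.N K e) := by
    intro K
    rw [P.comm, P.succ, map_add, smul_add, map_nsmul, ← Nat.cast_smul_eq_nsmul A, smul_smul,
      smul_smul]
    congr 2
    push_cast
    rw [mul_assoc (w k : A), ← smul_multiPow]
    ring
  rw [taylor, sum_congr rfl fun K _ => h1 K, sum_add_distrib, ← smul_sum, sum_multiPowPred h,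
    add_smul, one_smul]
  rfl

lemma IterDer.leibniz_taylor {ξ : Fin n → A} {N : ℕ} (h : ∀ k, ξ k ^ N = 0)
    (κ : E →+ (Fin r → A)) (π : A →+* A') (δ : A →+ A')
    (hδ : ∀ a b, δ (a * b) = π a * δ b + π b * δ a) (Γ : Matrix (Fin r) (Fin r) A')
    (l m : Fin n → A')
    (hκ : ∀ e, δ ∘ κ e + Γ.mulVec (π ∘ κ e) = ∑ k, l k • (π ∘ κ (nabla k e)))
    (hlm : ∀ k, δ (ξ k) + (1 + w k * π (ξ k)) * l k = (1 + w k * π (ξ k)) * m k) (e : E) :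
    δ ∘ taylor N ξ (fun K => κ (P.N K e)) +
      Γ.mulVec (π ∘ taylor N ξ fun K => κ (P.N K e)) =
      ∑ k, m k • (π ∘ taylor N ξ fun K => κ (P.N K (nabla k e))) := by
  have h' : ∀ k, (π ∘ ξ) k ^ N = 0 := fun k => by
    rw [Function.comp_apply, ← map_pow, h, map_zero]
  have e1 : δ ∘ taylor N ξ (fun K => κ (P.N K e)) =
      ∑ K ∈ box n N, (multiPow (π ∘ ξ) K • (δ ∘ κ (P.N K e)) +
        ∑ k, (δ (ξ k) * multiPowPred (π ∘ ξ) k K) • (π ∘ κ (P.N K e))) := by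
    ext x
    simp only [Function.comp_apply, taylor, Finset.sum_apply, Pi.smul_apply, smul_eq_mul, map_sum, hδ,
      map_multiPow, leibniz_multiPow π δ hδ, Pi.add_apply, mul_sum]
    refine sum_congr rfl fun K _ => congrArg₂ _ rfl (sum_congr rfl fun k _ => ?_)
    exact mul_comm _ _
  have e2 : Γ.mulVec (π ∘ taylor N ξ fun K => κ (P.N K e)) =
      ∑ K ∈ box n N, multiPow (π ∘ ξ) K • Γ.mulVec (π ∘ κ (P.N K e)) := by
    rw [map_taylor, taylor, Matrix.mulVec_sum]
    simp only [Matrix.mulVec_smul]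
  have e3 : ∑ K ∈ box n N, ∑ k, (δ (ξ k) * multiPowPred (π ∘ ξ) k K) • (π ∘ κ (P.N K e)) =
      ∑ k, δ (ξ k) • taylor N (π ∘ ξ) (fun K => π ∘ κ (P.N (K + Pi.single k 1) e)) := by
    rw [sum_comm]
    refine sum_congr rfl fun k _ => ?_
    simp only [mul_smul]
    rw [← smul_sum, sum_multiPowPred h' k fun K => π ∘ κ (P.N K e)]
    rfl
  have e4 : ∑ K ∈ box n N, multiPow (π ∘ ξ) K • (δ ∘ κ (P.N K e) + Γ.mulVec (π ∘ κ (P.N K e))) =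
      ∑ k, l k • (π ∘ taylor N ξ fun K => κ (P.N K (nabla k e))) := by
    simp only [hκ, smul_sum]
    rw [sum_comm]
    refine sum_congr rfl fun k _ => ?_
    rw [map_taylor, taylor, smul_sum]
    refine sum_congr rfl fun K _ => ?_
    rw [P.comm, smul_comm]
  have e5 (k : Fin n) : (π ∘ taylor N ξ fun K => κ (P.N K (nabla k e))) =
      (1 + w k * π (ξ k)) •
        taylor N (π ∘ ξ) (fun K => π ∘ κ (P.N (K + Pi.single k 1) e)) := by
    rw [P.taylor_nabla h, ← map_taylor]
    ext x
    simp
  rw [e1, e2, sum_add_distrib, e3, add_right_comm, ← sum_add_distrib]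
  simp only [← smul_add]
  rw [e4, ← sum_add_distrib]
  refine sum_congr rfl fun k _ => ?_
  rw [e5, smul_smul, smul_smul, ← add_smul, add_comm, mul_comm (l k), hlm, mul_comm]

end Taylor

/-! ### Uniqueness of horizontal extensions -/

section Uniqueness

variable {A : Type} [CommRing A] [Algebra ℚ A]

lemma mem_of_natCast_mul_mem (I : Ideal A) {m : ℕ} (hm : m ≠ 0) {y : A} (h : (m : A) * y ∈ I) :
    y ∈ I := by
  have := I.mul_mem_left (algebraMap ℚ A (m : ℚ)⁻¹) h
  rwa [← mul_assoc, ← map_natCast (algebraMap ℚ A), ← map_mul, inv_mul_cancel₀ (by exact_mod_cast hm),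
    map_one, one_mul] at this

/-- A multiplicative filtration with an Euler derivation `ε`, which acts on the `m`-th graded
piece as multiplication by `m`. -/
structure EulerFiltration (A : Type) [CommRing A] where
  F : ℕ → Ideal A
  mul : ∀ m l a b, a ∈ F m → b ∈ F l → a * b ∈ F (m + l)
  bound : ℕ
  eq_bot : ∀ m, bound ≤ m → F m = ⊥
  ε : A →+ A
  leibniz : ∀ a b, ε (a * b) = a * ε b + b * ε a
  euler : ∀ m a, a ∈ F m → ε a - m * a ∈ F (m + 1)

/-- Functions that satisfy a system of differential equations and that vanish at the origin are
zero. -/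
lemma EulerFiltration.eq_zero (Φ : EulerFiltration A) {σ : Type} (Δ : σ → A)
    (h1 : ∀ α, Δ α ∈ Φ.F 1)
    (h : ∀ m, (∀ α, Δ α ∈ Φ.F m) → ∀ α, Φ.ε (Δ α) ∈ Φ.F (m + 1)) (α : σ) : Δ α = 0 := by
  have key : ∀ m, ∀ α, Δ α ∈ Φ.F (m + 1) := by
    intro m
    induction m with
    | zero => exact h1
    | succ m ih =>
      intro α
      refine mem_of_natCast_mul_mem _ (Nat.succ_ne_zero m) ?_
      have := Ideal.sub_mem _ (h (m + 1) ih α) (Φ.euler (m + 1) _ (ih α))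
      simpa using this
  have := key Φ.bound α
  rwa [Φ.eq_bot _ (Nat.le_succ _)] at this

end Uniqueness

/-! ### Transport along pairs of infinitesimally close maps -/

section Transport

variable {B A : Type} [CommRing B] [CommRing A] [Algebra ℚ A] {E : Type} [AddCommGroup E]
  [Module B E] {n r : ℕ} {nabla : Fin n → E →+ E} {w : Fin n → ℕ} (P : IterDer nabla w)

lemma IterDer.taylor_sub_mem {ξ : Fin n → A} {I : Ideal A} (hξ : ∀ k, ξ k ∈ I) (N : ℕ)
    (κ : E →+ (Fin r → A)) (e : E) (x : Fin r) :
    taylor N ξ (fun K => κ (P.N K e)) x - κ e x ∈ I := by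
  have h0 : (0 : Fin n → ℕ) ∈ box n N := mem_box.mpr fun k => Nat.zero_le _
  rw [taylor, Finset.sum_apply, ← Finset.add_sum_erase _ _ h0, multiPow_zero, one_smul, P.N_zero,
    add_sub_cancel_left]
  refine Ideal.sum_mem _ fun K hK => ?_
  obtain ⟨k, hk⟩ : ∃ k, K k ≠ 0 := by
    by_contra! hc
    exact Finset.ne_of_mem_erase hK (funext hc)
  rw [Pi.smul_apply, smul_eq_mul, multiPow, ← Finset.mul_prod_erase _ _ (Finset.mem_univ k)]
  refine Ideal.mul_mem_right _ _ (Ideal.mul_mem_right _ _ (Ideal.mul_mem_left _ _ ?_))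
  exact Ideal.pow_mem_of_mem _ (hξ k) _ (Nat.pos_of_ne_zero hk)

/-- Transport is semilinear. -/
lemma IterDer.taylor_smul (Φ : EulerFiltration A) (φ ψ : B →+* A) {D : Fin n → B →+ B}
    (hE : ∀ k (a : B) (e : E), nabla k (a • e) = D k a • e + a • nabla k e)
    (κ : E →+ (Fin r → A)) (hκ : ∀ (a : B) e, κ (a • e) = φ a • κ e) (hφψ : ∀ a, ψ a - φ a ∈ Φ.F 1)
    (hφ : ∀ e x, Φ.ε (κ e x) = 0) {ξ m : Fin n → A} (hξ : ∀ k, ξ k ∈ Φ.F 1)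
    (hm : ∀ k, m k ∈ Φ.F 1) (hξm : ∀ k, Φ.ε (ξ k) = (1 + w k * ξ k) * m k)
    (hψ : ∀ a, Φ.ε (ψ a) = ∑ k, m k * ψ (D k a)) {N : ℕ} (hN : ∀ k, ξ k ^ N = 0)
    (a : B) (e : E) : taylor N ξ (fun K => κ (P.N K (a • e))) =
      ψ a • taylor N ξ fun K => κ (P.N K e) := by
  set τ : E → Fin r → A := fun e => taylor N ξ fun K => κ (P.N K e) with hτ
  have τ_add (e e' : E) : τ (e + e') = τ e + τ e' := by
    simp [τ, taylor, Finset.sum_add_distrib, smul_add]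
  have τ_der (e : E) (x : Fin r) : Φ.ε (τ e x) = ∑ k, m k * τ (nabla k e) x := by
    have := P.leibniz_taylor hN κ (RingHom.id A) Φ.ε Φ.leibniz 0 0 m (fun e => by
      ext x; simp [hφ]) (fun k => by simpa using hξm k) e
    have h2 := congr($this x)
    simpa [Finset.sum_apply] using h2
  have τ_mem (e : E) (x : Fin r) : τ e x - κ e x ∈ Φ.F 1 := P.taylor_sub_mem hξ N κ e x
  let Δ : B × E × Fin r → A := fun p => τ (p.1 • p.2.1) p.2.2 - ψ p.1 * τ p.2.1 p.2.2
  have hΔ : ∀ p, Δ p = 0 := by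
    refine Φ.eq_zero Δ ?_ ?_
    · rintro ⟨a, e, x⟩
      have h1 := τ_mem (a • e) x
      rw [hκ, Pi.smul_apply, smul_eq_mul] at h1
      have h2 := Ideal.mul_mem_left _ (ψ a) (τ_mem e x)
      have h3 := Ideal.mul_mem_right (κ e x) _ (hφψ a)
      have h4 := Ideal.sub_mem _ (Ideal.sub_mem _ h1 h2) h3
      refine (congrArg (· ∈ Φ.F 1) ?_).mp h4
      change _ = τ (a • e) x - ψ a * τ e x
      ring
    · rintro j hj ⟨a, e, x⟩
      have : Φ.ε (Δ (a, e, x)) = ∑ k, m k * (Δ (D k a, e, x) + Δ (a, nabla k e, x)) := by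
        simp only [Δ, map_sub, Φ.leibniz, τ_der, hψ, hE, τ_add, Pi.add_apply]
        rw [Finset.mul_sum, Finset.mul_sum, ← Finset.sum_add_distrib, ← Finset.sum_sub_distrib]
        exact Finset.sum_congr rfl fun k _ => by ring
      rw [this]
      refine Ideal.sum_mem _ fun k _ => ?_
      rw [add_comm j 1]
      exact Φ.mul 1 j _ _ (hm k) (Ideal.add_mem _ (hj _) (hj _))
  ext x
  exact sub_eq_zero.mp (hΔ (a, e, x))

end Transport

section Exists

variable {E : Type} [AddCommGroup E] {n : ℕ}

/-- The falling factorial with step `w`. -/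
def fall {C : Type} [CommRing C] (w : ℕ) (x : C) (m : ℕ) : C := ∏ i ∈ Finset.range m, (x - i * w)

open scoped IsMulCommutative in
lemma exists_commRing_of_comm {nabla : Fin n → AddMonoid.End E}
    (h : ∀ k l e, nabla k (nabla l e) = nabla l (nabla k e)) :
    ∃ (C : Type) (_ : CommRing C) (ev : C →+* AddMonoid.End E) (x : Fin n → C),
      ∀ k, ev (x k) = nabla k := by
  have : IsMulCommutative (Subring.closure (Set.range nabla)) :=
    Subring.isMulCommutative_closure (by
      rintro _ ⟨k, rfl⟩ _ ⟨l, rfl⟩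
      exact AddMonoidHom.ext (h k l))
  exact ⟨Subring.closure (Set.range nabla), inferInstance, (Subring.closure (Set.range nabla)).subtype,
    fun k => ⟨nabla k, Subring.subset_closure ⟨k, rfl⟩⟩, fun k => rfl⟩

/-- Iterated derivatives as falling factorials. -/
def iterDer {nabla : Fin n → E →+ E} (w : Fin n → ℕ) {C : Type} [CommRing C]
    (ev : C →+* AddMonoid.End E) (x : Fin n → C) (hx : ∀ k, ev (x k) = nabla k) :
    IterDer nabla w where
  N K := ev (∏ k, fall (w k) (x k) (K k))
  N_zero e := by
    simp only [fall, Pi.zero_apply, Finset.range_zero, Finset.prod_empty, Finset.prod_const_one,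
      map_one]
    rfl
  comm k K e := by
    have := congrArg ev (mul_comm (∏ k, fall (w k) (x k) (K k)) (x k))
    rw [map_mul, map_mul, hx] at this
    exact congr($this e)
  succ k K e := by
    have e1 : ∏ j, fall (w j) (x j) ((K + Pi.single k 1 : Fin n → ℕ) j) =
        (∏ k, fall (w k) (x k) (K k)) * (x k - K k * w k) := by
      rw [← Finset.prod_erase_mul _ _ (Finset.mem_univ k),
        ← Finset.prod_erase_mul _ (fun k => fall (w k) (x k) (K k)) (Finset.mem_univ k), mul_assoc]
      congr 1
      · refine Finset.prod_congr rfl fun j hj => ?_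
        simp [Finset.ne_of_mem_erase hj]
      · simp [fall, Finset.prod_range_succ]
    have : x k * ∏ k, fall (w k) (x k) (K k) =
        (∏ j, fall (w j) (x j) ((K + Pi.single k 1 : Fin n → ℕ) j)) +
          (w k * K k : ℕ) * ∏ k, fall (w k) (x k) (K k) := by
      rw [e1]
      push_cast
      ring
    have h2 := congrArg ev this
    rw [map_mul, hx, map_add, map_mul, map_natCast] at h2
    refine congr($h2 e).trans ?_
    change _ + ((w k * K k : ℕ) : AddMonoid.End E) _ = _
    rw [AddMonoid.End.natCast_apply]

end Exists

end

section

/-! ### Base change of affine open sets and of ideal sheaves -/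

lemma isAffineOpen_of_isPullback {Y T Y' T' : Scheme.{0}} {h : Y' ⟶ Y} {g' : Y' ⟶ T'} {g : Y ⟶ T}
    {u : T' ⟶ T} (H : IsPullback h g' g u) {W : T.Opens} {V : Y.Opens} {O : T'.Opens}
    (hW : IsAffineOpen W) (hV : IsAffineOpen V) (hVW : V ≤ g ⁻¹ᵁ W) (hO : IsAffineOpen O)
    (hOW : O ≤ u ⁻¹ᵁ W) (hle : h ⁻¹ᵁ V ≤ g' ⁻¹ᵁ O) :
    IsAffineOpen (h ⁻¹ᵁ V) ∧ IsPushout (g.appLE W V hVW) (u.appLE W O hOW)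
        (h.appLE V (h ⁻¹ᵁ V) le_rfl) (g'.appLE O (h ⁻¹ᵁ V) hle) := by
  have hUY : h ⁻¹ᵁ V = h ⁻¹ᵁ V ⊓ g' ⁻¹ᵁ O := (inf_eq_left.mpr hle).symm
  have i1 : IsAffine _ := hW
  have i2 : IsAffine _ := hO
  have i3 : IsAffine _ := hV
  refine ⟨.of_isIso (Scheme.Hom.isPullback_resLE H hOW hVW hUY).isoPullback.hom, ?_⟩
  exact (isIso_pushoutSection_iff H hOW hVW hUY).mp
    (isIso_pushoutSection_of_isAffineOpen H hOW hVW hUY hW hO hV)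

lemma ideal_comap_top {X Y : Scheme.{0}} [IsAffine X] [IsAffine Y] (f : X ⟶ Y)
    (I : Y.IdealSheafData) : (I.comap f).ideal ⟨⊤, isAffineOpen_top X⟩ =
      (I.ideal ⟨⊤, isAffineOpen_top Y⟩).map f.appTop.hom := by
  apply le_antisymm
  · let J := Scheme.IdealSheafData.ofIdealTop ((I.ideal ⟨⊤, isAffineOpen_top Y⟩).map f.appTop.hom)
    have h1 : J.ideal ⟨⊤, isAffineOpen_top X⟩ =
        (I.ideal ⟨⊤, isAffineOpen_top Y⟩).map f.appTop.hom :=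
      Scheme.IdealSheafData.equivOfIsAffine.right_inv _
    have h2 : I.comap f ≤ J := by
      rw [← Scheme.IdealSheafData.le_map_iff_comap_le]
      refine Scheme.IdealSheafData.le_of_isAffine ?_
      rw [Scheme.IdealSheafData.ideal_map J f ⟨⊤, isAffineOpen_top Y⟩ (isAffineOpen_top X)]
      exact Ideal.map_le_iff_le_comap.mp h1.ge
    rw [← h1]
    exact h2 _
  · rw [Ideal.map_le_iff_le_comap]
    have := Scheme.IdealSheafData.le_map_comap (f := f) (J := I) ⟨⊤, isAffineOpen_top Y⟩
    rwa [Scheme.IdealSheafData.ideal_map _ f ⟨⊤, isAffineOpen_top Y⟩ (isAffineOpen_top X)] at this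

lemma ideal_comap_ι_top {Y : Scheme.{0}} (I : Y.IdealSheafData) (U : Y.affineOpens)
    [IsAffine U.1] : (I.comap U.1.ι).ideal ⟨⊤, isAffineOpen_top _⟩ =
      (I.ideal U).comap U.1.topIso.hom.hom := by
  rw [Scheme.IdealSheafData.ideal_comap_of_isOpenImmersion]
  have h : U.1.ι ''ᵁ ⊤ = U.1 := by simp
  have key : ∀ (V : Y.affineOpens) (e : V.1 = U.1),
      I.ideal V = (I.ideal U).comap (Y.presheaf.map (eqToHom e.symm).op).hom := by
    obtain ⟨U, hU⟩ := U
    rintro ⟨V, hV⟩ (rfl : V = U)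
    simp
  rw [key ⟨_, (isAffineOpen_top U.1.toScheme).image_of_isOpenImmersion U.1.ι⟩ h,
    Ideal.comap_comap, ← CommRingCat.hom_comp]
  congr 2
  rw [Scheme.Opens.ι_appIso]
  exact Category.id_comp _

lemma ideal_comap {X Y : Scheme.{0}} (f : X ⟶ Y) (I : Y.IdealSheafData) (U : Y.affineOpens)
    (V : X.affineOpens) (h : V.1 ≤ f ⁻¹ᵁ U.1) :
    (I.comap f).ideal V = (I.ideal U).map (f.appLE U.1 V.1 h).hom := by
  have i1 : IsAffine _ := U.2
  have i2 : IsAffine _ := V.2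
  have e := ideal_comap_top (f.resLE U.1 V.1 h) (I.comap U.1.ι)
  rw [← Scheme.IdealSheafData.comap_comp, Scheme.Hom.resLE_comp_ι,
    Scheme.IdealSheafData.comap_comp, ideal_comap_ι_top, ideal_comap_ι_top] at e
  have e2 := congrArg (Ideal.map V.1.topIso.hom.hom) e
  rw [Ideal.map_comap_of_surjective V.1.topIso.hom.hom
    V.1.topIso.commRingCatIsoToRingEquiv.surjective] at e2
  rw [e2, Ideal.map_map]
  have e3 : (I.ideal U).comap U.1.topIso.hom.hom = (I.ideal U).map U.1.topIso.inv.hom :=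
    
    (Ideal.map_symm (I := I.ideal U) U.1.topIso.commRingCatIsoToRingEquiv).symm
  rw [e3, Ideal.map_map, ← CommRingCat.hom_comp, ← CommRingCat.hom_comp]
  congr 2
  rw [Scheme.Hom.appTop, Scheme.Hom.resLE_app_top]
  simp only [Category.assoc, Iso.inv_hom_id_assoc, Iso.inv_hom_id, Category.comp_id]

lemma memIdeal_appLE {X Y : Scheme.{0}} (f : X ⟶ Y) (I : Y.IdealSheafData) {U : Y.affineOpens}
    {V : X.affineOpens} (h : V.1 ≤ f ⁻¹ᵁ U.1) {a : Γ(Y, U.1)} (ha : a ∈ I.ideal U) :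
    MemIdeal (I.comap f) ((f.appLE U.1 V.1 h).hom a) := by
  apply memIdeal_of_affine
  rw [ideal_comap f I U V h]
  exact Ideal.mem_map_of_mem _ ha

/-- A section of a morphism is a preimmersion. -/
lemma isPreimmersion_of_section {S B : Scheme.{0}} {q : S ⟶ B} {s : B ⟶ S} (hs : s ≫ q = 𝟙 _) :
    IsPreimmersion s := by
  have h1 : Function.LeftInverse q s := fun x => by
    rw [← Scheme.Hom.comp_apply, hs]; rfl
  have : IsPreimmersion (s ≫ q) := by rw [hs]; infer_instance
  have h2 : SurjectiveOnStalks (s ≫ q) := inferInstance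
  have : SurjectiveOnStalks s := SurjectiveOnStalks.of_comp s q
  exact { toSurjectiveOnStalks := this, isEmbedding := .of_leftInverse h1 q.continuous s.continuous }

end

section

/-! ### Charts of a family near a section, and their base changes -/

lemma constMap_comp {Y T T' : Scheme.{0}} (u : T' ⟶ T) (g : T ⟶ Y) (x : Γ(Y, ⊤)) :
    constMap u ⊤ (constMap g ⊤ x) = constMap (u ≫ g) ⊤ x := by
  rw [constMap, constMap, constMap, ← CommRingCat.comp_apply, Scheme.Hom.appLE_comp_appLE]

section BaseChange

variable {X S : Scheme.{0}} (f : X ⟶ S)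

/-- The base change of an open subset of `X`. -/
abbrev bc {T : Scheme.{0}} (t : T ⟶ S) (U : X.Opens) : (pullback f t).Opens := pullback.fst f t ⁻¹ᵁ U

/-- Base change of functions. -/
def bcFun {T : Scheme.{0}} (t : T ⟶ S) (U : X.Opens) : Γ(X, U) →+* Γ(pullback f t, bc f t U) :=
  ((pullback.fst f t).appLE U (bc f t U) le_rfl).hom

variable {T T' T'' : Scheme.{0}} {t : T ⟶ S} {t' : T' ⟶ S} {t'' : T'' ⟶ S}

lemma bcMap_fst (u : T' ⟶ T) (w : u ≫ t = t') :
    bcMap f u w ≫ pullback.fst f t = pullback.fst f t' := pullback.lift_fst _ _ _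

lemma bcMap_snd (u : T' ⟶ T) (w : u ≫ t = t') :
    bcMap f u w ≫ pullback.snd f t = pullback.snd f t' ≫ u := pullback.lift_snd _ _ _

lemma bcMap_comp (u : T' ⟶ T) (w : u ≫ t = t') (u' : T'' ⟶ T') (w' : u' ≫ t' = t'')
    (u'' : T'' ⟶ T) (h : u' ≫ u = u'') (w'' : u'' ≫ t = t'') :
    bcMap f u' w' ≫ bcMap f u w = bcMap f u'' w'' := by
  subst h
  apply pullback.hom_ext
  · rw [Category.assoc, bcMap_fst, bcMap_fst, bcMap_fst]
  · rw [Category.assoc, bcMap_snd, ← Category.assoc, bcMap_snd, bcMap_snd, Category.assoc]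

lemma bc_le (u : T' ⟶ T) (w : u ≫ t = t') (U : X.Opens) :
    bc f t' U ≤ bcMap f u w ⁻¹ᵁ bc f t U := by
  rw [← Scheme.Hom.comp_preimage, bcMap_fst]

lemma bc_mono {U V : X.Opens} (h : U ≤ V) : bc f t U ≤ bc f t V := fun _ hx => h hx

lemma isPullback_bcMap (u : T' ⟶ T) (w : u ≫ t = t') :
    IsPullback (bcMap f u w) (pullback.snd f t') (pullback.snd f t) u := by
  refine IsPullback.of_right ?_ (bcMap_snd f u w) (IsPullback.of_hasPullback f t)
  rw [bcMap_fst]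
  subst w
  exact IsPullback.of_hasPullback f _

/-- Pullback of functions along a change of the base. -/
def bcPull (u : T' ⟶ T) (w : u ≫ t = t') (U : X.Opens) :
    Γ(pullback f t, bc f t U) →+* Γ(pullback f t', bc f t' U) :=
  ((bcMap f u w).appLE _ _ (bc_le f u w U)).hom

lemma bcPull_comp (u : T' ⟶ T) (w : u ≫ t = t') (u' : T'' ⟶ T') (w' : u' ≫ t' = t'')
    (u'' : T'' ⟶ T) (h : u' ≫ u = u'') (w'' : u'' ≫ t = t'') (U : X.Opens) (a) :
    bcPull f u' w' U (bcPull f u w U a) = bcPull f u'' w'' U a := by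
  rw [bcPull, bcPull, bcPull, ← CommRingCat.comp_apply, Scheme.Hom.appLE_comp_appLE]
  simp only [bcMap_comp f u w u' w' u'' h w'']

lemma bcPull_bcFun (u : T' ⟶ T) (w : u ≫ t = t') (U : X.Opens) (a : Γ(X, U)) :
    bcPull f u w U (bcFun f t U a) = bcFun f t' U a := by
  rw [bcPull, bcFun, bcFun, ← CommRingCat.comp_apply, Scheme.Hom.appLE_comp_appLE]
  simp only [bcMap_fst f u w]

lemma resO_bcPull (u : T' ⟶ T) (w : u ≫ t = t') {U V : X.Opens} (h : V ≤ U) (a) :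
    resO (bc_mono f h) (bcPull f u w U a) = bcPull f u w V (resO (bc_mono f h) a) :=
  (appLE_resO (bcMap f u w) (bc_le f u w U) (bc_le f u w V) (bc_mono f h) (bc_mono f h) a).symm

lemma resO_bcFun {U V : X.Opens} (h : V ≤ U) (a : Γ(X, U)) :
    resO (bc_mono f h) (bcFun f t U a) = bcFun f t V (resO h a) :=
  (appLE_resO (pullback.fst f t) le_rfl le_rfl h (bc_mono f h) a).symm

lemma bcPull_constMap [IsAffine T] [IsAffine T'] (u : T' ⟶ T) (w : u ≫ t = t') (U : X.Opens) (x : Γ(T, ⊤)) :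
    bcPull f u w U (constMap (pullback.snd f t) _ x) =
      constMap (pullback.snd f t') _ (constMap u ⊤ x) :=
  appLE_constMap (bcMap_snd f u w) _ x

end BaseChange

/-! ### Pushouts along surjections -/

lemma surjective_of_isPushout {Λ A Λ' A' : CommRingCat.{0}} {f : Λ ⟶ A} {g : Λ ⟶ Λ'} {g' : A ⟶ A'}
    {f' : Λ' ⟶ A'} (hp : IsPushout f g g' f') (hg : Function.Surjective g.hom) :
    Function.Surjective g'.hom := by
  algebraize [f.hom, g.hom, g'.hom, f'.hom, g'.hom.comp f.hom]
  have : IsScalarTower Λ Λ' A' := .of_algebraMap_eq fun x => congr($(hp.w) x)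
  have : Algebra.IsPushout Λ A Λ' A' := CommRingCat.isPushout_iff_isPushout.mp hp
  have : Algebra.IsPushout Λ Λ' A A' := Algebra.IsPushout.symm inferInstance
  exact RingHom.surjective_isStableUnderBaseChange Λ Λ' A A' hg

lemma ker_of_isPushout {Λ A Λ' A' : CommRingCat.{0}} {f : Λ ⟶ A} {g : Λ ⟶ Λ'} {g' : A ⟶ A'}
    {f' : Λ' ⟶ A'} (hp : IsPushout f g g' f') (hg : Function.Surjective g.hom) :
    RingHom.ker g'.hom = (RingHom.ker g.hom).map f.hom := by
  set J := (RingHom.ker g.hom).map f.hom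
  apply le_antisymm
  · have h1 : ∀ x, g.hom x = 0 → (Ideal.Quotient.mk J).comp f.hom x = 0 := fun x hx =>
      Ideal.Quotient.eq_zero_iff_mem.mpr (Ideal.mem_map_of_mem _ hx)
    let l : Λ' →+* A ⧸ J := RingHom.liftOfSurjective g.hom hg ⟨(Ideal.Quotient.mk J).comp f.hom, h1⟩
    have hl : ∀ x, l (g.hom x) = Ideal.Quotient.mk J (f.hom x) := fun x =>
      RingHom.liftOfRightInverse_comp_apply _ _ _ _ x
    let d := hp.desc (CommRingCat.ofHom (Ideal.Quotient.mk J)) (CommRingCat.ofHom l)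
      (by ext x; exact (hl x).symm)
    intro a ha
    have h2 : d.hom (g'.hom a) = Ideal.Quotient.mk J a :=
      congr($(hp.inl_desc (CommRingCat.ofHom (Ideal.Quotient.mk J)) (CommRingCat.ofHom l)
        (by ext x; exact (hl x).symm)) a)
    rw [RingHom.mem_ker.mp ha, map_zero] at h2
    exact Ideal.Quotient.eq_zero_iff_mem.mp h2.symm
  · rw [Ideal.map_le_iff_le_comap]
    intro x hx
    have := congr($(hp.w) x)
    rw [Ideal.mem_comap, RingHom.mem_ker]
    refine this.trans ?_
    rw [CommRingCat.comp_apply, RingHom.mem_ker.mp hx, map_zero]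

/-! ### Charts -/

variable {X S B : Scheme.{0}} (f : X ⟶ S) {ι : Type} (D : ι → X.IdealSheafData)
  (q : S ⟶ B) (s : B ⟶ S)

/-- An affine open subset of `X` with étale coordinates over an affine open subset of `S` such that
each of the `D i` is empty or cut out by a coordinate; its projection to `B` is contained in an
affine open set that the section `s` maps to the open subset of `S`. -/
structure BaseChart where
  V : X.Opens
  affine : IsAffineOpen V
  W : S.Opens
  affineW : IsAffineOpen W
  le : V ≤ f ⁻¹ᵁ W
  O : B.Opens
  affineO : IsAffineOpen O
  O_le : O ≤ s ⁻¹ᵁ W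
  le_O : V ≤ f ⁻¹ᵁ q ⁻¹ᵁ O
  n : ℕ
  c : Fin n → Γ(X, V)
  w : Fin n → ℕ
  w_eq : ∀ k, w k = 0 ∨ w k = 1
  etale : EtaleCoords (f.appLE W V le).hom c
  log : ∀ k, w k = 1 → ∃ i, (D i).ideal ⟨V, affine⟩ = Ideal.span {c k}
  ideal : ∀ i, (D i).ideal ⟨V, affine⟩ = ⊤ ∨
    ∃ k, w k = 1 ∧ (D i).ideal ⟨V, affine⟩ = Ideal.span {c k}

/-- A morphism to `S` that set-theoretically factors through the section `s`. -/
def OnSection {T : Scheme.{0}} (t : T ⟶ S) : Prop := ∀ x, t x = s (q (t x))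

lemma OnSection.comp {T T' : Scheme.{0}} {t : T ⟶ S} {t' : T' ⟶ S} {q : S ⟶ B} {s : B ⟶ S}
    (h : OnSection q s t) (u : T' ⟶ T) (w : u ≫ t = t') : OnSection q s t' := fun x => by
  rw [← w]
  exact h (u x)

lemma onSection_self {q : S ⟶ B} {s : B ⟶ S} (hs : s ≫ q = 𝟙 _) : OnSection q s s := fun x => by
  rw [← Scheme.Hom.comp_apply s q, hs]; rfl

namespace BaseChart

variable {f D q s} [IsAffine B] (ch : BaseChart f D q s) {T : Scheme.{0}} [IsAffine T] {t : T ⟶ S}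
  (ht : OnSection q s t)

lemma isPushout {U : X.Opens} (hU : U ≤ ch.V) (hUa : IsAffineOpen U) (ht : OnSection q s t) :
    IsAffineOpen (bc f t U) ∧ ∃ (O : T.Opens) (_ : IsAffineOpen O) (h : O ≤ t ⁻¹ᵁ ch.W)
      (h' : bc f t U ≤ pullback.snd f t ⁻¹ᵁ O),
      IsPushout (f.appLE ch.W U (hU.trans ch.le)) (t.appLE ch.W O h)
        ((pullback.fst f t).appLE U (bc f t U) le_rfl)
        ((pullback.snd f t).appLE O (bc f t U) h') := by
  let O := (t ≫ q) ⁻¹ᵁ ch.O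
  have hO : IsAffineOpen O := ch.affineO.preimage (t ≫ q)
  have h : O ≤ t ⁻¹ᵁ ch.W := fun x hx => by
    change t x ∈ ch.W
    rw [ht x]
    exact ch.O_le hx
  have h' : bc f t U ≤ pullback.snd f t ⁻¹ᵁ O := by
    have e : pullback.snd f t ⁻¹ᵁ O = pullback.fst f t ⁻¹ᵁ f ⁻¹ᵁ q ⁻¹ᵁ ch.O := by
      simp only [O, ← Scheme.Hom.comp_preimage, ← Category.assoc, pullback.condition]
    rw [e]
    exact fun x hx => ch.le_O (hU hx)
  have := isAffineOpen_of_isPullback (IsPullback.of_hasPullback f t) ch.affineW hUa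
    (hU.trans ch.le) hO h h'
  exact ⟨this.1, O, hO, h, h', this.2⟩

lemma isAffineOpen_bc {U : X.Opens} (hU : U ≤ ch.V) (hUa : IsAffineOpen U)
    (ht : OnSection q s t) : IsAffineOpen (bc f t U) := (ch.isPushout hU hUa ht).1

/-- The base change of a chart. -/
def logChart (ht : OnSection q s t) :
    LogChart (pullback.snd f t) (fun i => (D i).comap (pullback.fst f t)) ch.n where
  V := bc f t ch.V
  affine := ch.isAffineOpen_bc le_rfl ch.affine ht
  c k := bcFun f t ch.V (ch.c k)
  w := ch.w
  w_eq := ch.w_eq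
  etale := by
    obtain ⟨-, O, hO, h, h', hp⟩ := ch.isPushout le_rfl ch.affine ht
    have := (EtaleCoords.of_isPushout hp ch.etale).of_base _
      (etale_resO (le_top : O ≤ ⊤) (isAffineOpen_top T) hO)
    convert this using 1
    · ext a
      change _ = ((pullback.snd f t).appLE O _ h').hom (resO le_top a)
      rw [appLE_resO _ (le_preimage_top _ _) h' le_top le_rfl, resO_self]
      rfl
    · rfl
  log k hk := by
    obtain ⟨i, hi⟩ := ch.log k hk
    refine ⟨i, ?_⟩
    rw [ideal_comap _ _ ⟨ch.V, ch.affine⟩ _ le_rfl, hi, Ideal.map_span, Set.image_singleton]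
    rfl
  ideal i := by
    rw [ideal_comap _ _ ⟨ch.V, ch.affine⟩ _ le_rfl]
    rcases ch.ideal i with h | ⟨k, hk, h⟩
    · left; rw [h, Ideal.map_top]
    · right; refine ⟨k, hk, ?_⟩
      rw [h, Ideal.map_span, Set.image_singleton]
      rfl

variable {T' : Scheme.{0}} [IsAffine T'] {t' : T' ⟶ S}

lemma logChart_isPullback (ht : OnSection q s t) (ht' : OnSection q s t') (u : T' ⟶ T)
    (w : u ≫ t = t') : (ch.logChart ht).IsPullback (bcMap f u w) (ch.logChart ht') where
  le := bc_le f u w ch.V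
  w := rfl
  c k := (bcPull_bcFun f u w ch.V (ch.c k)).symm

lemma isPushout_bcPull {U : X.Opens} (hU : U ≤ ch.V) (hUa : IsAffineOpen U)
    (ht : OnSection q s t) (u : T' ⟶ T) (w : u ≫ t = t') :
    IsPushout (CommRingCat.ofHom (constMap (pullback.snd f t) (bc f t U)))
      (CommRingCat.ofHom (constMap u ⊤))
      (CommRingCat.ofHom (bcPull f u w U))
      (CommRingCat.ofHom (constMap (pullback.snd f t') (bc f t' U))) := by
  have e : bcMap f u w ⁻¹ᵁ bc f t U = bc f t' U := by
    rw [← Scheme.Hom.comp_preimage, bcMap_fst]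
  have := (isAffineOpen_of_isPullback (isPullback_bcMap f u w) (isAffineOpen_top T)
    (ch.isAffineOpen_bc hU hUa ht) (le_preimage_top _ _) (isAffineOpen_top T') le_top
    (le_preimage_top _ _)).2
  have key : ∀ (V : (pullback f t').Opens) (hV : V = bcMap f u w ⁻¹ᵁ bc f t U),
      IsPushout ((pullback.snd f t).appLE ⊤ (bc f t U) (le_preimage_top _ _)) (u.appLE ⊤ ⊤ le_top)
        ((bcMap f u w).appLE (bc f t U) V hV.le)
        ((pullback.snd f t').appLE ⊤ V (le_preimage_top _ _)) := by
    rintro V rfl; exact this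
  exact key _ e.symm

end BaseChart

end

section

/-! ### Gluing functions on base changes -/

section Glue

variable {X S : Scheme.{0}} (f : X ⟶ S) {T : Scheme.{0}} {t : T ⟶ S}

lemma bc_ext {W : X.Opens} {a b : Γ(pullback f t, bc f t W)}
    (h : ∀ (U : X.Opens) (hU : U ≤ W), IsAffineOpen U →
      resO (bc_mono f hU) a = resO (bc_mono f hU) b) : a = b := by
  refine resO_ext fun x hx => ?_
  obtain ⟨U, hUa, hUW, hxU⟩ := exists_affine_mem (U := W) (x := pullback.fst f t x) hx
  exact ⟨bc f t U, bc_mono f hUW, hxU, h U hUW hUa⟩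

lemma exists_bc_glue {W : X.Opens}
    (g : ∀ U : X.Opens, U ≤ W → IsAffineOpen U → Γ(pullback f t, bc f t U))
    (hg : ∀ (U V : X.Opens) (hU : U ≤ W) (hUa : IsAffineOpen U) (hV : V ≤ U)
      (hVa : IsAffineOpen V), resO (bc_mono f hV) (g U hU hUa) = g V (hV.trans hU) hVa) :
    ∃ a : Γ(pullback f t, bc f t W), ∀ (U : X.Opens) (hU : U ≤ W) (hUa : IsAffineOpen U),
      resO (bc_mono f hU) a = g U hU hUa := by
  refine (exists_of_locally (U := bc f t W) (fun V hV a => ∀ (U : X.Opens) (hU : U ≤ W)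
    (hUa : IsAffineOpen U) (O : (pullback f t).Opens) (hO : O ≤ V) (hOU : O ≤ bc f t U),
    resO hO a = resO hOU (g U hU hUa)) ?_ ?_ ?_ ?_).imp fun a ha U hU hUa => ?_
  · intro V V' hV hV' a ha U hU hUa O hO hOU
    rw [resO_resO]
    exact ha U hU hUa O _ hOU
  · intro V hV a b ha hb
    refine resO_ext fun x hx => ?_
    obtain ⟨U, hUa, hUW, hxU⟩ := exists_affine_mem (U := W) (x := pullback.fst f t x) (hV hx)
    refine ⟨V ⊓ bc f t U, inf_le_left, ⟨hx, hxU⟩, ?_⟩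
    rw [ha U hUW hUa _ _ inf_le_right, hb U hUW hUa _ _ inf_le_right]
  · intro x hx
    obtain ⟨U, hUa, hUW, hxU⟩ := exists_affine_mem (U := W) (x := pullback.fst f t x) hx
    refine ⟨bc f t U, bc_mono f hUW, hxU, g U hUW hUa, fun U' hU' hUa' O hO hOU => ?_⟩
    refine resO_ext fun y hy => ?_
    obtain ⟨U₁, hUa₁, hU₁, hyU₁⟩ := exists_affine_mem (U := U ⊓ U') (x := pullback.fst f t y)
      ⟨hO hy, hOU hy⟩
    refine ⟨O ⊓ bc f t U₁, inf_le_left, ⟨hy, hyU₁⟩, ?_⟩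
    have e1 := hg U U₁ hUW hUa (hU₁.trans inf_le_left) hUa₁
    have e2 := hg U' U₁ hU' hUa' (hU₁.trans inf_le_right) hUa₁
    have e3 := congr(resO (inf_le_right : O ⊓ bc f t U₁ ≤ bc f t U₁) $(e1.trans e2.symm))
    simpa only [resO_resO] using e3
  · intro a ha U hU hUa O hO hOU
    refine resO_ext fun y hy => ?_
    obtain ⟨V, hV, hyV, e⟩ := ha y (hO hy)
    refine ⟨O ⊓ V, inf_le_left, ⟨hy, hyV⟩, ?_⟩
    have := e U hU hUa (O ⊓ V) inf_le_right (inf_le_left.trans hOU)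
    simpa only [resO_resO] using this
  · simpa only [resO_self] using ha U hU hUa (bc f t U) (bc_mono f hU) le_rfl

end Glue

/-! ### Retractions onto the central fibre -/

variable {X S B : Scheme.{0}} {f : X ⟶ S} {ι : Type} {D : ι → X.IdealSheafData}
  {q : S ⟶ B} {s : B ⟶ S}

/-- `i : T₀ ⟶ T` is a nilpotent thickening and the restriction of `t : T ⟶ S` to `T₀` factors
through the section `s`. -/
structure Thickening (q : S ⟶ B) (s : B ⟶ S) {T₀ T : Scheme.{0}} (i : T₀ ⟶ T) (t : T ⟶ S) :
    Prop where
  on : OnSection q s t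
  fac : (i ≫ t ≫ q) ≫ s = i ≫ t
  surj : Function.Surjective (constMap i ⊤)
  nil : IsNilpotent (RingHom.ker (constMap i ⊤))

namespace BaseChart

variable [IsAffine B] (ch : BaseChart f D q s) {T T₀ : Scheme.{0}} [IsAffine T] [IsAffine T₀]
  {t : T ⟶ S} {i : T₀ ⟶ T} (th : Thickening q s i t) (hs : s ≫ q = 𝟙 _)

lemma le_logChart (ht : OnSection q s t) {U : X.Opens} (hU : U ≤ ch.V) :
    bc f t U ≤ (ch.logChart ht).V := bc_mono f hU

/-- The coordinates on the base change of an open subset. -/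
abbrev coord (ht : OnSection q s t) {U : X.Opens} (hU : U ≤ ch.V) (k : Fin ch.n) :
    Γ(pullback f t, bc f t U) := (ch.logChart ht).coord (ch.le_logChart ht hU) k

lemma etaleCoords (ht : OnSection q s t) {U : X.Opens} (hU : U ≤ ch.V) (hUa : IsAffineOpen U) :
    EtaleCoords (constMap (pullback.snd f t) (bc f t U)) (ch.coord ht hU) :=
  (ch.logChart ht).etaleCoords (ch.le_logChart ht hU) (ch.isAffineOpen_bc hU hUa ht)

lemma bcPull_coord {T' : Scheme.{0}} [IsAffine T'] {t' : T' ⟶ S} (ht : OnSection q s t)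
    (ht' : OnSection q s t') (u : T' ⟶ T) (w : u ≫ t = t') {U : X.Opens} (hU : U ≤ ch.V)
    (k : Fin ch.n) : bcPull f u w U (ch.coord ht hU k) = ch.coord ht' hU k := by
  change bcPull f u w U (resO _ (bcFun f t ch.V (ch.c k))) = resO _ (bcFun f t' ch.V (ch.c k))
  rw [← resO_bcPull f u w hU, bcPull_bcFun]

lemma bcPull_surjective (th : Thickening q s i t) {U : X.Opens} (hU : U ≤ ch.V)
    (hUa : IsAffineOpen U) : Function.Surjective (bcPull f i rfl U : Γ(pullback f t, bc f t U) →+* _) :=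
  surjective_of_isPushout (ch.isPushout_bcPull hU hUa th.on i rfl) th.surj

lemma ker_bcPull (th : Thickening q s i t) {U : X.Opens} (hU : U ≤ ch.V)
    (hUa : IsAffineOpen U) : RingHom.ker (bcPull f i rfl U : Γ(pullback f t, bc f t U) →+* _) =
      (RingHom.ker (constMap i ⊤)).map (constMap (pullback.snd f t) (bc f t U)) :=
  ker_of_isPushout (ch.isPushout_bcPull hU hUa th.on i rfl) th.surj

lemma isNilpotent_ker_bcPull (th : Thickening q s i t) {U : X.Opens} (hU : U ≤ ch.V)
    (hUa : IsAffineOpen U) :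
    IsNilpotent (RingHom.ker (bcPull f i rfl U : Γ(pullback f t, bc f t U) →+* _)) := by
  obtain ⟨N, hN⟩ := th.nil
  refine ⟨N, ?_⟩
  rw [ch.ker_bcPull th hU hUa, ← Ideal.map_pow, hN, Ideal.zero_eq_bot, Ideal.map_bot,
    Ideal.zero_eq_bot]

lemma exists_phi (hs : s ≫ q = 𝟙 _) {U : X.Opens} (hU : U ≤ ch.V) (hUa : IsAffineOpen U) :
    ∃ φ : Γ(pullback f s, bc f s U) →+* Γ(pullback f t, bc f t U),
      (∀ x : Γ(B, ⊤), φ (constMap (pullback.snd f s) _ x) =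
        constMap (pullback.snd f t) _ (constMap (t ≫ q) ⊤ x)) ∧
      (∀ k, φ (ch.coord (onSection_self hs) hU k) = ch.coord th.on hU k) ∧
      ∀ a, bcPull f i rfl U (φ a) = bcPull f (i ≫ t ≫ q) th.fac U a := by
  have on₀ : OnSection q s (i ≫ t) := th.on.comp i rfl
  refine (ch.etaleCoords (onSection_self hs) hU hUa).exists_lift (bcPull f i rfl U)
    (ch.bcPull_surjective th hU hUa) (ch.isNilpotent_ker_bcPull th hU hUa)
    (bcPull f (i ≫ t ≫ q) th.fac U)
    ((constMap (pullback.snd f t) _).comp (constMap (t ≫ q) ⊤)) _ (fun x => ?_) fun k => ?_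
  · rw [RingHom.comp_apply, bcPull_constMap, bcPull_constMap, constMap_comp]
  · rw [ch.bcPull_coord th.on on₀, ch.bcPull_coord (onSection_self hs) on₀]

/-- The retraction onto the central fibre that fixes the coordinates, on functions. -/
def phi {U : X.Opens} (hU : U ≤ ch.V) (hUa : IsAffineOpen U) :
    Γ(pullback f s, bc f s U) →+* Γ(pullback f t, bc f t U) := (ch.exists_phi th hs hU hUa).choose

lemma phi_constMap {U : X.Opens} (hU : U ≤ ch.V) (hUa : IsAffineOpen U) (x : Γ(B, ⊤)) :
    ch.phi th hs hU hUa (constMap (pullback.snd f s) _ x) =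
      constMap (pullback.snd f t) _ (constMap (t ≫ q) ⊤ x) :=
  (ch.exists_phi th hs hU hUa).choose_spec.1 x

lemma phi_coord {U : X.Opens} (hU : U ≤ ch.V) (hUa : IsAffineOpen U) (k : Fin ch.n) :
    ch.phi th hs hU hUa (ch.coord (onSection_self hs) hU k) = ch.coord th.on hU k :=
  (ch.exists_phi th hs hU hUa).choose_spec.2.1 k

lemma bcPull_phi_zero {U : X.Opens} (hU : U ≤ ch.V) (hUa : IsAffineOpen U) (a) :
    bcPull f i rfl U (ch.phi th hs hU hUa a) = bcPull f (i ≫ t ≫ q) th.fac U a :=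
  (ch.exists_phi th hs hU hUa).choose_spec.2.2 a

lemma resO_phi {U V : X.Opens} (hU : U ≤ ch.V) (hUa : IsAffineOpen U) (hV : V ≤ U)
    (hVa : IsAffineOpen V) (a) : resO (bc_mono f hV) (ch.phi th hs hU hUa a) =
      ch.phi th hs (hV.trans hU) hVa (resO (bc_mono f hV) a) := by
  refine DFunLike.congr_fun ((ch.etaleCoords (onSection_self hs) hU hUa).hom_ext
    (bcPull f i rfl V) (ch.isNilpotent_ker_bcPull th (hV.trans hU) hVa)
    ((resO (bc_mono f hV)).comp (ch.phi th hs hU hUa))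
    ((ch.phi th hs (hV.trans hU) hVa).comp (resO (bc_mono f hV))) (fun x => ?_) (fun k => ?_)
    fun a => ?_) a
  · rw [RingHom.comp_apply, RingHom.comp_apply, phi_constMap, resO_constMap, resO_constMap,
      phi_constMap]
  · rw [RingHom.comp_apply, RingHom.comp_apply, phi_coord]
    erw [LogChart.resO_coord, LogChart.resO_coord]
    exact (ch.phi_coord th hs (hV.trans hU) hVa k).symm
  · rw [RingHom.comp_apply, RingHom.comp_apply, ← resO_bcPull f i rfl hV, bcPull_phi_zero, bcPull_phi_zero,
      resO_bcPull f (i ≫ t ≫ q) th.fac hV]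

variable {T' T₀' : Scheme.{0}} [IsAffine T'] [IsAffine T₀'] {t' : T' ⟶ S} {i' : T₀' ⟶ T'}
  (th' : Thickening q s i' t')

lemma bcPull_phi (u : T' ⟶ T) (w : u ≫ t = t') (u₀ : T₀' ⟶ T₀) (hu : u₀ ≫ i = i' ≫ u)
    {U : X.Opens} (hU : U ≤ ch.V) (hUa : IsAffineOpen U) (a) :
    bcPull f u w U (ch.phi th hs hU hUa a) = ch.phi th' hs hU hUa a := by
  refine DFunLike.congr_fun ((ch.etaleCoords (onSection_self hs) hU hUa).hom_ext
    (bcPull f i' rfl U) (ch.isNilpotent_ker_bcPull th' hU hUa)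
    ((bcPull f u w U).comp (ch.phi th hs hU hUa)) (ch.phi th' hs hU hUa) (fun x => ?_)
    (fun k => ?_) fun a => ?_) a
  · rw [RingHom.comp_apply, phi_constMap, phi_constMap, bcPull_constMap, constMap_comp]
    subst w
    simp only [Category.assoc]
  · rw [RingHom.comp_apply, phi_coord, phi_coord, ch.bcPull_coord th.on th'.on]
  · have w1 : (i' ≫ u) ≫ t = i' ≫ t' := by rw [Category.assoc, w]
    have w2 : u₀ ≫ i ≫ t = i' ≫ t' := by rw [← Category.assoc, hu, w1]
    rw [RingHom.comp_apply, bcPull_comp f u w i' rfl (i' ≫ u) rfl w1,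
      ← bcPull_comp f i rfl u₀ w2 (i' ≫ u) hu w1, bcPull_phi_zero, bcPull_phi_zero,
      bcPull_comp f (i ≫ t ≫ q) th.fac u₀ w2 (i' ≫ t' ≫ q) _ th'.fac]
    rw [← Category.assoc, hu, Category.assoc, ← w, Category.assoc]

lemma memIdeal_phi {U : X.Opens} (hU : U ≤ ch.V) (hUa : IsAffineOpen U) (l : ι) {a}
    (ha : MemIdeal ((D l).comap (pullback.fst f s)) a) :
    MemIdeal ((D l).comap (pullback.fst f t)) (ch.phi th hs hU hUa a) := by
  refine memIdeal_of_affine (V := ⟨_, ch.isAffineOpen_bc hU hUa th.on⟩) ?_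
  have ha' := ha ⟨_, ch.isAffineOpen_bc hU hUa (onSection_self hs)⟩ le_rfl
  rw [resO_self, ideal_comap _ _ ⟨U, hUa⟩ _ le_rfl] at ha'
  rw [ideal_comap _ _ ⟨U, hUa⟩ _ le_rfl]
  rw [← (D l).map_ideal (U := ⟨U, hUa⟩) (V := ⟨ch.V, ch.affine⟩) hU] at ha' ⊢
  rcases ch.ideal l with h | ⟨k, -, h⟩
  · rw [h, Ideal.map_top, Ideal.map_top]; trivial
  · rw [h, Ideal.map_span, Ideal.map_span, Set.image_singleton, Set.image_singleton,
      Ideal.mem_span_singleton] at ha' ⊢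
    obtain ⟨b, rfl⟩ := ha'
    refine ⟨ch.phi th hs hU hUa b, ?_⟩
    have h1 : ∀ {T : Scheme.{0}} [IsAffine T] {t : T ⟶ S} (ht : OnSection q s t),
        bcFun f t U (resO hU (ch.c k)) = ch.coord ht hU k := fun {T} _ t ht =>
      (resO_bcFun f hU (ch.c k)).symm
    change ch.phi th hs hU hUa (bcFun f s U (resO hU (ch.c k)) * b) =
      bcFun f t U (resO hU (ch.c k)) * _
    rw [map_mul, h1 (onSection_self hs), h1 th.on, phi_coord]

lemma memIdeal_coord (ht : OnSection q s t) {U : X.Opens} (hU : U ≤ ch.V) (k : Fin ch.n) (l : ι)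
    (hl : (D l).ideal ⟨ch.V, ch.affine⟩ = Ideal.span {ch.c k}) :
    MemIdeal ((D l).comap (pullback.fst f t)) (ch.coord ht hU k) := by
  refine MemIdeal.res (bc_mono f hU) ?_
  refine memIdeal_appLE (pullback.fst f t) (D l) (U := ⟨ch.V, ch.affine⟩)
    (V := ⟨_, ch.isAffineOpen_bc le_rfl ch.affine ht⟩) le_rfl ?_
  rw [hl]
  exact Ideal.mem_span_singleton_self _

end BaseChart

end

section

/-! ### Extension of Euler derivations -/

section EulerExtension

variable {Λ A : Type} [CommRing Λ] [CommRing A] {n : ℕ}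

lemma isNilpotent_ker_of_mul_eq_zero (π : Λ →+* A) (h : ∀ x y, π x = 0 → π y = 0 → x * y = 0) :
    IsNilpotent (RingHom.ker π) :=
  ⟨2, by
    rw [Ideal.zero_eq_bot, eq_bot_iff, sq, Ideal.mul_le]
    exact fun x hx y hy => h x y hx hy⟩

lemma EtaleCoords.exists_extension {g : Λ →+* A} {c : Fin n → A} (h : EtaleCoords g c)
    (ε : Λ →+ Λ) (hε : ∀ a b, ε (a * b) = a * ε b + b * ε a) :
    ∃ d : A →+ A, (∀ a b, d (a * b) = a * d b + b * d a) ∧ (∀ x, d (g x) = g (ε x)) ∧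
      ∀ k, d (c k) = 0 := by
  have h1 : ε 1 = 0 := by simpa using hε 1 1
  let π : TrivSqZeroExt A A →+* A := (TrivSqZeroExt.fstHom A A A).toRingHom
  let β : Λ →+* TrivSqZeroExt A A :=
    { toFun := fun x => TrivSqZeroExt.inl (g x) + TrivSqZeroExt.inr (g (ε x))
      map_one' := by ext <;> simp [h1]
      map_zero' := by ext <;> simp
      map_add' := fun x y => by ext <;> simp
      map_mul' := fun x y => by
        ext
        · simp
        · simp [hε]; ring }
  have hπ : IsNilpotent (RingHom.ker π) := by
    refine isNilpotent_ker_of_mul_eq_zero π fun x y hx hy => ?_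
    have hx' : x.fst = 0 := hx
    have hy' : y.fst = 0 := hy
    ext <;> simp [hx', hy']
  obtain ⟨φ, hφ1, hφ2, hφ3⟩ := h.exists_lift π (fun a => ⟨TrivSqZeroExt.inl a, rfl⟩) hπ
    (RingHom.id A) β (fun k => TrivSqZeroExt.inl (c k)) (fun x => by simp [π, β]) fun k => rfl
  have hφ3' : ∀ a, (φ a).fst = a := hφ3
  refine ⟨AddMonoidHom.mk' (fun a => (φ a).snd) fun a b => by simp, fun a b => ?_, fun x => ?_,
    fun k => ?_⟩
  · simp [hφ3', mul_comm]
  · change (φ (g x)).snd = _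
    rw [hφ1]; simp [β]
  · change (φ (c k)).snd = _
    rw [hφ2]; rfl

lemma EtaleCoords.exists_eulerFiltration {g : Λ →+* A} {c : Fin n → A} (h : EtaleCoords g c)
    (Φ : EulerFiltration Λ) (h1 : ∀ x, Φ.ε x ∈ Φ.F 1) :
    ∃ Ψ : EulerFiltration A, (∀ m, Ψ.F m = (Φ.F m).map g) ∧ (∀ x, Ψ.ε (g x) = g (Φ.ε x)) ∧
      (∀ k, Ψ.ε (c k) = 0) ∧ ∀ a, Ψ.ε a ∈ Ψ.F 1 := by
  obtain ⟨d, hd1, hd2, hd3⟩ := h.exists_extension Φ.ε Φ.leibniz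
  have hd : ∀ a, d a ∈ (Φ.F 1).map g := by
    let J := (Φ.F 1).map g
    have : (Ideal.Quotient.mk J).toAddMonoidHom.comp d = 0 := by
      refine h.derivation_ext (Ideal.Quotient.mk J) _ _ (fun a b => by simp [hd1]) (by simp)
        (fun x => ?_) fun k => by simp [hd3]
      change Ideal.Quotient.mk J (d (g x)) = 0
      rw [hd2]
      exact Ideal.Quotient.eq_zero_iff_mem.mpr (Ideal.mem_map_of_mem _ (h1 x))
    intro a
    exact Ideal.Quotient.eq_zero_iff_mem.mp congr($this a)
  have hmul : ∀ m l, (Φ.F m).map g * (Φ.F l).map g ≤ (Φ.F (m + l)).map g := fun m l => by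
    rw [← Ideal.map_mul]
    refine Ideal.map_mono (Ideal.mul_le.mpr fun a ha b hb => Φ.mul m l a b ha hb)
  refine ⟨⟨fun m => (Φ.F m).map g, fun m l a b ha hb => hmul m l (Ideal.mul_mem_mul ha hb), Φ.bound,
    fun m hm => by rw [Φ.eq_bot m hm, Ideal.map_bot], d, hd1, fun m a ha => ?_⟩, fun m => rfl, hd2,
    hd3, hd⟩
  induction ha using Submodule.span_induction with
  | mem x hx =>
    obtain ⟨y, hy, rfl⟩ := hx
    rw [hd2]
    have := Ideal.mem_map_of_mem g (Φ.euler m y hy)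
    simpa using this
  | zero => simp
  | add x y _ _ hx hy =>
    have := Ideal.add_mem _ hx hy
    rw [map_add, mul_add]
    convert this using 1; ring
  | smul a x hx ih =>
    rw [smul_eq_mul, hd1]
    have h2 := hmul m 1 (Ideal.mul_mem_mul hx (hd a))
    have := Ideal.add_mem _ (Ideal.mul_mem_left _ a ih) h2
    convert this using 1; ring

end EulerExtension

/-! ### Bundles on affine charts -/

/-- A module with an integrable connection, coordinates and a frame. -/
structure LocalBundle (B E : Type) [CommRing B] [AddCommGroup E] [Module B E] (n r : ℕ) where
  c : Fin n → B
  w : Fin n → ℕ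
  w_eq : ∀ k, w k = 0 ∨ w k = 1
  D : Fin n → B →+ B
  D_c : ∀ k l, D k (c l) = if l = k then c l ^ w l else 0
  D_mul : ∀ k a b, D k (a * b) = a * D k b + b * D k a
  nabla : Fin n → E →+ E
  leibniz : ∀ k (a : B) (e : E), nabla k (a • e) = D k a • e + a • nabla k e
  comm : ∀ k l e, nabla k (nabla l e) = nabla l (nabla k e)
  κ : E →+ (Fin r → B)
  κ_smul : ∀ (a : B) e, κ (a • e) = a • κ e
  frame : Fin r → E
  κ_frame : ∀ l, κ (frame l) = Pi.single l 1
  sum_frame : ∀ e, ∑ l, κ e l • frame l = e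

lemma IterDer.map_N {E E' : Type} [AddCommGroup E] [AddCommGroup E'] {n : ℕ}
    {nabla : Fin n → E →+ E} {nabla' : Fin n → E' →+ E'} {w : Fin n → ℕ} (P : IterDer nabla w)
    (P' : IterDer nabla' w) (ρ : E →+ E') (h : ∀ k e, ρ (nabla k e) = nabla' k (ρ e))
    (K : Fin n → ℕ) (e : E) : ρ (P.N K e) = P'.N K (ρ e) := by
  induction hm : ∑ k, K k generalizing K with
  | zero =>
    have : K = 0 := by
      ext k
      simpa using (Finset.sum_eq_zero_iff.mp hm) k (Finset.mem_univ k)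
    rw [this, P.N_zero, P'.N_zero]
  | succ m ih =>
    obtain ⟨k, hk⟩ : ∃ k, K k ≠ 0 := by
      by_contra! hc
      simp [hc] at hm
    have e0 : K - Pi.single k 1 + Pi.single k 1 = K := by
      ext j
      by_cases hj : j = k
      · subst hj; simp; omega
      · simp [hj]
    have h0 : ∑ j, (K - Pi.single k 1 : Fin n → ℕ) j = m := by
      have := congrArg (fun L : Fin n → ℕ => ∑ j, L j) e0
      simp only [Pi.add_apply, Finset.sum_add_distrib, hm, Finset.sum_pi_single', Finset.mem_univ,
        if_true] at this
      omega
    set L := K - Pi.single k 1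
    have h1 := congrArg ρ (P.succ k L e)
    have h2 := P'.succ k L (ρ e)
    rw [h, ih L h0, h2, map_add, map_nsmul, ih L h0, e0] at h1
    exact (add_right_cancel h1).symm

namespace LocalBundle

variable {B E : Type} [CommRing B] [AddCommGroup E] [Module B E] {n r n' r' n'' r'' : ℕ}
  (L : LocalBundle B E n r)

lemma exists_iterDer : Nonempty (IterDer L.nabla L.w) := by
  obtain ⟨C, _, ev, x, hx⟩ := exists_commRing_of_comm (nabla := L.nabla) L.comm
  exact ⟨iterDer L.w ev x hx⟩

/-- Iterated covariant derivatives. -/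
def iter : IterDer L.nabla L.w := L.exists_iterDer.some

/-- Connection matrices. -/
def A (k : Fin n) : Matrix (Fin r) (Fin r) B := .of fun x l => L.κ (L.nabla k (L.frame l)) x

lemma κ_nabla (k : Fin n) (e : E) :
    L.κ (L.nabla k e) = L.D k ∘ L.κ e + (L.A k).mulVec (L.κ e) := by
  conv_lhs => rw [← L.sum_frame e]
  simp only [map_sum, L.leibniz, map_add, L.κ_smul, L.κ_frame, Finset.sum_add_distrib]
  ext x
  simp only [Pi.add_apply, Finset.sum_apply, Pi.smul_apply, smul_eq_mul, Function.comp_apply,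
    Matrix.mulVec, dotProduct, A, Matrix.of_apply, Pi.single_apply, mul_ite, mul_one, mul_zero,
    Finset.sum_ite_eq, Finset.mem_univ, if_true]
  congr 1
  exact Finset.sum_congr rfl fun l _ => mul_comm _ _

/-- Two charts for the same module with connection. -/
structure Transition (L : LocalBundle B E n r) (L' : LocalBundle B E n' r') where
  a : Fin n' → Fin n → B
  D : ∀ m b, L'.D m b = ∑ p, a m p * L.D p b
  nabla : ∀ m e, L'.nabla m e = ∑ p, a m p • L.nabla p e

/-- Two infinitesimally close maps to `A`. -/
structure Close (L : LocalBundle B E n r) (L' : LocalBundle B E n' r') (A : Type) [CommRing A] where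
  φ : B →+* A
  φ' : B →+* A
  ξ : Fin n → A
  N : ℕ
  ξ_pow : ∀ k, ξ k ^ N = 0
  ξ_spec : ∀ k, φ (L.c k) ^ L.w k * ξ k = φ' (L.c k) - φ (L.c k)

variable {L} {L' : LocalBundle B E n' r'} {A A' : Type} [CommRing A] [CommRing A'] [Algebra ℚ A]
  [Algebra ℚ A']

namespace Close

variable (T : Close L L' A)

/-- Parallel transport along a pair of infinitesimally close maps. -/
def τ (e : E) : Fin r → A := taylor T.N T.ξ fun K => T.φ ∘ L.κ (L.iter.N K e)

lemma τ_add (e e' : E) : T.τ (e + e') = T.τ e + T.τ e' := by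
  have : ∀ K, T.φ ∘ L.κ (L.iter.N K (e + e')) =
      T.φ ∘ L.κ (L.iter.N K e) + T.φ ∘ L.κ (L.iter.N K e') := fun K => by
    ext x; simp
  simp [τ, taylor, this, smul_add, Finset.sum_add_distrib]

/-- Parallel transport as a homomorphism. -/
def τHom : E →+ (Fin r → A) := AddMonoidHom.mk' T.τ T.τ_add

/-- The matrix of parallel transport with respect to the frames. -/
def G : Matrix (Fin r) (Fin r') A := .of fun x l => T.τ (L'.frame l) x

variable (hτ : ∀ (a : B) e, T.τ (a • e) = T.φ' a • T.τ e)

lemma τ_eq (hτ : ∀ (a : B) e, T.τ (a • e) = T.φ' a • T.τ e) (e : E) :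
    T.τ e = T.G.mulVec (T.φ' ∘ L'.κ e) := by
  conv_lhs => rw [← L'.sum_frame e]
  change T.τHom _ = _
  rw [map_sum]
  change ∑ l, T.τ _ = _
  ext x
  simp only [hτ, Finset.sum_apply, Pi.smul_apply, smul_eq_mul, Matrix.mulVec, dotProduct, G,
    Matrix.of_apply, Function.comp_apply]
  exact Finset.sum_congr rfl fun l _ => mul_comm _ _

section Horizontal

variable (tr : Transition L L') (π : A →+* A') (δ : A →+ A')
  (hδ : ∀ a b, δ (a * b) = π a * δ b + π b * δ a) (l : Fin n → A') (lam : Fin n' → A')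
  (hl : ∀ b, δ (T.φ b) = ∑ k, l k * π (T.φ (L.D k b)))
  (hlam : ∀ b, δ (T.φ' b) = ∑ m, lam m * π (T.φ' (L'.D m b)))
  (hreg : ∀ k a b, π (T.φ (L.c k)) ^ L.w k * a = π (T.φ (L.c k)) ^ L.w k * b → a = b)

lemma delta_xi (hδ : ∀ a b, δ (a * b) = π a * δ b + π b * δ a)
    (hl : ∀ b, δ (T.φ b) = ∑ k, l k * π (T.φ (L.D k b)))
    (hlam : ∀ b, δ (T.φ' b) = ∑ m, lam m * π (T.φ' (L'.D m b)))
    (hreg : ∀ k a b, π (T.φ (L.c k)) ^ L.w k * a = π (T.φ (L.c k)) ^ L.w k * b → a = b)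
    (p : Fin n) : δ (T.ξ p) + (1 + L.w p * π (T.ξ p)) * l p =
      (1 + L.w p * π (T.ξ p)) * ∑ m, lam m * π (T.φ' (tr.a m p)) := by
  set M := ∑ m, lam m * π (T.φ' (tr.a m p)) with hM
  have e1 : δ (T.φ (L.c p)) = π (T.φ (L.c p)) ^ L.w p * l p := by
    rw [hl]
    simp only [L.D_c]
    rw [Finset.sum_eq_single p]
    · simp; ring
    · intro b _ hb; simp [hb.symm]
    · simp
  have e2 : δ (T.φ' (L.c p)) = π (T.φ' (L.c p)) ^ L.w p * M := by
    rw [hlam, hM, Finset.mul_sum]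
    refine Finset.sum_congr rfl fun m _ => ?_
    rw [tr.D]
    simp only [L.D_c]
    rw [Finset.sum_eq_single p]
    · simp; ring
    · intro b _ hb; simp [hb.symm]
    · simp
  have e3 := congrArg π (T.ξ_spec p)
  have e4 := congrArg δ (T.ξ_spec p)
  apply hreg p
  rw [map_sub, map_mul] at e3
  rw [map_sub, hδ, e1, e2] at e4
  rcases L.w_eq p with h | h
  · simp only [h, pow_zero, map_one, one_mul] at e3 e4 ⊢
    have h1 : δ 1 = 0 := by simpa using hδ 1 1
    rw [h1, mul_zero, add_zero] at e4
    rw [e4]; simp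
  · simp only [h, pow_one] at e3 e4 e1 ⊢
    rw [e1] at e4
    have e5 : π (T.φ' (L.c p)) = π (T.φ (L.c p)) + π (T.φ (L.c p)) * π (T.ξ p) := by
      rw [e3]; ring
    rw [e5] at e4
    push_cast
    linear_combination e4

lemma delta_τ (hτ : ∀ (a : B) e, T.τ (a • e) = T.φ' a • T.τ e) (tr : Transition L L')
    (hδ : ∀ a b, δ (a * b) = π a * δ b + π b * δ a)
    (hl : ∀ b, δ (T.φ b) = ∑ k, l k * π (T.φ (L.D k b)))
    (hlam : ∀ b, δ (T.φ' b) = ∑ m, lam m * π (T.φ' (L'.D m b)))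
    (hreg : ∀ k a b, π (T.φ (L.c k)) ^ L.w k * a = π (T.φ (L.c k)) ^ L.w k * b → a = b) (e : E) :
    δ ∘ T.τ e + (∑ k, l k • (L.A k).map (π.comp T.φ) : Matrix (Fin r) (Fin r) A').mulVec
      (π ∘ T.τ e) = ∑ m, lam m • (π ∘ T.τ (L'.nabla m e)) := by
  let κ : E →+ (Fin r → A) := AddMonoidHom.mk' (fun e => T.φ ∘ L.κ e) fun e e' => by ext; simp
  have h1 := L.iter.leibniz_taylor T.ξ_pow κ π δ hδ
    (∑ k, l k • (L.A k).map (π.comp T.φ) : Matrix (Fin r) (Fin r) A') l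
    (fun p => ∑ m, lam m * π (T.φ' (tr.a m p))) (fun e => ?_)
    (T.delta_xi tr π δ l lam hδ hl hlam hreg) e
  · refine h1.trans ?_
    have h2 : ∀ m, T.τ (L'.nabla m e) = ∑ p, T.φ' (tr.a m p) • T.τ (L.nabla p e) := fun m => by
      rw [tr.nabla]
      change T.τHom _ = _
      rw [map_sum]
      exact Finset.sum_congr rfl fun p _ => hτ _ _
    have h3 : ∀ m, π ∘ T.τ (L'.nabla m e) =
        ∑ p, π (T.φ' (tr.a m p)) • (π ∘ T.τ (L.nabla p e)) := fun m => by
      rw [h2]; ext x; simp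
    simp only [h3, Finset.smul_sum, Finset.sum_smul, smul_smul]
    rw [Finset.sum_comm]
    rfl
  · ext x
    simp only [κ, AddMonoidHom.mk'_apply, Pi.add_apply, Function.comp_apply, hl, L.κ_nabla,
      Finset.sum_apply, Pi.smul_apply, smul_eq_mul, map_add, mul_add, Finset.sum_add_distrib]
    congr 1
    simp only [Matrix.mulVec, dotProduct, Matrix.sum_apply, Matrix.smul_apply, Matrix.map_apply,
      smul_eq_mul, Finset.sum_mul, map_sum, map_mul, Finset.mul_sum, Function.comp_apply,
      RingHom.comp_apply, mul_assoc]
    rw [Finset.sum_comm]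

/-- Parallel transport is horizontal. -/
lemma delta_G (hτ : ∀ (a : B) e, T.τ (a • e) = T.φ' a • T.τ e) (tr : Transition L L')
    (hδ : ∀ a b, δ (a * b) = π a * δ b + π b * δ a)
    (hl : ∀ b, δ (T.φ b) = ∑ k, l k * π (T.φ (L.D k b)))
    (hlam : ∀ b, δ (T.φ' b) = ∑ m, lam m * π (T.φ' (L'.D m b)))
    (hreg : ∀ k a b, π (T.φ (L.c k)) ^ L.w k * a = π (T.φ (L.c k)) ^ L.w k * b → a = b) :
    T.G.map δ = T.G.map π *
        (∑ m, lam m • (L'.A m).map (π.comp T.φ') : Matrix (Fin r') (Fin r') A') -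
      (∑ k, l k • (L.A k).map (π.comp T.φ) : Matrix (Fin r) (Fin r) A') * T.G.map π := by
  ext x y
  have h1 := congr($(T.delta_τ π δ l lam hτ tr hδ hl hlam hreg (L'.frame y)) x)
  rw [Matrix.sub_apply, eq_sub_iff_add_eq]
  refine Eq.trans ?_ (h1.trans ?_)
  · rfl
  · have h2 : ∀ m, T.τ (L'.nabla m (L'.frame y)) = fun x => (T.G * (L'.A m).map T.φ') x y :=
      fun m => by
        rw [T.τ_eq hτ]
        rfl
    simp only [h2, Finset.sum_apply, Pi.smul_apply, Function.comp_apply, smul_eq_mul]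
    rw [Matrix.mul_sum, Matrix.sum_apply]
    refine Finset.sum_congr rfl fun m _ => ?_
    rw [Matrix.mul_smul, Matrix.smul_apply, smul_eq_mul]
    congr 1
    simp [Matrix.mul_apply, map_sum]

end Horizontal

end Close

end LocalBundle

end

section

/-! ### Properties of parallel transport -/

lemma IterDer.map_N' {E E' : Type} [AddCommGroup E] [AddCommGroup E'] {n : ℕ}
    {nabla : Fin n → E →+ E} {nabla' : Fin n → E' →+ E'} {w w' : Fin n → ℕ} (hw : w = w')
    (P : IterDer nabla w) (P' : IterDer nabla' w') (ρ : E →+ E')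
    (h : ∀ k e, ρ (nabla k e) = nabla' k (ρ e)) (K : Fin n → ℕ) (e : E) :
    ρ (P.N K e) = P'.N K (ρ e) := by
  subst hw
  exact P.map_N P' ρ h K e

namespace LocalBundle.Close

variable {B E : Type} [CommRing B] [AddCommGroup E] [Module B E] {n r n' r' n'' r'' : ℕ}
  {L : LocalBundle B E n r} {L' : LocalBundle B E n' r'} {L'' : LocalBundle B E n'' r''}
  {A : Type} [CommRing A] [Algebra ℚ A]

lemma τ_sub_mem (T : Close L L' A) {I : Ideal A} (hξ : ∀ k, T.ξ k ∈ I) (e : E) (x : Fin r) :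
    T.τ e x - T.φ (L.κ e x) ∈ I := by
  let κ : E →+ (Fin r → A) := AddMonoidHom.mk' (fun e => T.φ ∘ L.κ e) fun e e' => by ext; simp
  exact L.iter.taylor_sub_mem hξ T.N κ e x

/-- Parallel transport is semilinear. -/
lemma τ_smul (T : Close L L' A) (tr : Transition L L') (Φ : EulerFiltration A)
    (hφ : ∀ b, Φ.ε (T.φ b) = 0) (lam : Fin n' → A)
    (hlam : ∀ b, Φ.ε (T.φ' b) = ∑ m, lam m * T.φ' (L'.D m b)) (hlam' : ∀ m, lam m ∈ Φ.F 1)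
    (hφφ' : ∀ b, T.φ' b - T.φ b ∈ Φ.F 1) (hξ : ∀ k, T.ξ k ∈ Φ.F 1)
    (hreg : ∀ k a b, T.φ (L.c k) ^ L.w k * a = T.φ (L.c k) ^ L.w k * b → a = b)
    (a : B) (e : E) : T.τ (a • e) = T.φ' a • T.τ e := by
  let κ : E →+ (Fin r → A) := AddMonoidHom.mk' (fun e => T.φ ∘ L.κ e) fun e e' => by ext; simp
  refine L.iter.taylor_smul Φ T.φ T.φ' (D := L.D) L.leibniz κ (fun a e => ?_) hφφ'
    (fun e x => hφ _) (m := fun p => ∑ m, lam m * T.φ' (tr.a m p)) hξ (fun p => ?_) (fun p => ?_)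
    (fun b => ?_) T.ξ_pow a e
  · ext x
    simp [κ, L.κ_smul]
  · exact Ideal.sum_mem _ fun m _ => Ideal.mul_mem_right _ _ (hlam' m)
  · have := T.delta_xi tr (RingHom.id A) Φ.ε 0 lam Φ.leibniz (fun b => by simp [hφ]) hlam hreg p
    simpa using this
  · rw [hlam]
    simp only [tr.D, map_sum, map_mul, Finset.mul_sum, Finset.sum_mul, mul_assoc]
    rw [Finset.sum_comm]

lemma G_self (T : Close L L A) (hφ : ∀ b, T.φ' b = T.φ b)
    (hreg : ∀ k a b, T.φ (L.c k) ^ L.w k * a = T.φ (L.c k) ^ L.w k * b → a = b) : T.G = 1 := by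
  have hξ : ∀ k, T.ξ k = 0 := fun k => hreg k _ _ (by rw [T.ξ_spec, hφ, sub_self, mul_zero])
  ext x l
  have := T.τ_sub_mem (I := ⊥) (fun k => by rw [hξ]; exact Ideal.zero_mem _) (L.frame l) x
  rw [Ideal.mem_bot, sub_eq_zero] at this
  refine this.trans ?_
  rw [L.κ_frame, Matrix.one_apply, Pi.single_apply]
  split_ifs <;> simp

/-- Parallel transport is transitive. -/
lemma G_mul (T : Close L L' A) (T' : Close L' L'' A) (T'' : Close L L'' A)
    (h1 : T''.φ = T.φ) (h2 : T'.φ = T.φ') (h3 : T''.φ' = T'.φ')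
    (hτ : ∀ (a : B) e, T.τ (a • e) = T.φ' a • T.τ e)
    (hτ' : ∀ (a : B) e, T'.τ (a • e) = T'.φ' a • T'.τ e)
    (hτ'' : ∀ (a : B) e, T''.τ (a • e) = T''.φ' a • T''.τ e)
    (tr : Transition L L') (tr' : Transition L' L'') (tr'' : Transition L L'')
    (Φ : EulerFiltration A) (hφ : ∀ b, Φ.ε (T.φ b) = 0) (lam : Fin n' → A)
    (hlam : ∀ b, Φ.ε (T.φ' b) = ∑ m, lam m * T.φ' (L'.D m b))
    (lam' : Fin n'' → A) (hlam' : ∀ b, Φ.ε (T'.φ' b) = ∑ m, lam' m * T'.φ' (L''.D m b))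
    (hlam1 : ∀ m, lam' m ∈ Φ.F 1)
    (hξ : ∀ k, T.ξ k ∈ Φ.F 1) (hξ' : ∀ k, T'.ξ k ∈ Φ.F 1) (hξ'' : ∀ k, T''.ξ k ∈ Φ.F 1)
    (hreg : ∀ k a b, T.φ (L.c k) ^ L.w k * a = T.φ (L.c k) ^ L.w k * b → a = b)
    (hreg' : ∀ k a b, T'.φ (L'.c k) ^ L'.w k * a = T'.φ (L'.c k) ^ L'.w k * b → a = b) :
    T''.G = T.G * T'.G := by
  have hφ' : ∀ b, Φ.ε (T''.φ b) = 0 := fun b => by rw [h1, hφ]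
  have d1 := T.delta_G (RingHom.id A) Φ.ε 0 lam hτ tr Φ.leibniz (fun b => by simp [hφ]) hlam hreg
  have d2 := T'.delta_τ (RingHom.id A) Φ.ε lam lam' hτ' tr' Φ.leibniz (fun b => by
    rw [h2]; exact hlam b) hlam' hreg'
  have d3 := T''.delta_τ (RingHom.id A) Φ.ε 0 lam' hτ'' tr'' Φ.leibniz
    (fun b => by rw [hφ']; simp) (fun b => by rw [h3]; exact hlam' b) (by rw [h1]; exact hreg)
  let Δ : E × Fin r → A := fun p => T''.τ p.1 p.2 - (T.G.mulVec (T'.τ p.1)) p.2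
  have key : ∀ p, Δ p = 0 := by
    refine Φ.eq_zero Δ ?_ ?_
    · rintro ⟨e, x⟩
      have e1 := T''.τ_sub_mem hξ'' e x
      have e2 := T.τ_sub_mem hξ e x
      have e3 : (T.G.mulVec (T'.τ e)) x - (T.G.mulVec (T'.φ ∘ L'.κ e)) x ∈ Φ.F 1 := by
        rw [← Pi.sub_apply, ← Matrix.mulVec_sub]
        change ∑ y, T.G x y * (T'.τ e y - T'.φ (L'.κ e y)) ∈ Φ.F 1
        exact Ideal.sum_mem _ fun y _ => Ideal.mul_mem_left _ _ (T'.τ_sub_mem hξ' e y)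
      rw [h2, ← T.τ_eq hτ] at e3
      have := Ideal.sub_mem _ (Ideal.sub_mem _ e1 e2) e3
      rw [h1] at this
      refine (congrArg (· ∈ Φ.F 1) ?_).mp this
      simp only [Δ]; ring
    · rintro j hj ⟨e, x⟩
      have : Φ.ε (Δ (e, x)) = ∑ m, lam' m * Δ (L''.nabla m e, x) := by
        have f1 : Φ.ε (T''.τ e x) = ∑ m, lam' m * T''.τ (L''.nabla m e) x := by
          have := congr($(d3 e) x)
          simpa [Finset.sum_apply] using this
        have f2 : Φ.ε (T.G.mulVec (T'.τ e) x) =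
            ∑ m, lam' m * T.G.mulVec (T'.τ (L''.nabla m e)) x := by
          have g1 : Φ.ε (T.G.mulVec (T'.τ e) x) =
              ((T.G.map Φ.ε).mulVec (T'.τ e) + T.G.mulVec (Φ.ε ∘ T'.τ e)) x := by
            simp only [Matrix.mulVec, dotProduct, map_sum, Φ.leibniz, Pi.add_apply,
              Matrix.map_apply, Function.comp_apply, ← Finset.sum_add_distrib]
            exact Finset.sum_congr rfl fun y _ => by ring
          have g2 := d2 e
          have g3 : (RingHom.id A) ∘ T'.τ e = T'.τ e := rfl
          have g4 : T.G.map (RingHom.id A) = T.G := by ext; rfl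
          rw [g3, h2] at g2
          rw [g4] at d1
          simp only [Pi.zero_apply, zero_smul, Finset.sum_const_zero, Matrix.zero_mul,
            sub_zero] at d1
          rw [g1, d1, ← Matrix.mulVec_mulVec, ← Matrix.mulVec_add, add_comm, g2]
          rw [Matrix.mulVec_sum, Finset.sum_apply]
          refine Finset.sum_congr rfl fun m _ => ?_
          rw [Matrix.mulVec_smul]
          rfl
        simp only [Δ, map_sub, f1, f2, mul_sub, Finset.sum_sub_distrib]
      rw [this]
      refine Ideal.sum_mem _ fun m _ => ?_
      rw [add_comm j 1]
      exact Φ.mul 1 j _ _ (hlam1 m) (hj _)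
  ext x l
  exact sub_eq_zero.mp (key (L''.frame l, x))

lemma G_map {B₁ E₁ : Type} [CommRing B₁] [AddCommGroup E₁] [Module B₁ E₁]
    {L₁ : LocalBundle B₁ E₁ n r} {L₁' : LocalBundle B₁ E₁ n' r'} {A₁ : Type} [CommRing A₁]
    [Algebra ℚ A₁] (T : Close L L' A) (T₁ : Close L₁ L₁' A₁) (ρ : B →+* B₁) (ρE : E →+ E₁)
    (π : A →+* A₁) (hw : L.w = L₁.w) (hnabla : ∀ k e, ρE (L.nabla k e) = L₁.nabla k (ρE e))
    (hκ : ∀ e, L₁.κ (ρE e) = ρ ∘ L.κ e) (hframe : ∀ l, ρE (L'.frame l) = L₁'.frame l)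
    (hφ : ∀ b, π (T.φ b) = T₁.φ (ρ b)) (hξ : ∀ k, π (T.ξ k) = T₁.ξ k) : T.G.map π = T₁.G := by
  ext x l
  change π (T.τ (L'.frame l) x) = T₁.τ (L₁'.frame l) x
  have hx : ∀ k, T.ξ k ^ (max T.N T₁.N) = 0 := fun k =>
    pow_eq_zero_of_le (le_max_left _ _) (T.ξ_pow k)
  have e1 : T.τ (L'.frame l) = taylor (max T.N T₁.N) T.ξ
      fun K => T.φ ∘ L.κ (L.iter.N K (L'.frame l)) :=
    (taylor_eq_of_le T.ξ_pow (le_max_left _ _) _).symm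
  have e2 : T₁.τ (L₁'.frame l) = taylor (max T.N T₁.N) T₁.ξ
      fun K => T₁.φ ∘ L₁.κ (L₁.iter.N K (L₁'.frame l)) :=
    (taylor_eq_of_le T₁.ξ_pow (le_max_right _ _) _).symm
  have e3 := map_taylor π (max T.N T₁.N) T.ξ fun K => T.φ ∘ L.κ (L.iter.N K (L'.frame l))
  rw [e1, e2]
  refine congr($e3 x).trans ?_
  have e4 : π ∘ T.ξ = T₁.ξ := funext hξ
  rw [e4]
  congr 2
  ext K y
  simp only [Function.comp_apply, hφ]
  rw [← hframe, ← L.iter.map_N' hw L₁.iter ρE hnabla, hκ]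
  rfl

end LocalBundle.Close

end

section

lemma LocalBundle.flat {B E : Type} [CommRing B] [AddCommGroup E] [Module B E] {n r : ℕ}
    (L : LocalBundle B E n r) (k l : Fin n) :
    (L.A l).map (L.D k) - (L.A k).map (L.D l) + L.A k * L.A l - L.A l * L.A k = 0 := by
  have h (k l : Fin n) (x y : Fin r) : L.κ (L.nabla k (L.nabla l (L.frame y))) x =
      ((L.A l).map (L.D k) + L.A k * L.A l) x y := by
    rw [L.κ_nabla]
    rfl
  ext x y
  have h1 := h k l x y
  rw [L.comm, h l k] at h1
  simp only [Matrix.add_apply, Matrix.sub_apply, Matrix.zero_apply] at h1 ⊢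
  linear_combination -h1

/-! ### Combinations of vector fields -/

section Fields

variable {Y T : Scheme.{0}}

lemma MemIdeal.mul_left {I : Y.IdealSheafData} {U : Y.Opens} (b : Γ(Y, U)) {a : Γ(Y, U)}
    (ha : MemIdeal I a) : MemIdeal I (b * a) := fun V h => by
  rw [map_mul]; exact Ideal.mul_mem_left _ _ (ha V h)

lemma MemIdeal.sub {I : Y.IdealSheafData} {U : Y.Opens} {a b : Γ(Y, U)} (ha : MemIdeal I a)
    (hb : MemIdeal I b) : MemIdeal I (a - b) := fun V h => by
  rw [map_sub]; exact Ideal.sub_mem _ (ha V h) (hb V h)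

variable {g : Y ⟶ T} {ι : Type} {D : ι → Y.IdealSheafData}

/-- The vector field `θ - a θ'`. -/
def LogField.subSmul {U : Y.Opens} (θ θ' : LogField g D U) (a : Γ(Y, U)) : LogField g D U where
  app V hV := θ.app V hV - (AddMonoidHom.mulLeft (resO hV a)).comp (θ'.app V hV)
  res_app V W hV hW b := by simp [θ.res_app, θ'.res_app]
  leibniz V hV b c := by simp [θ.leibniz, θ'.leibniz]; ring
  const V hV W hW b := by simp [θ.const, θ'.const]
  log i V hV b hb := (θ.log i V hV b hb).sub ((θ'.log i V hV b hb).mul_left _)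

lemma LogFlatBundle.nabla_eq_sum (E : LogFlatBundle g D) {U : Y.Opens} {n : ℕ}
    (a : Fin n → Γ(Y, U)) (θ' : Fin n → LogField g D U) (θ : LogField g D U)
    (h : ∀ (V : Y.Opens) (hV : V ≤ U) (b : Γ(Y, V)),
      θ.app V hV b = ∑ p, resO hV (a p) * (θ' p).app V hV b) (e : Γ(E.M, U)) :
    E.nabla U θ e = ∑ p, a p • E.nabla U (θ' p) e := by
  induction n generalizing θ with
  | zero =>
    have := E.linear U 1 θ θ θ (fun V hV b => by simp [h]) e
    simpa using this
  | succ n ih =>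
    rw [Fin.sum_univ_succ, ← ih (fun p => a p.succ) (fun p => θ' p.succ) (θ.subSmul (θ' 0) (a 0))]
    · refine E.linear U (a 0) θ (θ' 0) _ (fun V hV b => ?_) e
      simp [LogField.subSmul]
    · intro V hV b
      simp [LogField.subSmul, h, Fin.sum_univ_succ]

end Fields

lemma resM_smul {Y : Scheme.{0}} (M : Y.Modules) {U V : Y.Opens} (h : V ≤ U) (a : Γ(Y, U))
    (e : Γ(M, U)) : resM M h (a • e : Γ(M, U)) = (resO h a • resM M h e : Γ(M, V)) :=
  Scheme.Modules.map_smul M (homOfLE h) a e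

/-! ### Framed charts -/

variable {X S B : Scheme.{0}} {f : X ⟶ S} {ι : Type} {D : ι → X.IdealSheafData}
  {q : S ⟶ B} {s : B ⟶ S}

/-- A chart together with a frame of a bundle on the fibre at `s`. -/
structure FramedChart (q : S ⟶ B) (E : FlatBundleOver f D s) extends BaseChart f D q s where
  r : ℕ
  e : Fin r → Γ(E.M, bc f s V)
  isFrame : IsFrame E.M (bc f s V) e

variable [IsAffine B]

namespace FramedChart

variable {E : FlatBundleOver f D s} (C C' : FramedChart q E) (hs : s ≫ q = 𝟙 _)

lemma bijective_frame {U : X.Opens} (hU : U ≤ C.V) : Function.Bijective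
    (fun a : Fin C.r → Γ(pullback f s, bc f s U) =>
      ∑ i, a i • (resM E.M (bc_mono f hU) (C.e i) : Γ(E.M, bc f s U))) :=
  C.isFrame _ (bc_mono f hU)

/-- Coordinates of sections. -/
def coords {U : X.Opens} (hU : U ≤ C.V) :
    Γ(E.M, bc f s U) →+ (Fin C.r → Γ(pullback f s, bc f s U)) :=
  AddMonoidHom.mk' (Equiv.ofBijective _ (C.bijective_frame hU)).symm fun a b => by
    rw [Equiv.symm_apply_eq, Equiv.ofBijective_apply]
    simp only [Pi.add_apply, add_smul, Finset.sum_add_distrib]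
    congr 1
    · exact ((Equiv.ofBijective _ (C.bijective_frame hU)).apply_symm_apply a).symm
    · exact ((Equiv.ofBijective _ (C.bijective_frame hU)).apply_symm_apply b).symm

lemma sum_coords {U : X.Opens} (hU : U ≤ C.V) (e : Γ(E.M, bc f s U)) :
    ∑ l, C.coords hU e l • (resM E.M (bc_mono f hU) (C.e l) : Γ(E.M, bc f s U)) = e :=
  (Equiv.ofBijective _ (C.bijective_frame hU)).apply_symm_apply e

lemma coords_eq {U : X.Opens} (hU : U ≤ C.V) (e : Γ(E.M, bc f s U)) {a : Fin C.r → _}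
    (h : ∑ l, a l • (resM E.M (bc_mono f hU) (C.e l) : Γ(E.M, bc f s U)) = e) :
    C.coords hU e = a :=
  (C.bijective_frame hU).1 ((C.sum_coords hU e).trans h.symm)

/-- The vector fields dual to the coordinates. -/
abbrev field {U : X.Opens} (hU : U ≤ C.V) (k : Fin C.n) :
    LogField (pullback.snd f s) (fun i => (D i).comap (pullback.fst f s)) (bc f s U) :=
  ((C.logChart (onSection_self hs)).der k).restrict (C.le_logChart (onSection_self hs) hU)

/-- The restriction of the bundle to an open subset of a chart. -/
def loc {U : X.Opens} (hU : U ≤ C.V) :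
    LocalBundle Γ(pullback f s, bc f s U) Γ(E.M, bc f s U) C.n C.r where
  c := C.coord (onSection_self hs) hU
  w := C.w
  w_eq := C.w_eq
  D k := (C.field hs hU k).app _ le_rfl
  D_c k l := (C.logChart (onSection_self hs)).der_coord k (C.le_logChart (onSection_self hs) hU) l
  D_mul k a b := (C.field hs hU k).leibniz _ le_rfl a b
  nabla k := E.nabla _ (C.field hs hU k)
  leibniz k a e := by
    rw [E.leibniz, add_comm]
  comm k l e := by
    have h0 := E.nabla_eq_sum (n := 0) Fin.elim0 Fin.elim0
      ((C.field hs hU k).subSmul (C.field hs hU k) 1) (fun V hV b => by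
        simp [LogField.subSmul]) e
    have := E.flat _ ((C.field hs hU k).subSmul (C.field hs hU k) 1) (C.field hs hU k)
      (C.field hs hU l) (fun V hV a => by
        have h1 : (C.field hs hU k).app V hV ((C.field hs hU l).app V hV a) =
            (C.field hs hU l).app V hV ((C.field hs hU k).app V hV a) :=
          (C.logChart (onSection_self hs)).der_comm
            (hV.trans (C.le_logChart (onSection_self hs) hU)) k l a
        rw [h1]
        simp [LogField.subSmul]) e
    rw [h0, Fin.sum_univ_zero] at this
    exact (sub_eq_zero.mp this.symm)
  κ := C.coords hU
  κ_smul a e := C.coords_eq hU _ (by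
    conv_rhs => rw [← C.sum_coords hU e]
    simp only [Pi.smul_apply, smul_eq_mul, mul_smul, Finset.smul_sum])
  frame l := resM E.M (bc_mono f hU) (C.e l)
  κ_frame l := C.coords_eq hU _ (by
    rw [Finset.sum_eq_single l]
    · simp
    · intro b _ hb; simp [hb]
    · simp)
  sum_frame e := C.sum_coords hU e

/-- Comparison of two charts. -/
def trans {U : X.Opens} (hU : U ≤ C.V) (hU' : U ≤ C'.V) :
    LocalBundle.Transition (C.loc hs hU) (C'.loc hs hU') where
  a m := (C.logChart (onSection_self hs)).lam (C'.field hs hU' m) le_rfl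
    (C.le_logChart (onSection_self hs) hU)
  D m b := (C.logChart (onSection_self hs)).app_eq_sum (C'.field hs hU' m) le_rfl
    (C.le_logChart (onSection_self hs) hU) b
  nabla m e := E.nabla_eq_sum _ (fun p => C.field hs hU p) _ (fun V hV b => by
    rw [(C.logChart (onSection_self hs)).app_eq_sum (C'.field hs hU' m) hV
      (hV.trans (C.le_logChart (onSection_self hs) hU)) b]
    refine Finset.sum_congr rfl fun p _ => ?_
    rw [LogChart.res_lam]
    rfl) e

section Restrict

variable {U V : X.Opens} (hU : U ≤ C.V) (hV : V ≤ U)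

lemma resM_nabla (k : Fin C.n) (e : Γ(E.M, bc f s U)) :
    resM E.M (bc_mono f hV) ((C.loc hs hU).nabla k e) =
      (C.loc hs (hV.trans hU)).nabla k (resM E.M (bc_mono f hV) e) :=
  E.res_nabla _ _ (bc_mono f hV) _ e

lemma resM_frame (l : Fin C.r) : resM E.M (bc_mono f hV) ((C.loc hs hU).frame l) =
    (C.loc hs (hV.trans hU)).frame l := by
  change resM _ _ (resM _ _ _) = resM _ _ _
  simp only [resM, ← AddCommGrpCat.comp_apply, ← Functor.map_comp]
  rfl

lemma κ_resM (e : Γ(E.M, bc f s U)) :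
    (C.loc hs (hV.trans hU)).κ (resM E.M (bc_mono f hV) e) =
      resO (bc_mono f hV) ∘ (C.loc hs hU).κ e := by
  refine C.coords_eq (hV.trans hU) _ ?_
  conv_rhs => rw [← C.sum_coords hU e]
  rw [map_sum]
  refine Finset.sum_congr rfl fun l _ => ?_
  rw [resM_smul]
  exact congrArg _ (C.resM_frame hs hU hV l).symm

lemma map_A (k : Fin C.n) : ((C.loc hs hU).A k).map (resO (bc_mono f hV)) =
    (C.loc hs (hV.trans hU)).A k := by
  ext x l
  change resO _ ((C.loc hs hU).κ _ x) = (C.loc hs (hV.trans hU)).κ _ x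
  rw [← C.resM_frame hs hU hV, ← C.resM_nabla hs hU hV, C.κ_resM hs hU hV]
  rfl

end Restrict

end FramedChart

end

section

variable {X S B : Scheme.{0}} {f : X ⟶ S} {ι : Type} {D : ι → X.IdealSheafData}
  {q : S ⟶ B} {s : B ⟶ S} [IsAffine B]

namespace BaseChart

variable (ch ch' : BaseChart f D q s) {T T₀ : Scheme.{0}} [IsAffine T] [IsAffine T₀]
  {t : T ⟶ S} {i : T₀ ⟶ T} (th : Thickening q s i t) (hs : s ≫ q = 𝟙 _)

lemma divisible (ht : OnSection q s t) {U : X.Opens} (hU : U ≤ ch.V) (k : Fin ch.n) {y}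
    (hy : ∀ l, (D l).ideal ⟨ch.V, ch.affine⟩ = Ideal.span {ch.c k} →
      MemIdeal ((D l).comap (pullback.fst f t)) y) :
    (ch.logChart ht).Divisible (ch.le_logChart ht hU) k y := by
  refine (ch.logChart ht).divisible_of_exists _ _ _ fun hk => ?_
  obtain ⟨l, hl⟩ := ch.log k hk
  refine ⟨l, ?_, hy l hl⟩
  refine (ideal_comap (pullback.fst f t) (D l) ⟨ch.V, ch.affine⟩
    ⟨_, ch.isAffineOpen_bc le_rfl ch.affine ht⟩ le_rfl).trans ?_
  rw [hl, Ideal.map_span, Set.image_singleton]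
  rfl

/-- The difference between the coordinates and their images under the retraction of another
chart. -/
def xi {U : X.Opens} (hU : U ≤ ch.V) (hU' : U ≤ ch'.V) (hUa : IsAffineOpen U) (k : Fin ch.n) :
    Γ(pullback f t, bc f t U) :=
  (ch.logChart th.on).div (ch.le_logChart th.on hU) k
    (ch'.phi th hs hU' hUa (ch.coord (onSection_self hs) hU k) - ch.coord th.on hU k)

lemma coord_pow_cancel (ht : OnSection q s t) {U : X.Opens} (hU : U ≤ ch.V) (k : Fin ch.n) (m : ℕ)
    {a b} (e : ch.coord ht hU k ^ m * a = ch.coord ht hU k ^ m * b) : a = b :=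
  (ch.logChart ht).coord_pow_cancel _ k m e

lemma xi_spec {U : X.Opens} (hU : U ≤ ch.V) (hU' : U ≤ ch'.V) (hUa : IsAffineOpen U)
    (k : Fin ch.n) : ch.coord th.on hU k ^ ch.w k * ch.xi ch' th hs hU hU' hUa k =
      ch'.phi th hs hU' hUa (ch.coord (onSection_self hs) hU k) - ch.coord th.on hU k :=
  (ch.logChart th.on).div_spec _ _ (ch.divisible th.on hU k fun l hl =>
    (ch'.memIdeal_phi th hs hU' hUa l (ch.memIdeal_coord _ hU k l hl)).sub
      (ch.memIdeal_coord th.on hU k l hl))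

lemma resO_xi {U V : X.Opens} (hU : U ≤ ch.V) (hU' : U ≤ ch'.V) (hUa : IsAffineOpen U) (hV : V ≤ U)
    (hVa : IsAffineOpen V) (k : Fin ch.n) :
    resO (bc_mono f hV) (ch.xi ch' th hs hU hU' hUa k) =
      ch.xi ch' th hs (hV.trans hU) (hV.trans hU') hVa k := by
  apply ch.coord_pow_cancel th.on (hV.trans hU) k (ch.w k)
  have := congr(resO (bc_mono f hV) $(ch.xi_spec ch' th hs hU hU' hUa k))
  rw [map_mul, map_pow, map_sub, ch'.resO_phi th hs hU' hUa hV hVa] at this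
  erw [LogChart.resO_coord, LogChart.resO_coord] at this
  exact this.trans (ch.xi_spec ch' th hs (hV.trans hU) (hV.trans hU') hVa k).symm

lemma bcPull_xi {T' T₀' : Scheme.{0}} [IsAffine T'] [IsAffine T₀'] {t' : T' ⟶ S} {i' : T₀' ⟶ T'}
    (th' : Thickening q s i' t') (u : T' ⟶ T) (w : u ≫ t = t') (u₀ : T₀' ⟶ T₀)
    (hu : u₀ ≫ i = i' ≫ u) {U : X.Opens} (hU : U ≤ ch.V) (hU' : U ≤ ch'.V) (hUa : IsAffineOpen U)
    (k : Fin ch.n) :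
    bcPull f u w U (ch.xi ch' th hs hU hU' hUa k) = ch.xi ch' th' hs hU hU' hUa k := by
  apply ch.coord_pow_cancel th'.on hU k (ch.w k)
  have := congr(bcPull f u w U $(ch.xi_spec ch' th hs hU hU' hUa k))
  rw [map_mul, map_pow, map_sub, ch'.bcPull_phi th hs th' u w u₀ hu, ch.bcPull_coord th.on th'.on]
    at this
  exact this.trans (ch.xi_spec ch' th' hs hU hU' hUa k).symm

lemma bcPull_xi_zero {U : X.Opens} (hU : U ≤ ch.V) (hU' : U ≤ ch'.V) (hUa : IsAffineOpen U)
    (k : Fin ch.n) : bcPull f i rfl U (ch.xi ch' th hs hU hU' hUa k) = 0 := by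
  have on₀ : OnSection q s (i ≫ t) := th.on.comp i rfl
  apply ch.coord_pow_cancel on₀ hU k (ch.w k)
  have := congr(bcPull f i rfl U $(ch.xi_spec ch' th hs hU hU' hUa k))
  rw [map_mul, map_pow, map_sub, bcPull_phi_zero, ch.bcPull_coord th.on on₀,
    ch.bcPull_coord (onSection_self hs) on₀, sub_self] at this
  rw [this, mul_zero]

lemma phi_der {U : X.Opens} (hU : U ≤ ch.V) (hUa : IsAffineOpen U) (k : Fin ch.n) (a) :
    ((ch.logChart th.on).der k).app _ (ch.le_logChart th.on hU) (ch.phi th hs hU hUa a) =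
      ch.phi th hs hU hUa (((ch.logChart (onSection_self hs)).der k).app _
        (ch.le_logChart (onSection_self hs) hU) a) := by
  let φ := ch.phi th hs hU hUa
  refine DFunLike.congr_fun ((ch.etaleCoords (onSection_self hs) hU hUa).derivation_ext φ
    ((((ch.logChart th.on).der k).app _ (ch.le_logChart th.on hU)).comp φ.toAddMonoidHom)
    (φ.toAddMonoidHom.comp (((ch.logChart (onSection_self hs)).der k).app _
        (ch.le_logChart (onSection_self hs) hU))) (fun a b => ?_) (fun a b => ?_) (fun x => ?_)
    fun l => ?_) a
  · simp [LogField.leibniz]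
  · simp [LogField.leibniz]
  · simp [φ, phi_constMap, LogField.constMap]
  · change ((ch.logChart th.on).der k).app _ (ch.le_logChart th.on hU) (φ _) = φ _
    rw [phi_coord, LogChart.der_coord, LogChart.der_coord]
    split_ifs
    · rw [map_pow, phi_coord]; rfl
    · simp

end BaseChart

/-- An Euler filtration on the functions on a thickening of the central fibre. -/
structure EulerData {T T₀ : Scheme.{0}} (q : S ⟶ B) (i : T₀ ⟶ T) (t : T ⟶ S)
    (Φ : EulerFiltration Γ(T, ⊤)) : Prop where
  mem : ∀ x, Φ.ε x ∈ Φ.F 1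
  const : ∀ x, Φ.ε (constMap (t ≫ q) ⊤ x) = 0
  one : Φ.F 1 = RingHom.ker (constMap i ⊤)

namespace BaseChart

variable (ch ch' : BaseChart f D q s) {T T₀ : Scheme.{0}} [IsAffine T] [IsAffine T₀]
  {t : T ⟶ S} {i : T₀ ⟶ T} (th : Thickening q s i t) (hs : s ≫ q = 𝟙 _)
  {Φ : EulerFiltration Γ(T, ⊤)}

lemma exists_eulerFiltration (hΦ : EulerData q i t Φ) {U : X.Opens} (hU : U ≤ ch.V)
    (hUa : IsAffineOpen U) : ∃ Ψ : EulerFiltration Γ(pullback f t, bc f t U),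
      (∀ b, Ψ.ε (ch.phi th hs hU hUa b) = 0) ∧ Ψ.F 1 = RingHom.ker (bcPull f i rfl U) ∧
      (∀ a, Ψ.ε a ∈ Ψ.F 1) ∧ (∀ x, Ψ.ε (constMap (pullback.snd f t) _ (constMap (t ≫ q) ⊤ x)) = 0) ∧
      ∀ l a, MemIdeal ((D l).comap (pullback.fst f t)) a →
        MemIdeal ((D l).comap (pullback.fst f t)) (Ψ.ε a) := by
  obtain ⟨Ψ, h1, h2, h3, h4⟩ := (ch.etaleCoords th.on hU hUa).exists_eulerFiltration Φ hΦ.mem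
  have hc : ∀ x, Ψ.ε (constMap (pullback.snd f t) _ (constMap (t ≫ q) ⊤ x)) = 0 := fun x => by
    rw [h2, hΦ.const, map_zero]
  refine ⟨Ψ, fun b => ?_, by rw [h1, hΦ.one, ch.ker_bcPull th hU hUa], h4, hc, fun l a ha => ?_⟩
  · let φ := ch.phi th hs hU hUa
    refine DFunLike.congr_fun ((ch.etaleCoords (onSection_self hs) hU hUa).derivation_ext φ
      (Ψ.ε.comp φ.toAddMonoidHom) 0 (fun a b => by simp [Ψ.leibniz]) (by simp) (fun x => ?_)
      fun l => ?_) b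
    · change Ψ.ε (φ _) = 0
      rw [phi_constMap, hc]
    · change Ψ.ε (φ _) = 0
      rw [phi_coord, h3]
  · refine memIdeal_of_affine (V := ⟨_, ch.isAffineOpen_bc hU hUa th.on⟩) ?_
    have ha' := ha ⟨_, ch.isAffineOpen_bc hU hUa th.on⟩ le_rfl
    rw [resO_self] at ha'
    rcases (ch.logChart th.on).ideal l with h | ⟨k, -, h⟩
    · rw [(ch.logChart th.on).ideal_eq_top (ch.le_logChart th.on hU) _ h]; trivial
    · rw [(ch.logChart th.on).ideal_eq (ch.le_logChart th.on hU) _ h,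
        Ideal.mem_span_singleton] at ha' ⊢
      obtain ⟨b, rfl⟩ := ha'
      rw [Ψ.leibniz, h3, mul_zero, add_zero]
      exact dvd_mul_right _ _

/-- The coefficients of a derivation in the directions of the coordinate vector fields. -/
lemma exists_lam {T' T₀' : Scheme.{0}} [IsAffine T'] [IsAffine T₀'] {t' : T' ⟶ S} {i' : T₀' ⟶ T'}
    (th' : Thickening q s i' t') (u : T' ⟶ T) (w : u ≫ t = t') {U : X.Opens} (hU : U ≤ ch.V)
    (hUa : IsAffineOpen U) (δ : Γ(pullback f t, bc f t U) →+ Γ(pullback f t', bc f t' U))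
    (hδ : ∀ a b, δ (a * b) = bcPull f u w U a * δ b + bcPull f u w U b * δ a)
    (hc : ∀ x, δ (constMap (pullback.snd f t) _ (constMap (t ≫ q) ⊤ x)) = 0)
    (hlog : ∀ l a, MemIdeal ((D l).comap (pullback.fst f t)) a →
        MemIdeal ((D l).comap (pullback.fst f t')) (δ a))
    (lam : Fin ch.n → Γ(pullback f t', bc f t' U))
    (hlam : ∀ k, lam k = (ch.logChart th'.on).div (ch.le_logChart th'.on hU) k
      (δ (ch.coord th.on hU k))) :
    (∀ k, ch.coord th'.on hU k ^ ch.w k * lam k = δ (ch.coord th.on hU k)) ∧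
    ∀ b, δ (ch.phi th hs hU hUa b) = ∑ k, lam k * bcPull f u w U (ch.phi th hs hU hUa
      (((ch.logChart (onSection_self hs)).der k).app _
        (ch.le_logChart (onSection_self hs) hU) b)) := by
  have h1 : ∀ k, ch.coord th'.on hU k ^ ch.w k * lam k = δ (ch.coord th.on hU k) := fun k => by
    rw [hlam]
    exact (ch.logChart th'.on).div_spec _ _ (ch.divisible th'.on hU k fun l hl =>
      hlog l _ (ch.memIdeal_coord th.on hU k l hl))
  refine ⟨h1, fun b => ?_⟩
  let φ := ch.phi th hs hU hUa
  refine (ch.etaleCoords (onSection_self hs) hU hUa).derivation_eq_sum ((bcPull f u w U).comp φ)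
    (δ.comp φ.toAddMonoidHom) (fun a b => by simp [hδ]) (fun x => ?_) ch.w
    (fun k => ((ch.logChart (onSection_self hs)).der k).app _
      (ch.le_logChart (onSection_self hs) hU)) (fun k a b => LogField.leibniz _ _ _ a b)
    (fun k x => LogField.constMap _ _ x) (fun k l => LogChart.der_coord _ k _ l) lam
    (fun k => ?_) b
  · change δ (φ _) = 0
    rw [phi_constMap, hc]
  · change δ (φ _) = bcPull f u w U (φ _) ^ _ * _
    rw [phi_coord, ch.bcPull_coord th.on th'.on, h1]

end BaseChart

end

section

lemma bcPull_id {X S T : Scheme.{0}} (f : X ⟶ S) {t : T ⟶ S} (w : 𝟙 T ≫ t = t) (U : X.Opens) (a) :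
    bcPull f (𝟙 T) w U a = a := by
  have h : bcMap f (𝟙 T) w = 𝟙 _ := by
    apply pullback.hom_ext
    · rw [bcMap_fst, Category.id_comp]
    · rw [bcMap_snd, Category.id_comp, Category.comp_id]
  have key : ∀ (g : pullback f t ⟶ pullback f t) (_ : g = 𝟙 _) (hg : bc f t U ≤ g ⁻¹ᵁ bc f t U),
      (g.appLE (bc f t U) (bc f t U) hg).hom a = a := by
    rintro _ rfl hg
    have e : (𝟙 (pullback f t) : pullback f t ⟶ pullback f t).appLE (bc f t U) (bc f t U) hg =
        𝟙 _ := by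
      simp only [Scheme.Hom.appLE, Scheme.Hom.id_app]
      exact (Category.id_comp _).trans ((pullback f t).presheaf.map_id _)
    rw [e]; rfl
  exact key _ h _

variable {X S B : Scheme.{0}} {f : X ⟶ S} {ι : Type} {D : ι → X.IdealSheafData}
  {q : S ⟶ B} {s : B ⟶ S} [IsAffine B]

namespace FramedChart

variable {E : FlatBundleOver f D s} (C C' C'' : FramedChart q E) {T T₀ : Scheme.{0}} [IsAffine T]
  [IsAffine T₀] {t : T ⟶ S} {i : T₀ ⟶ T} (th : Thickening q s i t) (hs : s ≫ q = 𝟙 _)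

lemma exists_xi_pow {U : X.Opens} (hU : U ≤ C.V) (hU' : U ≤ C'.V) (hUa : IsAffineOpen U) :
    ∃ N, ∀ k, C.xi C'.toBaseChart th hs hU hU' hUa k ^ N = 0 := by
  obtain ⟨N, hN⟩ := C.isNilpotent_ker_bcPull th hU hUa
  refine ⟨N, fun k => ?_⟩
  have := Ideal.pow_mem_pow (RingHom.mem_ker.mpr (C.bcPull_xi_zero C'.toBaseChart th hs hU hU' hUa k)) N
  rwa [hN] at this

/-- The retractions given by two charts. -/
def close {U : X.Opens} (hU : U ≤ C.V) (hU' : U ≤ C'.V) (hUa : IsAffineOpen U) :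
    (C.loc hs hU).Close (C'.loc hs hU') Γ(pullback f t, bc f t U) where
  φ := C.phi th hs hU hUa
  φ' := C'.phi th hs hU' hUa
  ξ := C.xi C'.toBaseChart th hs hU hU' hUa
  N := (C.exists_xi_pow C' th hs hU hU' hUa).choose
  ξ_pow := (C.exists_xi_pow C' th hs hU hU' hUa).choose_spec
  ξ_spec k := by
    change C.phi th hs hU hUa (C.coord _ hU k) ^ C.w k * _ = C'.phi th hs hU' hUa (C.coord _ hU k) -
      C.phi th hs hU hUa (C.coord _ hU k)
    rw [BaseChart.phi_coord]
    exact C.xi_spec C'.toBaseChart th hs hU hU' hUa k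

variable [Algebra ℚ Γ(T, ⊤)] {Φ : EulerFiltration Γ(T, ⊤)} (hΦ : EulerData q i t Φ)

lemma reg {U : X.Opens} (hU : U ≤ C.V) (hUa : IsAffineOpen U) (k : Fin C.n) {m : ℕ} {a b}
    (e : C.phi th hs hU hUa ((C.loc hs hU).c k) ^ m * a =
      C.phi th hs hU hUa ((C.loc hs hU).c k) ^ m * b) : a = b := by
  change C.phi th hs hU hUa (C.coord _ hU k) ^ _ * _ = C.phi th hs hU hUa (C.coord _ hU k) ^ _ * _
    at e
  rw [BaseChart.phi_coord] at e
  exact C.coord_pow_cancel th.on hU k m e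

lemma phi_sub_mem {U : X.Opens} (hU : U ≤ C.V) (hU' : U ≤ C'.V) (hUa : IsAffineOpen U) (b) :
    C'.phi th hs hU' hUa b - C.phi th hs hU hUa b ∈ RingHom.ker (bcPull f i rfl U) := by
  rw [RingHom.mem_ker, map_sub, BaseChart.bcPull_phi_zero, BaseChart.bcPull_phi_zero, sub_self]

/-- The derivatives of functions induced by another chart in the direction of an Euler derivation. -/
lemma exists_lam_euler {U : X.Opens} (hU : U ≤ C.V) (hUa : IsAffineOpen U)
    {Ψ : EulerFiltration Γ(pullback f t, bc f t U)} (h1 : Ψ.F 1 = RingHom.ker (bcPull f i rfl U))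
    (h2 : ∀ a, Ψ.ε a ∈ Ψ.F 1)
    (h3 : ∀ x, Ψ.ε (constMap (pullback.snd f t) _ (constMap (t ≫ q) ⊤ x)) = 0)
    (h4 : ∀ l a, MemIdeal ((D l).comap (pullback.fst f t)) a →
        MemIdeal ((D l).comap (pullback.fst f t)) (Ψ.ε a)) :
    ∃ lam : Fin C.n → Γ(pullback f t, bc f t U), (∀ m, lam m ∈ Ψ.F 1) ∧
      ∀ b, Ψ.ε (C.phi th hs hU hUa b) =
        ∑ m, lam m * C.phi th hs hU hUa ((C.loc hs hU).D m b) := by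
  obtain ⟨e1, e2⟩ := C.exists_lam th hs th (𝟙 T) (Category.id_comp _) hU hUa Ψ.ε
    (fun a b => by rw [bcPull_id, bcPull_id, Ψ.leibniz]) h3 h4 _ fun _ => rfl
  refine ⟨fun k => (C.logChart th.on).div (C.le_logChart th.on hU) k (Ψ.ε (C.coord th.on hU k)),
    fun m => ?_, fun b => (e2 b).trans ?_⟩
  · rw [h1, RingHom.mem_ker]
    have on₀ : OnSection q s (i ≫ t) := th.on.comp i rfl
    apply C.coord_pow_cancel on₀ hU m (C.w m)
    have := congr(bcPull f i rfl U $(e1 m))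
    rw [map_mul, map_pow, C.bcPull_coord th.on on₀] at this
    rw [this, mul_zero, ← RingHom.mem_ker, ← h1]
    exact h2 _
  · exact Finset.sum_congr rfl fun m _ => by rw [bcPull_id]; rfl

/-- The matrix of parallel transport between two charts. -/
def transport {U : X.Opens} (hU : U ≤ C.V) (hU' : U ≤ C'.V) (hUa : IsAffineOpen U) :
    Matrix (Fin C.r) (Fin C'.r) Γ(pullback f t, bc f t U) :=
  let _ : Algebra ℚ Γ(pullback f t, bc f t U) :=
    ((constMap (pullback.snd f t) (bc f t U)).comp (algebraMap ℚ Γ(T, ⊤))).toAlgebra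
  (C.close C' th hs hU hU' hUa).G

lemma close_τ_smul (hΦ : EulerData q i t Φ)
    {U : X.Opens} [Algebra ℚ Γ(pullback f t, bc f t U)] (hU : U ≤ C.V) (hU' : U ≤ C'.V)
    (hUa : IsAffineOpen U) (a e) : (C.close C' th hs hU hU' hUa).τ (a • e) =
      (C.close C' th hs hU hU' hUa).φ' a • (C.close C' th hs hU hU' hUa).τ e := by
  obtain ⟨Ψ, h1, h2, h3, h4, h5⟩ := C.exists_eulerFiltration th hs hΦ hU hUa
  obtain ⟨lam, e1, e2⟩ := C'.exists_lam_euler th hs hU' hUa h2 h3 h4 h5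
  exact (C.close C' th hs hU hU' hUa).τ_smul (C.trans C' hs hU hU') Ψ h1 lam e2 e1
    (fun b => h2 ▸ C.phi_sub_mem C' th hs hU hU' hUa b)
    (fun k => h2 ▸ C.bcPull_xi_zero C'.toBaseChart th hs hU hU' hUa k)
    (fun k a b h => C.reg th hs hU hUa k h) a e

lemma transport_self {U : X.Opens} (hU : U ≤ C.V) (hUa : IsAffineOpen U) :
    C.transport C th hs hU hU hUa = 1 := by
  let _ : Algebra ℚ Γ(pullback f t, bc f t U) :=
    ((constMap (pullback.snd f t) (bc f t U)).comp (algebraMap ℚ Γ(T, ⊤))).toAlgebra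
  exact (C.close C th hs hU hU hUa).G_self (fun _ => rfl) fun k a b h => C.reg th hs hU hUa k h

lemma transport_mul (hΦ : EulerData q i t Φ) {U : X.Opens} (hU : U ≤ C.V) (hU' : U ≤ C'.V)
    (hU'' : U ≤ C''.V) (hUa : IsAffineOpen U) :
    C.transport C'' th hs hU hU'' hUa =
      C.transport C' th hs hU hU' hUa * C'.transport C'' th hs hU' hU'' hUa := by
  let _ : Algebra ℚ Γ(pullback f t, bc f t U) :=
    ((constMap (pullback.snd f t) (bc f t U)).comp (algebraMap ℚ Γ(T, ⊤))).toAlgebra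
  obtain ⟨Ψ, h1, h2, h3, h4, h5⟩ := C.exists_eulerFiltration th hs hΦ hU hUa
  obtain ⟨lam, -, e2⟩ := C'.exists_lam_euler th hs hU' hUa h2 h3 h4 h5
  obtain ⟨lam', e1', e2'⟩ := C''.exists_lam_euler th hs hU'' hUa h2 h3 h4 h5
  exact (C.close C' th hs hU hU' hUa).G_mul (C'.close C'' th hs hU' hU'' hUa)
    (C.close C'' th hs hU hU'' hUa) rfl rfl rfl (C.close_τ_smul C' th hs hΦ hU hU' hUa)
    (C'.close_τ_smul C'' th hs hΦ hU' hU'' hUa) (C.close_τ_smul C'' th hs hΦ hU hU'' hUa)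
    (C.trans C' hs hU hU') (C'.trans C'' hs hU' hU'') (C.trans C'' hs hU hU'') Ψ h1 lam e2 lam' e2'
    e1' (fun k => h2 ▸ C.bcPull_xi_zero C'.toBaseChart th hs hU hU' hUa k)
    (fun k => h2 ▸ C'.bcPull_xi_zero C''.toBaseChart th hs hU' hU'' hUa k)
    (fun k => h2 ▸ C.bcPull_xi_zero C''.toBaseChart th hs hU hU'' hUa k)
    (fun k a b h => C.reg th hs hU hUa k h) (fun k a b h => C'.reg th hs hU' hUa k h)

lemma resO_transport {U V : X.Opens} (hU : U ≤ C.V) (hU' : U ≤ C'.V) (hUa : IsAffineOpen U)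
    (hV : V ≤ U) (hVa : IsAffineOpen V) :
    (C.transport C' th hs hU hU' hUa).map (resO (bc_mono f hV)) =
      C.transport C' th hs (hV.trans hU) (hV.trans hU') hVa := by
  let _ : Algebra ℚ Γ(pullback f t, bc f t U) :=
    ((constMap (pullback.snd f t) (bc f t U)).comp (algebraMap ℚ Γ(T, ⊤))).toAlgebra
  let _ : Algebra ℚ Γ(pullback f t, bc f t V) :=
    ((constMap (pullback.snd f t) (bc f t V)).comp (algebraMap ℚ Γ(T, ⊤))).toAlgebra
  exact (C.close C' th hs hU hU' hUa).G_map (C.close C' th hs (hV.trans hU) (hV.trans hU') hVa)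
    (resO (bc_mono f hV)) (resM E.M (bc_mono f hV)) (resO (bc_mono f hV)) rfl
    (C.resM_nabla hs hU hV) (C.κ_resM hs hU hV) (C'.resM_frame hs hU' hV)
    (C.resO_phi th hs hU hUa hV hVa) (C.resO_xi C'.toBaseChart th hs hU hU' hUa hV hVa)

variable {T' T₀' : Scheme.{0}} [IsAffine T'] [IsAffine T₀'] {t' : T' ⟶ S} {i' : T₀' ⟶ T'}
    (th' : Thickening q s i' t') [Algebra ℚ Γ(T', ⊤)] (u : T' ⟶ T) (w : u ≫ t = t')

lemma bcPull_transport (u₀ : T₀' ⟶ T₀)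
    (hu : u₀ ≫ i = i' ≫ u) {U : X.Opens} (hU : U ≤ C.V) (hU' : U ≤ C'.V) (hUa : IsAffineOpen U) :
    (C.transport C' th hs hU hU' hUa).map (bcPull f u w U) =
      C.transport C' th' hs hU hU' hUa := by
  let _ : Algebra ℚ Γ(pullback f t, bc f t U) :=
    ((constMap (pullback.snd f t) (bc f t U)).comp (algebraMap ℚ Γ(T, ⊤))).toAlgebra
  let _ : Algebra ℚ Γ(pullback f t', bc f t' U) :=
    ((constMap (pullback.snd f t') (bc f t' U)).comp (algebraMap ℚ Γ(T', ⊤))).toAlgebra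
  exact (C.close C' th hs hU hU' hUa).G_map (C.close C' th' hs hU hU' hUa)
    (RingHom.id _) (AddMonoidHom.id _) (bcPull f u w U) rfl (fun _ _ => rfl) (fun _ => rfl)
    (fun _ => rfl) (C.bcPull_phi th hs th' u w u₀ hu hU hUa)
    (C.bcPull_xi C'.toBaseChart th hs th' u w u₀ hu hU hU' hUa)

/-- Parallel transport is horizontal. -/
lemma map_transport (hΦ : EulerData q i t Φ) (u₀ : T₀' ⟶ T₀) (hu : u₀ ≫ i = i' ≫ u) {U : X.Opens}
    (hU : U ≤ C.V) (hU' : U ≤ C'.V) (hUa : IsAffineOpen U)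
    (δ : Γ(pullback f t, bc f t U) →+ Γ(pullback f t', bc f t' U))
    (hδ : ∀ a b, δ (a * b) = bcPull f u w U a * δ b + bcPull f u w U b * δ a)
    (hc : ∀ x, δ (constMap (pullback.snd f t) _ (constMap (t ≫ q) ⊤ x)) = 0)
    (hlog : ∀ l a, MemIdeal ((D l).comap (pullback.fst f t)) a →
        MemIdeal ((D l).comap (pullback.fst f t')) (δ a)) :
    (C.transport C' th hs hU hU' hUa).map δ = C.transport C' th' hs hU hU' hUa *
      (∑ m, (C'.logChart th'.on).div (C'.le_logChart th'.on hU') m (δ (C'.coord th.on hU' m)) •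
        ((C'.loc hs hU').A m).map (C'.phi th' hs hU' hUa) :
          Matrix (Fin C'.r) (Fin C'.r) Γ(pullback f t', bc f t' U)) -
      (∑ m, (C.logChart th'.on).div (C.le_logChart th'.on hU) m (δ (C.coord th.on hU m)) •
        ((C.loc hs hU).A m).map (C.phi th' hs hU hUa) :
          Matrix (Fin C.r) (Fin C.r) Γ(pullback f t', bc f t' U)) *
        C.transport C' th' hs hU hU' hUa := by
  let _ : Algebra ℚ Γ(pullback f t, bc f t U) :=
    ((constMap (pullback.snd f t) (bc f t U)).comp (algebraMap ℚ Γ(T, ⊤))).toAlgebra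
  let _ : Algebra ℚ Γ(pullback f t', bc f t' U) :=
    ((constMap (pullback.snd f t') (bc f t' U)).comp (algebraMap ℚ Γ(T', ⊤))).toAlgebra
  have key := (C.close C' th hs hU hU' hUa).delta_G (bcPull f u w U) δ _ _
    (C.close_τ_smul C' th hs hΦ hU hU' hUa) (C.trans C' hs hU hU') hδ
    (C.exists_lam th hs th' u w hU hUa δ hδ hc hlog _ fun _ => rfl).2
    (C'.exists_lam th hs th' u w hU' hUa δ hδ hc hlog _ fun _ => rfl).2
    (fun k a b h => C.reg th' hs hU hUa k (m := C.w k) (by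
      rw [← C.bcPull_phi th hs th' u w u₀ hu hU hUa]; exact h))
  have e1 : ∀ b, bcPull f u w U ((C.close C' th hs hU hU' hUa).φ b) = C.phi th' hs hU hUa b :=
    C.bcPull_phi th hs th' u w u₀ hu hU hUa
  have e2 : ∀ b, bcPull f u w U ((C.close C' th hs hU hU' hUa).φ' b) = C'.phi th' hs hU' hUa b :=
    C'.bcPull_phi th hs th' u w u₀ hu hU' hUa
  have e3 := C.bcPull_transport C' th hs th' u w u₀ hu hU hU' hUa
  have e1' : ∀ m, ((C.loc hs hU).A m).map ((bcPull f u w U).comp (C.close C' th hs hU hU' hUa).φ) =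
      ((C.loc hs hU).A m).map (C.phi th' hs hU hUa) := fun m => by
    ext x y; exact e1 _
  have e2' : ∀ m, ((C'.loc hs hU').A m).map
      ((bcPull f u w U).comp (C.close C' th hs hU hU' hUa).φ') =
      ((C'.loc hs hU').A m).map (C'.phi th' hs hU' hUa) := fun m => by
    ext x y; exact e2 _
  simp only [e1', e2'] at key
  rw [← e3]
  exact key

end FramedChart

end

section

variable {X S B : Scheme.{0}} {f : X ⟶ S} {ι : Type} {D : ι → X.IdealSheafData}
  {q : S ⟶ B} {s : B ⟶ S} [IsAffine B] {E : FlatBundleOver f D s}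

/-- The matrices of the connection on a thickening that is the pullback along the retraction. -/
abbrev FramedChart.conn (C : FramedChart q E) {T T₀ : Scheme.{0}} [IsAffine T] [IsAffine T₀]
    {t : T ⟶ S} {i : T₀ ⟶ T} (th : Thickening q s i t) (hs : s ≫ q = 𝟙 _) {U : X.Opens}
    (hU : U ≤ C.V) (hUa : IsAffineOpen U) (k : Fin C.n) :
    Matrix (Fin C.r) (Fin C.r) Γ(pullback f t, bc f t U) :=
  ((C.loc hs hU).A k).map (C.phi th hs hU hUa)

lemma FramedChart.resO_conn (C : FramedChart q E) {T T₀ : Scheme.{0}} [IsAffine T] [IsAffine T₀]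
    {t : T ⟶ S} {i : T₀ ⟶ T} (th : Thickening q s i t) (hs : s ≫ q = 𝟙 _) {U V : X.Opens}
    (hU : U ≤ C.V) (hUa : IsAffineOpen U) (hV : V ≤ U) (hVa : IsAffineOpen V) (k : Fin C.n) :
    (C.conn th hs hU hUa k).map (resO (bc_mono f hV)) = C.conn th hs (hV.trans hU) hVa k := by
  rw [FramedChart.conn, FramedChart.conn, ← C.map_A hs hU hV]
  ext x y
  exact C.resO_phi th hs hU hUa hV hVa _

lemma FramedChart.flat_conn (C : FramedChart q E) {T T₀ : Scheme.{0}} [IsAffine T] [IsAffine T₀]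
    {t : T ⟶ S} {i : T₀ ⟶ T} (th : Thickening q s i t) (hs : s ≫ q = 𝟙 _) {U : X.Opens}
    (hU : U ≤ C.V) (hUa : IsAffineOpen U) (k l : Fin C.n) :
    (C.conn th hs hU hUa l).map (((C.logChart th.on).der k).app _ (C.le_logChart th.on hU)) -
    (C.conn th hs hU hUa k).map (((C.logChart th.on).der l).app _ (C.le_logChart th.on hU)) +
    C.conn th hs hU hUa k * C.conn th hs hU hUa l - C.conn th hs hU hUa l * C.conn th hs hU hUa k =
      0 := by
  have h (k l) : (C.conn th hs hU hUa l).map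
      (((C.logChart th.on).der k).app _ (C.le_logChart th.on hU)) =
      (((C.loc hs hU).A l).map ((C.loc hs hU).D k)).map (C.phi th hs hU hUa) := by
    ext x y
    exact C.phi_der th hs hU hUa k _
  have := congrArg (fun M => M.map (C.phi th hs hU hUa)) ((C.loc hs hU).flat k l)
  rw [h, h]
  simpa only [Matrix.map_sub _ (map_sub _), Matrix.map_add _ (map_add _), Matrix.map_mul,
    Matrix.map_zero _ (map_zero _)] using this

/-- Cocycles given on affine open subsets that define flat bundles with given connection matrices
over a thickening. -/
structure LocalCocycle {J : Type} (C : J → FramedChart q E) {T T₀ : Scheme.{0}} [IsAffine T]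
    [IsAffine T₀] {t : T ⟶ S} {i : T₀ ⟶ T} (th : Thickening q s i t) (hs : s ≫ q = 𝟙 _) where
  G : ∀ (a b : J) (U : X.Opens), U ≤ (C a).V → U ≤ (C b).V → IsAffineOpen U →
    Matrix (Fin (C a).r) (Fin (C b).r) Γ(pullback f t, bc f t U)
  res : ∀ (a b : J) (U V : X.Opens) (ha : U ≤ (C a).V) (hb : U ≤ (C b).V) (hU : IsAffineOpen U)
    (hV : V ≤ U) (hVa : IsAffineOpen V), (G a b U ha hb hU).map (resO (bc_mono f hV)) =
      G a b V (hV.trans ha) (hV.trans hb) hVa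
  self : ∀ a U ha hU, G a a U ha ha hU = 1
  mul : ∀ a b c U ha hb hc hU, G a b U ha hb hU * G b c U hb hc hU = G a c U ha hc hU
  gauge : ∀ (a b : J) (U : X.Opens) (ha : U ≤ (C a).V) (hb : U ≤ (C b).V) (hU : IsAffineOpen U)
    (k : Fin (C a).n), (G a b U ha hb hU).map
      ((((C a).logChart th.on).der k).app _ ((C a).le_logChart th.on ha)) = G a b U ha hb hU *
      (∑ m, ((C b).logChart th.on).lam (((C a).logChart th.on).der k)
        ((C a).le_logChart th.on ha) ((C b).le_logChart th.on hb) m •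
          (C b).conn th hs hb hU m :
          Matrix (Fin (C b).r) (Fin (C b).r) Γ(pullback f t, bc f t U)) -
      (C a).conn th hs ha hU k * G a b U ha hb hU

namespace LocalCocycle

variable {J : Type} {C : J → FramedChart q E} {T T₀ : Scheme.{0}} [IsAffine T]
    [IsAffine T₀] {t : T ⟶ S} {i : T₀ ⟶ T} {th : Thickening q s i t} {hs : s ≫ q = 𝟙 _}

/-- The cocycle given by parallel transport. -/
def ofTransport (C : J → FramedChart q E) (th : Thickening q s i t) (hs : s ≫ q = 𝟙 _)
    [Algebra ℚ Γ(T, ⊤)] {Φ : EulerFiltration Γ(T, ⊤)} (hΦ : EulerData q i t Φ) :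
    LocalCocycle C th hs where
  G a b _ ha hb hU := (C a).transport (C b) th hs ha hb hU
  res a b _ _ ha hb hU hV hVa := (C a).resO_transport (C b) th hs ha hb hU hV hVa
  self a _ ha hU := (C a).transport_self th hs ha hU
  mul a b c _ ha hb hc hU := ((C a).transport_mul (C b) (C c) th hs hΦ ha hb hc hU).symm
  gauge a b U ha hb hU k := by
    have := (C a).map_transport (C b) th hs th (𝟙 T) (Category.id_comp _) hΦ (𝟙 _)
      (by rw [Category.id_comp, Category.comp_id]) ha hb hU
      ((((C a).logChart th.on).der k).app _ ((C a).le_logChart th.on ha))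
      (fun x y => by rw [bcPull_id, bcPull_id, LogField.leibniz])
      (fun x => LogField.constMap _ _ _) (fun l x => LogField.log (((C a).logChart th.on).der k) l _ _ x)
    refine this.trans (congrArg₂ _ rfl (congrArg (· * _) ?_))
    refine (Finset.sum_congr rfl fun m _ => congrArg (· • _)
      (((C a).logChart th.on).lam_der ((C a).le_logChart th.on ha) k m)).trans ?_
    simp only [ite_smul, one_smul, zero_smul, Finset.sum_ite_eq', Finset.mem_univ, if_true]

lemma matrix_ext {W : X.Opens} {O : (pullback f t).Opens} (hO : O = bc f t W) {m n : ℕ}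
    {M N : Matrix (Fin m) (Fin n) Γ(pullback f t, O)}
    (h : ∀ (U : X.Opens) (_ : U ≤ W) (h' : bc f t U ≤ O), IsAffineOpen U →
      M.map (resO h') = N.map (resO h')) : M = N := by
  subst hO
  ext x y
  exact bc_ext f fun U hU hUa => congr($(h U hU (bc_mono f hU) hUa) x y)

variable (N : LocalCocycle C th hs)

lemma exists_glue (a b : J) : ∃ M : Matrix (Fin (C a).r) (Fin (C b).r)
    Γ(pullback f t, bc f t (C a).V ⊓ bc f t (C b).V),
    ∀ (U : X.Opens) (ha : U ≤ (C a).V) (hb : U ≤ (C b).V) (hU : IsAffineOpen U),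
      M.map (resO (le_inf (bc_mono f ha) (bc_mono f hb))) = N.G a b U ha hb hU := by
  have key (x y) := exists_bc_glue f (t := t) (W := (C a).V ⊓ (C b).V)
    (fun U hU hUa => N.G a b U (hU.trans inf_le_left) (hU.trans inf_le_right) hUa x y)
    fun U V hU hUa hV hVa => congr($(N.res a b U V (hU.trans inf_le_left) (hU.trans inf_le_right)
      hUa hV hVa) x y)
  choose M hM using key
  refine ⟨fun x y => M x y, fun U ha hb hU => ?_⟩
  ext x y
  exact hM x y U (le_inf ha hb) hU

/-- The transition matrices over the intersections of charts. -/
def glued (a b : J) : Matrix (Fin (C a).r) (Fin (C b).r)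
    Γ(pullback f t, bc f t (C a).V ⊓ bc f t (C b).V) := (N.exists_glue a b).choose

lemma glued_map (a b : J) {U : X.Opens} (ha : U ≤ (C a).V) (hb : U ≤ (C b).V)
    (hU : IsAffineOpen U) :
    (N.glued a b).map (resO (le_inf (bc_mono f ha) (bc_mono f hb))) = N.G a b U ha hb hU :=
  (N.exists_glue a b).choose_spec U ha hb hU

variable (hC : ∀ x : (pullback f s : Scheme), ∃ a, pullback.fst f s x ∈ (C a).V)

lemma _root_.Isomonodromy.exists_mem_bc (ht : OnSection q s t) (y : (pullback f t : Scheme)) :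
    ∃ x : (pullback f s : Scheme), pullback.fst f s x = pullback.fst f t y := by
  obtain ⟨z, hz, -⟩ := Scheme.Pullback.exists_preimage_pullback (f := f) (g := s)
    (pullback.fst f t y) (q (t (pullback.snd f t y))) (by
      rw [← ht, ← Scheme.Hom.comp_apply, pullback.condition, Scheme.Hom.comp_apply])
  exact ⟨z, hz⟩

lemma gauge_glued (a b : J) (k : Fin (C a).n) : (N.glued a b).map
      ((((C a).logChart th.on).der k).app _
        (inf_le_left.trans ((C a).le_logChart th.on le_rfl))) = N.glued a b *
      (∑ m, ((C b).logChart th.on).lam (((C a).logChart th.on).der k)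
        (inf_le_left.trans ((C a).le_logChart th.on le_rfl))
        (inf_le_right.trans ((C b).le_logChart th.on le_rfl)) m •
          ((C b).conn th hs le_rfl (C b).affine m).map (resO inf_le_right) :
          Matrix (Fin (C b).r) (Fin (C b).r) Γ(pullback f t, bc f t (C a).V ⊓ bc f t (C b).V)) -
      (((C a).conn th hs le_rfl (C a).affine k).map (resO inf_le_left) :
        Matrix (Fin (C a).r) (Fin (C a).r) Γ(pullback f t, bc f t (C a).V ⊓ bc f t (C b).V)) *
      N.glued a b :=
  matrix_ext (W := (C a).V ⊓ (C b).V) (O := _ ⊓ _) rfl fun U hU h' hUa => by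
    have ha := hU.trans inf_le_left
    have hb := hU.trans inf_le_right
    have key := N.gauge a b U ha hb hUa k
    rw [← N.glued_map a b ha hb hUa, ← (C a).resO_conn th hs le_rfl (C a).affine ha hUa] at key
    simp only [← (C b).resO_conn th hs le_rfl (C b).affine hb hUa] at key
    refine (BundleDatum.map_app_res _ _ _ _).trans (key.trans ?_)
    rw [Matrix.map_sub _ (map_sub _), Matrix.map_mul, Matrix.map_mul, map_sum_smul]
    simp only [map_resO_resO, LogChart.res_lam]

/-- The flat bundle given by a local cocycle. -/
def datum : BundleDatum (pullback.snd f t) (fun l => (D l).comap (pullback.fst f t))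
    (fun a => (C a).n) (fun a => (C a).r) where
  Z :=
  { V := fun a => bc f t (C a).V
    cover := fun y => by
      obtain ⟨x, hx⟩ := exists_mem_bc th.on y
      obtain ⟨a, ha⟩ := hC x
      exact ⟨a, by rw [hx] at ha; exact ha⟩
    G := N.glued
    G_self := fun a => matrix_ext (W := (C a).V) (inf_idem _) fun U hU h' hUa => by
      refine (N.glued_map a a hU hU hUa).trans ((N.self _ _ _ _).trans ?_)
      exact (Matrix.map_one _ (map_zero _) (map_one _)).symm
    G_mul := fun a b c U ha hb hc => by
      have h1 : U ≤ bc f t ((C a).V ⊓ (C b).V ⊓ (C c).V) := le_inf (le_inf ha hb) hc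
      have h2 : (C a).V ⊓ (C b).V ⊓ (C c).V ≤ (C a).V := inf_le_left.trans inf_le_left
      have h3 : (C a).V ⊓ (C b).V ⊓ (C c).V ≤ (C b).V := inf_le_left.trans inf_le_right
      have h4 : (C a).V ⊓ (C b).V ⊓ (C c).V ≤ (C c).V := inf_le_right
      have key : ((N.glued a b).map (resO (le_inf (bc_mono f h2) (bc_mono f h3)))) *
          ((N.glued b c).map (resO (le_inf (bc_mono f h3) (bc_mono f h4)))) =
          (N.glued a c).map (resO (le_inf (bc_mono f h2) (bc_mono f h4))) :=
        matrix_ext rfl fun V hV h' hVa => by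
          rw [Matrix.map_mul, map_resO_resO, map_resO_resO, map_resO_resO,
            N.glued_map a b (hV.trans h2) (hV.trans h3) hVa,
            N.glued_map b c (hV.trans h3) (hV.trans h4) hVa,
            N.glued_map a c (hV.trans h2) (hV.trans h4) hVa, N.mul]
      have := congrArg (fun M => M.map (resO h1)) key
      rwa [Matrix.map_mul, map_resO_resO, map_resO_resO, map_resO_resO] at this }
  ch a := (C a).logChart th.on
  V_le a := (C a).le_logChart th.on le_rfl
  A a k := (C a).conn th hs le_rfl (C a).affine k
  flat a k l := (C a).flat_conn th hs le_rfl (C a).affine k l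
  gauge a b k := N.gauge_glued a b k

section Descend

variable {T' T₀' : Scheme.{0}} [IsAffine T'] [IsAffine T₀'] {t' : T' ⟶ S} {i' : T₀' ⟶ T'}
    {th' : Thickening q s i' t'} (u : T' ⟶ T) (w : u ≫ t = t') (u₀ : T₀' ⟶ T₀)
    (hu : u₀ ≫ i = i' ≫ u)

lemma map_conn (hu : u₀ ≫ i = i' ≫ u) (a : J) {U : X.Opens} (ha : U ≤ (C a).V) (hU : IsAffineOpen U)
    (k : Fin (C a).n) :
    ((C a).conn th hs ha hU k).map (bcPull f u w U) = (C a).conn th' hs ha hU k := by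
  ext x y
  exact (C a).bcPull_phi th hs th' u w u₀ hu ha hU _

lemma isPullback (N' : LocalCocycle C th' hs) (hu : u₀ ≫ i = i' ≫ u)
    (h : ∀ a b U ha hb hU, (N.G a b U ha hb hU).map (bcPull f u w U) = N'.G a b U ha hb hU) :
    (N.datum hC : BundleDatum _ _ _ _).IsPullback (bcMap f u w) (N'.datum hC) where
  chart a := (C a).logChart_isPullback th.on th'.on u w
  le a := bc_le f u w _
  G a b := matrix_ext (W := (C a).V ⊓ (C b).V) (O := _ ⊓ _) rfl fun U hU h' hUa => by
    refine (N'.glued_map a b (hU.trans inf_le_left) (hU.trans inf_le_right) hUa).trans ?_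
    rw [← h, ← N.glued_map]
    ext x y
    exact appLE_resO (bcMap f u w) _ _ _ _ _
  A a k := (map_conn u w u₀ hu a le_rfl (C a).affine k).symm

/-- Descent of a cocycle along a dominant morphism. -/
def descend (N' : LocalCocycle C th' hs)
    (hinj : ∀ a U, U ≤ (C a).V → IsAffineOpen U → Function.Injective (bcPull f u w U))
    (hN : ∀ a b U ha hb hU, ∃ M : Matrix (Fin (C a).r) (Fin (C b).r) Γ(pullback f t, bc f t U),
      M.map (bcPull f u w U) = N'.G a b U ha hb hU)
    (hu : u₀ ≫ i = i' ≫ u) : LocalCocycle C th hs where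
  G a b U ha hb hU := (hN a b U ha hb hU).choose
  res a b U V ha hb hU hV hVa := by
    apply Matrix.map_injective (hinj a V (hV.trans ha) hVa)
    dsimp only
    have h1 := (hN a b U ha hb hU).choose_spec
    set M := (hN a b U ha hb hU).choose
    rw [(hN a b V _ _ hVa).choose_spec, ← N'.res a b U V ha hb hU hV hVa, ← h1]
    ext x y
    exact (resO_bcPull f u w hV _).symm
  self a U ha hU := by
    apply Matrix.map_injective (hinj a U ha hU)
    dsimp only
    rw [(hN a a U ha ha hU).choose_spec, N'.self, Matrix.map_one _ (map_zero _) (map_one _)]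
  mul a b c U ha hb hc hU := by
    apply Matrix.map_injective (hinj a U ha hU)
    dsimp only
    rw [Matrix.map_mul, (hN a b U ha hb hU).choose_spec, (hN b c U hb hc hU).choose_spec,
      (hN a c U ha hc hU).choose_spec, N'.mul]
  gauge a b U ha hb hU k := by
    have h1 := (hN a b U ha hb hU).choose_spec
    set M := (hN a b U ha hb hU).choose
    have p (a) := (C a).logChart_isPullback th.on th'.on u w
    have hd (x) : ((((C a).logChart th'.on).der k).app _ ((C a).le_logChart th'.on ha))
        (bcPull f u w U x) = bcPull f u w U ((((C a).logChart th.on).der k).app _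
          ((C a).le_logChart th.on ha) x) :=
      (p a).der (bcMap_snd f u w) ((C a).le_logChart th.on ha) ((C a).le_logChart th'.on ha)
        (bc_le f u w U) k x
    have hlam (m) : ((C b).logChart th'.on).lam (((C a).logChart th'.on).der k)
        ((C a).le_logChart th'.on ha) ((C b).le_logChart th'.on hb) m =
        bcPull f u w U (((C b).logChart th.on).lam (((C a).logChart th.on).der k)
        ((C a).le_logChart th.on ha) ((C b).le_logChart th.on hb) m) :=
      (p b).lam ((C a).le_logChart th.on ha) ((C b).le_logChart th.on hb)
        ((C a).le_logChart th'.on ha) ((C b).le_logChart th'.on hb) (bc_le f u w U)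
        (((C a).logChart th.on).der k) (((C a).logChart th'.on).der k) hd m
    apply Matrix.map_injective (hinj a U ha hU)
    dsimp only
    have key := N'.gauge a b U ha hb hU k
    simp only [hlam, ← h1, ← map_conn (th := th) (th' := th') u w u₀ hu a ha hU,
      ← map_conn (th := th) (th' := th') u w u₀ hu b hb hU] at key
    rw [Matrix.map_sub _ (map_sub _), Matrix.map_mul, Matrix.map_mul, map_sum_smul, ← key]
    ext x y
    exact (hd _).symm

lemma map_descend (N' : LocalCocycle C th' hs)
    (hinj : ∀ a U, U ≤ (C a).V → IsAffineOpen U → Function.Injective (bcPull f u w U))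
    (hN : ∀ a b U ha hb hU, ∃ M : Matrix (Fin (C a).r) (Fin (C b).r) Γ(pullback f t, bc f t U),
      M.map (bcPull f u w U) = N'.G a b U ha hb hU) (a b U ha hb hU) :
    ((N'.descend (th := th) u w u₀ hinj hN hu).G a b U ha hb hU).map (bcPull f u w U) =
      N'.G a b U ha hb hU := (hN a b U ha hb hU).choose_spec

end Descend

end LocalCocycle

end

section

/-! ### Formal flat bundles given by cocycles -/

section Formal

variable {X S : Scheme.{0}} {f : X ⟶ S} {ι : Type} {D : ι → X.IdealSheafData}
  {J : Type} {n r : J → ℕ}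

/-- The formal flat bundle given by a compatible system of data. -/
abbrev formalBundle {𝒯 : Tower S} [∀ m, IsAffine (𝒯.T m)]
    (N : ∀ m, BundleDatum (pullback.snd f (𝒯.t m)) (fun l => (D l).comap (pullback.fst f (𝒯.t m))) n r)
    (p : ∀ m, (N (m + 1)).IsPullback (𝒯.incl f m) (N m)) : FormalFlatBundle f D 𝒯 where
  E m := (N m).bundle
  β m := (p m).pullbackMap

/-- The identification of formal flat bundles given by the compatibility of data. -/
def formalPullbackMap {𝒬 𝒮 : Tower S} [∀ m, IsAffine (𝒬.T m)] [∀ m, IsAffine (𝒮.T m)]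
    (j : TowerMap 𝒬 𝒮)
    (N : ∀ m, BundleDatum (pullback.snd f (𝒮.t m)) (fun l => (D l).comap (pullback.fst f (𝒮.t m))) n r)
    (p : ∀ m, (N (m + 1)).IsPullback (𝒮.incl f m) (N m))
    (N' : ∀ m, BundleDatum (pullback.snd f (𝒬.t m)) (fun l => (D l).comap (pullback.fst f (𝒬.t m))) n r)
    (p' : ∀ m, (N' (m + 1)).IsPullback (𝒬.incl f m) (N' m))
    (pj : ∀ m, (N m).IsPullback (bcMap f (j.j m) (j.w m)) (N' m)) :
    FormalPullbackMap f D j (formalBundle N p) (formalBundle N' p') where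
  γ m := (pj m).pullbackMap
  comm m U V U' V' h₁ h₂ h₃ h₄ e := (N' m).Z.vec_ext fun a O hO ha => by
    have k1 : O ≤ 𝒬.incl f m ⁻¹ᵁ (V ⊓ (N' (m + 1)).Z.V a) :=
      le_inf (hO.trans h₂) (ha.trans ((p' m).le a))
    have k2 : V ⊓ (N' (m + 1)).Z.V a ≤ bcMap f (j.j (m + 1)) (j.w (m + 1)) ⁻¹ᵁ
      (U ⊓ (N (m + 1)).Z.V a) := inf_le_inf h₁ ((pj (m + 1)).le a)
    have k3 : O ≤ bcMap f (j.j m) (j.w m) ⁻¹ᵁ (U' ⊓ (N m).Z.V a) :=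
      le_inf (hO.trans h₄) (ha.trans ((pj m).le a))
    have k4 : U' ⊓ (N m).Z.V a ≤ 𝒮.incl f m ⁻¹ᵁ (U ⊓ (N (m + 1)).Z.V a) :=
      inf_le_inf h₃ ((p m).le a)
    refine ((p' m).vec_app a h₂ inf_le_left inf_le_right hO ha k1 _).trans ?_
    refine (congrArg _ ((pj (m + 1)).vec_app a h₁ inf_le_left inf_le_right inf_le_left inf_le_right
      k2 e)).trans ?_
    refine Eq.trans ?_ ((pj m).vec_app a h₄ inf_le_left inf_le_right hO ha k3 _).symm
    refine Eq.trans ?_ (congrArg _ ((p m).vec_app a h₃ inf_le_left inf_le_right inf_le_left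
      inf_le_right k4 e)).symm
    ext x
    simp only [Function.comp_apply, ← CommRingCat.comp_apply, Scheme.Hom.appLE_comp_appLE]
    have e1 : 𝒬.incl f m ≫ bcMap f (j.j (m + 1)) (j.w (m + 1)) =
        bcMap f (j.j m) (j.w m) ≫ 𝒮.incl f m := by
      rw [bcMap_comp f _ (j.w (m + 1)) _ (𝒬.w m) _ rfl (by rw [Category.assoc, j.w, 𝒬.w]),
        bcMap_comp f _ (𝒮.w m) _ (j.w m) _ (j.comm m) (by rw [Category.assoc, j.w, 𝒬.w])]
    simp only [e1]

end Formal

/-! ### Absolute connections -/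

variable {X S B : Scheme.{0}} {f : X ⟶ S} {ι : Type} {D : ι → X.IdealSheafData}
  {q : S ⟶ B} {s : B ⟶ S} [IsAffine B] {𝒯 : Tower S} [∀ m, IsAffine (𝒯.T m)]

namespace AbsField

variable {W : X.Opens} (δ : AbsField f D q 𝒯 W)

lemma constMap (m : ℕ) {U : X.Opens} (hW : U ≤ W) (x : Γ(B, ⊤)) :
    δ.app m U hW (Isomonodromy.constMap (pullback.snd f (𝒯.t (m + 1))) _
      (Isomonodromy.constMap (𝒯.t (m + 1) ≫ q) ⊤ x)) = 0 := by
  have e : Isomonodromy.constMap (pullback.snd f (𝒯.t (m + 1))) (𝒯.opens f (m + 1) U)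
      (Isomonodromy.constMap (𝒯.t (m + 1) ≫ q) ⊤ x) =
      ((pullback.fst f (𝒯.t (m + 1)) ≫ f ≫ q).appLE ⊤ _ (fun _ _ => trivial)).hom x := by
    rw [Isomonodromy.constMap, Isomonodromy.constMap, ← CommRingCat.comp_apply,
      Scheme.Hom.appLE_comp_appLE]
    have e' : pullback.snd f (𝒯.t (m + 1)) ≫ 𝒯.t (m + 1) ≫ q =
        pullback.fst f (𝒯.t (m + 1)) ≫ f ≫ q := by
      rw [← Category.assoc, ← pullback.condition, Category.assoc]
    simp only [e']
  rw [e]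
  exact δ.const m U hW ⊤ _ x

variable (C : BaseChart f D q s) (on : ∀ m, OnSection q s (𝒯.t m))

/-- The coefficients of an absolute vector field in the directions of the coordinates. -/
def lam (m : ℕ) {U : X.Opens} (hU : U ≤ C.V) (hW : U ≤ W) (k : Fin C.n) :
    Γ(𝒯.fam f m, 𝒯.opens f m U) :=
  (C.logChart (on m)).div (C.le_logChart (on m) hU) k (δ.app m U hW (C.coord (on (m + 1)) hU k))

lemma lam_spec (m : ℕ) {U : X.Opens} (hU : U ≤ C.V) (hW : U ≤ W) (k : Fin C.n) :
    C.coord (on m) hU k ^ C.w k * δ.lam C on m hU hW k =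
      δ.app m U hW (C.coord (on (m + 1)) hU k) :=
  (C.logChart (on m)).div_spec _ _ (C.divisible (on m) hU k fun l hl =>
    δ.log m l U hW _ (C.memIdeal_coord (on (m + 1)) hU k l hl))

lemma lam_eq (m : ℕ) {U : X.Opens} (hU : U ≤ C.V) (hW : U ≤ W) (k : Fin C.n) {a}
    (ha : C.coord (on m) hU k ^ C.w k * a = δ.app m U hW (C.coord (on (m + 1)) hU k)) :
    δ.lam C on m hU hW k = a :=
  C.coord_pow_cancel (on m) hU k (C.w k) ((δ.lam_spec C on m hU hW k).trans ha.symm)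

lemma resO_lam (m : ℕ) {U V : X.Opens} (hU : U ≤ C.V) (hW : U ≤ W) (hV : V ≤ U) (k : Fin C.n) :
    resO (bc_mono f hV) (δ.lam C on m hU hW k) =
      δ.lam C on m (hV.trans hU) (hV.trans hW) k := by
  refine (δ.lam_eq C on m (hV.trans hU) (hV.trans hW) k ?_).symm
  have := congr(resO (bc_mono f hV) $(δ.lam_spec C on m hU hW k))
  rw [map_mul, map_pow, δ.res_app m U V hW hV] at this
  erw [LogChart.resO_coord, LogChart.resO_coord] at this
  exact this

lemma red_lam (m : ℕ) {U : X.Opens} (hU : U ≤ C.V) (hW : U ≤ W) (k : Fin C.n) :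
    𝒯.red f m U (δ.lam C on (m + 1) hU hW k) = δ.lam C on m hU hW k := by
  refine (δ.lam_eq C on m hU hW k ?_).symm
  have := congr(𝒯.red f m U $(δ.lam_spec C on (m + 1) hU hW k))
  rw [map_mul, map_pow, δ.red_app] at this
  have e (m : ℕ) : 𝒯.red f m U (C.coord (on (m + 1)) hU k) = C.coord (on m) hU k :=
    C.bcPull_coord (on (m + 1)) (on m) (𝒯.i m) (𝒯.w m) hU k
  rwa [e, e] at this

end AbsField

/-- Sections over base changes of open sets are determined by their coordinates on affine open
sets. -/
lemma ext_bc {T : Scheme.{0}} {t : T ⟶ S} {J : Type} {r : J → ℕ}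
    {Z : VectorCocycle (pullback f t) r} {V : J → X.Opens} (hV : ∀ a, Z.V a = bc f t (V a))
    {W : X.Opens} {e e' : Γ(Z.bundle, bc f t W)}
    (h : ∀ a (U : X.Opens) (hW : U ≤ W) (ha : bc f t U ≤ Z.V a), U ≤ V a → IsAffineOpen U →
      Z.vec a e (bc_mono f hW) ha = Z.vec a e' (bc_mono f hW) ha) : e = e' := by
  refine Z.vec_ext fun a O hO ha => ?_
  ext x
  refine resO_ext fun y hy => ?_
  obtain ⟨U, hUa, hU, hyU⟩ := exists_affine_mem (U := W ⊓ V a) (x := pullback.fst f t y)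
    ⟨hO hy, show y ∈ bc f t (V a) from hV a ▸ ha hy⟩
  have ha' : bc f t U ≤ Z.V a := (hV a).symm ▸ bc_mono f (hU.trans inf_le_right)
  refine ⟨O ⊓ bc f t U, inf_le_left, ⟨hy, hyU⟩, ?_⟩
  have := congrArg (fun v => resV (inf_le_right : O ⊓ bc f t U ≤ _) v x)
    (h a U (hU.trans inf_le_left) ha' (hU.trans inf_le_right) hUa)
  simp only [VectorCocycle.resV_vec] at this
  rw [← resV_apply, ← resV_apply, VectorCocycle.resV_vec, VectorCocycle.resV_vec]
  exact this

namespace LocalCocycle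

variable {E : FlatBundleOver f D s} {J : Type} {C : J → FramedChart q E} {T T₀ : Scheme.{0}}
  [IsAffine T] [IsAffine T₀] {t : T ⟶ S} {i : T₀ ⟶ T} {th : Thickening q s i t}
  {hs : s ≫ q = 𝟙 _} (N : LocalCocycle C th hs)
  (hC : ∀ x : (pullback f s : Scheme), ∃ a, pullback.fst f s x ∈ (C a).V) {W : X.Opens}

/-- The sections of the bundle given by a cocycle. -/
abbrev Sec (W : X.Opens) : Type := Γ((N.datum hC).bundle.M, bc f t W)

/-- The coordinates of a section over an open subset of a chart. -/
def vec (a : J) (e : N.Sec hC W) {U : X.Opens} (ha : U ≤ (C a).V) (hW : U ≤ W) :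
    Fin (C a).r → Γ(pullback f t, bc f t U) :=
  (N.datum hC).Z.vec a e (bc_mono f hW) (show bc f t U ≤ bc f t (C a).V from bc_mono f ha)

lemma sec_ext {e e' : N.Sec hC W} (h : ∀ a (U : X.Opens) (ha : U ≤ (C a).V) (hW : U ≤ W),
    IsAffineOpen U → N.vec hC a e ha hW = N.vec hC a e' ha hW) : e = e' :=
  ext_bc (Z := (N.datum hC).Z) (V := fun a => (C a).V) (fun _ => rfl)
    fun a U hW _ ha hU => h a U ha hW hU

lemma vec_add (a : J) (e e' : N.Sec hC W) {U : X.Opens} (ha : U ≤ (C a).V) (hW : U ≤ W) :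
    N.vec hC a (e + e') ha hW = N.vec hC a e ha hW + N.vec hC a e' ha hW :=
  (N.datum hC).Z.vec_add _ _ _ _ _

lemma vec_sub (a : J) (e e' : N.Sec hC W) {U : X.Opens} (ha : U ≤ (C a).V) (hW : U ≤ W) :
    N.vec hC a (e - e') ha hW = N.vec hC a e ha hW - N.vec hC a e' ha hW :=
  (N.datum hC).Z.vec_sub _ _ _ _ _

lemma vec_smul (a : J) (x : Γ(pullback f t, bc f t W)) (e : N.Sec hC W) {U : X.Opens}
    (ha : U ≤ (C a).V) (hW : U ≤ W) :
    N.vec hC a (x • e : N.Sec hC W) ha hW = resO (bc_mono f hW) x • N.vec hC a e ha hW :=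
  (N.datum hC).Z.vec_smul _ _ _ _ _

lemma resV_vec (a : J) (e : N.Sec hC W) {U V : X.Opens} (ha : U ≤ (C a).V) (hW : U ≤ W)
    (hV : V ≤ U) : resV (bc_mono f hV) (N.vec hC a e ha hW) =
      N.vec hC a e (hV.trans ha) (hV.trans hW) :=
  (N.datum hC).Z.resV_vec a e (bc_mono f hW) _ (bc_mono f hV)

lemma vec_resM (a : J) {W' : X.Opens} (h : W' ≤ W) (e : N.Sec hC W) {U : X.Opens}
    (ha : U ≤ (C a).V) (hW : U ≤ W') :
    N.vec hC a (resM (N.datum hC).bundle.M (bc_mono f h) e) ha hW =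
      N.vec hC a e ha (hW.trans h) :=
  (N.datum hC).Z.vec_res a e (bc_mono f h) (bc_mono f hW) _

lemma on_eq (a b : J) {U : X.Opens} (ha : U ≤ (C a).V) (hb : U ≤ (C b).V) (hU : IsAffineOpen U)
    (ha' : bc f t U ≤ (N.datum hC).Z.V a) (hb' : bc f t U ≤ (N.datum hC).Z.V b) :
    (N.datum hC).Z.on a b ha' hb' = N.G a b U ha hb hU := N.glued_map a b ha hb hU

lemma G_mulVec_vec (a b : J) (e : N.Sec hC W) {U : X.Opens} (ha : U ≤ (C a).V)
    (hb : U ≤ (C b).V) (hW : U ≤ W) (hU : IsAffineOpen U) :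
    (N.G a b U ha hb hU).mulVec (N.vec hC b e hb hW) = N.vec hC a e ha hW := by
  rw [← N.on_eq hC a b ha hb hU (bc_mono f ha) (bc_mono f hb)]
  exact (N.datum hC).Z.on_mulVec_vec _ _ _ _ _ _

lemma vec_nabla (a : J) (θ : LogField (pullback.snd f t)
    (fun l => (D l).comap (pullback.fst f t)) (bc f t W)) (e : N.Sec hC W) {U : X.Opens}
    (ha : U ≤ (C a).V) (hW : U ≤ W) : N.vec hC a ((N.datum hC).bundle.nabla _ θ e) ha hW =
      θ.app _ (bc_mono f hW) ∘ N.vec hC a e ha hW +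
      (∑ k, ((C a).logChart th.on).lam θ (bc_mono f hW) ((C a).le_logChart th.on ha) k •
        ((C a).conn th hs le_rfl (C a).affine k).map (resO (bc_mono f ha)) :
        Matrix (Fin (C a).r) (Fin (C a).r) Γ(pullback f t, bc f t U)).mulVec
        (N.vec hC a e ha hW) := (N.datum hC).vec_nabla a θ e _ _

lemma exists_sec (v : ∀ a, Fin (C a).r → Γ(pullback f t, bc f t (W ⊓ (C a).V)))
    (hv : ∀ a b (U : X.Opens) (ha : U ≤ (C a).V) (hb : U ≤ (C b).V) (hW : U ≤ W)
      (hU : IsAffineOpen U), (N.G a b U ha hb hU).mulVec (resV (bc_mono f (le_inf hW hb)) (v b)) =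
        resV (bc_mono f (le_inf hW ha)) (v a)) :
    ∃ e : N.Sec hC W, ∀ a (U : X.Opens) (ha : U ≤ (C a).V) (hW : U ≤ W),
      N.vec hC a e ha hW = resV (bc_mono f (le_inf hW ha)) (v a) := by
  have res {O : (pullback f t).Opens} {U : X.Opens} (a : J) (hU : U ≤ W ⊓ (C a).V)
      (hO : O ≤ bc f t U) (hO' : O ≤ bc f t (W ⊓ (C a).V)) :
      resV hO (resV (bc_mono f hU) (v a)) = resV hO' (v a) := by
    ext x; simp only [resV_apply, resO_resO]
  refine ⟨(N.datum hC).Z.mkSection (fun a => resV (U := bc f t (W ⊓ (C a).V))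
    (V := bc f t W ⊓ (N.datum hC).Z.V a) le_rfl (v a)) fun a b O hO ha hb => ?_,
    fun a U ha hW => ?_⟩
  · have h1 : O ≤ bc f t (W ⊓ (C a).V ⊓ (C b).V) := le_inf (le_inf hO ha) hb
    have h2 : W ⊓ (C a).V ⊓ (C b).V ≤ W := inf_le_left.trans inf_le_left
    have h3 : W ⊓ (C a).V ⊓ (C b).V ≤ (C a).V := inf_le_left.trans inf_le_right
    have h4 : W ⊓ (C a).V ⊓ (C b).V ≤ (C b).V := inf_le_right
    have key : resV (bc_mono f (le_inf h2 h3)) (v a) =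
        ((N.datum hC).Z.on a b (bc_mono f h3) (bc_mono f h4)).mulVec
          (resV (bc_mono f (le_inf h2 h4)) (v b)) := by
      ext x
      refine bc_ext f fun U hU hUa => ?_
      refine congrFun (?_ : resV (bc_mono f hU) _ = resV (bc_mono f hU) _) x
      rw [resV_mulVec, res a (le_inf h2 h3) _ (bc_mono f (hU.trans (le_inf h2 h3))),
        res b (le_inf h2 h4) _ (bc_mono f (hU.trans (le_inf h2 h4)))]
      refine ((hv a b U (hU.trans h3) (hU.trans h4) (hU.trans h2) hUa).symm.trans ?_)
      congr 1
      refine (N.on_eq hC a b (hU.trans h3) (hU.trans h4) hUa (bc_mono f (hU.trans h3))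
        (bc_mono f (hU.trans h4))).symm.trans ?_
      exact ((N.datum hC).Z.on_map a b _ _ _).symm
    have := congrArg (fun v => resV h1 v) key
    rw [resV_mulVec, res a (le_inf h2 h3) h1 (le_inf hO ha),
      res b (le_inf h2 h4) h1 (le_inf hO hb)] at this
    have e1 (c) (hc : O ≤ (N.datum hC).Z.V c) (hc' : O ≤ bc f t (W ⊓ (C c).V)) :
        resV (le_inf hO hc) (resV (U := bc f t (W ⊓ (C c).V))
          (V := bc f t W ⊓ (N.datum hC).Z.V c) le_rfl (v c)) = resV hc' (v c) :=
      funext fun x => resO_resO _ _ _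
    refine (e1 a ha _).trans (this.trans ?_)
    refine (congrArg (Matrix.mulVec _) (e1 b hb (le_inf hO hb)).symm).trans ?_
    exact congrArg (fun M => Matrix.mulVec M _) ((N.datum hC).Z.on_map a b _ _ h1)
  · exact (VectorCocycle.vec_mkSection _ _ _ _ _ _).trans (funext fun x => resO_resO _ _ _)

end LocalCocycle

end

section

variable {X S B : Scheme.{0}} {f : X ⟶ S} {ι : Type} {D : ι → X.IdealSheafData}
  {q : S ⟶ B} {s : B ⟶ S} [IsAffine B] {𝒯 : Tower S} [∀ m, IsAffine (𝒯.T m)]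
  {E : FlatBundleOver f D s}

/-- A tower of thickenings with Euler filtrations. -/
structure EulerTower (q : S ⟶ B) (s : B ⟶ S) (𝒯 : Tower S) (T₀ : Scheme.{0})
    [∀ m, Algebra ℚ Γ(𝒯.T m, ⊤)] where
  i : ∀ m, T₀ ⟶ 𝒯.T m
  th : ∀ m, Thickening q s (i m) (𝒯.t m)
  comm : ∀ m, i m ≫ 𝒯.i m = i (m + 1)
  Φ : ∀ m, EulerFiltration Γ(𝒯.T m, ⊤)
  hΦ : ∀ m, EulerData q (i m) (𝒯.t m) (Φ m)
  hs : s ≫ q = 𝟙 _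

namespace EulerTower

variable {T₀ : Scheme.{0}} [IsAffine T₀] [∀ m, Algebra ℚ Γ(𝒯.T m, ⊤)]
  (P : EulerTower q s 𝒯 T₀) {J : Type} (C : J → FramedChart q E)
  (hC : ∀ x : (pullback f s : Scheme), ∃ a, pullback.fst f s x ∈ (C a).V)

/-- The cocycles given by parallel transport. -/
abbrev cocycle (m : ℕ) : LocalCocycle C (P.th m) P.hs := .ofTransport C (P.th m) P.hs (P.hΦ m)

/-- The bundles on the levels of the tower given by parallel transport. -/
abbrev datum (m : ℕ) := (P.cocycle C m).datum hC

lemma map_cocycle (m : ℕ) (a b : J) (U : X.Opens) (ha : U ≤ (C a).V) (hb : U ≤ (C b).V)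
    (hU : IsAffineOpen U) : ((P.cocycle C (m + 1)).G a b U ha hb hU).map
      (bcPull f (𝒯.i m) (𝒯.w m) U) = (P.cocycle C m).G a b U ha hb hU :=
  (C a).bcPull_transport (C b) (P.th (m + 1)) P.hs (P.th m) (𝒯.i m) (𝒯.w m) (𝟙 _)
    (by rw [Category.id_comp, P.comm]) ha hb hU

lemma isPullback_datum (m : ℕ) : (P.datum C hC (m + 1)).IsPullback (𝒯.incl f m) (P.datum C hC m) :=
  LocalCocycle.isPullback _ hC (𝒯.i m) (𝒯.w m) (𝟙 _) _ (by rw [Category.id_comp, P.comm])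
    (P.map_cocycle C m)

/-- The formal flat bundle given by parallel transport. -/
abbrev formal : FormalFlatBundle f D 𝒯 := formalBundle (P.datum C hC) (P.isPullback_datum C hC)

variable {W : X.Opens} (δ δ₁ δ₂ : AbsField f D q 𝒯 W) (m : ℕ) (a b : J)

lemma on (P : EulerTower q s 𝒯 T₀) (m : ℕ) : OnSection q s (𝒯.t m) := (P.th m).on

/-- The connection matrices on open subsets of charts. -/
abbrev mat {U : X.Opens} (ha : U ≤ (C a).V) (k : Fin (C a).n) :
    Matrix (Fin (C a).r) (Fin (C a).r) Γ(𝒯.fam f m, 𝒯.opens f m U) :=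
  ((C a).conn (P.th m) P.hs le_rfl (C a).affine k).map (resO (bc_mono f ha))

lemma mat_eq {U : X.Opens} (ha : U ≤ (C a).V) (hU : IsAffineOpen U) (k : Fin (C a).n) :
    P.mat C m a ha k = (C a).conn (P.th m) P.hs ha hU k :=
  (C a).resO_conn (P.th m) P.hs le_rfl (C a).affine ha hU k

lemma red_mat {U : X.Opens} (ha : U ≤ (C a).V) (k : Fin (C a).n) :
    (P.mat C (m + 1) a ha k).map (𝒯.red f m U) = P.mat C m a ha k := by
  rw [mat, mat, ← LocalCocycle.map_conn (th := P.th (m + 1)) (th' := P.th m) (𝒯.i m) (𝒯.w m) (𝟙 _)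
    (by rw [Category.id_comp, P.comm]) a le_rfl (C a).affine k]
  ext x y
  exact (resO_bcPull f (𝒯.i m) (𝒯.w m) ha _).symm

/-- The matrix of the absolute connection. -/
def absConn {U : X.Opens} (ha : U ≤ (C a).V) (hW : U ≤ W) :
    Matrix (Fin (C a).r) (Fin (C a).r) Γ(𝒯.fam f m, 𝒯.opens f m U) :=
  ∑ k, δ.lam (C a).toBaseChart P.on m ha hW k • P.mat C m a ha k

lemma resO_absConn {U V : X.Opens} (ha : U ≤ (C a).V) (hW : U ≤ W) (hV : V ≤ U) :
    (P.absConn C δ m a ha hW).map (resO (bc_mono f hV)) =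
      P.absConn C δ m a (hV.trans ha) (hV.trans hW) := by
  rw [absConn, map_sum_smul]
  simp only [AbsField.resO_lam _ _ _ _ _ _ hV, map_resO_resO]
  rfl

lemma red_absConn {U : X.Opens} (ha : U ≤ (C a).V) (hW : U ≤ W) :
    (P.absConn C δ (m + 1) a ha hW).map (𝒯.red f m U) = P.absConn C δ m a ha hW := by
  rw [absConn, map_sum_smul]
  simp only [AbsField.red_lam, red_mat]
  rfl

/-- The absolute covariant derivative in coordinates. -/
def cov {U : X.Opens} (ha : U ≤ (C a).V) (hW : U ≤ W)
    (v : Fin (C a).r → Γ(𝒯.fam f (m + 1), 𝒯.opens f (m + 1) U)) :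
    Fin (C a).r → Γ(𝒯.fam f m, 𝒯.opens f m U) :=
  δ.app m U hW ∘ v + (P.absConn C δ m a ha hW).mulVec (𝒯.red f m U ∘ v)

lemma resO_red {U V : X.Opens} (hV : V ≤ U) (x : Γ(𝒯.fam f (m + 1), 𝒯.opens f (m + 1) U)) :
    resO (𝒯.opens_mono f m hV) (𝒯.red f m U x) =
      𝒯.red f m V (resO (𝒯.opens_mono f (m + 1) hV) x) :=
  resO_bcPull f (𝒯.i m) (𝒯.w m) hV x

lemma resV_cov {U V : X.Opens} (ha : U ≤ (C a).V) (hW : U ≤ W) (hV : V ≤ U) (v) :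
    resV (𝒯.opens_mono f m hV) (P.cov C δ m a ha hW v) =
      P.cov C δ m a (hV.trans ha) (hV.trans hW) (resV (𝒯.opens_mono f (m + 1) hV) v) := by
  rw [cov, map_add, resV_mulVec, P.resO_absConn C δ m a ha hW hV, cov]
  congr 1
  · ext x
    exact δ.res_app m U V hW hV _
  · congr 1
    ext x
    exact resO_red m hV _

lemma cov_add {U : X.Opens} (ha : U ≤ (C a).V) (hW : U ≤ W) (v v') :
    P.cov C δ m a ha hW (v + v') = P.cov C δ m a ha hW v + P.cov C δ m a ha hW v' := by
  have e1 : δ.app m U hW ∘ (v + v') = δ.app m U hW ∘ v + δ.app m U hW ∘ v' := by ext; simp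
  have e2 : 𝒯.red f m U ∘ (v + v') = 𝒯.red f m U ∘ v + 𝒯.red f m U ∘ v' := by ext; simp
  rw [cov, cov, cov, e1, e2, Matrix.mulVec_add]
  abel

/-- Parallel transport commutes with the absolute connection. -/
lemma G_mulVec_cov {U : X.Opens} (ha : U ≤ (C a).V) (hb : U ≤ (C b).V) (hW : U ≤ W)
    (hU : IsAffineOpen U) (v) : ((P.cocycle C m).G a b U ha hb hU).mulVec (P.cov C δ m b hb hW v) =
      P.cov C δ m a ha hW (((P.cocycle C (m + 1)).G a b U ha hb hU).mulVec v) := by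
  have key := (C a).map_transport (C b) (P.th (m + 1)) P.hs (P.th m) (𝒯.i m) (𝒯.w m)
    (P.hΦ (m + 1)) (𝟙 _) (by rw [Category.id_comp, P.comm]) ha hb hU (δ.app m U hW)
    (δ.leibniz m U hW) (δ.constMap m hW) (fun l x => δ.log m l U hW x)
  have key' : ((P.cocycle C (m + 1)).G a b U ha hb hU).map (δ.app m U hW) =
      (P.cocycle C m).G a b U ha hb hU * P.absConn C δ m b hb hW -
      P.absConn C δ m a ha hW * (P.cocycle C m).G a b U ha hb hU := by
    rw [absConn, absConn]
    simp only [P.mat_eq C m _ _ hU]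
    exact key
  have e1 := P.map_cocycle C m a b U ha hb hU
  set G := (P.cocycle C (m + 1)).G a b U ha hb hU
  have e2 : 𝒯.red f m U ∘ (G.mulVec v) =
      ((P.cocycle C m).G a b U ha hb hU).mulVec (𝒯.red f m U ∘ v) := by
    rw [← e1]
    ext x
    exact RingHom.map_mulVec _ _ _ _
  rw [cov, cov, map_mulVec_of_leibniz (𝒯.red f m U) _ (δ.leibniz m U hW), e2, key',
    show G.map (𝒯.red f m U) = _ from e1, Matrix.sub_mulVec, Matrix.mulVec_add,
    Matrix.mulVec_mulVec, Matrix.mulVec_mulVec]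
  abel

lemma exists_nabla (e : (P.formal C hC).sec (m + 1) W) :
    ∃ e' : (P.formal C hC).sec m W, ∀ a (U : X.Opens) (ha : U ≤ (C a).V) (hW : U ≤ W),
      (P.cocycle C m).vec hC a e' ha hW =
        P.cov C δ m a ha hW ((P.cocycle C (m + 1)).vec hC a e ha hW) := by
  have h (a) (U : X.Opens) (ha : U ≤ (C a).V) (hW : U ≤ W) :
      resV (𝒯.opens_mono f m (le_inf hW ha)) (P.cov C δ m a inf_le_right inf_le_left
        ((P.cocycle C (m + 1)).vec hC a e inf_le_right inf_le_left)) =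
        P.cov C δ m a ha hW ((P.cocycle C (m + 1)).vec hC a e ha hW) := by
    rw [P.resV_cov C δ m a _ _ (le_inf hW ha),
      (P.cocycle C (m + 1)).resV_vec hC a e _ _ (le_inf hW ha)]
  obtain ⟨e', he'⟩ := (P.cocycle C m).exists_sec hC (fun a => P.cov C δ m a inf_le_right inf_le_left
    ((P.cocycle C (m + 1)).vec hC a e inf_le_right inf_le_left))
    fun a b U ha hb hW hU => by
      rw [h a U ha hW, h b U hb hW, P.G_mulVec_cov, LocalCocycle.G_mulVec_vec]
  exact ⟨e', fun a U ha hW => (he' a U ha hW).trans (h a U ha hW)⟩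

/-- The absolute connection. -/
def nabla : (P.formal C hC).sec (m + 1) W →+ (P.formal C hC).sec m W :=
  AddMonoidHom.mk' (fun e => (P.exists_nabla C hC δ m e).choose) fun e e' =>
    (P.cocycle C m).sec_ext hC fun a U ha hW _ => by
      rw [LocalCocycle.vec_add, (P.exists_nabla C hC δ m _).choose_spec,
        (P.exists_nabla C hC δ m _).choose_spec, (P.exists_nabla C hC δ m _).choose_spec,
        ← P.cov_add, LocalCocycle.vec_add]

lemma vec_nabla (e : (P.formal C hC).sec (m + 1) W) {U : X.Opens} (ha : U ≤ (C a).V)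
    (hW : U ≤ W) : (P.cocycle C m).vec hC a (P.nabla C hC δ m e) ha hW =
      P.cov C δ m a ha hW ((P.cocycle C (m + 1)).vec hC a e ha hW) :=
  (P.exists_nabla C hC δ m e).choose_spec a U ha hW

lemma vec_red (e : (P.formal C hC).sec (m + 1) W) {U : X.Opens} (ha : U ≤ (C a).V)
    (hW : U ≤ W) : (P.cocycle C m).vec hC a ((P.formal C hC).red m W e) ha hW =
      𝒯.red f m U ∘ (P.cocycle C (m + 1)).vec hC a e ha hW :=
  (P.isPullback_datum C hC m).vec_app a (𝒯.opens_le f m W) (bc_mono f hW) _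
    (bc_mono f hW) _ (𝒯.opens_le f m U) e

end EulerTower

end

section

variable {X S B : Scheme.{0}} {f : X ⟶ S} {ι : Type} {D : ι → X.IdealSheafData}
  {q : S ⟶ B} {s : B ⟶ S} [IsAffine B] {𝒯 : Tower S} [∀ m, IsAffine (𝒯.T m)]
  {E : FlatBundleOver f D s}

namespace EulerTower

variable {T₀ : Scheme.{0}} [IsAffine T₀] [∀ m, Algebra ℚ Γ(𝒯.T m, ⊤)]
  (P : EulerTower q s 𝒯 T₀) {J : Type} (C : J → FramedChart q E)
  (hC : ∀ x : (pullback f s : Scheme), ∃ a, pullback.fst f s x ∈ (C a).V)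
  {W : X.Opens} (δ δ₁ δ₂ : AbsField f D q 𝒯 W) (m : ℕ) (a : J)

lemma red_cov {U : X.Opens} (ha : U ≤ (C a).V) (hW : U ≤ W) (v) :
    𝒯.red f m U ∘ P.cov C δ (m + 1) a ha hW v =
      P.cov C δ m a ha hW (𝒯.red f (m + 1) U ∘ v) := by
  ext x
  have e := RingHom.map_mulVec (𝒯.red f m U) (P.absConn C δ (m + 1) a ha hW)
    (𝒯.red f (m + 1) U ∘ v) x
  rw [P.red_absConn C δ m a ha hW] at e
  simp only [cov, Function.comp_apply, Pi.add_apply, map_add, δ.red_app]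
  rw [e]

lemma absConn_linear {r : Γ(𝒯.fam f m, 𝒯.opens f m W)}
    (h : ∀ (V : X.Opens) (hV : V ≤ W) (a : Γ(𝒯.fam f (m + 1), 𝒯.opens f (m + 1) V)),
      δ.app m V hV a = resO (𝒯.opens_mono f m hV) r * δ₁.app m V hV a + δ₂.app m V hV a)
    {U : X.Opens} (ha : U ≤ (C a).V) (hW : U ≤ W) : P.absConn C δ m a ha hW =
      resO (𝒯.opens_mono f m hW) r • P.absConn C δ₁ m a ha hW + P.absConn C δ₂ m a ha hW := by
  rw [absConn, absConn, absConn, Finset.smul_sum, ← Finset.sum_add_distrib]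
  refine Finset.sum_congr rfl fun k _ => ?_
  rw [smul_smul, ← add_smul]
  congr 1
  apply δ.lam_eq
  rw [h, ← δ₁.lam_spec, ← δ₂.lam_spec]
  ring

/-- The derivatives of the connection matrices along an absolute vector field. -/
lemma map_mat {U : X.Opens} (ha : U ≤ (C a).V) (hW : U ≤ W) (hU : IsAffineOpen U)
    (k : Fin (C a).n) : (P.mat C (m + 1) a ha k).map (δ.app m U hW) =
      ∑ l, δ.lam (C a).toBaseChart P.on m ha hW l •
        (P.mat C m a ha k).map ((((C a).logChart (P.on m)).der l).app _
          ((C a).le_logChart (P.on m) ha)) := by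
  rw [P.mat_eq C (m + 1) a ha hU, P.mat_eq C m a ha hU]
  ext x y
  simp only [Matrix.map_apply, Matrix.sum_apply, Matrix.smul_apply, smul_eq_mul]
  refine (((C a).exists_lam (P.th (m + 1)) P.hs (P.th m) (𝒯.i m) (𝒯.w m) ha hU (δ.app m U hW)
    (δ.leibniz m U hW) (δ.constMap m hW) (fun l x => δ.log m l U hW x) _ fun _ => rfl).2 _).trans ?_
  refine Finset.sum_congr rfl fun l _ => ?_
  congr 1
  rw [(C a).bcPull_phi (P.th (m + 1)) P.hs (P.th m) (𝒯.i m) (𝒯.w m) (𝟙 _)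
    (by rw [Category.id_comp, P.comm])]
  exact ((C a).phi_der (P.th m) P.hs ha hU l _).symm

/-- The absolute connection on the bundle given by parallel transport. -/
def absConnection : AbsConnection q (P.formal C hC) where
  nabla W δ m := P.nabla C hC δ m
  res_nabla W W' h δ m e := (P.cocycle C m).sec_ext hC fun a U ha hW _ => by
    refine ((P.cocycle C m).vec_resM hC a h _ ha hW).trans ?_
    rw [P.vec_nabla, P.vec_nabla]
    exact congrArg _ ((P.cocycle C (m + 1)).vec_resM hC a h e ha hW).symm
  red_nabla W δ m e := (P.cocycle C m).sec_ext hC fun a U ha hW _ => by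
    rw [P.vec_red, P.vec_nabla, P.vec_nabla, P.vec_red, red_cov]
  linear W r δ δ₁ δ₂ _ h m e := (P.cocycle C m).sec_ext hC fun a U ha hW _ => by
    refine Eq.trans ?_ ((P.cocycle C m).vec_add hC a _ _ ha hW).symm
    have e1 : δ.app m U hW ∘ (P.cocycle C (m + 1)).vec hC a e ha hW =
        resO (𝒯.opens_mono f m hW) (r m) • δ₁.app m U hW ∘ (P.cocycle C (m + 1)).vec hC a e ha hW +
          δ₂.app m U hW ∘ (P.cocycle C (m + 1)).vec hC a e ha hW := by
      ext x; simp [h]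
    rw [P.vec_nabla]
    refine Eq.trans ?_ (congrArg (· + _) ((P.cocycle C m).vec_smul hC a _ _ ha hW).symm)
    rw [P.vec_nabla, P.vec_nabla, cov, cov, cov, P.absConn_linear C δ δ₁ δ₂ m a (h m) ha hW, e1,
      Matrix.add_mulVec, Matrix.smul_mulVec, smul_add]
    abel
  leibniz W δ m x e := (P.cocycle C m).sec_ext hC fun a U ha hW _ => by
    refine Eq.trans ?_ ((P.cocycle C m).vec_add hC a _ _ ha hW).symm
    rw [P.vec_nabla]
    refine Eq.trans ?_ (congrArg₂ (· + ·) ((P.cocycle C m).vec_smul hC a _ _ ha hW).symm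
      ((P.cocycle C m).vec_smul hC a _ _ ha hW).symm)
    have e0 := (P.cocycle C (m + 1)).vec_smul hC a x e ha hW
    rw [P.vec_nabla, P.vec_red, resO_red m hW, δ.res_app m W U le_rfl hW]
    refine (congrArg (P.cov C δ m a ha hW) e0).trans ?_
    set v := (P.cocycle C (m + 1)).vec hC a e ha hW
    set y := resO (bc_mono f hW) x
    have e1 : δ.app m U hW ∘ (y • v) = 𝒯.red f m U y • (δ.app m U hW ∘ v) +
        δ.app m U hW y • (𝒯.red f m U ∘ v) := by
      ext z; exact (δ.leibniz m U hW y (v z)).trans (congrArg₂ (· + ·) rfl (mul_comm _ _))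
    have e2 : 𝒯.red f m U ∘ (y • v) = 𝒯.red f m U y • (𝒯.red f m U ∘ v) := by
      ext z; exact map_mul _ _ _
    rw [cov, cov, e1, e2, Matrix.mulVec_smul, smul_add]
    abel
  flat W δ δ₁ δ₂ h m e := (P.cocycle C m).sec_ext hC fun a U ha hW hU => by
    refine Eq.trans ?_ ((P.cocycle C m).vec_sub hC a _ _ ha hW).symm
    rw [P.vec_nabla, P.vec_red, P.vec_nabla, P.vec_nabla, P.vec_nabla, P.vec_nabla]
    have key := nabla_comm (𝒯.red f (m + 1) U) (𝒯.red f m U) (δ₁.app (m + 1) U hW)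
      (δ₂.app (m + 1) U hW) (δ₁.app m U hW) (δ₂.app m U hW) (δ.app m U hW) (δ₁.leibniz m U hW)
      (δ₂.leibniz m U hW) (δ₁.red_app m U hW) (δ₂.red_app m U hW) (h m U hW)
      (P.mat C (m + 1) a ha) (δ₁.lam (C a).toBaseChart P.on (m + 1) ha hW)
      (δ₂.lam (C a).toBaseChart P.on (m + 1) ha hW)
      (fun l k => (P.mat C m a ha k).map ((((C a).logChart (P.on m)).der l).app _
          ((C a).le_logChart (P.on m) ha)))
      (fun k => by simp only [AbsField.red_lam]; exact P.map_mat C δ₁ m a ha hW hU k)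
      (fun k => by simp only [AbsField.red_lam]; exact P.map_mat C δ₂ m a ha hW hU k)
      (fun k l => by
        rw [P.red_mat, P.red_mat, P.mat_eq C m a ha hU, P.mat_eq C m a ha hU]
        exact (C a).flat_conn (P.th m) P.hs ha hU k l)
      ((P.cocycle C (m + 2)).vec hC a e ha hW)
    have e1 : ∑ k, (δ₁.app m U hW (δ₂.lam (C a).toBaseChart P.on (m + 1) ha hW k) -
        δ₂.app m U hW (δ₁.lam (C a).toBaseChart P.on (m + 1) ha hW k)) •
          (P.mat C (m + 1) a ha k).map (𝒯.red f m U) = P.absConn C δ m a ha hW := by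
      refine Finset.sum_congr rfl fun k _ => ?_
      rw [P.red_mat]
      congr 1
      symm
      apply δ.lam_eq
      have e2 : 𝒯.red f (m + 1) U ((C a).coord (P.on (m + 2)) ha k) =
          (C a).coord (P.on (m + 1)) ha k :=
        (C a).bcPull_coord (P.on (m + 2)) (P.on (m + 1)) (𝒯.i (m + 1)) (𝒯.w (m + 1)) ha k
      have e3 : 𝒯.red f m U ((C a).coord (P.on (m + 1)) ha k) = (C a).coord (P.on m) ha k :=
        (C a).bcPull_coord (P.on (m + 1)) (P.on m) (𝒯.i m) (𝒯.w m) ha k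
      rw [← e2, h m U hW, ← δ₁.lam_spec (C a).toBaseChart P.on,
        ← δ₂.lam_spec (C a).toBaseChart P.on]
      rcases (C a).w_eq k with hk | hk
      · simp [hk]
      · simp only [hk, pow_one, δ₁.leibniz, δ₂.leibniz, e3, ← δ₁.lam_spec (C a).toBaseChart P.on,
          ← δ₂.lam_spec (C a).toBaseChart P.on, AbsField.red_lam]
        ring
    rw [e1] at key
    simp only [AbsField.red_lam, P.red_mat] at key
    exact key
  extend W δ θ h m e := (P.cocycle C m).sec_ext hC fun a U ha hW _ => by
    refine Eq.trans ?_ ((P.cocycle C m).vec_nabla hC a (θ m) _ ha hW).symm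
    rw [P.vec_nabla, P.vec_red, cov]
    congr 1
    · ext x; exact h m U hW _
    · congr 1
      refine Finset.sum_congr rfl fun k _ => ?_
      congr 1
      apply δ.lam_eq
      refine (LogChart.lam_spec _ _ _ _ _).trans (Eq.trans (congrArg _ ?_) (h m U hW _).symm)
      exact ((C a).bcPull_coord (P.on (m + 1)) (P.on m) (𝒯.i m) (𝒯.w m) ha k).symm

end EulerTower

end

section

/-! ### Coordinates of sections with respect to a frame -/

lemma resM_resM {Y : Scheme.{0}} (M : Y.Modules) {U V W : Y.Opens} (h : V ≤ U) (h' : W ≤ V)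
    (e : Γ(M, U)) : resM M h' (resM M h e) = resM M (h'.trans h) e := by
  simp only [resM, ← AddCommGrpCat.comp_apply, ← Functor.map_comp]
  rfl

lemma resM_self {Y : Scheme.{0}} (M : Y.Modules) {U : Y.Opens} (e : Γ(M, U)) :
    resM M le_rfl e = e := by
  have : (homOfLE (le_refl U)).op = 𝟙 _ := rfl
  rw [resM, this, CategoryTheory.Functor.map_id]
  rfl

namespace IsFrame

variable {Y : Scheme.{0}} {M : Y.Modules} {U V W : Y.Opens} {n : ℕ} {e : Fin n → Γ(M, U)}
  (he : IsFrame M U e)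

lemma exists_coords (he : IsFrame M U e) (h : V ≤ U) : ∃ κ : Γ(M, V) →+ (Fin n → Γ(Y, V)), ∀ m,
    ∑ l, κ m l • (resM M h (e l) : Γ(M, V)) = m := by
  let eq := Equiv.ofBijective _ (he V h)
  refine ⟨AddMonoidHom.mk' eq.symm fun a b => ?_, eq.apply_symm_apply⟩
  rw [Equiv.symm_apply_eq, Equiv.ofBijective_apply]
  simp only [Pi.add_apply, add_smul, Finset.sum_add_distrib]
  congr 1
  · exact (eq.apply_symm_apply a).symm
  · exact (eq.apply_symm_apply b).symm

/-- The coordinates of a section. -/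
def coords (h : V ≤ U) : Γ(M, V) →+ (Fin n → Γ(Y, V)) := (he.exists_coords h).choose

lemma sum_coords (h : V ≤ U) (m : Γ(M, V)) :
    ∑ l, he.coords h m l • (resM M h (e l) : Γ(M, V)) = m := (he.exists_coords h).choose_spec m

lemma coords_eq (h : V ≤ U) (m : Γ(M, V)) {a : Fin n → Γ(Y, V)}
    (ha : ∑ l, a l • (resM M h (e l) : Γ(M, V)) = m) : he.coords h m = a :=
  (he V h).1 ((he.sum_coords h m).trans ha.symm)

lemma resV_coords (h : V ≤ U) (h' : W ≤ V) (m : Γ(M, V)) :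
    resV h' (he.coords h m) = he.coords (h'.trans h) (resM M h' m) := by
  refine (he.coords_eq _ _ ?_).symm
  conv_rhs => rw [← he.sum_coords h m]
  rw [map_sum]
  exact Finset.sum_congr rfl fun l _ => by rw [resM_smul, resM_resM]; rfl

lemma coords_smul (h : V ≤ U) (a : Γ(Y, V)) (m : Γ(M, V)) :
    he.coords h (a • m : Γ(M, V)) = a • he.coords h m :=
  he.coords_eq _ _ (by
    conv_rhs => rw [← he.sum_coords h m]
    simp only [Pi.smul_apply, smul_eq_mul, mul_smul, Finset.smul_sum])

/-- The matrix of coordinates of a family of sections. -/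
def mat (h : V ≤ U) {r : ℕ} (m : Fin r → Γ(M, V)) : Matrix (Fin n) (Fin r) Γ(Y, V) :=
  .of fun x l => he.coords h (m l) x

lemma mat_map (h : V ≤ U) (h' : W ≤ V) {r : ℕ} (m : Fin r → Γ(M, V)) :
    (he.mat h m).map (resO h') = he.mat (h'.trans h) fun l => resM M h' (m l) := by
  ext x l
  exact congrFun (he.resV_coords h h' (m l)) x

variable {U' : Y.Opens} {n' : ℕ} {e' : Fin n' → Γ(M, U')} (he' : IsFrame M U' e')

lemma mat_mulVec_coords (h : V ≤ U) (h' : V ≤ U') (m : Γ(M, V)) :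
    (he.mat h fun l => resM M h' (e' l)).mulVec (he'.coords h' m) = he.coords h m := by
  conv_rhs => rw [← he'.sum_coords h' m]
  rw [map_sum]
  ext x
  rw [Finset.sum_apply, Matrix.mulVec, dotProduct]
  exact Finset.sum_congr rfl fun l _ => by
    rw [coords_smul, Pi.smul_apply, smul_eq_mul, mul_comm]; rfl

lemma mat_mul_mat (h : V ≤ U) (h' : V ≤ U') {r : ℕ} (m : Fin r → Γ(M, V)) :
    (he.mat h fun l => resM M h' (e' l)) * he'.mat h' m = he.mat h m := by
  ext x l
  exact congrFun (he.mat_mulVec_coords he' h h' (m l)) x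

lemma mat_self (h : V ≤ U) : he.mat h (fun l => resM M h (e l)) = 1 := by
  ext x l
  rw [mat, Matrix.of_apply, he.coords_eq h _ (a := Pi.single l 1), Matrix.one_apply,
    Pi.single_apply]
  rw [Finset.sum_eq_single l]
  · simp
  · intro b _ hb; simp [hb]
  · simp

end IsFrame

/-! ### Presentations of flat bundles -/

section Presentation

variable {Y T : Scheme.{0}} [IsAffine T] {g : Y ⟶ T} {ι : Type} {D : ι → Y.IdealSheafData}
  {I : Type} {n r : I → ℕ}

/-- A presentation of a flat bundle by a datum. -/
structure BundleDatum.Presentation (N : BundleDatum g D n r) (E : LogFlatBundle g D) where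
  e : ∀ a, Fin (r a) → Γ(E.M, N.Z.V a)
  isFrame : ∀ a, IsFrame E.M (N.Z.V a) (e a)
  G : ∀ a b, N.Z.G a b = (isFrame a).mat inf_le_left fun l => resM E.M inf_le_right (e b l)
  A : ∀ a k, N.A a k = (isFrame a).mat le_rfl fun l =>
    E.nabla _ (((N.ch a).der k).restrict (N.V_le a)) (e a l)

namespace BundleDatum.Presentation

variable {N : BundleDatum g D n r} {E : LogFlatBundle g D} (P : N.Presentation E)

lemma on (P : N.Presentation E) (a b : I) {O : Y.Opens} (ha : O ≤ N.Z.V a) (hb : O ≤ N.Z.V b) :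
    N.Z.on a b ha hb = (P.isFrame a).mat ha fun l => resM E.M hb (P.e b l) := by
  rw [VectorCocycle.on, P.G, IsFrame.mat_map]
  simp only [resM_resM]

/-- The comparison with the bundle given by the datum. -/
def app (U : Y.Opens) : Γ(E.M, U) →+ Γ(N.Z.bundle, U) :=
  AddMonoidHom.mk' (fun e => N.Z.mkSection
    (fun a => (P.isFrame a).coords inf_le_right (resM E.M inf_le_left e)) fun a b O hO ha hb => by
      rw [IsFrame.resV_coords, IsFrame.resV_coords, P.on, resM_resM, resM_resM,
        IsFrame.mat_mulVec_coords])
    fun e e' => N.Z.vec_ext fun i O h h' => by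
      simp only [VectorCocycle.vec_add, VectorCocycle.vec_mkSection, ← map_add]

lemma vec_app {U O : Y.Opens} (e : Γ(E.M, U)) (a : I) (hO : O ≤ U) (ha : O ≤ N.Z.V a) :
    N.Z.vec a (P.app U e) hO ha = (P.isFrame a).coords ha (resM E.M hO e) := by
  refine (VectorCocycle.vec_mkSection _ _ _ _ _ _).trans ?_
  rw [IsFrame.resV_coords, resM_resM]

lemma app_res {U V : Y.Opens} (h : V ≤ U) (e : Γ(E.M, U)) :
    resM N.Z.bundle h (P.app U e) = P.app V (resM E.M h e) :=
  N.Z.vec_ext fun a O hO ha => by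
    rw [VectorCocycle.vec_res, vec_app, vec_app, resM_resM]

lemma app_smul {U : Y.Opens} (x : Γ(Y, U)) (e : Γ(E.M, U)) :
    P.app U (x • e : Γ(E.M, U)) = (x • P.app U e : Γ(N.Z.bundle, U)) :=
  N.Z.vec_ext fun a O hO ha => by
    rw [VectorCocycle.vec_smul, vec_app, vec_app, resM_smul, IsFrame.coords_smul]

lemma isFrame_app {U : Y.Opens} {n : ℕ} {e : Fin n → Γ(E.M, U)} (he : IsFrame E.M U e) :
    IsFrame N.Z.bundle U fun l => P.app U (e l) := by
  have h (a) : N.Z.mat a (fun l => P.app U (e l)) inf_le_left inf_le_right =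
      (P.isFrame a).mat inf_le_right fun l => resM E.M inf_le_left (e l) := by
    ext x l
    exact congrFun (P.vec_app (e l) a inf_le_left inf_le_right) x
  refine N.Z.isFrame_of_inverse
    (fun a => he.mat inf_le_left fun l => resM E.M inf_le_right (P.e a l))
    (fun a => ?_) fun a => ?_
  · rw [h, (P.isFrame a).mat_mul_mat he, (P.isFrame a).mat_self]
  · rw [h, he.mat_mul_mat (P.isFrame a), he.mat_self]

lemma coords_nabla (a : I) {O : Y.Opens} (ha : O ≤ N.Z.V a) (θ : LogField g D O) (e : Γ(E.M, O)) :
    (P.isFrame a).coords ha (E.nabla O θ e) =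
      N.cov a θ le_rfl ha ((P.isFrame a).coords ha e) := by
  have h1 (k) (l : Fin (r a)) : (P.isFrame a).coords ha
      (E.nabla O (((N.ch a).der k).restrict (ha.trans (N.V_le a))) (resM E.M ha (P.e a l))) =
      fun x => resO ha (N.A a k x l) := by
    have e1 := E.res_nabla _ _ ha (((N.ch a).der k).restrict (N.V_le a)) (P.e a l)
    have e2 := (P.isFrame a).resV_coords (le_refl _) ha
      (E.nabla _ (((N.ch a).der k).restrict (N.V_le a)) (P.e a l))
    rw [e1] at e2
    refine e2.symm.trans ?_
    ext x
    rw [resV_apply, P.A]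
    rfl
  have h2 (l) : (P.isFrame a).coords ha (E.nabla O θ (resM E.M ha (P.e a l))) =
      fun x => N.conn a θ le_rfl ha x l := by
    rw [E.nabla_eq_sum (fun k => (N.ch a).lam θ le_rfl (ha.trans (N.V_le a)) k)
      (fun k => ((N.ch a).der k).restrict (ha.trans (N.V_le a))) θ
      (fun V hV b => by
        rw [(N.ch a).app_eq_sum θ hV (hV.trans (ha.trans (N.V_le a))) b]
        exact Finset.sum_congr rfl fun p _ => by rw [LogChart.res_lam]; rfl), map_sum]
    ext x
    rw [Finset.sum_apply, BundleDatum.conn, Matrix.sum_apply]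
    refine Finset.sum_congr rfl fun k _ => ?_
    rw [IsFrame.coords_smul, h1, Pi.smul_apply, Matrix.smul_apply]
    rfl
  conv_lhs => rw [← (P.isFrame a).sum_coords ha e]
  simp only [map_sum, E.leibniz, map_add, IsFrame.coords_smul, h2]
  rw [Finset.sum_add_distrib, add_comm, BundleDatum.cov]
  congr 1
  · ext x
    have h3 := congrFun (congrFun ((P.isFrame a).mat_self ha) x)
    simp only [IsFrame.mat, Matrix.of_apply] at h3
    simp only [Finset.sum_apply, Pi.smul_apply, smul_eq_mul, h3, Matrix.one_apply, mul_ite, mul_one,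
      mul_zero, Finset.sum_ite_eq, Finset.mem_univ, if_true, Function.comp_apply]
  · ext x
    rw [Finset.sum_apply, Matrix.mulVec, dotProduct]
    exact Finset.sum_congr rfl fun l _ => mul_comm _ _

lemma app_nabla {U : Y.Opens} (θ : LogField g D U) (e : Γ(E.M, U)) :
    P.app U (E.nabla U θ e) = N.nabla U θ (P.app U e) :=
  N.Z.vec_ext fun a O hO ha => by
    rw [BundleDatum.vec_nabla, vec_app, vec_app, E.res_nabla, P.coords_nabla a ha]
    rfl

/-- The identification with the pullback of a datum that presents a flat bundle. -/
def pullbackMap {Y' T' : Scheme.{0}} [IsAffine T'] {g' : Y' ⟶ T'} {D' : ι → Y'.IdealSheafData}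
    {N' : BundleDatum g' D' n r} {h : Y' ⟶ Y} (p : N.IsPullback h N') :
    PullbackMap h E N'.bundle where
  app U U' hU := (p.app U U' hU).comp (P.app U)
  app_res U V U' V' hU hV i i' e :=
    (p.app_res U V U' V' hU hV i i' _).trans (congrArg _ (P.app_res i e))
  semilinear U U' hU a e := (congrArg _ (P.app_smul a e)).trans (p.app_smul U U' hU a _)
  frame U U' hU n e he := p.isFrame_app U U' hU n _ (P.isFrame_app he)
  horizontal U U' hU θ θ' hθ e :=
    (congrArg _ (P.app_nabla θ e)).trans (p.app_nabla U U' hU θ θ' hθ _)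

end BundleDatum.Presentation

end Presentation

/-! ### The central fibre -/

variable {X S B : Scheme.{0}} {f : X ⟶ S} {ι : Type} {D : ι → X.IdealSheafData}
  {q : S ⟶ B} {s : B ⟶ S} [IsAffine B] {E : FlatBundleOver f D s}

lemma constMap_id {T : Scheme.{0}} (x : Γ(T, ⊤)) : constMap (𝟙 T) ⊤ x = x := by
  have e : (𝟙 T : T ⟶ T).appLE ⊤ ⊤ le_top = 𝟙 _ := by
    simp only [Scheme.Hom.appLE, Scheme.Hom.id_app]
    exact (Category.id_comp _).trans (T.presheaf.map_id _)
  exact congr($(congrArg CommRingCat.Hom.hom e) x)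

lemma Thickening.refl (hs : s ≫ q = 𝟙 _) : Thickening q s (𝟙 B) s where
  on := onSection_self hs
  fac := by rw [hs, Category.id_comp, Category.id_comp]
  surj x := ⟨x, constMap_id x⟩
  nil := ⟨1, by
    rw [pow_one, Ideal.zero_eq_bot, eq_bot_iff]
    intro x hx
    rwa [RingHom.mem_ker, constMap_id] at hx⟩

lemma BaseChart.phi_refl (ch : BaseChart f D q s) (hs : s ≫ q = 𝟙 _) {U : X.Opens} (hU : U ≤ ch.V)
    (hUa : IsAffineOpen U) (a) : ch.phi (Thickening.refl hs) hs hU hUa a = a := by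
  have := ch.bcPull_phi_zero (Thickening.refl hs) hs hU hUa a
  have e (u : B ⟶ B) (hu : u = 𝟙 B) {t : B ⟶ S} (ht : t = s) (w w') :
      bcPull f u (t := s) (t' := t) w U (ch.phi (Thickening.refl hs) hs hU hUa a) =
        bcPull f (𝟙 B ≫ s ≫ q) (t := s) (t' := t) w' U a ↔
      ch.phi (Thickening.refl hs) hs hU hUa a = a := by
    subst ht hu
    have e2 : 𝟙 B ≫ t ≫ q = 𝟙 B := by rw [hs, Category.id_comp]
    simp only [e2, bcPull_id]
  exact (e (𝟙 B) rfl (Category.id_comp s) rfl _).mp this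

namespace FramedChart

variable (C : FramedChart q E) (hs : s ≫ q = 𝟙 _)

lemma κ_eq_coords {U : X.Opens} (hU : U ≤ C.V) (e : Γ(E.M, bc f s U)) :
    (C.loc hs hU).κ e = C.isFrame.coords (bc_mono f hU) e :=
  C.coords_eq hU e (C.isFrame.sum_coords (bc_mono f hU) e)

lemma conn_refl {U : X.Opens} (hU : U ≤ C.V) (hUa : IsAffineOpen U) (k : Fin C.n) :
    C.conn (Thickening.refl hs) hs hU hUa k = (C.loc hs hU).A k := by
  ext x y
  exact C.phi_refl hs hU hUa _

end FramedChart

namespace LocalCocycle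

variable {J : Type} (C : J → FramedChart q E) (hs : s ≫ q = 𝟙 _)

/-- The cocycle of a bundle on the central fibre. -/
def central : LocalCocycle C (Thickening.refl hs) hs where
  G a b _ ha hb _ := (C a).isFrame.mat (bc_mono f ha) fun l => resM E.M (bc_mono f hb) ((C b).e l)
  res a b U V ha hb hU hV hVa := by
    rw [IsFrame.mat_map]; simp only [resM_resM]
  self a U ha hU := (C a).isFrame.mat_self _
  mul a b c U ha hb hc hU := (C a).isFrame.mat_mul_mat (C b).isFrame _ _ _
  gauge a b U ha hb hU k := by
    simp only [FramedChart.conn_refl]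
    set G := (C a).isFrame.mat (bc_mono f ha) fun l => resM E.M (bc_mono f hb) ((C b).e l) with hG
    let La := (C a).loc hs ha
    let Lb := (C b).loc hs hb
    have hGk (x l) : G x l = La.κ (Lb.frame l) x :=
      (congrFun ((C a).κ_eq_coords hs ha (Lb.frame l)) x).symm
    have h1 (e) : La.κ e = G.mulVec (Lb.κ e) := by
      rw [(C a).κ_eq_coords hs ha, (C b).κ_eq_coords hs hb, IsFrame.mat_mulVec_coords]
    ext x l
    have h2 := congrFun (La.κ_nabla k (Lb.frame l)) x
    have h3 := ((C b).trans (C a) hs hb ha).nabla k (Lb.frame l)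
    rw [h3, map_sum, Finset.sum_apply] at h2
    simp only [La.κ_smul, h1, Lb.κ_frame] at h2
    rw [eq_comm, Pi.add_apply, ← eq_sub_iff_add_eq] at h2
    have h4 : G.mulVec (Pi.single l 1) = fun x => G x l := by
      ext x; simp
    rw [h4] at h2
    refine h2.trans ?_
    rw [Matrix.sub_apply]
    congr 1
    rw [Matrix.mul_sum, Matrix.sum_apply]
    refine Finset.sum_congr rfl fun m _ => ?_
    rw [Matrix.mul_smul, Matrix.smul_apply, Pi.smul_apply]
    rfl

/-- The presentation of a bundle on the central fibre by its cocycle. -/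
def presentation (hC : ∀ x : (pullback f s : Scheme), ∃ a, pullback.fst f s x ∈ (C a).V) :
    ((central C hs).datum hC).Presentation E where
  e a := (C a).e
  isFrame a := (C a).isFrame
  G a b := matrix_ext (W := (C a).V ⊓ (C b).V) (O := _ ⊓ _) rfl fun U hU h' hUa => by
    refine ((central C hs).glued_map a b (hU.trans inf_le_left) (hU.trans inf_le_right)
      hUa).trans ?_
    refine Eq.trans ?_ (IsFrame.mat_map (C a).isFrame inf_le_left (bc_mono f hU)
      (fun l => resM E.M inf_le_right ((C b).e l))).symm
    exact congrArg (IsFrame.mat _ _) (funext fun l => (resM_resM _ _ _ _).symm)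
  A a k := by
    refine ((C a).conn_refl hs le_rfl (C a).affine k).trans ?_
    ext x l
    change ((C a).loc hs le_rfl).κ (((C a).loc hs le_rfl).nabla k
      (resM E.M le_rfl ((C a).e l))) x = _
    rw [resM_self, (C a).κ_eq_coords hs le_rfl]
    rfl

variable {C} {T T₀ : Scheme.{0}} [IsAffine T] [IsAffine T₀] {t : T ⟶ S} {i : T₀ ⟶ T}
  (th : Thickening q s i t)

lemma _root_.Isomonodromy.BaseChart.bcPull_injective (ch : BaseChart f D q s)
    (th : Thickening q s i t) (hi : Function.Injective (constMap i ⊤)) {U : X.Opens} (hU : U ≤ ch.V) (hUa : IsAffineOpen U) :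
    Function.Injective (bcPull f i rfl U : Γ(pullback f t, bc f t U) →+* _) := by
  rw [RingHom.injective_iff_ker_eq_bot, ch.ker_bcPull th hU hUa,
    (RingHom.injective_iff_ker_eq_bot _).mp hi, Ideal.map_bot]

lemma map_central (hi : Function.Injective (constMap i ⊤)) [Algebra ℚ Γ(T, ⊤)] (u : T ⟶ B)
    (w : u ≫ s = t) (a b : J) (U : X.Opens) (ha : U ≤ (C a).V) (hb : U ≤ (C b).V)
    (hU : IsAffineOpen U) : ((central C hs).G a b U ha hb hU).map (bcPull f u w U) =
      (C a).transport (C b) th hs ha hb hU := by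
  have hinj := (C a).bcPull_injective th hi ha hU
  have e1 (x) : (C a).phi th hs ha hU x = bcPull f u w U x := hinj (by
    have e : t ≫ q = u := by rw [← w, Category.assoc, hs, Category.comp_id]
    rw [BaseChart.bcPull_phi_zero, bcPull_comp f u w i rfl (i ≫ t ≫ q) (by rw [e]) th.fac])
  have hxi (k) : (C a).xi (C b).toBaseChart th hs ha hb hU k ∈ (⊥ : Ideal _) := by
    rw [Ideal.mem_bot]
    exact hinj (by rw [BaseChart.bcPull_xi_zero, map_zero])
  let _ : Algebra ℚ Γ(pullback f t, bc f t U) :=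
    ((constMap (pullback.snd f t) (bc f t U)).comp (algebraMap ℚ Γ(T, ⊤))).toAlgebra
  ext x l
  have := ((C a).close (C b) th hs ha hb hU).τ_sub_mem hxi
    (((C b).loc hs hb).frame l) x
  rw [Ideal.mem_bot, sub_eq_zero] at this
  refine Eq.trans ?_ this.symm
  refine (e1 _).symm.trans (congrArg _ ?_)
  exact (congrFun ((C a).κ_eq_coords hs ha (((C b).loc hs hb).frame l)) x).symm

/-- The identification of the bundle with the one given by parallel transport over a base on which
parallel transport is constant. -/
def pullbackMapOfInjective (hi : Function.Injective (constMap i ⊤)) [Algebra ℚ Γ(T, ⊤)]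
    {Φ : EulerFiltration Γ(T, ⊤)} (hΦ : EulerData q i t Φ) (u : T ⟶ B) (w : u ≫ s = t)
    (hC : ∀ x : (pullback f s : Scheme), ∃ a, pullback.fst f s x ∈ (C a).V) :
    PullbackMap (bcMap f u w) E ((ofTransport C th hs hΦ).datum hC).bundle :=
  (presentation C hs hC).pullbackMap (isPullback _ hC u w (i ≫ u) _
    (Category.comp_id _) (map_central hs th hi u w))

end LocalCocycle

end

section

/-! ### Affine schemes and rings -/

/-- The functions on the spectrum of a ring. -/
def specEquiv (A : Type) [CommRing A] : A ≃+* Γ(Spec (CommRingCat.of A), ⊤) :=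
  (Scheme.ΓSpecIso (CommRingCat.of A)).symm.commRingCatIsoToRingEquiv

lemma constMap_spec {A A' : Type} [CommRing A] [CommRing A'] (φ : A →+* A') (a : A) :
    constMap (Spec.map (CommRingCat.ofHom φ)) ⊤ (specEquiv A a) = specEquiv A' (φ a) := by
  have e : (Spec.map (CommRingCat.ofHom φ)).appLE ⊤ ⊤ le_top =
      (Spec.map (CommRingCat.ofHom φ)).appTop := (Scheme.Hom.app_eq_appLE _).symm
  rw [constMap, e]
  exact congr($(Scheme.ΓSpecIso_inv_naturality (CommRingCat.ofHom φ)).hom a).symm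

lemma constMap_of_eq {A A' : Type} [CommRing A] [CommRing A'] (φ : A →+* A')
    {u : Spec (CommRingCat.of A') ⟶ Spec (CommRingCat.of A)}
    (hu : u = Spec.map (CommRingCat.ofHom φ)) (a : A) :
    constMap u ⊤ (specEquiv A a) = specEquiv A' (φ a) := by
  subst hu; exact constMap_spec φ a

lemma constMap_spec_surjective {A A' : Type} [CommRing A] [CommRing A'] {φ : A →+* A'}
    (h : Function.Surjective φ) :
    Function.Surjective (constMap (Spec.map (CommRingCat.ofHom φ)) ⊤) := fun y => by
  obtain ⟨y, rfl⟩ := (specEquiv A').surjective y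
  obtain ⟨x, rfl⟩ := h y
  exact ⟨specEquiv A x, constMap_spec φ x⟩

lemma constMap_spec_injective {A A' : Type} [CommRing A] [CommRing A'] {φ : A →+* A'}
    (h : Function.Injective φ) :
    Function.Injective (constMap (Spec.map (CommRingCat.ofHom φ)) ⊤) := by
  intro x y e
  obtain ⟨x, rfl⟩ := (specEquiv A).surjective x
  obtain ⟨y, rfl⟩ := (specEquiv A).surjective y
  rw [constMap_spec, constMap_spec] at e
  exact congrArg _ (h ((specEquiv A').injective e))

lemma ker_constMap_spec {A A' : Type} [CommRing A] [CommRing A'] (φ : A →+* A') :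
    RingHom.ker (constMap (Spec.map (CommRingCat.ofHom φ)) ⊤) =
      (RingHom.ker φ).map (specEquiv A) := by
  ext x
  obtain ⟨x, rfl⟩ := (specEquiv A).surjective x
  rw [RingHom.mem_ker, constMap_spec, map_eq_zero_iff _ (specEquiv A').injective,
    Ideal.mem_map_of_equiv]
  simp

variable {S B : Scheme.{0}} {q : S ⟶ B} {s : B ⟶ S}

lemma thickening_spec {A A₀ : Type} [CommRing A] [CommRing A₀] {φ : A →+* A₀}
    (hφ : Function.Surjective φ) (hn : IsNilpotent (RingHom.ker φ))
    (t : Spec (CommRingCat.of A) ⟶ S)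
    (fac : (Spec.map (CommRingCat.ofHom φ) ≫ t ≫ q) ≫ s = Spec.map (CommRingCat.ofHom φ) ≫ t) :
    Thickening q s (Spec.map (CommRingCat.ofHom φ)) t where
  on x := by
    obtain ⟨y, rfl⟩ : ∃ y, Spec.map (CommRingCat.ofHom φ) y = x := by
      have h : x ∈ Set.range (PrimeSpectrum.comap φ) := by
        rw [range_comap_of_surjective _ _ hφ]
        refine (PrimeSpectrum.mem_zeroLocus _ _).mpr ?_
        obtain ⟨n, hn⟩ := hn
        intro a ha
        have : a ^ n ∈ RingHom.ker φ ^ n := Ideal.pow_mem_pow ha n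
        rw [hn, Ideal.zero_eq_bot, Ideal.mem_bot] at this
        exact x.2.mem_of_pow_mem n (by rw [this]; exact Submodule.zero_mem _)
      exact h
    have := congr($fac y)
    simp only [Scheme.Hom.comp_apply] at this
    exact this.symm
  fac := fac
  surj := constMap_spec_surjective hφ
  nil := by
    obtain ⟨n, hn⟩ := hn
    refine ⟨n, ?_⟩
    rw [ker_constMap_spec, ← Ideal.map_pow, hn, Ideal.zero_eq_bot, Ideal.map_bot, Ideal.zero_eq_bot]

/-! ### Levels of adic rings -/

namespace AdicRing

variable {d : ℕ} (P : AdicRing d)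

lemma I_le (n : ℕ) : P.I n ≤ P.I 0 := antitone_nat_of_succ_le P.anti n.zero_le

/-- The projection to the zeroth level. -/
def projZero (n : ℕ) : P.Level n →+* P.Level 0 := Ideal.Quotient.factor (P.I_le n)

lemma projZero_surjective (n : ℕ) : Function.Surjective (P.projZero n) :=
  Ideal.Quotient.factor_surjective (P.I_le n)

lemma specZero_eq (n : ℕ) : P.specZero n = Spec.map (CommRingCat.ofHom (P.projZero n)) := by
  induction n with
  | zero =>
    have : P.projZero 0 = RingHom.id _ := by ext x; rfl
    rw [this, CommRingCat.ofHom_id, Spec.map_id]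
    rfl
  | succ n ih =>
    rw [specZero, ih, ← Spec.map_comp, ← CommRingCat.ofHom_comp]
    congr 2
    ext x; rfl

lemma ker_projZero (n : ℕ) : RingHom.ker (P.projZero n) = (P.I 0).map (Ideal.Quotient.mk (P.I n)) := by
  ext x
  obtain ⟨x, rfl⟩ := Ideal.Quotient.mk_surjective x
  rw [RingHom.mem_ker]
  change Ideal.Quotient.mk (P.I 0) x = 0 ↔ _
  rw [Ideal.Quotient.eq_zero_iff_mem, Ideal.mem_map_iff_of_surjective _ Ideal.Quotient.mk_surjective]
  refine ⟨fun h => ⟨x, h, rfl⟩, fun ⟨y, hy, e⟩ => ?_⟩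
  rw [Ideal.Quotient.eq] at e
  have := (P.I 0).sub_mem hy (P.I_le n e)
  rwa [sub_sub_cancel] at this

lemma isNilpotent_ker_projZero (n : ℕ) (h : ∃ N, P.I 0 ^ N ≤ P.I n) :
    IsNilpotent (RingHom.ker (P.projZero n)) := by
  obtain ⟨N, hN⟩ := h
  refine ⟨N, ?_⟩
  rw [ker_projZero, ← Ideal.map_pow, Ideal.zero_eq_bot, eq_bot_iff, Ideal.map_le_iff_le_comap]
  intro x hx
  exact Ideal.Quotient.eq_zero_iff_mem.mpr (hN hx)

lemma Le.specZero {Q : AdicRing d} (h : P.Le Q) (n : ℕ) :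
    Q.specZero n ≫ h.spec n = h.spec 0 ≫ P.specZero n := by
  induction n with
  | zero => exact (Category.id_comp _).trans (Category.comp_id _).symm
  | succ n ih =>
    rw [AdicRing.specZero, AdicRing.specZero, Category.assoc, ← h.spec_incl, ← Category.assoc, ih,
      Category.assoc]

end AdicRing

lemma orderIdeal_pow {d : ℕ} (A : Subring (MvPowerSeries (Fin d) ℂ)) (n : ℕ) :
    orderIdeal A 1 ^ n ≤ orderIdeal A n := by
  induction n with
  | zero => intro f _ I hI; exact absurd hI (Nat.not_lt_zero _)
  | succ n ih => rw [pow_succ]; exact (Ideal.mul_mono_left ih).trans (orderIdeal_mul A n 1)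

lemma trunc_nilpotent {d : ℕ} (A : Subring (MvPowerSeries (Fin d) ℂ)) (n : ℕ) :
    ∃ N, (trunc A).I 0 ^ N ≤ (trunc A).I n := ⟨n + 1, orderIdeal_pow A (n + 1)⟩

namespace FormalCoordinates

variable {S : Scheme.{0}} {R R' : Subring ℂ} {h : R ≤ R'}
  {q : S ⟶ Spec (CommRingCat.of R)} {s : Spec (CommRingCat.of R) ⟶ S} {d : ℕ}
  (c : FormalCoordinates h q s d)

lemma specZero_σ (n : ℕ) : (adic (coeffsIn d R')).specZero n ≫ c.σ n = c.σ 0 := by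
  induction n with
  | zero => exact Category.id_comp _
  | succ n ih => rw [AdicRing.specZero, Category.assoc, c.trans, ih]

lemma tower_fac (P : AdicRing d) (hP : (adic (coeffsIn d R')).Le P) (n : ℕ) :
    P.specZero n ≫ (c.tower P hP).t n = (hP.spec 0 ≫ constSpec d h 0) ≫ s := by
  rw [c.tower_zero P hP]
  change P.specZero n ≫ hP.spec n ≫ c.σ n = hP.spec 0 ≫ c.σ 0
  rw [← Category.assoc, hP.specZero, Category.assoc, c.specZero_σ]

lemma tower_comp_q (P : AdicRing d) (hP : (adic (coeffsIn d R')).Le P) (n : ℕ) :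
    (c.tower P hP).t n ≫ q = hP.spec n ≫ constSpec d h n := by
  rw [← c.comp_q, ← Category.assoc]; rfl

lemma thickening (hs : s ≫ q = 𝟙 _) (P : AdicRing d) (hP : (adic (coeffsIn d R')).Le P) (n : ℕ)
    (hn : ∃ N, P.I 0 ^ N ≤ P.I n) : Thickening q s (P.specZero n) ((c.tower P hP).t n) := by
  have e := c.tower_fac P hP n
  have e' : (P.specZero n ≫ (c.tower P hP).t n ≫ q) ≫ s = P.specZero n ≫ (c.tower P hP).t n := by
    have e1 : P.specZero n ≫ (c.tower P hP).t n ≫ q = hP.spec 0 ≫ constSpec d h 0 := by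
      refine (Category.assoc _ _ _).symm.trans ?_
      rw [e, Category.assoc, hs, Category.comp_id]
    rw [e1, e]
  rw [P.specZero_eq] at e' ⊢
  exact thickening_spec (P.projZero_surjective n) (P.isNilpotent_ker_projZero n hn) _ e'

end FormalCoordinates

/-! ### The Euler derivation -/

/-- The Euler derivation of the ring of power series. -/
def eulerDer (d : ℕ) : MvPowerSeries (Fin d) ℂ →+ MvPowerSeries (Fin d) ℂ where
  toFun f := fun I => (I.degree : ℂ) * MvPowerSeries.coeff I f
  map_zero' := by funext I; exact mul_zero _
  map_add' f g := by funext I; exact mul_add _ _ _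

lemma coeff_eulerDer {d : ℕ} (f : MvPowerSeries (Fin d) ℂ) (I : Fin d →₀ ℕ) :
    MvPowerSeries.coeff I (eulerDer d f) = I.degree * MvPowerSeries.coeff I f := rfl

lemma eulerDer_mul {d : ℕ} (f g : MvPowerSeries (Fin d) ℂ) :
    eulerDer d (f * g) = f * eulerDer d g + g * eulerDer d f := by
  ext I
  rw [mul_comm g, map_add, coeff_eulerDer, MvPowerSeries.coeff_mul, MvPowerSeries.coeff_mul,
    MvPowerSeries.coeff_mul, ← Finset.sum_add_distrib, Finset.mul_sum]
  refine Finset.sum_congr rfl fun x hx => ?_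
  rw [← Finset.HasAntidiagonal.mem_antidiagonal.mp hx, coeff_eulerDer, coeff_eulerDer, map_add]
  push_cast
  ring

lemma mem_coeffsIn {d : ℕ} {R : Subring ℂ} {f : MvPowerSeries (Fin d) ℂ} :
    f ∈ coeffsIn d R ↔ ∀ I, MvPowerSeries.coeff I f ∈ R := by
  constructor
  · rintro ⟨g, rfl⟩ I
    rw [MvPowerSeries.coeff_map]
    exact (MvPowerSeries.coeff I g).2
  · intro hf
    exact ⟨fun I => ⟨_, hf I⟩, by ext I; rfl⟩

section EulerFiltration

variable {d : ℕ} {R : Subring ℂ}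

/-- The Euler derivation on power series with coefficients in a subring. -/
def coeffsInDer (d : ℕ) (R : Subring ℂ) : coeffsIn d R →+ coeffsIn d R :=
  AddMonoidHom.mk' (fun f => ⟨eulerDer d f, mem_coeffsIn.mpr fun I => by
    rw [coeff_eulerDer]; exact R.mul_mem (natCast_mem R _) (mem_coeffsIn.mp f.2 I)⟩)
    fun f g => Subtype.ext ((eulerDer d).map_add _ _)

lemma coeffsInDer_mem {m : ℕ} {f : coeffsIn d R} (hf : f ∈ orderIdeal (coeffsIn d R) m) :
    coeffsInDer d R f ∈ orderIdeal (coeffsIn d R) m := fun I hI => by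
  change MvPowerSeries.coeff I (eulerDer d _) = 0
  rw [coeff_eulerDer, hf I hI, mul_zero]

lemma coeffsInDer_sub_mem {m : ℕ} {f : coeffsIn d R} (hf : f ∈ orderIdeal (coeffsIn d R) m) :
    coeffsInDer d R f - m * f ∈ orderIdeal (coeffsIn d R) (m + 1) := fun I hI => by
  change MvPowerSeries.coeff I (eulerDer d f - (m : MvPowerSeries (Fin d) ℂ) * f.1) = 0
  rw [map_sub, coeff_eulerDer]
  have : ((m : MvPowerSeries (Fin d) ℂ) * f.1) = (m : ℂ) • f.1 := by
    rw [← map_natCast (MvPowerSeries.C (σ := Fin d) (R := ℂ)), MvPowerSeries.smul_eq_C_mul]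
  rw [this, map_smul, smul_eq_mul]
  rcases (Nat.lt_succ_iff.mp hI).lt_or_eq with h | h
  · rw [hf I h]; simp
  · rw [h, sub_self]

end EulerFiltration

/-- An Euler filtration on the quotient by a step of a filtration. -/
def EulerFiltration.ofSurjective {A A' : Type} [CommRing A] [CommRing A'] (F : ℕ → Ideal A)
    (mul : ∀ m l, F m * F l ≤ F (m + l)) (anti : Antitone F) (ε : A →+ A)
    (leibniz : ∀ a b, ε (a * b) = a * ε b + b * ε a) (mem : ∀ m, ∀ a ∈ F m, ε a ∈ F m)
    (euler : ∀ m, ∀ a ∈ F m, ε a - m * a ∈ F (m + 1)) (π : A →+* A')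
    (hπ : Function.Surjective π) (n : ℕ) (hn : RingHom.ker π = F n) : EulerFiltration A' :=
  have h (a b) (e : π a = π b) : π (ε a) = π (ε b) := by
    rw [← sub_eq_zero, ← map_sub, ← RingHom.mem_ker, hn] at e
    rw [← sub_eq_zero, ← map_sub, ← map_sub, ← RingHom.mem_ker, hn]
    exact mem n _ e
  have hε (a) : π (ε (Function.surjInv hπ (π a))) = π (ε a) := h _ _ (Function.surjInv_eq (f := π) hπ _)
  { F := fun m => (F m).map π
    mul := fun m l a b ha hb => by
      have := Ideal.mul_mem_mul ha hb
      rw [← Ideal.map_mul] at this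
      exact Ideal.map_mono (mul m l) this
    bound := n
    eq_bot := fun m hm => by
      rw [eq_bot_iff, Ideal.map_le_iff_le_comap, ← RingHom.ker_eq_comap_bot, hn]
      exact anti hm
    ε := AddMonoidHom.mk' (fun a => π (ε (Function.surjInv hπ a))) fun a b => by
      rw [← map_add, ← map_add]
      exact h _ _ (by
        rw [map_add, Function.surjInv_eq (f := π), Function.surjInv_eq (f := π),
          Function.surjInv_eq (f := π)])
    leibniz := fun a b => by
      obtain ⟨a, rfl⟩ := hπ a
      obtain ⟨b, rfl⟩ := hπ b
      simp only [AddMonoidHom.mk'_apply]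
      rw [← map_mul, hε, hε, hε, leibniz, map_add, map_mul, map_mul]
    euler := fun m a ha => by
      rw [Ideal.mem_map_iff_of_surjective _ hπ] at ha
      obtain ⟨a, ha, rfl⟩ := ha
      simp only [AddMonoidHom.mk'_apply]
      rw [hε, ← map_natCast π, ← map_mul, ← map_sub]
      exact Ideal.mem_map_of_mem _ (euler m a ha) }

lemma EulerFiltration.ofSurjective_ε {A A' : Type} [CommRing A] [CommRing A'] (F : ℕ → Ideal A)
    (mul) (anti) (ε : A →+ A) (leibniz) (mem) (euler) (π : A →+* A')
    (hπ : Function.Surjective π) (n : ℕ) (hn : RingHom.ker π = F n) (a : A) :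
    (EulerFiltration.ofSurjective F mul anti ε leibniz mem euler π hπ n hn).ε (π a) = π (ε a) := by
  have e : π (Function.surjInv hπ (π a) - a) = 0 := by
    rw [map_sub, Function.surjInv_eq (f := π), sub_self]
  rw [← RingHom.mem_ker, hn] at e
  have := mem n _ e
  rw [← hn, RingHom.mem_ker, map_sub, map_sub, sub_eq_zero] at this
  exact this

/-- The functions on a level of an adic ring. -/
def AdicRing.toLevel {d : ℕ} (P : AdicRing d) (n : ℕ) : P.A →+* Γ(P.spec n, ⊤) :=
  (specEquiv (P.Level n)).toRingHom.comp (Ideal.Quotient.mk (P.I n))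

lemma AdicRing.toLevel_surjective {d : ℕ} (P : AdicRing d) (n : ℕ) :
    Function.Surjective (P.toLevel n) :=
  (specEquiv (P.Level n)).surjective.comp Ideal.Quotient.mk_surjective

lemma AdicRing.ker_toLevel {d : ℕ} (P : AdicRing d) (n : ℕ) : RingHom.ker (P.toLevel n) = P.I n := by
  ext x
  rw [RingHom.mem_ker, ← Ideal.Quotient.eq_zero_iff_mem]
  exact map_eq_zero_iff _ (specEquiv (P.Level n)).injective

lemma AdicRing.constMap_toLevel {d : ℕ} {P Q : AdicRing d} (h : P.Le Q) (n : ℕ) (a : P.A) :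
    constMap (h.spec n) ⊤ (P.toLevel n a) = Q.toLevel n (Subring.inclusion h.1 a) :=
  constMap_spec (h.level n) _

lemma orderIdeal_antitone {d : ℕ} (A : Subring (MvPowerSeries (Fin d) ℂ)) :
    Antitone (orderIdeal A) := fun _ _ h _ hf I hI => hf I (hI.trans_le h)

/-- The Euler filtration on the functions on a level of the ring of power series. -/
def truncFiltration (d : ℕ) (R : Subring ℂ) (n : ℕ) :
    EulerFiltration Γ((trunc (coeffsIn d R)).spec n, ⊤) :=
  .ofSurjective (A := coeffsIn d R) (orderIdeal (coeffsIn d R)) (orderIdeal_mul _)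
    (orderIdeal_antitone _) (coeffsInDer d R)
    (fun a b => Subtype.ext (eulerDer_mul a.1 b.1)) (fun _ _ => coeffsInDer_mem)
    (fun _ _ => coeffsInDer_sub_mem) ((trunc (coeffsIn d R)).toLevel n)
    ((trunc (coeffsIn d R)).toLevel_surjective n) (n + 1) ((trunc (coeffsIn d R)).ker_toLevel n)

lemma truncFiltration_F (d : ℕ) (R : Subring ℂ) (n m : ℕ) : (truncFiltration d R n).F m =
    (orderIdeal (trunc (coeffsIn d R)).A m).map ((trunc (coeffsIn d R)).toLevel n) := rfl

lemma truncFiltration_ε (d : ℕ) (R : Subring ℂ) (n : ℕ) (f : coeffsIn d R) :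
    (truncFiltration d R n).ε ((trunc (coeffsIn d R)).toLevel n f) =
      (trunc (coeffsIn d R)).toLevel n (coeffsInDer d R f) :=
  EulerFiltration.ofSurjective_ε ..

/-- Power series with coefficients in `R_ℚ` contain the rational numbers. -/
def ratHom (d : ℕ) (R : Subring ℂ) : ℚ →+* coeffsIn d (rat R) :=
  (MvPowerSeries.map (σ := Fin d) (rat R).subtype).rangeRestrict.comp (MvPowerSeries.C.comp
    ((algebraMap ℚ ℂ).codRestrict (rat R) fun x => (le_sup_right : _ ≤ rat R) ⟨x, rfl⟩))

namespace FormalCoordinates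

variable {S : Scheme.{0}} {R R' : Subring ℂ} {h : R ≤ R'}
  {q : S ⟶ Spec (CommRingCat.of R)} {s : Spec (CommRingCat.of R) ⟶ S} {d : ℕ}
  (c : FormalCoordinates h q s d)

lemma eulerData (hQ : (adic (coeffsIn d R')).Le (trunc (coeffsIn d (rat R')))) (n : ℕ) :
    EulerData q ((trunc (coeffsIn d (rat R'))).specZero n) ((c.tower _ hQ).t n)
      (truncFiltration d (rat R') n) where
  mem x := by
    obtain ⟨x, rfl⟩ := (trunc (coeffsIn d (rat R'))).toLevel_surjective n x
    refine (congrArg (· ∈ (truncFiltration d (rat R') n).F 1)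
      (truncFiltration_ε d (rat R') n x)).mpr ?_
    refine Ideal.mem_map_of_mem _ fun I hI => ?_
    change MvPowerSeries.coeff I (eulerDer d _) = 0
    rw [coeff_eulerDer, Nat.lt_one_iff.mp hI, Nat.cast_zero, zero_mul]
  const x := by
    obtain ⟨x, rfl⟩ := (specEquiv R).surjective x
    have e : (c.tower _ hQ).t n ≫ q =
        Spec.map (CommRingCat.ofHom ((hQ.level n).comp (constHom d h n))) := by
      rw [c.tower_comp_q, CommRingCat.ofHom_comp, Spec.map_comp]
    refine (congrArg (truncFiltration d (rat R') n).ε (constMap_of_eq _ e x)).trans ?_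
    let y : coeffsIn d (rat R') := Subring.inclusion hQ.1
      ((MvPowerSeries.map (σ := Fin d) R'.subtype).rangeRestrict
        (MvPowerSeries.C (Subring.inclusion h x)))
    refine (truncFiltration_ε d (rat R') n y).trans ?_
    have : coeffsInDer d (rat R') y = 0 := by
      refine Subtype.ext ?_
      ext I
      change MvPowerSeries.coeff I (eulerDer d (MvPowerSeries.map R'.subtype
        (MvPowerSeries.C (Subring.inclusion h x)))) = 0
      rw [coeff_eulerDer, MvPowerSeries.coeff_map, MvPowerSeries.coeff_C]
      split_ifs with hI
      · simp [hI]
      · simp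
    rw [this]
    exact map_zero ((trunc (coeffsIn d (rat R'))).toLevel n)
  one := by
    rw [AdicRing.specZero_eq, ker_constMap_spec, AdicRing.ker_projZero, truncFiltration_F,
      ← Ideal.map_coe (specEquiv _), Ideal.map_map]
    rfl

/-- The Euler tower of the formal deformation over `R'_ℚ`. -/
def eulerTower (hs : s ≫ q = 𝟙 _)
    (hQ : (adic (coeffsIn d R')).Le (trunc (coeffsIn d (rat R'))))
    [∀ m, Algebra ℚ Γ((c.tower _ hQ).T m, ⊤)] :
    EulerTower q s (c.tower _ hQ) ((trunc (coeffsIn d (rat R'))).spec 0) where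
  i := (trunc (coeffsIn d (rat R'))).specZero
  th n := c.thickening hs _ hQ n (trunc_nilpotent _ n)
  comm n := rfl
  Φ := truncFiltration d (rat R')
  hΦ := c.eulerData hQ
  hs := hs

end FormalCoordinates

end

section

/-! ### Divisibility of iterated covariant derivatives -/

section Divisibility

open Polynomial

lemma ZMod.prod_X_sub_C (p : ℕ) [Fact p.Prime] (a : ℕ) :
    ∏ i ∈ Finset.range p, (X - C ((a + i : ℕ) : ZMod p)) = X ^ p - X := by
  have h1 : ∏ x : ZMod p, (X - C x) = X ^ p - X := by
    have h2 := FiniteField.roots_X_pow_card_sub_X (ZMod p)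
    rw [ZMod.card] at h2
    have hp := (Fact.out : p.Prime).one_lt
    have h3 := Polynomial.prod_multiset_X_sub_C_of_monic_of_roots_card_eq
      (p := (X ^ p - X : (ZMod p)[X])) (monic_X_pow_sub (by rw [degree_X]; exact_mod_cast hp))
      (by rw [h2, FiniteField.X_pow_card_sub_X_natDegree_eq _ hp]; simp [ZMod.card])
    rwa [h2] at h3
  rw [← h1]
  refine Finset.prod_bij (fun i _ => ((a + i : ℕ) : ZMod p)) (fun _ _ => Finset.mem_univ _)
    (fun i hi j hj e => ?_) (fun x _ => ?_) fun _ _ => rfl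
  · rw [Finset.mem_range] at hi hj
    rw [ZMod.natCast_eq_natCast_iff] at e
    exact (Nat.ModEq.add_left_cancel' a e).eq_of_lt_of_lt hi hj
  · refine ⟨(x - a).val, Finset.mem_range.mpr (ZMod.val_lt _), ?_⟩
    simp

lemma exists_prod_eq (p : ℕ) [Fact p.Prime] (a : ℕ) {w : ℕ} (hw : w = 0 ∨ w = 1) :
    ∃ G : ℤ[X], ∏ i ∈ Finset.range p, (X - C ((w * (a + i) : ℕ) : ℤ)) =
      X ^ p - C (w : ℤ) * X + C (p : ℤ) * G := by
  suffices C (p : ℤ) ∣ ∏ i ∈ Finset.range p, (X - C ((w * (a + i) : ℕ) : ℤ)) -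
      (X ^ p - C (w : ℤ) * X) by
    obtain ⟨G, hG⟩ := this
    exact ⟨G, by rw [← hG]; ring⟩
  rw [C_dvd_iff_dvd_coeff]
  intro i
  rw [← ZMod.intCast_zmod_eq_zero_iff_dvd]
  refine (coeff_map (Int.castRingHom (ZMod p)) i).symm.trans ?_
  have : (∏ i ∈ Finset.range p, (X - C ((w * (a + i) : ℕ) : ℤ)) -
      (X ^ p - C (w : ℤ) * X)).map (Int.castRingHom (ZMod p)) = 0 := by
    rcases hw with rfl | rfl
    · simp
    · have := ZMod.prod_X_sub_C p a
      simp only [one_mul, Nat.cast_one, map_one, Polynomial.map_sub, Polynomial.map_prod,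
        Polynomial.map_X, Polynomial.map_pow, map_natCast]
      rw [← this]
      simp
  rw [this, coeff_zero]

variable {E : Type} [AddCommGroup E] {n : ℕ} {nabla : Fin n → E →+ E} {w : Fin n → ℕ}
  (P : IterDer nabla w)

lemma aeval_mul_X_sub (D : AddMonoid.End E) (G : ℤ[X]) (m : ℕ) (e : E) :
    aeval D (G * (X - C (m : ℤ))) e = D (aeval D G e) - m • aeval D G e := by
  have : aeval D (G * (X - C (m : ℤ))) = (D - (m : AddMonoid.End E)) * aeval D G := by
    rw [mul_comm, map_mul, map_sub, aeval_X, aeval_C]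
    simp
  rw [this]
  rfl

lemma aeval_X_pow_sub (D : AddMonoid.End E) (G : ℤ[X]) (p w : ℕ) (e : E) :
    aeval D (X ^ p - C (w : ℤ) * X + C (p : ℤ) * G) e = D^[p] e - w • D e + p • aeval D G e := by
  have : aeval D (X ^ p - C (w : ℤ) * X + C (p : ℤ) * G) =
      D ^ p - (w : AddMonoid.End E) * D + (p : AddMonoid.End E) * aeval D G := by
    simp
  rw [this, ← AddMonoid.End.coe_pow]
  rfl

lemma IterDer.N_add (k : Fin n) (K : Fin n → ℕ) (m : ℕ) (e : E) :
    P.N (K + Pi.single k m) e = aeval (R := ℤ) (A := AddMonoid.End E) (nabla k)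
      (∏ i ∈ Finset.range m, (X - C ((w k * (K k + i) : ℕ) : ℤ))) (P.N K e) := by
  induction m with
  | zero => simp
  | succ m ih =>
    have h := P.succ k (K + Pi.single k m) e
    have e0 : K + Pi.single k m + Pi.single k 1 = K + Pi.single k (m + 1) := by
      rw [add_assoc, ← Pi.single_add]
    rw [e0, ← sub_eq_iff_eq_add] at h
    rw [← h, Finset.prod_range_succ]
    refine Eq.trans ?_ (aeval_mul_X_sub (nabla k : AddMonoid.End E) _ _ _).symm
    rw [ih, Pi.add_apply, Pi.single_eq_same]
    rfl

lemma IterDer.exists_eq_pow_smul {p : ℕ} (hp : p.Prime) (hw : ∀ k, w k = 0 ∨ w k = 1)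
    (h : ∀ k e, ∃ e', (nabla k)^[p] e - w k • nabla k e = p • e') (K : Fin n → ℕ) (e : E) :
    ∃ e', P.N K e = p ^ (∑ k, K k / p) • e' := by
  have := Fact.mk hp
  induction hm : ∑ k, K k / p generalizing K with
  | zero => exact ⟨P.N K e, by simp⟩
  | succ m ih =>
    obtain ⟨k, hk⟩ : ∃ k, K k / p ≠ 0 := by
      by_contra! hc
      simp [hc] at hm
    have hk' : p ≤ K k := by
      by_contra! hc
      exact hk (Nat.div_eq_of_lt hc)
    set L := K - Pi.single k p
    have e0 : L + Pi.single k p = K := by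
      ext j
      by_cases hj : j = k
      · subst hj; simp [L]; omega
      · simp [hj, L]
    have hL : ∑ j, L j / p = m := by
      rw [← Finset.add_sum_erase _ _ (Finset.mem_univ k)] at hm ⊢
      have e1 : ∑ j ∈ Finset.univ.erase k, L j / p = ∑ j ∈ Finset.univ.erase k, K j / p :=
        Finset.sum_congr rfl fun j hj => by
          simp [L, Finset.ne_of_mem_erase hj]
      have e2 : L k / p + 1 = K k / p := by
        rw [← Nat.add_div_right _ hp.pos, ← congrFun e0 k]; simp
      omega
    obtain ⟨e₁, he₁⟩ := ih L hL
    obtain ⟨G, hG⟩ := exists_prod_eq p (L k) (hw k)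
    obtain ⟨e₂, he₂⟩ := h k e₁
    refine ⟨e₂ + aeval (R := ℤ) (A := AddMonoid.End E) (nabla k) G e₁, ?_⟩
    rw [← e0, P.N_add, hG, he₁, map_nsmul, pow_succ, mul_smul]
    congr 1
    rw [smul_add, ← he₂]
    exact aeval_X_pow_sub (nabla k : AddMonoid.End E) G p (w k) e₁

lemma padicValNat_factorial_of_lt {p n : ℕ} (hp : p.Prime) (h : n < p ^ 2) :
    padicValNat p n.factorial = n / p := by
  have := Fact.mk hp
  have h1 : n / p < p := by rwa [Nat.div_lt_iff_lt_mul hp.pos, ← sq]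
  conv_lhs => rw [← Nat.div_add_mod n p]
  rw [padicValNat_factorial_mul_add _ (Nat.mod_lt _ hp.pos), padicValNat_factorial_mul,
    padicValNat.eq_zero_of_not_dvd (fun hd => ?_), zero_add]
  exact absurd (hp.dvd_factorial.mp hd) (not_le.mpr h1)

lemma IterDer.exists_smul_eq_factorial_smul (hw : ∀ k, w k = 0 ∨ w k = 1) {good : ℕ → Prop}
    (h : ∀ p, p.Prime → good p → ∀ k e, ∃ e', (nabla k)^[p] e - w k • nabla k e = p • e')
    (K : Fin n → ℕ) (e : E) : ∃ M : ℕ, M ∣ ∏ k, (K k).factorial ∧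
      (∀ p, p.Prime → p ∣ M → good p → p ^ 2 ≤ ∑ k, K k) ∧
      ∃ e', M • P.N K e = (∏ k, (K k).factorial) • e' := by
  set F := ∏ k, (K k).factorial
  let I : Ideal ℤ :=
    { carrier := {m | ∃ e', m • P.N K e = F • e'}
      zero_mem' := ⟨0, by simp⟩
      add_mem' := by
        rintro a b ⟨x, hx⟩ ⟨y, hy⟩
        exact ⟨x + y, by rw [add_smul, hx, hy, smul_add]⟩
      smul_mem' := by
        rintro c a ⟨x, hx⟩
        exact ⟨c • x, by rw [smul_eq_mul, mul_smul, hx, smul_comm]⟩ }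
  obtain ⟨M, hM⟩ := IsPrincipalIdealRing.principal I
  have hmem (m : ℤ) : m ∈ I ↔ M ∣ m := by
    rw [hM]; exact Ideal.mem_span_singleton
  refine ⟨M.natAbs, ?_, fun p hp hpM hg => ?_, ?_⟩
  · rw [← Int.natCast_dvd_natCast, Int.natAbs_dvd, ← hmem]
    exact ⟨P.N K e, by rw [natCast_zsmul]⟩
  · by_contra! hlt
    have := Fact.mk hp
    obtain ⟨e', he'⟩ := P.exists_eq_pow_smul hp hw (h p hp hg) K e
    have hF : F ≠ 0 := Finset.prod_ne_zero_iff.mpr fun k _ => Nat.factorial_ne_zero _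
    have hv : padicValNat p F = ∑ k, K k / p := by
      rw [← Nat.factorization_def _ hp, Nat.factorization_prod fun k _ => Nat.factorial_ne_zero _,
        Finsupp.finsetSum_apply]
      simp only [Nat.factorization_def _ hp]
      exact Finset.sum_congr rfl fun k hk => padicValNat_factorial_of_lt hp
        ((Finset.single_le_sum (fun _ _ => Nat.zero_le _) hk).trans_lt hlt)
    obtain ⟨c, hc⟩ : p ^ padicValNat p F ∣ F := pow_padicValNat_dvd
    have hcI : (c : ℤ) ∈ I := ⟨e', by
      rw [natCast_zsmul, he', ← hv, smul_smul, mul_comm c, ← hc]⟩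
    rw [hmem, ← Int.natAbs_dvd, Int.natCast_dvd_natCast] at hcI
    obtain ⟨c', rfl⟩ := hpM.trans hcI
    rw [← mul_assoc, ← pow_succ] at hc
    exact pow_succ_padicValNat_not_dvd hF ⟨c', hc⟩
  · have : (M.natAbs : ℤ) ∈ I := (hmem _).mpr (Int.dvd_natAbs.mpr dvd_rfl)
    obtain ⟨e', he'⟩ := this
    exact ⟨e', by rw [← he', natCast_zsmul]⟩

end Divisibility

end

section

/-! ### Vanishing `p`-curvature -/

lemma iterate_leibniz {A : Type} [CommRing A] (d : A →+ A) (h : ∀ a b, d (a * b) = a * d b + b * d a)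
    (n : ℕ) (a b : A) : d^[n] (a * b) =
      ∑ ij ∈ Finset.HasAntidiagonal.antidiagonal n, n.choose ij.1 • (d^[ij.1] a * d^[ij.2] b) := by
  induction n with
  | zero => simp
  | succ n ih =>
    rw [Finset.sum_antidiagonal_choose_succ_nsmul (M := A) (fun i j => d^[i] a * d^[j] b) n]
    simp only [Function.iterate_succ_apply', ih, map_sum, map_nsmul, h, smul_add,
      Finset.sum_add_distrib]
    congr 1
    exact Finset.sum_congr rfl fun _ hi => by
      rw [mul_comm, Nat.choose_symm_of_eq_add (Finset.HasAntidiagonal.mem_antidiagonal.mp hi).symm]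

lemma iterate_leibniz_of_prime {A : Type} [CommRing A] (d : A →+ A)
    (h : ∀ a b, d (a * b) = a * d b + b * d a) {p : ℕ} (hp : p.Prime) (h0 : (p : A) = 0) (a b : A) :
    d^[p] (a * b) = a * d^[p] b + b * d^[p] a := by
  rw [iterate_leibniz d h, Finset.Nat.sum_antidiagonal_eq_sum_range_succ_mk,
    Finset.sum_range_succ, Finset.sum_range_eq_add_Ico _ hp.pos, Finset.sum_eq_zero fun i hi => ?_]
  · simp [mul_comm]
  · rw [Finset.mem_Ico] at hi
    obtain ⟨c, hc⟩ := hp.dvd_choose_self (by omega) hi.2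
    rw [hc, mul_smul, ← Nat.cast_smul_eq_nsmul A, h0, zero_smul]

section

variable {Y T : Scheme.{0}} [IsAffine T] {g : Y ⟶ T} {ι : Type} {D : ι → Y.IdealSheafData} {n : ℕ}

lemma LogField.resO_iterate {U V W : Y.Opens} (θ : LogField g D U) (hV : V ≤ U) (hW : W ≤ V)
    (m : ℕ) (a : Γ(Y, V)) :
    resO hW ((θ.app V hV)^[m] a) = (θ.app W (hW.trans hV))^[m] (resO hW a) := by
  induction m with
  | zero => rfl
  | succ m ih => rw [Function.iterate_succ_apply', Function.iterate_succ_apply', θ.res_app, ih]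

lemma LogChart.iterate_der (ch : LogChart g D n) {p : ℕ} (hp : p.Prime) (h0 : (p : Γ(T, ⊤)) = 0)
    (k : Fin n) {V : Y.Opens} (hV : V ≤ ch.V) (a : Γ(Y, V)) :
    ((ch.der k).app V hV)^[p] a = ch.w k • (ch.der k).app V hV a := by
  refine resO_ext fun y hy => ?_
  obtain ⟨W, hWa, hWV, hyW⟩ := exists_affine_mem hy
  refine ⟨W, hWV, hyW, ?_⟩
  rw [LogField.resO_iterate, map_nsmul, LogField.res_app]
  let d : Γ(Y, W) →+ Γ(Y, W) := (ch.der k).app W (hWV.trans hV)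
  have hd : ∀ a b, d (a * b) = a * d b + b * d a := (ch.der k).leibniz W _
  have hp0 : (p : Γ(Y, W)) = 0 := by
    rw [← map_natCast (Isomonodromy.constMap g W), h0, map_zero]
  let dp : Γ(Y, W) →+ Γ(Y, W) := ⟨⟨d^[p], iterate_map_zero d p⟩, iterate_map_add d p⟩
  have h1 (m : ℕ) (hm : m ≠ 0) (x : Γ(Y, W)) (hx : d x = 0) : d^[m] x = 0 := by
    obtain ⟨m, rfl⟩ := Nat.exists_eq_succ_of_ne_zero hm
    rw [Function.iterate_succ_apply, hx]
    exact Function.iterate_fixed (map_zero d) m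
  refine (DFunLike.congr_fun ((ch.etaleCoords (hWV.trans hV) hWa).derivation_ext
    (RingHom.id _) dp (ch.w k • d) (fun a b => ?_) (fun a b => ?_)
    (fun x => ?_) fun l => ?_) (resO hWV a))
  · exact iterate_leibniz_of_prime d hd hp hp0 a b
  · simp only [AddMonoidHom.smul_apply, hd, RingHom.id_apply, nsmul_eq_mul]; ring
  · refine (h1 p hp.ne_zero _ (LogField.constMap _ _ x)).trans ?_
    rw [AddMonoidHom.smul_apply,
      show d _ = 0 from LogField.constMap _ _ x, smul_zero]
  · rw [AddMonoidHom.smul_apply]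
    change d^[p] _ = _
    have hc : d (ch.coord (hWV.trans hV) l) = _ := ch.der_coord k (hWV.trans hV) l
    split_ifs at hc with hl
    · subst hl
      rcases ch.w_eq l with hw | hw
      · rw [hw, pow_zero] at hc
        rw [hw, zero_smul]
        obtain ⟨m, rfl⟩ : ∃ m, p = m + 1 := ⟨p - 1, by have := hp.pos; omega⟩
        rw [Function.iterate_succ_apply, hc]
        refine h1 m (by have := hp.one_lt; omega) _ ?_
        simpa using hd 1 1
      · rw [hw, pow_one] at hc
        rw [hw, one_smul, hc]
        exact Function.iterate_fixed hc p
    · rw [hc, smul_zero]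
      exact h1 p hp.ne_zero _ hc

lemma LogFlatBundle.iterate_nabla_der {E : LogFlatBundle g D} {p : ℕ}
    (hE : E.PCurvatureVanishes p) (ch : LogChart g D n) (hp : p.Prime) (h0 : (p : Γ(T, ⊤)) = 0)
    (k : Fin n) {V : Y.Opens} (hV : V ≤ ch.V) (e : Γ(E.M, V)) :
    (E.nabla V ((ch.der k).restrict hV))^[p] e = ch.w k • E.nabla V ((ch.der k).restrict hV) e := by
  set θ := (ch.der k).restrict hV
  have h (W : Y.Opens) (hW : W ≤ V) (a : Γ(Y, W)) : (θ.app W hW)^[p] a = ch.w k • θ.app W hW a :=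
    ch.iterate_der hp h0 k (hW.trans hV) a
  rcases ch.w_eq k with hw | hw
  · rw [hw, zero_smul, hE V θ (θ.subSmul θ 1) (fun W hW a => by
      rw [h, hw]; simp [LogField.subSmul])]
    rw [E.nabla_eq_sum (n := 0) Fin.elim0 Fin.elim0 _ fun W hW b => by simp [LogField.subSmul]]
    simp
  · rw [hw, one_smul]
    exact hE V θ θ (fun W hW a => by rw [h, hw, one_smul]) e

end

lemma IsFrame.restrict {Y : Scheme.{0}} {M : Y.Modules} {U V : Y.Opens} {n : ℕ}
    {e : Fin n → Γ(M, U)} (he : IsFrame M U e) (h : V ≤ U) : IsFrame M V fun i => resM M h (e i) :=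
  fun W hW => by
    simp only [resM_resM]
    exact he W (hW.trans h)

variable {X S : Scheme.{0}} {f : X ⟶ S} {ι : Type} {D : ι → X.IdealSheafData} {R : Subring ℂ}
  {q : S ⟶ Spec (CommRingCat.of R)} {s : Spec (CommRingCat.of R) ⟶ S} {E : FlatBundleOver f D s}

lemma FramedChart.exists_iterate_nabla_sub (C : FramedChart q E) (hs : s ≫ q = 𝟙 _) {U : X.Opens}
    (hU : U ≤ C.V) (hUa : IsAffineOpen U) {p : ℕ} (hp : p.Prime) (hE : PCurvatureVanishesModP E p)
    (k : Fin C.n) (e : Γ(E.M, bc f s U)) :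
    ∃ e', ((C.loc hs hU).nabla k)^[p] e - C.w k • (C.loc hs hU).nabla k e = p • e' := by
  obtain ⟨Ep, ⟨γ⟩, hEp⟩ := hE
  let u := modP R p
  let L := C.loc hs hU
  have on' : OnSection q s (u ≫ s) := (onSection_self hs).comp u rfl
  let ch' := C.logChart on'
  let γU := γ.app (bc f s U) (bc f (u ≫ s) U) (bc_le f u rfl U)
  let N' : Γ(Ep.M, bc f (u ≫ s) U) →+ Γ(Ep.M, bc f (u ≫ s) U) :=
    Ep.nabla _ ((ch'.der k).restrict (C.le_logChart on' hU))
  have hγ (e) : γU (L.nabla k e) = N' (γU e) :=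
    γ.horizontal _ _ _ _ _ (fun V V' i i' hV a =>
      (C.logChart_isPullback (onSection_self hs) on' u rfl).der (bcMap_snd f u rfl)
        (i.trans (C.le_logChart _ hU)) (i'.trans (C.le_logChart on' hU)) hV k a) e
  have hp0 : (p : Γ(Spec (CommRingCat.of (R ⧸ Ideal.span {(p : R)})), ⊤)) = 0 := by
    rw [← map_natCast (specEquiv _), ← map_natCast (Ideal.Quotient.mk (Ideal.span {(p : R)})),
      Ideal.Quotient.eq_zero_iff_mem.mpr (Ideal.mem_span_singleton_self _), map_zero]
  have h0 : γU ((L.nabla k)^[p] e - C.w k • L.nabla k e) = 0 := by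
    have h1 := (show Function.Semiconj γU (L.nabla k) N' from hγ).iterate_right p e
    have h2 : N'^[p] (γU e) = C.w k • N' (γU e) :=
      LogFlatBundle.iterate_nabla_der hEp ch' hp hp0 k (C.le_logChart on' hU) (γU e)
    rw [map_sub, map_nsmul, h1, hγ, h2, sub_self]
  set x := (L.nabla k)^[p] e - C.w k • L.nabla k e
  have hfr := γ.frame _ _ (bc_le f u rfl U) _ _ (C.isFrame.restrict (bc_mono f hU))
  have h3 : ∀ l, bcPull f u rfl U (L.κ x l) = 0 := by
    have h4 := congrArg γU (L.sum_frame x)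
    rw [h0, map_sum] at h4
    refine congrFun ((hfr _ le_rfl).1 ((?_ : _ = (0 : Γ(Ep.M, bc f (u ≫ s) U))).trans ?_) :
      (fun l => bcPull f u rfl U (L.κ x l)) = 0)
    · refine Eq.trans (Finset.sum_congr rfl fun l _ => ?_) h4
      rw [resM_self]
      exact (γ.semilinear _ _ (bc_le f u rfl U) (L.κ x l) (L.frame l)).symm
    · simp
  have h5 : ∀ l, ∃ b, L.κ x l = p * b := fun l => by
    have h6 := ker_of_isPushout (C.isPushout_bcPull hU hUa (onSection_self hs) u rfl)
      (constMap_spec_surjective Ideal.Quotient.mk_surjective)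
    have h7 : L.κ x l ∈ RingHom.ker (bcPull f u rfl U) := h3 l
    have h8 : RingHom.ker (bcPull f u rfl U) = Ideal.span {(p : Γ(pullback f s, bc f s U))} := by
      refine h6.trans ?_
      have h9 : RingHom.ker (constMap u ⊤) = Ideal.span {(p : Γ(Spec (CommRingCat.of R), ⊤))} := by
        rw [ker_constMap_spec, Ideal.mk_ker, ← Ideal.map_coe (specEquiv _), Ideal.map_span,
          Set.image_singleton]
        congr 2
        exact map_natCast (specEquiv R) p
      refine (congrArg (Ideal.map _) h9).trans ?_
      rw [Ideal.map_span, Set.image_singleton, map_natCast]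
    rw [h8, Ideal.mem_span_singleton] at h7
    exact h7
  choose b hb using h5
  refine ⟨∑ l, b l • L.frame l, ?_⟩
  rw [← L.sum_frame x, Finset.smul_sum]
  refine Finset.sum_congr rfl fun l _ => ?_
  rw [hb, mul_smul, Nat.cast_smul_eq_nsmul]

end

section

/-! ### Integrality of parallel transport -/

lemma inv_smul_mem_gSubring {d : ℕ} (R : Subring ℂ) (g : Nat.Primes → ℕ) {M : ℕ} (hM : M ≠ 0)
    {m : ℕ} (hg : ∀ p : Nat.Primes, (p : ℕ) ∣ M → g p + 1 ≤ m) {f : MvPowerSeries (Fin d) ℂ}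
    (hf : f ∈ coeffsIn d R) (ho : OrderGE m f) : (M : ℂ)⁻¹ • f ∈ gSubring d R g := by
  induction M using Nat.recOnPosPrimePosCoprime with
  | zero => exact absurd rfl hM
  | one => simpa using coeffsIn_le_gSubring R g hf
  | prime_pow p n hp hn =>
    refine Subring.subset_closure (Or.inr ⟨⟨p, hp⟩, ?_, fun I hI => ?_⟩)
    · rw [mem_coeffsIn] at hf ⊢
      intro I
      rw [MvPowerSeries.coeff_smul, Nat.cast_pow, ← inv_pow]
      exact Subring.mul_mem _ (Subring.pow_mem _ ((le_sup_right : _ ≤ invert R p)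
        (Subring.subset_closure rfl)) _) ((le_sup_left : R ≤ _) (hf I))
    · have := hg ⟨p, hp⟩ (dvd_pow_self p hn.ne')
      rw [MvPowerSeries.coeff_smul, ho I (hI.trans_le this), mul_zero]
  | coprime a b ha hb hab iha ihb =>
    have h1 := iha (by omega) fun p hp => hg p (hp.mul_right b)
    have h2 := ihb (by omega) fun p hp => hg p (hp.mul_left a)
    have e := Nat.gcd_eq_gcd_ab a b
    rw [hab] at e
    have e' : (1 : ℂ) = a * a.gcdA b + b * a.gcdB b := by exact_mod_cast e
    have ha' : (a : ℂ) ≠ 0 := by exact_mod_cast (by omega : a ≠ 0)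
    have hb' : (b : ℂ) ≠ 0 := by exact_mod_cast (by omega : b ≠ 0)
    have : ((a * b : ℕ) : ℂ)⁻¹ • f =
        a.gcdA b • ((b : ℂ)⁻¹ • f) + a.gcdB b • ((a : ℂ)⁻¹ • f) := by
      rw [← Int.cast_smul_eq_zsmul ℂ, ← Int.cast_smul_eq_zsmul ℂ, smul_smul, smul_smul, ← add_smul]
      congr 1
      push_cast
      field_simp
      linear_combination e'
    rw [this]
    exact Subring.add_mem _ (Subring.zsmul_mem _ h2 _) (Subring.zsmul_mem _ h1 _)

lemma LocalBundle.Close.τ_mem {B E A : Type} [CommRing B] [AddCommGroup E] [Module B E]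
    [CommRing A] [Algebra ℚ A] {n r n' r' : ℕ} {L : LocalBundle B E n r} {L' : LocalBundle B E n' r'}
    (T : L.Close L' A) (Z : Subring A) (hφ : ∀ b, T.φ b ∈ Z) {good : ℕ → Prop}
    (h : ∀ p, p.Prime → good p → ∀ k e, ∃ e', (L.nabla k)^[p] e - L.w k • L.nabla k e = p • e')
    (g : Nat.Primes → ℕ) (hg : ∀ p : Nat.Primes, good p → g p + 1 ≤ (p : ℕ) ^ 2)
    (hg' : ∀ p : Nat.Primes, ¬ good p → g p = 0)
    (hZ : ∀ (K : Fin n → ℕ) (M : ℕ), M ≠ 0 → (∀ p : Nat.Primes, (p : ℕ) ∣ M → g p + 1 ≤ ∑ k, K k) →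
      algebraMap ℚ A (M : ℚ)⁻¹ * ∏ k, T.ξ k ^ K k ∈ Z) (e : E) (x : Fin r) : T.τ e x ∈ Z := by
  rw [τ, taylor, Finset.sum_apply]
  refine Subring.sum_mem _ fun K _ => ?_
  obtain ⟨M, hMF, hM, e', he'⟩ := L.iter.exists_smul_eq_factorial_smul L.w_eq h K e
  set F := ∏ k, (K k).factorial with hF
  have hF0 : F ≠ 0 := Finset.prod_ne_zero_iff.mpr fun k _ => Nat.factorial_ne_zero _
  have hM0 : M ≠ 0 := fun h0 => hF0 (Nat.eq_zero_of_zero_dvd (h0 ▸ hMF))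
  have h1 : (M : A) * T.φ (L.κ (L.iter.N K e) x) = F * T.φ (L.κ e' x) := by
    have := congrArg (fun v => T.φ (L.κ v x)) he'
    simpa using this
  have h2 : multiPow T.ξ K = algebraMap ℚ A (F : ℚ)⁻¹ * ∏ k, T.ξ k ^ K k := by
    rw [multiPow, hF]
    simp only [divPow]
    rw [Finset.prod_mul_distrib, ← map_prod, Nat.cast_prod, Finset.prod_inv_distrib]
  have h3 (m : ℕ) (hm : m ≠ 0) : algebraMap ℚ A (m : ℚ)⁻¹ * m = 1 := by
    rw [← map_natCast (algebraMap ℚ A), ← map_mul, inv_mul_cancel₀ (by exact_mod_cast hm), map_one]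
  have h4 : (multiPow T.ξ K • (T.φ ∘ L.κ (L.iter.N K e))) x =
      (algebraMap ℚ A (M : ℚ)⁻¹ * ∏ k, T.ξ k ^ K k) * T.φ (L.κ e' x) := by
    rw [Pi.smul_apply, Function.comp_apply, smul_eq_mul, h2]
    linear_combination (-(algebraMap ℚ A (F : ℚ)⁻¹ * (∏ k, T.ξ k ^ K k) *
      T.φ (L.κ (L.iter.N K e) x))) * h3 M hM0 + algebraMap ℚ A (F : ℚ)⁻¹ *
      algebraMap ℚ A (M : ℚ)⁻¹ * (∏ k, T.ξ k ^ K k) * h1 +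
      algebraMap ℚ A (M : ℚ)⁻¹ * (∏ k, T.ξ k ^ K k) * T.φ (L.κ e' x) * h3 F hF0
  rw [h4]
  refine Subring.mul_mem _ (hZ K M hM0 fun p hp => ?_) (hφ _)
  by_cases hp' : good p
  · exact (hg p hp').trans (hM p p.2 hp hp')
  · rw [hg' p hp']
    obtain ⟨k, -, hk⟩ := p.2.prime.exists_mem_finset_dvd (hp.trans hMF)
    exact (p.2.pos.trans_le ((Nat.Prime.dvd_factorial p.2).mp hk)).trans_le
      (Finset.single_le_sum (f := K) (fun _ _ => Nat.zero_le _) (Finset.mem_univ k))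

lemma injective_of_isPushout {Λ A Λ' A' : CommRingCat.{0}} {f : Λ ⟶ A} {g : Λ ⟶ Λ'} {g' : A ⟶ A'}
    {f' : Λ' ⟶ A'} (hp : IsPushout f g g' f') (hf : f.hom.Flat) (hg : Function.Injective g.hom) :
    Function.Injective g'.hom := by
  algebraize [f.hom, g.hom]
  have h := (CommRingCat.isPushout_tensorProduct Λ A Λ').flip.flip
  have e := IsPushout.inl_isoIsPushout_hom _ _ hp h
  have h1 : Function.Injective (Algebra.TensorProduct.includeLeftRingHom : A →+* TensorProduct Λ A Λ') :=
    Algebra.TensorProduct.includeLeft_injective (S := Λ) hg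
  intro a b hab
  apply h1
  have := congrArg (IsPushout.isoIsPushout _ _ hp h).hom.hom hab
  rw [← CommRingCat.comp_apply, ← CommRingCat.comp_apply, e] at this
  exact this

lemma BaseChart.bcPull_injective_of_flat {X S B T T' : Scheme.{0}} {f : X ⟶ S} {ι : Type}
    {D : ι → X.IdealSheafData} {q : S ⟶ B} {s : B ⟶ S} [IsAffine B] [IsAffine T] [IsAffine T']
    {t : T ⟶ S} {t' : T' ⟶ S} (ch : BaseChart f D q s) (ht : OnSection q s t) (u : T' ⟶ T)
    (w : u ≫ t = t') (hu : Function.Injective (constMap u ⊤)) {U : X.Opens} (hU : U ≤ ch.V)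
    (hUa : IsAffineOpen U) : Function.Injective (bcPull f u w U) :=
  injective_of_isPushout (ch.isPushout_bcPull hU hUa ht u w) (ch.etaleCoords ht hU hUa).flat hu

lemma AdicRing.Le.constMap_injective {d : ℕ} {A A' : Subring (MvPowerSeries (Fin d) ℂ)}
    (h : (trunc A).Le (trunc A')) (n : ℕ) : Function.Injective (constMap (h.spec n) ⊤) :=
  constMap_spec_injective (Ideal.quotientMap_injective' fun _ hx => hx)

section

variable {X S B : Scheme.{0}} {f : X ⟶ S} {ι : Type} {D : ι → X.IdealSheafData} {q : S ⟶ B}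
  {s : B ⟶ S} [IsAffine B] {T₀ T₁ T₂ Z₀ Z₁ Z₂ : Scheme.{0}} [IsAffine T₀] [IsAffine T₁] [IsAffine T₂]
  [IsAffine Z₀] [IsAffine Z₁] [IsAffine Z₂] {i₀ : Z₀ ⟶ T₀} {i₁ : Z₁ ⟶ T₁} {i₂ : Z₂ ⟶ T₂} {t₀ : T₀ ⟶ S}
  {t₁ : T₁ ⟶ S} {t₂ : T₂ ⟶ S} (th₀ : Thickening q s i₀ t₀) (th₁ : Thickening q s i₁ t₁)
  (th₂ : Thickening q s i₂ t₂) (hs : s ≫ q = 𝟙 _) (u₁ : T₁ ⟶ T₀) (w₁ : u₁ ≫ t₀ = t₁) (u₂ : T₂ ⟶ T₁)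
  (w₂ : u₂ ≫ t₁ = t₂) (v₁ : Z₁ ⟶ Z₀) (hv₁ : v₁ ≫ i₀ = i₁ ≫ u₁) (v₂ : Z₂ ⟶ Z₁)
  (hv₂ : v₂ ≫ i₁ = i₂ ≫ u₂)

/-- Monomials in the differences of coordinates have small denominators. -/
lemma BaseChart.prod_xi_mem (th₀ : Thickening q s i₀ t₀) (th₁ : Thickening q s i₁ t₁)
    (w₁ : u₁ ≫ t₀ = t₁) (hv₁ : v₁ ≫ i₀ = i₁ ≫ u₁) (hv₂ : v₂ ≫ i₁ = i₂ ≫ u₂)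
    (ch ch' : BaseChart f D q s) {U : X.Opens} (hU : U ≤ ch.V) (hU' : U ≤ ch'.V)
    (hUa : IsAffineOpen U) (K : Fin ch.n → ℕ) (a : Γ(T₂, ⊤))
    (ha : ∀ x ∈ RingHom.ker (constMap i₀ ⊤) ^ ∑ k, K k,
      ∃ y, a * constMap u₂ ⊤ (constMap u₁ ⊤ x) = constMap u₂ ⊤ y) :
    constMap (pullback.snd f t₂) (bc f t₂ U) a * ∏ k, ch.xi ch' th₂ hs hU hU' hUa k ^ K k ∈
      (bcPull f u₂ w₂ U).range := by
  set Z := (bcPull f u₂ w₂ U).range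
  let π := (bcPull f u₂ w₂ U).comp (bcPull f u₁ w₁ U)
  have hprod : ∏ k, ch.xi ch' th₀ hs hU hU' hUa k ^ K k ∈
      (RingHom.ker (constMap i₀ ⊤) ^ ∑ k, K k).map (constMap (pullback.snd f t₀) (bc f t₀ U)) := by
    rw [Ideal.map_pow, ← Finset.prod_pow_eq_pow_sum, ← ch.ker_bcPull th₀ hU hUa]
    exact Ideal.prod_mem_prod fun k _ => Ideal.pow_mem_pow
      (RingHom.mem_ker.mpr (ch.bcPull_xi_zero ch' th₀ hs hU hU' hUa k)) _
  have h1 (y) (hy : y ∈ (RingHom.ker (constMap i₀ ⊤) ^ ∑ k, K k).map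
      (constMap (pullback.snd f t₀) (bc f t₀ U))) :
      constMap (pullback.snd f t₂) (bc f t₂ U) a * π y ∈ Z := by
    refine Submodule.span_induction (p := fun y _ => constMap (pullback.snd f t₂) _ a * π y ∈ Z)
      ?_ ?_ ?_ ?_ hy
    · rintro _ ⟨x, hx, rfl⟩
      obtain ⟨y, hy⟩ := ha x hx
      refine ⟨constMap (pullback.snd f t₁) (bc f t₁ U) y, ?_⟩
      rw [RingHom.comp_apply, bcPull_constMap, bcPull_constMap, bcPull_constMap, ← map_mul, hy]
    · rw [map_zero, mul_zero]; exact Subring.zero_mem _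
    · intro x y _ _ hx hy
      rw [map_add, mul_add]
      exact Subring.add_mem _ hx hy
    · intro b x _ hx
      rw [smul_eq_mul, map_mul, mul_left_comm]
      exact Subring.mul_mem _ ⟨_, rfl⟩ hx
  have h2 := h1 _ hprod
  rw [map_prod] at h2
  simp only [map_pow] at h2
  have h3 (k) : π (ch.xi ch' th₀ hs hU hU' hUa k) = ch.xi ch' th₂ hs hU hU' hUa k :=
    (congrArg _ (ch.bcPull_xi ch' th₀ hs th₁ u₁ w₁ v₁ hv₁ hU hU' hUa k)).trans
      (ch.bcPull_xi ch' th₁ hs th₂ u₂ w₂ v₂ hv₂ hU hU' hUa k)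
  simp only [h3] at h2
  exact h2

end

variable {X S : Scheme.{0}} {f : X ⟶ S} {ι : Type} {D : ι → X.IdealSheafData} {R R' : Subring ℂ}
  {h : R ≤ R'} {q : S ⟶ Spec (CommRingCat.of R)} {s : Spec (CommRingCat.of R) ⟶ S} {d : ℕ}
  {E : FlatBundleOver f D s}

lemma FramedChart.exists_transport (C C' : FramedChart q E) {T₀ T₁ T₂ Z₀ Z₁ Z₂ : Scheme.{0}}
    [IsAffine T₀] [IsAffine T₁] [IsAffine T₂] [IsAffine Z₀] [IsAffine Z₁] [IsAffine Z₂]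
    {i₀ : Z₀ ⟶ T₀} {i₁ : Z₁ ⟶ T₁} {i₂ : Z₂ ⟶ T₂} {t₀ : T₀ ⟶ S} {t₁ : T₁ ⟶ S} {t₂ : T₂ ⟶ S}
    (th₀ : Thickening q s i₀ t₀) (th₁ : Thickening q s i₁ t₁) (th₂ : Thickening q s i₂ t₂)
    (hs : s ≫ q = 𝟙 _) (u₁ : T₁ ⟶ T₀) (w₁ : u₁ ≫ t₀ = t₁) (u₂ : T₂ ⟶ T₁) (w₂ : u₂ ≫ t₁ = t₂)
    (v₁ : Z₁ ⟶ Z₀) (hv₁ : v₁ ≫ i₀ = i₁ ≫ u₁) (v₂ : Z₂ ⟶ Z₁) (hv₂ : v₂ ≫ i₁ = i₂ ≫ u₂)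
    [Algebra ℚ Γ(T₂, ⊤)] (g : Nat.Primes → ℕ)
    (hg : ∀ p : Nat.Primes, PCurvatureVanishesModP E p → g p + 1 ≤ (p : ℕ) ^ 2)
    (hg' : ∀ p : Nat.Primes, ¬ PCurvatureVanishesModP E p → g p = 0)
    (hT : ∀ m M : ℕ, M ≠ 0 → (∀ p : Nat.Primes, (p : ℕ) ∣ M → g p + 1 ≤ m) →
      ∀ x ∈ RingHom.ker (constMap i₀ ⊤) ^ m, ∃ y,
        algebraMap ℚ Γ(T₂, ⊤) (M : ℚ)⁻¹ * constMap u₂ ⊤ (constMap u₁ ⊤ x) = constMap u₂ ⊤ y)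
    {U : X.Opens} (hU : U ≤ C.V) (hU' : U ≤ C'.V) (hUa : IsAffineOpen U) :
    ∃ M : Matrix (Fin C.r) (Fin C'.r) Γ(pullback f t₁, bc f t₁ U),
      M.map (bcPull f u₂ w₂ U) = C.transport C' th₂ hs hU hU' hUa := by
  let _ : Algebra ℚ Γ(pullback f t₂, bc f t₂ U) :=
    ((constMap (pullback.snd f t₂) (bc f t₂ U)).comp (algebraMap ℚ Γ(T₂, ⊤))).toAlgebra
  have key (l x) : (C.close C' th₂ hs hU hU' hUa).τ ((C'.loc hs hU').frame l) x ∈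
      (bcPull f u₂ w₂ U).range :=
    (C.close C' th₂ hs hU hU' hUa).τ_mem (bcPull f u₂ w₂ U).range
      (fun b => ⟨_, C.bcPull_phi th₁ hs th₂ u₂ w₂ v₂ hv₂ hU hUa b⟩)
      (fun p hp hE k e => C.exists_iterate_nabla_sub hs hU hUa hp hE k e) g hg hg'
      (fun K M hM hK => C.prod_xi_mem th₂ hs u₁ u₂ w₂ v₁ v₂ th₀ th₁ w₁ hv₁ hv₂
        C'.toBaseChart hU hU' hUa K _ (hT _ M hM hK)) _ x
  choose M hM using key
  exact ⟨.of fun x l => M l x, by ext x l; exact hM l x⟩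

namespace FormalCoordinates

variable (c : FormalCoordinates h q s d)

instance (P : AdicRing d) (hP : (adic (coeffsIn d R')).Le P) (n : ℕ) :
    IsAffine ((c.tower P hP).T n) := inferInstanceAs (IsAffine (P.spec n))

/-- The thickenings given by subrings of the ring of power series. -/
lemma truncThickening (hs : s ≫ q = 𝟙 _) (A : Subring (MvPowerSeries (Fin d) ℂ))
    (hA : (adic (coeffsIn d R')).Le (trunc A)) (n : ℕ) :
    Thickening q s ((trunc A).specZero n) ((c.tower _ hA).t n) :=
  c.thickening hs _ hA n (trunc_nilpotent _ n)

end FormalCoordinates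

lemma exists_inv_mul_toLevel (R : Subring ℂ) (g : Nat.Primes → ℕ) (n : ℕ)
    (hg : (trunc (coeffsIn d R)).Le (trunc (gSubring d R g)))
    (hQ : (trunc (gSubring d R g)).Le (trunc (coeffsIn d (rat R))))
    [Algebra ℚ Γ((trunc (coeffsIn d (rat R))).spec n, ⊤)] {m M : ℕ} (hM : M ≠ 0)
    (hm : ∀ p : Nat.Primes, (p : ℕ) ∣ M → g p + 1 ≤ m) (x)
    (hx : x ∈ RingHom.ker (constMap ((trunc (coeffsIn d R)).specZero n) ⊤) ^ m) :
    ∃ y, algebraMap ℚ Γ((trunc (coeffsIn d (rat R))).spec n, ⊤) (M : ℚ)⁻¹ *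
      constMap (hQ.spec n) ⊤ (constMap (hg.spec n) ⊤ x) = constMap (hQ.spec n) ⊤ y := by
  have h1 : RingHom.ker (constMap ((trunc (coeffsIn d R)).specZero n) ⊤) ^ m ≤
      (orderIdeal (trunc (coeffsIn d R)).A m).map ((trunc (coeffsIn d R)).toLevel n) := by
    refine le_trans (le_of_eq ?_) (Ideal.map_mono (orderIdeal_pow _ m))
    rw [AdicRing.specZero_eq, ker_constMap_spec, AdicRing.ker_projZero, Ideal.map_pow,
      ← Ideal.map_coe (specEquiv _), Ideal.map_map]
    rfl
  obtain ⟨l, hl, rfl⟩ := (Ideal.mem_map_iff_of_surjective _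
    ((trunc (coeffsIn d R)).toLevel_surjective n)).mp (h1 hx)
  let l' : (trunc (gSubring d R g)).A :=
    ⟨(M : ℂ)⁻¹ • l.1, inv_smul_mem_gSubring R g hM hm l.2 hl⟩
  have e : Subring.inclusion hQ.1 (Subring.inclusion hg.1 l) =
      (M : (trunc (coeffsIn d (rat R))).A) * Subring.inclusion hQ.1 l' := by
    refine Subtype.ext ?_
    change l.1 = (M : MvPowerSeries (Fin d) ℂ) * ((M : ℂ)⁻¹ • l.1)
    rw [← nsmul_eq_mul, ← Nat.cast_smul_eq_nsmul ℂ, smul_smul,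
      mul_inv_cancel₀ (by exact_mod_cast hM), one_smul]
  refine ⟨(trunc (gSubring d R g)).toLevel n l', ?_⟩
  rw [AdicRing.constMap_toLevel, AdicRing.constMap_toLevel, AdicRing.constMap_toLevel, e, map_mul,
    map_natCast, ← mul_assoc, ← map_natCast (algebraMap ℚ
    Γ((trunc (coeffsIn d (rat R))).spec n, ⊤)), ← map_mul, inv_mul_cancel₀ (by exact_mod_cast hM),
    map_one, one_mul]

end

section

/-! ### Models of the isomonodromic deformation -/

namespace LocalCocycle

variable {X S B : Scheme.{0}} {f : X ⟶ S} {ι : Type} {D : ι → X.IdealSheafData}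
  {q : S ⟶ B} {s : B ⟶ S} [IsAffine B] {E : FlatBundleOver f D s} {J : Type}
  {C : J → FramedChart q E} {T T₀ T' T₀' : Scheme.{0}} [IsAffine T] [IsAffine T₀] [IsAffine T']
  [IsAffine T₀'] {t : T ⟶ S} {i : T₀ ⟶ T} {t' : T' ⟶ S} {i' : T₀' ⟶ T'} {th : Thickening q s i t}
  {hs : s ≫ q = 𝟙 _}

/-- The pullback of a cocycle. -/
def pullback (N : LocalCocycle C th hs) (th' : Thickening q s i' t') (u : T' ⟶ T)
    (w : u ≫ t = t') (u₀ : T₀' ⟶ T₀) (hu : u₀ ≫ i = i' ≫ u) : LocalCocycle C th' hs where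
  G a b U ha hb hU := (N.G a b U ha hb hU).map (bcPull f u w U)
  res a b U V ha hb hU hV hVa := by
    rw [← N.res a b U V ha hb hU hV hVa]
    ext x y
    exact resO_bcPull f u w hV _
  self a U ha hU := by rw [N.self, Matrix.map_one _ (map_zero _) (map_one _)]
  mul a b c U ha hb hc hU := by rw [← Matrix.map_mul, N.mul]
  gauge a b U ha hb hU k := by
    have p (a) := (C a).logChart_isPullback th.on th'.on u w
    have hd (x) : ((((C a).logChart th'.on).der k).app _ ((C a).le_logChart th'.on ha))
        (bcPull f u w U x) = bcPull f u w U ((((C a).logChart th.on).der k).app _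
          ((C a).le_logChart th.on ha) x) :=
      (p a).der (bcMap_snd f u w) ((C a).le_logChart th.on ha) ((C a).le_logChart th'.on ha)
        (bc_le f u w U) k x
    have hlam (m) : ((C b).logChart th'.on).lam (((C a).logChart th'.on).der k)
        ((C a).le_logChart th'.on ha) ((C b).le_logChart th'.on hb) m =
        bcPull f u w U (((C b).logChart th.on).lam (((C a).logChart th.on).der k)
        ((C a).le_logChart th.on ha) ((C b).le_logChart th.on hb) m) :=
      (p b).lam ((C a).le_logChart th.on ha) ((C b).le_logChart th.on hb)
        ((C a).le_logChart th'.on ha) ((C b).le_logChart th'.on hb) (bc_le f u w U)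
        (((C a).logChart th.on).der k) (((C a).logChart th'.on).der k) hd m
    have key := congrArg (fun M => M.map (bcPull f u w U)) (N.gauge a b U ha hb hU k)
    rw [Matrix.map_sub _ (map_sub _), Matrix.map_mul, Matrix.map_mul, map_sum_smul] at key
    simp only [hlam, ← map_conn (th := th) (th' := th') u w u₀ hu a ha hU,
      ← map_conn (th := th) (th' := th') u w u₀ hu b hb hU]
    rw [← key]
    ext x y
    exact hd _

end LocalCocycle

variable {X S : Scheme.{0}} {f : X ⟶ S} {ι : Type} {D : ι → X.IdealSheafData} {R R' : Subring ℂ}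
  {h : R ≤ R'} {q : S ⟶ Spec (CommRingCat.of R)} {s : Spec (CommRingCat.of R) ⟶ S} {d : ℕ}
  {E : FlatBundleOver f D s} (c : FormalCoordinates h q s d) (hs : s ≫ q = 𝟙 _) {J : Type}
  (C : J → FramedChart q E)

instance (n : ℕ) : Algebra ℚ Γ((trunc (coeffsIn d (rat R))).spec n, ⊤) :=
  (((trunc (coeffsIn d (rat R))).toLevel n).comp (ratHom d R)).toAlgebra

namespace FormalCoordinates

instance (hQ : (adic (coeffsIn d R')).Le (trunc (coeffsIn d (rat R')))) (n : ℕ) :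
    Algebra ℚ Γ((c.tower _ hQ).T n, ⊤) :=
  inferInstanceAs (Algebra ℚ Γ((trunc (coeffsIn d (rat R'))).spec n, ⊤))

/-- A model of the isomonodromic deformation given by a compatible system of cocycles. -/
lemma hasModel (hC : ∀ x : (pullback f s : Scheme), ∃ a, pullback.fst f s x ∈ (C a).V)
    {P : AdicRing d} (hP : (adic (coeffsIn d R')).Le P)
    (hQ : P.Le (trunc (coeffsIn d (rat R'))))
    (th : ∀ n, Thickening q s (P.specZero n) ((c.tower P hP).t n))
    (N : ∀ n, LocalCocycle C (th n) hs)
    (hN : ∀ n a b U ha hb hU, ((N (n + 1)).G a b U ha hb hU).map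
      (bcPull f (P.specIncl n) ((c.tower P hP).w n) U) = (N n).G a b U ha hb hU)
    (hN' : ∀ n a b U ha hb hU, ((N n).G a b U ha hb hU).map
      (bcPull f (hQ.spec n) ((c.towerMap hP hQ).w n) U) =
        ((c.eulerTower hs (hP.trans hQ)).cocycle C n).G a b U ha hb hU) :
    HasModel c P hP hQ E := by
  let Q := c.eulerTower hs (hP.trans hQ)
  have p (m) : ((N (m + 1)).datum hC).IsPullback ((c.tower P hP).incl f m) ((N m).datum hC) :=
    LocalCocycle.isPullback _ hC (P.specIncl m) ((c.tower P hP).w m) (𝟙 _) _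
      (by rw [Category.id_comp]; rfl) (hN m)
  have pj (m) : ((N m).datum hC).IsPullback (bcMap f ((c.towerMap hP hQ).j m)
      ((c.towerMap hP hQ).w m)) (Q.datum C hC m) :=
    LocalCocycle.isPullback _ hC (hQ.spec m) ((c.towerMap hP hQ).w m) (hQ.spec 0) _
      (AdicRing.Le.specZero _ hQ m).symm (hN' m)
  refine ⟨Q.formal C hC, ⟨⟨Q.absConnection C hC⟩, ⟨?_⟩⟩, formalBundle _ p,
    ⟨formalPullbackMap (c.towerMap hP hQ) _ p _ (Q.isPullback_datum C hC) pj⟩⟩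
  exact LocalCocycle.pullbackMapOfInjective hs (Q.th 0)
    (fun x y e => by
      have e' : constMap (𝟙 ((trunc (coeffsIn d (rat R'))).spec 0)) ⊤ x =
        constMap (𝟙 ((trunc (coeffsIn d (rat R'))).spec 0)) ⊤ y := e
      exact (constMap_id x).symm.trans (e'.trans (constMap_id y))) (Q.hΦ 0) _ (c.tower_zero _ (hP.trans hQ)) hC

variable (g : Nat.Primes → ℕ)

lemma le_gSubring (R' : Subring ℂ) (g : Nat.Primes → ℕ) :
    (adic (coeffsIn d R')).Le (trunc (gSubring d R' g)) :=
  (adic_le_trunc _).trans (trunc_le_trunc (coeffsIn_le_gSubring R' g))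

variable (hg : ∀ p : Nat.Primes, PCurvatureVanishesModP E p → g p + 1 ≤ (p : ℕ) ^ 2)
    (hg' : ∀ p : Nat.Primes, ¬ PCurvatureVanishesModP E p → g p = 0)

lemma bcPull_gSubring_injective (hs : s ≫ q = 𝟙 _) (C : J → FramedChart q E)
    (g : Nat.Primes → ℕ) (n : ℕ) (a : J) {U : X.Opens} (hU : U ≤ (C a).V)
    (hUa : IsAffineOpen U) : Function.Injective (bcPull f ((trunc_le_trunc (gSubring_le R' g)).spec n)
      ((c.towerMap (le_gSubring R' g) (trunc_le_trunc (gSubring_le R' g))).w n) U) :=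
  (C a).bcPull_injective_of_flat (c.truncThickening hs _ (le_gSubring R' g) n).on _ _
    (AdicRing.Le.constMap_injective (trunc_le_trunc (gSubring_le R' g)) n) hU hUa

/-- The cocycles over the rings of integral elements. -/
def gCocycle (hg : ∀ p : Nat.Primes, PCurvatureVanishesModP E p → g p + 1 ≤ (p : ℕ) ^ 2)
    (hg' : ∀ p : Nat.Primes, ¬ PCurvatureVanishesModP E p → g p = 0) (n : ℕ) :
    LocalCocycle C (c.truncThickening hs _ (le_gSubring R' g) n) hs :=
  LocalCocycle.descend ((trunc_le_trunc (gSubring_le R' g)).spec n)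
    ((c.towerMap (le_gSubring R' g) (trunc_le_trunc (gSubring_le R' g))).w n)
    ((trunc_le_trunc (gSubring_le R' g)).spec 0)
    ((c.eulerTower hs _).cocycle C n)
    (fun a _ hU hUa => c.bcPull_gSubring_injective hs C g n a hU hUa)
    (fun a b U ha hb hU => (C a).exists_transport (C b)
      (c.truncThickening hs _ (adic_le_trunc _) n)
      (c.truncThickening hs _ (le_gSubring R' g) n)
      (c.truncThickening hs _ ((le_gSubring R' g).trans (trunc_le_trunc (gSubring_le R' g))) n) hs
      ((trunc_le_trunc (coeffsIn_le_gSubring R' g)).spec n)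
      ((c.towerMap (adic_le_trunc _) (trunc_le_trunc (coeffsIn_le_gSubring R' g))).w n) _ _
      ((trunc_le_trunc (coeffsIn_le_gSubring R' g)).spec 0)
      (AdicRing.Le.specZero _ _ n).symm _
      (AdicRing.Le.specZero _ (trunc_le_trunc (gSubring_le R' g)) n).symm g hg hg'
      (fun m M hM hm => exists_inv_mul_toLevel R' g n _ _ hM hm) ha hb hU)
    (AdicRing.Le.specZero _ (trunc_le_trunc (gSubring_le R' g)) n).symm

lemma map_gCocycle (n : ℕ) (a b U ha hb hU) :
    ((c.gCocycle hs C g hg hg' n).G a b U ha hb hU).map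
      (bcPull f ((trunc_le_trunc (gSubring_le R' g)).spec n)
        ((c.towerMap (le_gSubring R' g) (trunc_le_trunc (gSubring_le R' g))).w n) U) =
      ((c.eulerTower hs _).cocycle C n).G a b U ha hb hU :=
  LocalCocycle.map_descend _ _ _ _ _ _ _ a b U ha hb hU

lemma map_gCocycle_incl (n : ℕ) (a b U ha hb hU) :
    ((c.gCocycle hs C g hg hg' (n + 1)).G a b U ha hb hU).map
      (bcPull f ((trunc (gSubring d R' g)).specIncl n) ((c.tower _ (le_gSubring R' g)).w n) U) =
      (c.gCocycle hs C g hg hg' n).G a b U ha hb hU := by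
  apply Matrix.map_injective (c.bcPull_gSubring_injective hs C g n a ha hU)
  dsimp only
  refine Eq.trans ?_ (c.map_gCocycle hs C g hg hg' n a b U ha hb hU).symm
  rw [← (c.eulerTower hs _).map_cocycle C n a b U ha hb hU]
  rw [← c.map_gCocycle hs C g hg hg' (n + 1) a b U ha hb hU]
  have hQ := trunc_le_trunc (gSubring_le (d := d) R' g)
  have w : (hQ.spec n ≫ (trunc (gSubring d R' g)).specIncl n) ≫
      (c.tower _ (le_gSubring R' g)).t (n + 1) = (c.tower _ ((le_gSubring R' g).trans hQ)).t n :=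
    (Category.assoc _ _ _).trans ((congrArg _ ((c.tower _ (le_gSubring R' g)).w n)).trans
      ((c.towerMap (le_gSubring R' g) hQ).w n))
  ext x y
  exact (bcPull_comp f _ _ _ _ _ rfl w U _).trans
    (bcPull_comp f _ _ _ _ _ (hQ.spec_incl n).symm w U _).symm

/-- The isomonodromic deformation is integral up to the degrees given by the squares of primes. -/
lemma isGIntegralDegreewise
    (hC : ∀ x : (pullback f s : Scheme), ∃ a, pullback.fst f s x ∈ (C a).V)
    (hg : ∀ p : Nat.Primes, PCurvatureVanishesModP E p → g p + 1 ≤ (p : ℕ) ^ 2)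
    (hg' : ∀ p : Nat.Primes, ¬ PCurvatureVanishesModP E p → g p = 0) (hs : s ≫ q = 𝟙 _) :
    IsGIntegralDegreewise c g E :=
  c.hasModel hs C hC _ _ _ (c.gCocycle hs C g hg hg') (c.map_gCocycle_incl hs C g hg hg')
    (c.map_gCocycle hs C g hg hg')

end FormalCoordinates

end

section

/-! ### Comparison of the topologies on the rings of integral elements -/

section PowerSeries

variable {d : ℕ}

lemma exists_eq_sum_X_mul (Λ : Subring ℂ) {m : ℕ} {f : MvPowerSeries (Fin d) ℂ}
    (hf : f ∈ coeffsIn d Λ) (hm : OrderGE (m + 1) f) :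
    ∃ k : Fin d → MvPowerSeries (Fin d) ℂ, (∀ i, k i ∈ coeffsIn d Λ ∧ OrderGE m (k i)) ∧
      f = ∑ i, MvPowerSeries.X i * k i := by
  classical
  have hne (I : Fin d →₀ ℕ) : ∃ i : Fin d → Prop, I ≠ 0 → ∃ j, i = (· = j) ∧ I j ≠ 0 := by
    by_cases hI : I = 0
    · exact ⟨fun _ => False, fun h => absurd hI h⟩
    · obtain ⟨j, hj⟩ := Finsupp.ne_iff.mp hI
      exact ⟨(· = j), fun _ => ⟨j, rfl, hj⟩⟩
  choose i hi using hne
  let k (j : Fin d) : MvPowerSeries (Fin d) ℂ := fun I =>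
    if i (I + Finsupp.single j 1) j then MvPowerSeries.coeff (I + Finsupp.single j 1) f else 0
  have hk (j I) : MvPowerSeries.coeff I (k j) = if i (I + Finsupp.single j 1) j then
      MvPowerSeries.coeff (I + Finsupp.single j 1) f else 0 := rfl
  refine ⟨k, fun j => ⟨?_, fun I hI => ?_⟩, ?_⟩
  · rw [mem_coeffsIn] at hf ⊢
    intro I
    rw [hk]
    split_ifs
    · exact hf _
    · exact Λ.zero_mem
  · rw [hk, hm _ (by rw [map_add, Finsupp.degree_single]; omega), ite_self]
  · ext I
    rw [map_sum]
    simp only [MvPowerSeries.X, MvPowerSeries.coeff_monomial_mul, one_mul, hk]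
    by_cases hI : I = 0
    · rw [hm I (by rw [hI, map_zero]; omega), Finset.sum_eq_zero fun j _ => ?_]
      rw [if_neg]
      intro hle
      have := hle j
      simp [hI] at this
    · obtain ⟨j, hj, hIj⟩ := hi I hI
      rw [Finset.sum_eq_single j]
      · have hle : Finsupp.single j 1 ≤ I := by simpa [Nat.one_le_iff_ne_zero] using hIj
        rw [if_pos hle, tsub_add_cancel_of_le hle, hj, if_pos rfl]
      · intro l _ hl
        split_ifs with hle h2
        · rw [tsub_add_cancel_of_le hle, hj] at h2
          exact absurd h2 hl
        · rfl
        · rfl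
      · simp

lemma mem_augIdeal_pow {A : Subring (MvPowerSeries (Fin d) ℂ)} {Λ : Subring ℂ} {m : ℕ}
    (hX : ∀ i, MvPowerSeries.X i ∈ A) (hA : ∀ f ∈ coeffsIn d Λ, OrderGE (m + 1) f → f ∈ A) (n : ℕ)
    {f : MvPowerSeries (Fin d) ℂ} (hf : f ∈ coeffsIn d Λ) (ho : OrderGE (n + m + 1) f) :
    f ∈ (augIdeal A ^ (n + 1)).toAddSubgroup.map A.subtype.toAddMonoidHom := by
  induction n generalizing f with
  | zero =>
    rw [zero_add] at ho
    refine ⟨⟨f, hA f hf ho⟩, ?_, rfl⟩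
    rw [zero_add, pow_one]
    exact ho 0 (by simp)
  | succ n ih =>
    obtain ⟨k, hk, rfl⟩ := exists_eq_sum_X_mul Λ hf
      (m := n + m + 1) (by rwa [show n + m + 1 + 1 = n + 1 + m + 1 by omega])
    refine AddSubgroup.sum_mem _ fun i _ => ?_
    obtain ⟨a, ha, hak⟩ := ih (hk i).1 (hk i).2
    refine ⟨⟨_, hX i⟩ * a, ?_, by rw [← hak]; rfl⟩
    rw [pow_succ', SetLike.mem_coe]
    refine Ideal.mul_mem_mul ?_ ha
    change MvPowerSeries.constantCoeff (MvPowerSeries.X i : MvPowerSeries (Fin d) ℂ) = 0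
    simp

lemma exists_partialFractions (R : Subring ℂ) (F : Finset Nat.Primes) {M : ℕ} (hM : M ≠ 0)
    (hF : ∀ p : Nat.Primes, (p : ℕ) ∣ M → p ∈ F) {c : ℂ} (hc : M * c ∈ R) :
    ∃ c₀ ∈ R, ∃ v : Nat.Primes → ℂ, (∀ p : Nat.Primes, v p ∈ invert R ((p : ℕ) : ℂ)) ∧
      (∀ p : Nat.Primes, ¬ (p : ℕ) ∣ M → v p = 0) ∧ c = c₀ + ∑ p ∈ F, v p := by
  classical
  induction M using Nat.recOnPosPrimePosCoprime generalizing c with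
  | zero => exact absurd rfl hM
  | one => exact ⟨c, by simpa using hc, 0, fun _ => Subring.zero_mem _, fun _ _ => rfl, by simp⟩
  | prime_pow p n hp hn =>
    let P : Nat.Primes := ⟨p, hp⟩
    refine ⟨0, R.zero_mem, Pi.single P c, fun l => ?_, fun l hl => ?_, ?_⟩
    · by_cases hl : l = P
      · subst hl
        rw [Pi.single_eq_same]
        have hp0 : (p : ℂ) ≠ 0 := by exact_mod_cast hp.ne_zero
        have : c = (p : ℂ)⁻¹ ^ n * ((p ^ n : ℕ) * c) := by
          rw [← mul_assoc, Nat.cast_pow, ← mul_pow, inv_mul_cancel₀ hp0, one_pow, one_mul]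
        rw [this]
        exact Subring.mul_mem _ (Subring.pow_mem _ ((le_sup_right : _ ≤ invert R p)
          (Subring.subset_closure rfl)) _) ((le_sup_left : R ≤ _) hc)
      · rw [Pi.single_eq_of_ne hl]; exact Subring.zero_mem _
    · refine Pi.single_eq_of_ne ?_ _
      rintro rfl
      exact hl (dvd_pow_self p hn.ne')
    · rw [Finset.sum_pi_single', if_pos (hF P (dvd_pow_self p hn.ne')), zero_add]
  | coprime a b ha hb hab iha ihb =>
    have e := Nat.gcd_eq_gcd_ab a b
    rw [hab] at e
    have e' : (1 : ℂ) = a * a.gcdA b + b * a.gcdB b := by exact_mod_cast e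
    push_cast at hc
    obtain ⟨x, hx, v, hv, hv', h1⟩ := iha (by omega) (fun p hp => hF p (hp.mul_right b))
      (c := b * c) (by rwa [← mul_assoc])
    obtain ⟨y, hy, w, hw, hw', h2⟩ := ihb (by omega) (fun p hp => hF p (hp.mul_left a))
      (c := a * c) (by rwa [← mul_assoc, mul_comm (b : ℂ)])
    refine ⟨a.gcdA b • y + a.gcdB b • x, Subring.add_mem _ (Subring.zsmul_mem _ hy _)
      (Subring.zsmul_mem _ hx _), fun p => a.gcdA b • w p + a.gcdB b • v p,
      fun p => Subring.add_mem _ (Subring.zsmul_mem _ (hw p) _) (Subring.zsmul_mem _ (hv p) _),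
      fun p hp => ?_, ?_⟩
    · dsimp only
      rw [hw' p fun h => hp (h.mul_left a), hv' p fun h => hp (h.mul_right b)]
      simp
    · rw [Finset.sum_add_distrib, ← Finset.smul_sum, ← Finset.smul_sum]
      simp only [zsmul_eq_mul]
      linear_combination c * e' + (a.gcdA b : ℂ) * h2 + (a.gcdB b : ℂ) * h1

/-- The power series such that the denominators of the coefficients in each degree are products of
primes in a finite set allowed by `g`. -/
def boundedDenominators (d : ℕ) (R : Subring ℂ) (g : Nat.Primes → ℕ) :
    Subring (MvPowerSeries (Fin d) ℂ) where
  carrier := {f | ∃ F : Finset Nat.Primes, ∀ I, ∃ M : ℕ, M ≠ 0 ∧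
    (∀ p : Nat.Primes, (p : ℕ) ∣ M → p ∈ F ∧ g p < I.degree) ∧ M * MvPowerSeries.coeff I f ∈ R}
  zero_mem' := ⟨∅, fun I => ⟨1, one_ne_zero, fun p hp => absurd (Nat.dvd_one.mp hp) p.2.ne_one,
    by simp [R.zero_mem]⟩⟩
  one_mem' := ⟨∅, fun I => ⟨1, one_ne_zero, fun p hp => absurd (Nat.dvd_one.mp hp) p.2.ne_one, by
    classical
    rw [MvPowerSeries.coeff_one]
    split_ifs <;> simp [R.zero_mem, R.one_mem]⟩⟩
  neg_mem' := by
    rintro f ⟨F, hF⟩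
    refine ⟨F, fun I => ?_⟩
    obtain ⟨M, h1, h2, h3⟩ := hF I
    exact ⟨M, h1, h2, by rw [map_neg, mul_neg]; exact R.neg_mem h3⟩
  add_mem' := by
    classical
    rintro f f' ⟨F, hF⟩ ⟨F', hF'⟩
    refine ⟨F ∪ F', fun I => ?_⟩
    obtain ⟨M, h1, h2, h3⟩ := hF I
    obtain ⟨M', h1', h2', h3'⟩ := hF' I
    refine ⟨M * M', mul_ne_zero h1 h1', fun p hp => ?_, ?_⟩
    · rw [Finset.mem_union]
      rcases p.2.dvd_mul.mp hp with h | h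
      · exact ⟨Or.inl (h2 p h).1, (h2 p h).2⟩
      · exact ⟨Or.inr (h2' p h).1, (h2' p h).2⟩
    · have : ((M * M' : ℕ) : ℂ) * MvPowerSeries.coeff I (f + f') =
          M' * (M * MvPowerSeries.coeff I f) + M * (M' * MvPowerSeries.coeff I f') := by
        rw [map_add]; push_cast; ring
      rw [this]
      exact R.add_mem (R.mul_mem (natCast_mem R _) h3) (R.mul_mem (natCast_mem R _) h3')
  mul_mem' := by
    classical
    rintro f f' ⟨F, hF⟩ ⟨F', hF'⟩
    refine ⟨F ∪ F', fun I => ?_⟩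
    choose M h1 h2 h3 using hF
    choose M' h1' h2' h3' using hF'
    have hI (x) (hx : x ∈ Finset.HasAntidiagonal.antidiagonal I) :
        x.1.degree ≤ I.degree ∧ x.2.degree ≤ I.degree := by
      rw [← Finset.HasAntidiagonal.mem_antidiagonal.mp hx, map_add]; omega
    refine ⟨∏ x ∈ Finset.HasAntidiagonal.antidiagonal I, M x.1 * M' x.2,
      Finset.prod_ne_zero_iff.mpr fun x _ => mul_ne_zero (h1 _) (h1' _), fun p hp => ?_, ?_⟩
    · obtain ⟨x, hx, hp⟩ := p.2.prime.exists_mem_finset_dvd hp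
      rw [Finset.mem_union]
      rcases p.2.dvd_mul.mp hp with h | h
      · exact ⟨Or.inl (h2 _ p h).1, (h2 _ p h).2.trans_le (hI x hx).1⟩
      · exact ⟨Or.inr (h2' _ p h).1, (h2' _ p h).2.trans_le (hI x hx).2⟩
    · rw [MvPowerSeries.coeff_mul, Finset.mul_sum]
      refine R.sum_mem fun x hx => ?_
      rw [← Finset.mul_prod_erase _ _ hx]
      have : ((M x.1 * M' x.2 * ∏ y ∈ (Finset.HasAntidiagonal.antidiagonal I).erase x,
          M y.1 * M' y.2 : ℕ) : ℂ) * (MvPowerSeries.coeff x.1 f * MvPowerSeries.coeff x.2 f') =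
          (∏ y ∈ (Finset.HasAntidiagonal.antidiagonal I).erase x, M y.1 * M' y.2 : ℕ) *
          ((M x.1 * MvPowerSeries.coeff x.1 f) * (M' x.2 * MvPowerSeries.coeff x.2 f')) := by
        push_cast; ring
      rw [this]
      exact R.mul_mem (natCast_mem R _) (R.mul_mem (h3 _) (h3' _))

lemma exists_pow_mul_mem (R : Subring ℂ) {p c : ℂ} (hp : p ∈ R) (hp0 : p ≠ 0)
    (hc : c ∈ invert R p) : ∃ n : ℕ, p ^ n * c ∈ R := by
  rw [invert, ← Subring.closure_eq R, ← Subring.closure_union] at hc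
  induction hc using Subring.closure_induction with
  | mem x hx =>
    rcases hx with hx | hx
    · exact ⟨0, by simpa using hx⟩
    · rw [Set.mem_singleton_iff] at hx
      exact ⟨1, by rw [hx, pow_one, mul_inv_cancel₀ hp0]; exact R.one_mem⟩
  | zero => exact ⟨0, by simp [R.zero_mem]⟩
  | one => exact ⟨0, by simp [R.one_mem]⟩
  | add x y _ _ hx hy =>
    obtain ⟨a, ha⟩ := hx
    obtain ⟨b, hb⟩ := hy
    refine ⟨a + b, ?_⟩
    rw [show p ^ (a + b) * (x + y) = p ^ b * (p ^ a * x) + p ^ a * (p ^ b * y) by ring]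
    exact R.add_mem (R.mul_mem (R.pow_mem hp _) ha) (R.mul_mem (R.pow_mem hp _) hb)
  | neg x _ hx => exact hx.imp fun n h => by rw [mul_neg]; exact R.neg_mem h
  | mul x y _ _ hx hy =>
    obtain ⟨a, ha⟩ := hx
    obtain ⟨b, hb⟩ := hy
    refine ⟨a + b, ?_⟩
    rw [show p ^ (a + b) * (x * y) = (p ^ a * x) * (p ^ b * y) by ring]
    exact R.mul_mem ha hb

lemma gSubring_le_boundedDenominators (R : Subring ℂ) (g : Nat.Primes → ℕ) :
    gSubring d R g ≤ boundedDenominators d R g := by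
  rw [gSubring, Subring.closure_le]
  rintro f (hf | ⟨p, hf, ho⟩) <;> replace hf := mem_coeffsIn.mp hf
  · exact ⟨∅, fun I => ⟨1, one_ne_zero, fun p hp => absurd (Nat.dvd_one.mp hp) p.2.ne_one,
      by simpa using hf I⟩⟩
  · refine ⟨{p}, fun I => ?_⟩
    by_cases hI : I.degree < g p + 1
    · exact ⟨1, one_ne_zero, fun p hp => absurd (Nat.dvd_one.mp hp) p.2.ne_one,
        by simp [ho I hI, R.zero_mem]⟩
    · obtain ⟨n, hn⟩ := exists_pow_mul_mem R (natCast_mem R p)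
        (Nat.cast_ne_zero.mpr p.2.ne_zero) (hf I)
      rw [← Nat.cast_pow] at hn
      refine ⟨p ^ n, pow_ne_zero _ p.2.ne_zero, fun l hl => ?_, hn⟩
      have : l = p := Subtype.ext ((Nat.prime_dvd_prime_iff_eq l.2 p.2).mp
        (l.2.dvd_of_dvd_pow hl))
      subst this
      exact ⟨Finset.mem_singleton_self _, by omega⟩

lemma gSubring_anti (R : Subring ℂ) {g g' : Nat.Primes → ℕ} (h : ∀ p, g p ≤ g' p) :
    gSubring d R g' ≤ gSubring d R g := by
  rw [gSubring, Subring.closure_le]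
  rintro f (hf | ⟨p, hf, ho⟩)
  · exact coeffsIn_le_gSubring R g hf
  · exact Subring.subset_closure (Or.inr ⟨p, hf, fun I hI => ho I (by have := h p; omega)⟩)

lemma mem_augIdeal_pow_of_orderGE (R : Subring ℂ) {g g' : Nat.Primes → ℕ}
    (h : ∀ p, 2 * g p ≤ g' p) (n : ℕ) {f : MvPowerSeries (Fin d) ℂ} (hf : f ∈ gSubring d R g')
    (ho : OrderGE (2 * n + 2) f) :
    f ∈ (augIdeal (gSubring d R g) ^ (n + 1)).toAddSubgroup.map
      (gSubring d R g).subtype.toAddMonoidHom := by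
  classical
  obtain ⟨F, hF⟩ := gSubring_le_boundedDenominators R g' hf
  have key (I : Fin d →₀ ℕ) : ∃ c₀ ∈ R, ∃ v : Nat.Primes → ℂ,
      (∀ p : Nat.Primes, v p ∈ invert R ((p : ℕ) : ℂ)) ∧ (I.degree < 2 * n + 2 → c₀ = 0) ∧
      (∀ p : Nat.Primes, I.degree < n + g p + 1 → v p = 0) ∧
      MvPowerSeries.coeff I f = c₀ + ∑ p ∈ F, v p := by
    by_cases hI : I.degree < 2 * n + 2
    · exact ⟨0, R.zero_mem, 0, fun _ => Subring.zero_mem _, fun _ => rfl, fun _ _ => rfl,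
        by simp [ho I hI]⟩
    · obtain ⟨M, h1, h2, h3⟩ := hF I
      obtain ⟨c₀, hc₀, v, hv, hv', e⟩ := exists_partialFractions R F h1 (fun p hp => (h2 p hp).1) h3
      refine ⟨c₀, hc₀, v, hv, fun hI' => absurd hI' hI, fun p hp => hv' p fun hpM => ?_, e⟩
      have := (h2 p hpM).2
      have := h p
      omega
  choose c₀ hc₀ v hv hc₀' hv' e using key
  let f₀ : MvPowerSeries (Fin d) ℂ := c₀
  let k (p : Nat.Primes) : MvPowerSeries (Fin d) ℂ := fun I => v I p
  have hX (i) : MvPowerSeries.X i ∈ gSubring d R g := coeffsIn_le_gSubring R g (by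
    rw [mem_coeffsIn]
    intro I
    rw [MvPowerSeries.coeff_X]
    split_ifs
    exacts [R.one_mem, R.zero_mem])
  have : f = f₀ + ∑ p ∈ F, k p := by
    ext I
    rw [map_add, map_sum]
    exact e I
  rw [this]
  refine AddSubgroup.add_mem _ ?_ (AddSubgroup.sum_mem _ fun p _ => ?_)
  · exact mem_augIdeal_pow (Λ := R) (m := 0) hX (fun f hf _ => coeffsIn_le_gSubring R g hf) n
      (mem_coeffsIn.mpr hc₀) fun I hI => hc₀' I (by omega)
  · exact mem_augIdeal_pow (Λ := invert R ((p : ℕ) : ℂ)) (m := g p) hX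
      (fun f hf hf' => Subring.subset_closure (Or.inr ⟨p, hf, hf'⟩)) n
      (mem_coeffsIn.mpr fun I => hv I p) fun I hI => hv' I p hI

end PowerSeries

end

section

namespace AdicRing

variable {d : ℕ} {P Q O : AdicRing d}

/-- The morphism between levels of adic rings given by an inclusion of rings. -/
def levelMap (h : P.A ≤ Q.A) {m n : ℕ} (hI : ∀ a ∈ P.I m, Subring.inclusion h a ∈ Q.I n) :
    Q.spec n ⟶ P.spec m :=
  Spec.map (CommRingCat.ofHom (Ideal.quotientMap (Q.I n) (Subring.inclusion h) hI))

lemma levelMap_comp (h : P.A ≤ Q.A) (h' : Q.A ≤ O.A) {l m n : ℕ}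
    (hI : ∀ a ∈ P.I l, Subring.inclusion h a ∈ Q.I m)
    (hI' : ∀ a ∈ Q.I m, Subring.inclusion h' a ∈ O.I n)
    (hI'' : ∀ a ∈ P.I l, Subring.inclusion (h.trans h') a ∈ O.I n) :
    levelMap h' hI' ≫ levelMap h hI = levelMap (h.trans h') hI'' := by
  refine (Spec.map_comp _ _).symm.trans (congrArg Spec.map ?_)
  ext x; rfl

lemma I_le_I (P : AdicRing d) {m n : ℕ} (h : m ≤ n) (a) (ha : a ∈ P.I n) :
    Subring.inclusion (le_refl P.A) a ∈ P.I m :=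
  antitone_nat_of_succ_le P.anti h ha

lemma specIncl_eq (P : AdicRing d) (n : ℕ) :
    P.specIncl n = levelMap (le_refl P.A) (P.I_le_I n.le_succ) := by
  refine congrArg Spec.map ?_
  ext x; rfl

lemma specZero_eq_levelMap (P : AdicRing d) (n : ℕ) :
    P.specZero n = levelMap (le_refl P.A) (P.I_le_I n.zero_le) := by
  rw [specZero_eq]
  refine congrArg Spec.map ?_
  ext x; rfl

lemma levelMap_spec (hP : O.Le P) (hQ : O.Le Q) (hPQ : P.A ≤ Q.A) {m n : ℕ} (hmn : n ≤ m)
    (hI : ∀ a ∈ P.I m, Subring.inclusion hPQ a ∈ Q.I n) :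
    levelMap hPQ hI ≫ hP.spec m = hQ.spec n ≫ levelMap (le_refl O.A) (O.I_le_I hmn) := by
  refine (Spec.map_comp _ _).symm.trans ((congrArg Spec.map ?_).trans (Spec.map_comp _ _))
  ext x; rfl

end AdicRing

open AdicRing

variable {X S : Scheme.{0}} {f : X ⟶ S} {ι : Type} {D : ι → X.IdealSheafData} {R R' : Subring ℂ}
  {h : R ≤ R'} {q : S ⟶ Spec (CommRingCat.of R)} {s : Spec (CommRingCat.of R) ⟶ S} {d : ℕ}
  {E : FlatBundleOver f D s} (c : FormalCoordinates h q s d) (hs : s ≫ q = 𝟙 _) {J : Type}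
  (C : J → FramedChart q E)

namespace FormalCoordinates

lemma levelMap_σ {m n : ℕ} (hmn : m ≤ n) :
    levelMap (le_refl (adic (coeffsIn d R')).A) (I_le_I _ hmn) ≫ c.σ n = c.σ m := by
  induction n, hmn using Nat.le_induction with
  | base =>
    have : levelMap (le_refl (adic (coeffsIn d R')).A) (I_le_I _ (le_refl m)) = 𝟙 _ := by
      refine Eq.trans (congrArg Spec.map ?_) (Spec.map_id _)
      ext x; rfl
    rw [this, Category.id_comp]
  | succ n hmn ih =>
    rw [← ih, ← c.trans n, specIncl_eq, ← Category.assoc]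
    exact congrArg (· ≫ c.σ (n + 1)) (levelMap_comp _ _ _ _ _).symm

lemma levelMap_tower {P Q : AdicRing d} (hP : (adic (coeffsIn d R')).Le P)
    (hQ : (adic (coeffsIn d R')).Le Q) (hPQ : P.A ≤ Q.A) {m n : ℕ} (hmn : n ≤ m)
    (hI : ∀ a ∈ P.I m, Subring.inclusion hPQ a ∈ Q.I n) :
    levelMap hPQ hI ≫ (c.tower P hP).t m = (c.tower Q hQ).t n := by
  change levelMap hPQ hI ≫ hP.spec m ≫ c.σ m = hQ.spec n ≫ c.σ n
  rw [← c.levelMap_σ hmn, ← Category.assoc, ← Category.assoc, levelMap_spec hP hQ hPQ hmn hI]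

lemma le_adic_gSubring (R' : Subring ℂ) (g : Nat.Primes → ℕ) :
    (adic (coeffsIn d R')).Le (adic (gSubring d R' g)) :=
  adic_le_adic (coeffsIn_le_gSubring R' g)

lemma adicThickening (hs : s ≫ q = 𝟙 _) (g : Nat.Primes → ℕ) (n : ℕ) :
    Thickening q s ((adic (gSubring d R' g)).specZero n)
      ((c.tower _ (le_adic_gSubring R' g)).t n) :=
  c.thickening hs _ _ n ⟨n + 1,
    Ideal.pow_right_mono (pow_one (augIdeal (gSubring d R' g))).le (n + 1)⟩

lemma inclusion_mem {A B : Subring (MvPowerSeries (Fin d) ℂ)} (hA : A ≤ B) (a : A) {I : Ideal B}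
    (h : a.1 ∈ I.toAddSubgroup.map B.subtype.toAddMonoidHom) : Subring.inclusion hA a ∈ I := by
  obtain ⟨b, hb, e⟩ := h
  have h1 : b = Subring.inclusion hA a := Subtype.ext e
  exact h1 ▸ hb

lemma inclusion_mem_augIdeal_pow (R' : Subring ℂ) {g g' : Nat.Primes → ℕ}
    (h : ∀ p, 2 * g p ≤ g' p) (hA : gSubring d R' g' ≤ gSubring d R' g) (n : ℕ)
    (a : gSubring d R' g') (ha : OrderGE (2 * n + 2) a.1) :
    Subring.inclusion hA a ∈ augIdeal (gSubring d R' g) ^ (n + 1) :=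
  inclusion_mem hA a (mem_augIdeal_pow_of_orderGE R' h n a.2 ha)

lemma inclusion_mem_adic {A B : Subring (MvPowerSeries (Fin d) ℂ)} (hA : A ≤ B) {m n : ℕ}
    (h : ∀ a : A, OrderGE (m + 1) a.1 → Subring.inclusion hA a ∈ augIdeal B ^ (n + 1)) (a)
    (ha : a ∈ (trunc A).I m) : Subring.inclusion hA a ∈ (adic B).I n :=
  h a ha

lemma orderIdeal_le (R' : Subring ℂ) {g g' : Nat.Primes → ℕ} (h : ∀ p, 2 * g p ≤ g' p)
    (hA : gSubring d R' g' ≤ gSubring d R' g) (n : ℕ) (a)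
    (ha : a ∈ (trunc (gSubring d R' g')).I (2 * n + 1)) :
    Subring.inclusion hA a ∈ (adic (gSubring d R' g)).I n :=
  inclusion_mem_adic hA (inclusion_mem_augIdeal_pow R' h hA n) a ha

lemma orderIdeal_zero_le {A B : Subring (MvPowerSeries (Fin d) ℂ)} (hA : A ≤ B) (a)
    (ha : a ∈ (trunc A).I 0) : Subring.inclusion hA a ∈ (adic B).I 0 :=
  (pow_one (augIdeal B)).ge (ha 0 (by simp))

/-- Models of the isomonodromic deformation over an adic ring give models over a larger ring with
a finer filtration. -/
lemma hasModel_of_le (hC : ∀ x : (pullback f s : Scheme), ∃ a, pullback.fst f s x ∈ (C a).V)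
    {P T : AdicRing d} (hP : (adic (coeffsIn d R')).Le P) (hT : (adic (coeffsIn d R')).Le T)
    (hQ : P.Le (trunc (coeffsIn d (rat R')))) (hTQ : T.Le (trunc (coeffsIn d (rat R'))))
    (hA : T.A ≤ P.A) (hI : ∀ n, ∀ a ∈ T.I (2 * n + 1), Subring.inclusion hA a ∈ P.I n)
    (hu₀ : ∀ a ∈ T.I 0, Subring.inclusion hA a ∈ P.I 0)
    (thP : ∀ n, Thickening q s (P.specZero n) ((c.tower P hP).t n))
    (thT : ∀ n, Thickening q s (T.specZero n) ((c.tower T hT).t n))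
    (M : ∀ n, LocalCocycle C (thT n) hs)
    (hM : ∀ n a b U ha hb hU, ((M (n + 1)).G a b U ha hb hU).map
      (bcPull f (T.specIncl n) ((c.tower T hT).w n) U) = (M n).G a b U ha hb hU)
    (hM' : ∀ n a b U ha hb hU, ((M n).G a b U ha hb hU).map
      (bcPull f (hTQ.spec n) ((c.towerMap hT hTQ).w n) U) =
        ((c.eulerTower hs (hT.trans hTQ)).cocycle C n).G a b U ha hb hU) :
    HasModel c P hP hQ E := by
  let u (n : ℕ) : P.spec n ⟶ T.spec (2 * n + 1) :=
    levelMap hA (hI n)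
  have w (n : ℕ) : u n ≫ (c.tower _ hT).t (2 * n + 1) = (c.tower _ hP).t n :=
    c.levelMap_tower hT hP hA (by omega) _
  let u₀ : P.spec 0 ⟶ T.spec 0 :=
    levelMap hA hu₀
  let N (n : ℕ) : LocalCocycle C (thP n) hs :=
    (M (2 * n + 1)).pullback (thP n) (u n) (w n) u₀ (by
      rw [specZero_eq_levelMap, specZero_eq_levelMap]
      exact (levelMap_comp _ _ _ _ fun a ha =>
        hu₀ a (I_le_I _ (2 * n + 1).zero_le a ha)).trans (levelMap_comp _ _ _ _ _).symm)
  refine c.hasModel hs C hC hP hQ _ N (fun n a b U ha hb hU => ?_) fun n a b U ha hb hU => ?_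
  · change (((M (2 * n + 3)).G a b U ha hb hU).map
      (bcPull f (u (n + 1)) (w (n + 1)) U)).map _ = ((M (2 * n + 1)).G a b U
        ha hb hU).map (bcPull f (u n) (w n) U)
    rw [← hM (2 * n + 1), ← hM (2 * n + 2)]
    have e : u n ≫ T.specIncl (2 * n + 1) ≫
        T.specIncl (2 * n + 2) =
        P.specIncl n ≫ u (n + 1) := by
      rw [specIncl_eq, specIncl_eq, specIncl_eq, levelMap_comp _ _ _ _ (I_le_I _ (by omega))]
      exact (levelMap_comp _ _ _ _ fun a ha => hI n _
        (I_le_I _ (by omega) a ha)).trans (levelMap_comp _ _ _ _ _).symm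
    have w1 := c.levelMap_tower hT hT le_rfl (by omega : 2 * n + 1 ≤ 2 * n + 3)
      (I_le_I _ (by omega))
    have w2 := c.levelMap_tower hT hP hA (by omega : n ≤ 2 * n + 3)
      (fun _ ha => hI n _ (I_le_I _ (by omega) _ ha))
    have e1 : T.specIncl (2 * n + 1) ≫
        T.specIncl (2 * n + 2) =
        levelMap le_rfl (I_le_I _ (by omega)) := by
      rw [specIncl_eq, specIncl_eq]
      exact levelMap_comp _ _ _ _ _
    have e2 : u n ≫ levelMap (le_refl T.A)
        (I_le_I _ (by omega : 2 * n + 1 ≤ 2 * n + 3)) =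
        levelMap hA (fun _ ha => hI n _ (I_le_I _ (by omega) _ ha)) :=
      levelMap_comp _ _ _ _ _
    ext x y
    refine Eq.trans (bcPull_comp f _ _ _ _ _ (e.symm.trans ((congrArg _ e1).trans e2)) w2 U _)
      (Eq.trans ?_ (congrArg (bcPull f (u n) (w n) U) (bcPull_comp f _ _ _ _ _ e1 w1 U _)).symm)
    exact (bcPull_comp f _ w1 _ (w n) _ e2 w2 U _).symm
  · change (((M (2 * n + 1)).G a b U ha hb hU).map
      (bcPull f (u n) (w n) U)).map _ = _
    have wQ := c.levelMap_tower (hP.trans hQ) (hP.trans hQ) le_rfl (by omega : n ≤ 2 * n + 1)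
      (I_le_I _ (by omega))
    have w3 := c.levelMap_tower hT (hP.trans hQ) (hA.trans hQ.1) (by omega : n ≤ 2 * n + 1)
      (fun _ ha => hQ.2 n (hI n _ ha))
    have e1 := (C a).bcPull_transport (C b) (c.truncThickening hs _ (hP.trans hQ) (2 * n + 1)) hs
      (c.truncThickening hs _ (hP.trans hQ) n) _ wQ (𝟙 _) (by
        rw [Category.id_comp, specZero_eq_levelMap, specZero_eq_levelMap]
        exact (levelMap_comp _ _ _ _ _).symm) ha hb hU
    refine Eq.trans ?_ e1
    have e2 := hM' (2 * n + 1) a b U ha hb hU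
    refine Eq.trans ?_ (congrArg (fun M => M.map (bcPull f _ wQ U)) e2)
    ext x y
    exact (bcPull_comp f _ _ _ _ _ (levelMap_comp _ _ _ _ _) w3 U _).trans
      (bcPull_comp f _ _ _ _ _ (levelMap_comp _ _ _ _ _) w3 U _).symm

/-- The isomonodromic deformation is integral. -/
lemma isGIntegral (hC : ∀ x : (pullback f s : Scheme), ∃ a, pullback.fst f s x ∈ (C a).V)
    {g g' : Nat.Primes → ℕ} (h2 : ∀ p, 2 * g p ≤ g' p)
    (hg : ∀ p : Nat.Primes, PCurvatureVanishesModP E p → g' p + 1 ≤ (p : ℕ) ^ 2)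
    (hg' : ∀ p : Nat.Primes, ¬ PCurvatureVanishesModP E p → g' p = 0) (hs : s ≫ q = 𝟙 _) :
    IsGIntegral c g E :=
  c.hasModel_of_le hs C hC _ (le_gSubring R' g') _ (trunc_le_trunc (gSubring_le R' g'))
    (gSubring_anti R' fun p => by have := h2 p; omega) (orderIdeal_le R' h2 _)
    (orderIdeal_zero_le _) (c.adicThickening hs g) _
    (c.gCocycle hs C g' hg hg') (c.map_gCocycle_incl hs C g' hg hg')
    (c.map_gCocycle hs C g' hg hg')

end FormalCoordinates

end

section

variable {X S B : Scheme.{0}} {f : X ⟶ S} {ι : Type} {D : ι → X.IdealSheafData}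
  {q : S ⟶ B} {s : B ⟶ S}

/-- Relative normal crossings divisors have charts around every point of the fibre at `s`. -/
lemma exists_framedChart [Smooth f] (hD : IsRelSNC f D) (hs : s ≫ q = 𝟙 _)
    (E : FlatBundleOver f D s) (x : (pullback f s : Scheme)) :
    ∃ C : FramedChart q E, pullback.fst f s x ∈ C.V := by
  classical
  obtain ⟨W, V, hy, hV, n, c, k, ⟨b, hb⟩, -, hk, hk'⟩ := hD (pullback.fst f s x)
  obtain ⟨U, hxU, r, e, he⟩ := E.locallyFree x
  have := isPreimmersion_of_section hs
  obtain ⟨V', rfl⟩ : ∃ V' : X.Opens, pullback.fst f s ⁻¹ᵁ V' = U := by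
    obtain ⟨V', h1, h2⟩ := (Scheme.Hom.isEmbedding (pullback.fst f s)).isOpen_iff.mp U.isOpen
    exact ⟨⟨V', h1⟩, TopologicalSpace.Opens.ext h2⟩
  have hfx : f (pullback.fst f s x) = s (pullback.snd f s x) := by
    rw [← Scheme.Hom.comp_apply, ← Scheme.Hom.comp_apply, pullback.condition]
  have hqx : q (f (pullback.fst f s x)) = pullback.snd f s x := by
    rw [hfx, ← Scheme.Hom.comp_apply s q, hs]; rfl
  obtain ⟨O, hO, hxO, hOW⟩ := exists_isAffineOpen_mem_and_subset
    (U := s ⁻¹ᵁ W.1) (x := pullback.snd f s x) (by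
      change s (pullback.snd f s x) ∈ W.1
      rw [← hfx]; exact hV hy)
  obtain ⟨V₁, hV₁, hxV₁, hle⟩ := exists_isAffineOpen_mem_and_subset
    (U := V.1 ⊓ V' ⊓ f ⁻¹ᵁ q ⁻¹ᵁ O) (x := pullback.fst f s x)
      ⟨⟨hy, hxU⟩, by change q (f (pullback.fst f s x)) ∈ O; rwa [hqx]⟩
  have h1 : V₁ ≤ V.1 := fun z hz => (hle hz).1.1
  have hI (i) : (D i).ideal ⟨V₁, hV₁⟩ = ((D i).ideal V).map (resO h1) :=
    ((D i).map_ideal (U := ⟨V₁, hV₁⟩) (V := V) h1).symm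
  have hI' (i) (j) (h : (D i).ideal V = Ideal.span {c j}) :
      (D i).ideal ⟨V₁, hV₁⟩ = Ideal.span {resO h1 (c j)} := by
    rw [hI, h, Ideal.map_span, Set.image_singleton]
  have het : EtaleCoords (f.appLE W.1 V₁ (h1.trans hV)).hom (fun j => resO h1 (c j)) := by
    let _ := (f.appLE W.1 V.1 hV).hom.toAlgebra
    have : Algebra.Smooth Γ(S, W.1) Γ(X, V.1) := f.smooth_appLE W.2 V.2 hV
    have := (EtaleCoords.of_basis c b hb).comp (resO h1) (etale_resO h1 V.2 hV₁)
    convert this using 1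
    ext a
    exact (resO_appLE f hV h1 a).symm
  refine ⟨{
    V := V₁
    affine := hV₁
    W := W.1
    affineW := W.2
    le := h1.trans hV
    O := O
    affineO := hO
    O_le := hOW
    le_O := fun z hz => (hle hz).2
    n := n
    c := fun j => resO h1 (c j)
    w := fun j => if ∃ i, k i = j then 1 else 0
    w_eq := fun j => by split_ifs <;> simp
    etale := het
    log := fun j hj => ?_
    ideal := fun i => ?_
    r := r
    e := _
    isFrame := he.restrict fun z hz => (hle hz).1.2 }, hxV₁⟩
  · obtain ⟨i, rfl⟩ : ∃ i, k i = j := by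
      by_contra h
      simp [h] at hj
    exact ⟨i.1, hI' _ _ (hk i)⟩
  · by_cases hi : pullback.fst f s x ∈ (D i).support
    · exact .inr ⟨k ⟨i, hi⟩, by simp, hI' _ _ (hk ⟨i, hi⟩)⟩
    · exact .inl (by rw [hI, hk' i hi, Ideal.map_top])

end

section

section Taylor

variable {d : ℕ}

lemma mem_idealOfVars {R : Type} [CommRing R] {x : MvPolynomial (Fin d) R} :
    x ∈ MvPolynomial.idealOfVars (Fin d) R ↔ MvPolynomial.constantCoeff x = 0 := by
  rw [← pow_one (MvPolynomial.idealOfVars (Fin d) R), MvPolynomial.mem_pow_idealOfVars_iff']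
  refine ⟨fun h => h 0 (by simp), fun h x hx => ?_⟩
  rw [Nat.lt_one_iff, Finsupp.degree_eq_zero_iff] at hx
  rwa [hx]

lemma ker_pow_eq_bot {A L R : Type} [CommRing A] [CommRing L] [CommRing R] {π : A →+* L}
    (hπ : Function.Surjective π) {ρ : L →+* R} {I : Ideal A} (h : ∀ a, ρ (π a) = 0 → a ∈ I)
    {n : ℕ} (hn : I ^ n ≤ RingHom.ker π) : RingHom.ker ρ ^ n = ⊥ := by
  have : RingHom.ker ρ ≤ I.map π := fun y hy => by
    obtain ⟨a, rfl⟩ := hπ y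
    exact Ideal.mem_map_of_mem _ (h a hy)
  rw [eq_bot_iff]
  refine (Ideal.pow_right_mono this n).trans ?_
  rw [← Ideal.map_pow, Ideal.map_le_iff_le_comap]
  exact hn

lemma pow_le_ker {A L R : Type} [CommRing A] [CommRing L] [CommRing R] {f : A →+* L}
    {ρ : L →+* R} {I : Ideal A} (h : ∀ a ∈ I, ρ (f a) = 0) {n : ℕ} (hn : RingHom.ker ρ ^ n = ⊥) :
    I ^ n ≤ RingHom.ker f := by
  have : I ^ n ≤ (⊥ : Ideal L).comap f := by
    rw [← Ideal.map_le_iff_le_comap, Ideal.map_pow, ← hn]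
    exact Ideal.pow_right_mono (Ideal.map_le_iff_le_comap.mpr h) _
  exact this

/-- The Taylor expansion along a section in étale coordinates. -/
lemma EtaleCoords.exists_taylor {R R' A L : Type} [CommRing R] [CommRing R'] [CommRing A]
    [CommRing L] {φ : R →+* A} {c : Fin d → A} (h : EtaleCoords φ c) {γ : R' →+* A} {ε : A →+* R'}
    (hγ : ∀ r, ε (γ r) = r) {i : R →+* R'} (hi : ∀ r, γ (i r) = φ r)
    (hepi : ∀ x y : R' →+* L, x.comp i = y.comp i → x = y) {π : MvPolynomial (Fin d) R' →+* L}
    (hπ : Function.Surjective π) {n : ℕ}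
    (hk : RingHom.ker π = MvPolynomial.idealOfVars (Fin d) R' ^ (n + 1)) :
    ∃ (ρ : L →+* R') (τ : A →+* L), (∀ x, ρ (π x) = MvPolynomial.constantCoeff x) ∧
      RingHom.ker ρ ^ (n + 1) = ⊥ ∧ (∀ r, τ (φ r) = π (.C (i r))) ∧
      (∀ k, τ (c k) = π (.C (ε (c k)) + .X k)) ∧ (∀ a, ρ (τ a) = ε a) ∧
      Function.Surjective τ ∧ RingHom.ker τ = RingHom.ker ε ^ (n + 1) := by
  have hle : RingHom.ker π ≤ RingHom.ker (MvPolynomial.constantCoeff (σ := Fin d) (R := R')) := by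
    rw [hk]
    exact (Ideal.pow_le_self n.succ_ne_zero).trans fun x hx => mem_idealOfVars.mp hx
  let ρ : L →+* R' := RingHom.liftOfSurjective π hπ ⟨MvPolynomial.constantCoeff, hle⟩
  have hρ (x) : ρ (π x) = MvPolynomial.constantCoeff x :=
    RingHom.liftOfRightInverse_comp_apply _ _ _ _ _
  have hρn : RingHom.ker ρ ^ (n + 1) = ⊥ :=
    ker_pow_eq_bot hπ (fun x hx => mem_idealOfVars.mpr ((hρ x).symm.trans hx)) hk.ge
  obtain ⟨τ, h1, h2, h3⟩ := h.exists_lift ρ (fun r => ⟨π (.C r), by simp [hρ]⟩) ⟨n + 1, hρn⟩ ε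
    ((π.comp MvPolynomial.C).comp i) (fun k => π (.C (ε (c k)) + .X k))
    (fun r => by simp [hρ, ← hi, hγ]) (fun k => by simp [hρ])
  have hτγ : τ.comp γ = π.comp MvPolynomial.C := hepi _ _ (by
    ext r
    simpa [hi] using h1 r)
  have hτγ' (r) : τ (γ r) = π (.C r) := congr($hτγ r)
  refine ⟨ρ, τ, hρ, hρn, h1, h2, h3, fun y => ?_, le_antisymm ?_ ?_⟩
  · obtain ⟨x, rfl⟩ := hπ y
    induction x using MvPolynomial.induction_on with
    | C r => exact ⟨γ r, hτγ' r⟩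
    | add x y hx hy =>
      obtain ⟨a, ha⟩ := hx
      obtain ⟨b, hb⟩ := hy
      exact ⟨a + b, by simp [ha, hb]⟩
    | mul_X x k hx =>
      obtain ⟨a, ha⟩ := hx
      exact ⟨a * (c k - γ (ε (c k))), by simp [ha, h2, hτγ']⟩
  · let J := RingHom.ker ε ^ (n + 1)
    let κ' : MvPolynomial (Fin d) R' →+* A ⧸ J :=
      MvPolynomial.eval₂Hom ((Ideal.Quotient.mk J).comp γ)
        fun k => Ideal.Quotient.mk J (c k - γ (ε (c k)))
    let ε' : A ⧸ J →+* R' := Ideal.Quotient.lift J ε fun a ha =>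
      Ideal.pow_le_self n.succ_ne_zero ha
    have hε (a) : ε' (Ideal.Quotient.mk J a) = ε a := rfl
    have hε' : RingHom.ker ε' ^ (n + 1) = ⊥ :=
      ker_pow_eq_bot (π := Ideal.Quotient.mk J) (ρ := ε')
        Ideal.Quotient.mk_surjective (fun a ha => ha) (by rw [Ideal.mk_ker])
    have hεκ (x) : ε' (κ' x) = MvPolynomial.constantCoeff x := by
      refine DFunLike.congr_fun (f := ε'.comp κ') (MvPolynomial.ringHom_ext (fun r => ?_)
        fun k => ?_) x
      · simp [κ', hε, hγ]
      · simp [κ', -map_sub, hε]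
        simp [hγ]
    have hκ' : RingHom.ker π ≤ RingHom.ker κ' := by
      rw [hk]
      exact pow_le_ker (fun x hx => (hεκ x).trans (mem_idealOfVars.mp hx)) hε'
    let κ : L →+* A ⧸ J := RingHom.liftOfSurjective π hπ ⟨κ', hκ'⟩
    have hκ (x) : κ (π x) = κ' x := RingHom.liftOfRightInverse_comp_apply _ _ _ _ _
    have key : κ.comp τ = Ideal.Quotient.mk J := by
      refine h.hom_ext ε' ⟨n + 1, hε'⟩ _ _ (fun r => ?_) (fun k => ?_) fun a => ?_
      · simp [h1, hκ, κ', hi]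
      · rw [RingHom.comp_apply, h2, hκ]
        simp [κ']
      · obtain ⟨x, hx⟩ := hπ (τ a)
        rw [RingHom.comp_apply, ← hx, hκ, hεκ, ← hρ, hx, h3]
        rfl
    intro a ha
    rw [← Ideal.Quotient.eq_zero_iff_mem, ← key, RingHom.comp_apply, (ha : τ a = 0), map_zero]
  · exact pow_le_ker (fun a ha => (h3 a).trans ha) hρn

/-- The map from polynomials to the levels of the ring of power series. -/
def polyToLevel (d : ℕ) (R' : Subring ℂ) (n : ℕ) :
    MvPolynomial (Fin d) R' →+* (adic (coeffsIn d R')).Level n :=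
  (Ideal.Quotient.mk _).comp ((MvPowerSeries.map (σ := Fin d) R'.subtype).rangeRestrict.comp
    MvPolynomial.coeToMvPowerSeries.ringHom)

lemma mem_augIdeal_coeffsIn_pow {R' : Subring ℂ} {n : ℕ} {f : coeffsIn d R'} :
    f ∈ augIdeal (coeffsIn d R') ^ (n + 1) ↔ OrderGE (n + 1) f.1 := by
  refine ⟨fun h => augIdeal_pow_le _ _ h, fun h => ?_⟩
  have hX (i) : MvPowerSeries.X i ∈ coeffsIn d R' := ⟨.X i, MvPowerSeries.map_X _ i⟩
  exact FormalCoordinates.inclusion_mem le_rfl f (mem_augIdeal_pow (m := 0) hX (fun f hf _ => hf) n f.2 h)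

lemma ker_polyToLevel (R' : Subring ℂ) (n : ℕ) : RingHom.ker (polyToLevel d R' n) =
    MvPolynomial.idealOfVars (Fin d) R' ^ (n + 1) := by
  ext x
  rw [MvPolynomial.mem_pow_idealOfVars_iff']
  refine Ideal.Quotient.eq_zero_iff_mem.trans (mem_augIdeal_coeffsIn_pow.trans ?_)
  refine forall₂_congr fun I _ => ?_
  change ((x.coeff I : R') : ℂ) = 0 ↔ _
  exact ZeroMemClass.coe_eq_zero

lemma polyToLevel_surjective (R' : Subring ℂ) (n : ℕ) :
    Function.Surjective (polyToLevel d R' n) := by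
  intro y
  obtain ⟨⟨_, f, rfl⟩, rfl⟩ := Ideal.Quotient.mk_surjective y
  refine ⟨MvPowerSeries.truncTotal n.succ f, ?_⟩
  refine Ideal.Quotient.eq.mpr (mem_augIdeal_coeffsIn_pow.mpr fun I hI => ?_)
  change (((MvPowerSeries.truncTotal n.succ f).coeff I : R') : ℂ) -
    ((MvPowerSeries.coeff I f : R') : ℂ) = 0
  rw [MvPowerSeries.coeff_truncTotal _ hI, sub_self]

end Taylor

end

section

lemma isLocalization_invert {R : Subring ℂ} {a : ℂ} (ha : a ∈ R) (ha0 : a ≠ 0) :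
    @IsLocalization.Away R _ ⟨a, ha⟩ (invert R a) _
      (Subring.inclusion (T := invert R a) le_sup_left).toAlgebra := by
  let _ := (Subring.inclusion (T := invert R a) (S := R) le_sup_left).toAlgebra
  have ha' : a⁻¹ ∈ invert R a :=
    (le_sup_right : _ ≤ R ⊔ Subring.closure {a⁻¹}) (Subring.subset_closure rfl)
  refine ⟨?_, fun z => ?_, fun {x y} e => ⟨1, ?_⟩⟩
  · rintro ⟨_, n, rfl⟩
    rw [map_pow]
    refine IsUnit.pow n (IsUnit.of_mul_eq_one ⟨_, ha'⟩ (Subtype.ext ?_))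
    exact mul_inv_cancel₀ ha0
  · obtain ⟨n, hn⟩ := exists_pow_mul_mem R ha ha0 z.2
    exact ⟨⟨⟨_, hn⟩, ⟨_, n, rfl⟩⟩, Subtype.ext (mul_comm _ _)⟩
  · have e' : (x : ℂ) = y := congrArg (Subtype.val : invert R a → ℂ) e
    rw [Subtype.ext e']

section Stalks

variable {S T : Scheme.{0}} {V : S.Opens}

lemma _root_.AlgebraicGeometry.IsAffineOpen.germ_surj (hV : IsAffineOpen V) {x : S} (hx : x ∈ V)
    (y : S.presheaf.stalk x) : ∃ a b : Γ(S, V), IsUnit ((S.presheaf.germ V x hx).hom b) ∧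
      y * (S.presheaf.germ V x hx).hom b = (S.presheaf.germ V x hx).hom a := by
  let _ := TopCat.Presheaf.algebra_section_stalk S.presheaf (U := V) ⟨x, hx⟩
  have := hV.isLocalization_stalk ⟨x, hx⟩
  obtain ⟨⟨a, b⟩, h⟩ := IsLocalization.surj (hV.primeIdealOf ⟨x, hx⟩).asIdeal.primeCompl y
  exact ⟨a, b, IsLocalization.map_units (S.presheaf.stalk x) b, h⟩

lemma _root_.AlgebraicGeometry.IsAffineOpen.germ_eq_zero (hV : IsAffineOpen V) {x : S} (hx : x ∈ V)
    {a : Γ(S, V)} (h : (S.presheaf.germ V x hx).hom a = 0) :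
    ∃ b : Γ(S, V), IsUnit ((S.presheaf.germ V x hx).hom b) ∧ b * a = 0 := by
  let _ := TopCat.Presheaf.algebra_section_stalk S.presheaf (U := V) ⟨x, hx⟩
  have := hV.isLocalization_stalk ⟨x, hx⟩
  obtain ⟨b, hb⟩ := (IsLocalization.map_eq_zero_iff (hV.primeIdealOf ⟨x, hx⟩).asIdeal.primeCompl
    (S.presheaf.stalk x) a).mp h
  exact ⟨b, IsLocalization.map_units (S.presheaf.stalk x) b, hb⟩

lemma stalkMap_germ_top (σ : T ⟶ S) (h : ⊤ ≤ σ ⁻¹ᵁ V) (z : T) (a : Γ(S, V)) :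
    (σ.stalkMap z).hom ((S.presheaf.germ V (σ z) (h trivial)).hom a) =
      (T.presheaf.germ ⊤ z trivial).hom ((σ.appLE V ⊤ h).hom a) := by
  refine (σ.germ_stalkMap_apply V z (h trivial) a).trans ?_
  exact (T.presheaf.germ_res_apply (homOfLE h) z trivial _).symm

/-- The stalks of a closed immersion into an affine open set. -/
lemma stalkMap_surjective_and_ker [IsAffine T] (hV : IsAffineOpen V) (σ : T ⟶ S)
    (h : ⊤ ≤ σ ⁻¹ᵁ V) (hs : Function.Surjective (σ.appLE V ⊤ h).hom) (z : T) :
    Function.Surjective (σ.stalkMap z).hom ∧ RingHom.ker (σ.stalkMap z).hom =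
      (RingHom.ker (σ.appLE V ⊤ h).hom).map (S.presheaf.germ V (σ z) (h trivial)).hom := by
  have hu {b} (hb : IsUnit ((T.presheaf.germ ⊤ z trivial).hom ((σ.appLE V ⊤ h).hom b))) :
      IsUnit ((S.presheaf.germ V (σ z) (h trivial)).hom b) := by
    rw [← stalkMap_germ_top] at hb
    exact isUnit_of_map_unit (σ.stalkMap z).hom _ hb
  refine ⟨fun y => ?_, le_antisymm (fun y hy => ?_) ?_⟩
  · obtain ⟨a, b, hb, e⟩ := (isAffineOpen_top T).germ_surj (x := z) trivial y
    obtain ⟨a, rfl⟩ := hs a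
    obtain ⟨b, rfl⟩ := hs b
    obtain ⟨v, hv⟩ := hu hb
    refine ⟨(S.presheaf.germ V (σ z) (h trivial)).hom a * ↑v⁻¹, hb.mul_right_cancel ?_⟩
    rw [e, ← stalkMap_germ_top, ← hv, ← map_mul, mul_assoc, Units.inv_mul, mul_one,
      stalkMap_germ_top]
  · obtain ⟨a, b, hb, e⟩ := hV.germ_surj (h trivial) y
    have h0 : (T.presheaf.germ ⊤ z trivial).hom ((σ.appLE V ⊤ h).hom a) = 0 := by
      rw [← stalkMap_germ_top, ← e, map_mul, (hy : (σ.stalkMap z).hom y = 0), zero_mul]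
    obtain ⟨t, ht, e'⟩ := (isAffineOpen_top T).germ_eq_zero (x := z) trivial h0
    obtain ⟨t, rfl⟩ := hs t
    have h1 : t * a ∈ RingHom.ker (σ.appLE V ⊤ h).hom := (map_mul _ _ _).trans e'
    have h2 := Ideal.mem_map_of_mem (S.presheaf.germ V (σ z) (h trivial)).hom h1
    rw [map_mul, Ideal.unit_mul_mem_iff_mem _ (hu ht), ← e, Ideal.mul_unit_mem_iff_mem _ hb] at h2
    exact h2
  · rw [Ideal.map_le_iff_le_comap]
    intro a ha
    refine (stalkMap_germ_top σ h z a).trans ?_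
    rw [(ha : (σ.appLE V ⊤ h).hom a = 0), map_zero]

lemma appLE_fromSpec {L : Type} [CommRing L] (hV : IsAffineOpen V) (τ : Γ(S, V) →+* L)
    (h : ⊤ ≤ (Spec.map (CommRingCat.ofHom τ) ≫ hV.fromSpec) ⁻¹ᵁ V) :
    ((Spec.map (CommRingCat.ofHom τ) ≫ hV.fromSpec).appLE V ⊤ h).hom =
      (specEquiv L).toRingHom.comp τ := by
  have e : (Spec.map (CommRingCat.ofHom τ) ≫ hV.fromSpec).appLE V ⊤ h =
      CommRingCat.ofHom τ ≫ (Scheme.ΓSpecIso (CommRingCat.of L)).inv := by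
    rw [Scheme.Hom.comp_appLE, hV.fromSpec_app_self, Category.assoc,
      Scheme.ΓSpecIso_inv_naturality]
    refine congrArg _ ((Scheme.Hom.map_appLE (Spec.map (CommRingCat.ofHom τ)) (U := hV.fromSpec ⁻¹ᵁ V) (V := ⊤) h _).trans ?_)
    exact (Scheme.Hom.app_eq_appLE _).symm
  rw [e]
  rfl

lemma stalkMap_of_eq {L : Type} [CommRing L] (hV : IsAffineOpen V) (τ : Γ(S, V) →+* L)
    (hτ : Function.Surjective τ) {σ : Spec (CommRingCat.of L) ⟶ S}
    (e : σ = Spec.map (CommRingCat.ofHom τ) ≫ hV.fromSpec) (z) : ∃ hz : σ z ∈ V,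
    Function.Surjective (σ.stalkMap z).hom ∧ RingHom.ker (σ.stalkMap z).hom =
      (RingHom.ker τ).map (S.presheaf.germ V (σ z) hz).hom := by
  subst e
  have h : ⊤ ≤ (Spec.map (CommRingCat.ofHom τ) ≫ hV.fromSpec) ⁻¹ᵁ V := fun x _ => by
    have := hV.range_fromSpec.le ⟨Spec.map (CommRingCat.ofHom τ) x, rfl⟩
    exact this
  have e := appLE_fromSpec hV τ h
  have hk : RingHom.ker ((Spec.map (CommRingCat.ofHom τ) ≫ hV.fromSpec).appLE V ⊤ h).hom =
      RingHom.ker τ := by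
    rw [e]
    ext a
    exact (specEquiv L).map_eq_zero_iff
  have := stalkMap_surjective_and_ker hV _ h
    (by rw [e]; exact (specEquiv L).surjective.comp hτ) z
  rw [hk] at this
  exact ⟨h trivial, this⟩

lemma exists_eq_fromSpec {L : Type} [CommRing L] (hV : IsAffineOpen V)
    (σ : Spec (CommRingCat.of L) ⟶ S) (h : ∀ x, σ x ∈ V) :
    ∃ τ : Γ(S, V) →+* L, σ = Spec.map (CommRingCat.ofHom τ) ≫ hV.fromSpec := by
  refine ⟨(Spec.preimage (IsOpenImmersion.lift hV.fromSpec σ ?_)).hom, ?_⟩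
  · rw [hV.range_fromSpec]
    rintro _ ⟨x, rfl⟩
    exact h x
  · rw [CommRingCat.ofHom_hom, Spec.map_preimage, IsOpenImmersion.lift_fac]

/-- The functions on the base, as functions on an open set. -/
abbrev baseHom {R : Type} [CommRing R] (q : S ⟶ Spec (CommRingCat.of R)) (V : S.Opens) :
    R →+* Γ(S, V) := (constMap q V).comp (specEquiv R).toRingHom

lemma fromSpec_comp {R : Type} [CommRing R] (q : S ⟶ Spec (CommRingCat.of R))
    (hV : IsAffineOpen V) : hV.fromSpec ≫ q = Spec.map (CommRingCat.ofHom (baseHom q V)) := by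
  rw [← IsAffineOpen.SpecMap_appLE_fromSpec q (isAffineOpen_top _) hV (le_preimage_top q V),
    IsAffineOpen.fromSpec_top, Scheme.isoSpec_Spec_inv, ← Spec.map_comp]
  rfl

/-- Smooth morphisms have étale coordinates locally. -/
lemma exists_etaleCoords {B : Scheme.{0}} [IsAffine B] (q : S ⟶ B) [Smooth q] (x : S) :
    ∃ (V : S.Opens) (_ : IsAffineOpen V) (_ : x ∈ V) (d : ℕ) (c : Fin d → Γ(S, V)),
      EtaleCoords (constMap q V) c := by
  obtain ⟨U, hU, V, hV, hx, e, hq⟩ := Smooth.exists_isStandardSmooth q x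
  let _ := (q.appLE U V e).hom.toAlgebra
  obtain ⟨ι, σ, _, _, ⟨P⟩⟩ : Algebra.IsStandardSmooth Γ(B, U) Γ(S, V) := hq
  have : Algebra.Smooth Γ(B, U) Γ(S, V) := q.smooth_appLE hU hV e
  let E := Finite.equivFin ((Set.range P.map)ᶜ : Set ι)
  have h := EtaleCoords.of_basis (fun k => P.val (E.symm k)) (P.basisKaehler.reindex E) fun k => by
    rw [Module.Basis.reindex_apply, P.basisKaehler_apply]
  have := h.of_base (resO le_top) (etale_resO le_top (isAffineOpen_top B) hU)
  refine ⟨V, hV, hx, _, fun k => P.val (E.symm k), ?_⟩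
  convert this using 1
  ext a
  exact ((appLE_resO q (le_preimage_top q V) e le_top le_rfl a).trans (resO_self _ _)).symm

end Stalks

end

section

section

variable {S : Scheme.{0}} {R R' : Subring ℂ} {h : R ≤ R'} {q : S ⟶ Spec (CommRingCat.of R)}
  {s : Spec (CommRingCat.of R) ⟶ S} {d : ℕ} {V : S.Opens}

lemma specZero_comp {σ : ∀ n, (adic (coeffsIn d R')).spec n ⟶ S}
    (trans : ∀ n, (adic (coeffsIn d R')).specIncl n ≫ σ (n + 1) = σ n) (n : ℕ) :
    (adic (coeffsIn d R')).specZero n ≫ σ n = σ 0 := by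
  induction n with
  | zero => exact Category.id_comp _
  | succ n ih => rw [← ih, ← trans n]; exact Category.assoc _ _ _

/-- The formal coordinates given by étale coordinates around a section. -/
lemma exists_formalCoordinates (hV : IsAffineOpen V) {c : Fin d → Γ(S, V)}
    (hc : EtaleCoords (baseHom q V) c) {γ : R' →+* Γ(S, V)} {ε : Γ(S, V) →+* R'}
    (hγ : ∀ r, ε (γ r) = r) (hi : ∀ r, γ (Subring.inclusion h r) = baseHom q V r)
    (hepi : ∀ {L : Type} [CommRing L] (x y : R' →+* L),
      x.comp (Subring.inclusion h) = y.comp (Subring.inclusion h) → x = y)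
    (hε : Spec.map (CommRingCat.ofHom (Subring.inclusion h)) ≫ s =
      Spec.map (CommRingCat.ofHom ε) ≫ hV.fromSpec) : Nonempty (FormalCoordinates h q s d) := by
  choose ρ τ h1 h2 h3 h4 h5 h6 h7 using fun n => hc.exists_taylor hγ hi hepi
    (polyToLevel_surjective R' n) (ker_polyToLevel (d := d) R' n)
  have hτ (n) : ((adic (coeffsIn d R')).proj n).comp (τ (n + 1)) = τ n := by
    refine hc.hom_ext (ρ n) ⟨n + 1, h2 n⟩ _ _ (fun r => ?_) (fun k => ?_) fun a => ?_
    · rw [RingHom.comp_apply, h3, h3]; rfl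
    · rw [RingHom.comp_apply, h4, h4]; rfl
    · obtain ⟨x, hx⟩ := polyToLevel_surjective R' (n + 1) (τ (n + 1) a)
      rw [h5, RingHom.comp_apply, ← hx, ← h5 (n + 1) a, ← hx, h1]
      exact h1 n x
  have hτ0 : τ 0 = ((polyToLevel d R' 0).comp MvPolynomial.C).comp ε := by
    ext a
    have : Function.Injective (ρ 0) := by
      rw [RingHom.injective_iff_ker_eq_bot, ← h2 0, zero_add, pow_one]
    refine this ((h5 0 a).trans ?_)
    simp [h1]
  have hconst (n) : constHom d h n =
      ((polyToLevel d R' n).comp MvPolynomial.C).comp (Subring.inclusion h) := by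
    ext r
    refine congrArg (Ideal.Quotient.mk _) (congrArg
      (MvPowerSeries.map (σ := Fin d) R'.subtype).rangeRestrict ?_)
    exact (MvPolynomial.coe_C _).symm
  let σ (n) : (adic (coeffsIn d R')).spec n ⟶ S :=
    Spec.map (CommRingCat.ofHom (τ n)) ≫ hV.fromSpec
  have htrans (n) : (adic (coeffsIn d R')).specIncl n ≫ σ (n + 1) = σ n := by
    rw [← Category.assoc, ← Spec.map_comp, ← CommRingCat.ofHom_comp, hτ]
  have hk (n) (z : (adic (coeffsIn d R')).spec 0) :=
    stalkMap_of_eq hV (τ n) (h6 n) (σ := σ n) rfl ((adic (coeffsIn d R')).specZero n z)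
  refine ⟨σ, fun n => ?_, htrans, ?_, fun n z => (hk n z).2.1, fun n z => ?_⟩
  · rw [Category.assoc, fromSpec_comp, ← Spec.map_comp, ← CommRingCat.ofHom_comp, constSpec, hconst]
    congr 2
    ext r
    exact h3 n r
  · rw [constSpec, hconst, CommRingCat.ofHom_comp, Spec.map_comp, Category.assoc, hε,
      ← Category.assoc, ← Spec.map_comp, ← CommRingCat.ofHom_comp, ← hτ0]
  · obtain ⟨hz, -, e⟩ := hk n z
    obtain ⟨hz', -, e'⟩ := stalkMap_of_eq hV (τ 0) (h6 0) (specZero_comp htrans n) z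
    rw [Scheme.Hom.stalkMap_comp] at e'
    refine e.trans ?_
    refine Eq.trans ?_ (congrArg (· ^ (n + 1)) e').symm
    rw [h7, h7, zero_add, pow_one, Ideal.map_pow]
    rfl

end

/-- Formal coordinates exist around the generic point of a section of a smooth morphism. -/
lemma exists_invert_formalCoordinates {S : Scheme.{0}} {R : Subring ℂ}
    (q : S ⟶ Spec (CommRingCat.of R)) [Smooth q] {s : Spec (CommRingCat.of R) ⟶ S}
    (hs : s ≫ q = 𝟙 _) : ∃ a ∈ R, a ≠ 0 ∧ ∃ d : ℕ, Nonempty (FormalCoordinates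
      (le_sup_left : R ≤ invert R a) q s d) := by
  let η : PrimeSpectrum R := ⟨⊥, Ideal.isPrime_bot⟩
  obtain ⟨V₀, hV₀, hη, d, c, hc⟩ := exists_etaleCoords q (s η)
  obtain ⟨_, ⟨_, ⟨a, rfl⟩, rfl⟩, hηa, haV⟩ := PrimeSpectrum.isBasis_basic_opens.exists_subset_of_mem_open
    (show η ∈ {x : PrimeSpectrum R | s x ∈ V₀} from hη)
    (s ⁻¹ᵁ V₀).isOpen
  have ha0 : a ≠ 0 := fun e => hηa (e ▸ Ideal.zero_mem _)
  have ha0' : (a : ℂ) ≠ 0 := fun e => ha0 (Subtype.ext e)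
  refine ⟨a, a.2, ha0', d, ?_⟩
  let R' := invert R (a : ℂ)
  let i : R →+* R' := Subring.inclusion (T := R') le_sup_left
  let _ : Algebra R R' := i.toAlgebra
  have hloc : IsLocalization.Away a R' := isLocalization_invert a.2 ha0'
  let V := S.basicOpen (baseHom q V₀ a)
  have hV : IsAffineOpen V := hV₀.basicOpen _
  have hle : V ≤ V₀ := S.basicOpen_le _
  have hau : IsUnit (baseHom q V a) := by
    have : IsUnit (resO hle (constMap q V₀ (specEquiv R a))) :=
      S.toRingedSpace.isUnit_res_basicOpen (baseHom q V₀ a)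
    rwa [resO_constMap] at this
  have hj (x) : (Spec.map (CommRingCat.ofHom i) ≫ s) x ∈ V := by
    have h1 : Spec.map (CommRingCat.ofHom i) x ∈ PrimeSpectrum.basicOpen a :=
      fun hx => x.2.ne_top (Ideal.eq_top_of_isUnit_mem _ hx (IsLocalization.Away.algebraMap_isUnit a))
    have h2 : V = V₀ ⊓ q ⁻¹ᵁ (Spec (CommRingCat.of R)).basicOpen (specEquiv R a) :=
      Scheme.basicOpen_appLE q V₀ ⊤ _ _
    rw [h2]
    refine ⟨haV h1, ?_⟩
    have e : q ((Spec.map (CommRingCat.ofHom i) ≫ s) x) = Spec.map (CommRingCat.ofHom i) x := by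
      rw [← Scheme.Hom.comp_apply, Category.assoc, hs, Category.comp_id]
    have h3 : Spec.map (CommRingCat.ofHom i) x ∈
        (Spec (CommRingCat.of R)).basicOpen (specEquiv R a) :=
        (basicOpen_eq_of_affine (R := CommRingCat.of R) a).ge h1
    rwa [← e] at h3
  obtain ⟨ε, hε⟩ := exists_eq_fromSpec hV _ hj
  have hεi : ε.comp (baseHom q V) = i := by
    have := congrArg (· ≫ q) hε
    simp only [Category.assoc, hs, Category.comp_id, fromSpec_comp, ← Spec.map_comp] at this
    exact congrArg CommRingCat.Hom.hom (Spec.map_injective this).symm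
  let γ : R' →+* Γ(S, V) := IsLocalization.Away.lift a hau
  have hγ (r) : γ (i r) = baseHom q V r := IsLocalization.Away.lift_eq a hau r
  have hepi {L : Type} [CommRing L] (x y : R' →+* L) (e : x.comp i = y.comp i) : x = y :=
    IsLocalization.ringHom_ext (Submonoid.powers a) e
  have hεγ : ε.comp γ = RingHom.id _ := hepi _ _ (by
    ext r
    rw [RingHom.comp_apply, RingHom.comp_apply, hγ, ← RingHom.comp_apply, hεi]
    rfl)
  have hc' := (hc.comp (resO hle) (etale_resO hle hV₀ hV)).of_base (specEquiv R).toRingHom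
    (RingHom.Etale.of_bijective (specEquiv R).bijective)
  have e : ((resO hle).comp (constMap q V₀)).comp (specEquiv R).toRingHom = baseHom q V := by
    ext r
    exact resO_constMap q hle _
  rw [e] at hc'
  exact exists_formalCoordinates (h := (le_sup_left : R ≤ invert R (a : ℂ))) hV hc'
    (fun r => congr($hεγ r)) hγ hepi hε

end

end Isomonodromy

end

theorem mainTheorem10
    (R : Subring ℂ) [Algebra.FiniteType ℤ R]
    {S X : Scheme.{0}} (q : S ⟶ Spec (CommRingCat.of R)) [Smooth q]
    (f : X ⟶ S) [Smooth f] [IsProper f]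
    {ι : Type} [Finite ι] (D : ι → X.IdealSheafData) (hD : Isomonodromy.IsRelSNC f D)
    (s : Spec (CommRingCat.of R) ⟶ S) (hs : s ≫ q = 𝟙 _)
    (E : Isomonodromy.FlatBundleOver f D s)
    (hE : ∀ᶠ p : Nat.Primes in Filter.cofinite, Isomonodromy.PCurvatureVanishesModP E p) :
    (∃ a ∈ R, a ≠ 0 ∧ ∃ d : ℕ, Nonempty (Isomonodromy.FormalCoordinates
        (le_sup_left : R ≤ Isomonodromy.invert R a) q s d)) ∧
    ∀ a ∈ R, a ≠ 0 → ∀ (d : ℕ) (c : Isomonodromy.FormalCoordinates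
        (le_sup_left : R ≤ Isomonodromy.invert R a) q s d),
      Isomonodromy.IsOmegaIntegral c E ∧
      ∃ g : Nat.Primes → ℕ, (∀ᶠ p in Filter.cofinite, g p + 1 = (p : ℕ) ^ 2) ∧
        Isomonodromy.IsGIntegralDegreewise c g E := by
  classical
  have hU := Isomonodromy.exists_invert_formalCoordinates q hs
  refine ⟨hU, fun a ha ha0 d c => ?_⟩
  choose C hC using Isomonodromy.exists_framedChart hD hs E
  let g' (p : Nat.Primes) : ℕ :=
    if Isomonodromy.PCurvatureVanishesModP E p then (p : ℕ) ^ 2 - 1 else 0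
  have hg (p : Nat.Primes) (hp : Isomonodromy.PCurvatureVanishesModP E p) :
      g' p + 1 = (p : ℕ) ^ 2 := by
    have : 1 ≤ (p : ℕ) ^ 2 := Nat.one_le_pow _ _ p.2.pos
    simp only [g', if_pos hp]
    omega
  have hg' (p : Nat.Primes) (hp : ¬ Isomonodromy.PCurvatureVanishesModP E p) : g' p = 0 := if_neg hp
  refine ⟨⟨fun p => g' p / 2, ?_, ?_⟩, g', hE.mono hg, ?_⟩
  · have h1 : Filter.Tendsto (fun p : Nat.Primes => ((p : ℕ) : ℝ) / 4) Filter.cofinite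
        Filter.atTop :=
      (tendsto_natCast_atTop_atTop.comp ((Nat.cofinite_eq_atTop ▸
        Subtype.val_injective.tendsto_cofinite))).atTop_div_const (by norm_num)
    refine Filter.tendsto_atTop_mono' _ ?_ h1
    filter_upwards [hE] with p hp
    have h2 := p.2.two_le
    have h3 : (p : ℕ) ^ 2 ≤ 4 * (g' p / 2) := by
      have := hg p hp
      have : 2 * 2 ≤ (p : ℕ) ^ 2 := by rw [sq]; exact Nat.mul_le_mul h2 h2
      omega
    have h4 : ((p : ℕ) : ℝ) ^ 2 ≤ 4 * ((g' p / 2 : ℕ) : ℝ) := by exact_mod_cast h3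
    have h5 : (0 : ℝ) < (p : ℕ) := by exact_mod_cast p.2.pos
    rw [le_div_iff₀ h5]
    linarith
  · exact c.isGIntegral C (fun x => ⟨x, hC x⟩) (fun p => Nat.mul_div_le _ _)
      (fun p hp => (hg p hp).le) hg' hs
  · exact c.isGIntegralDegreewise C g' (fun x => ⟨x, hC x⟩) (fun p hp => (hg p hp).le) hg' hs
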